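/- Let $0<s<1$. For measurable $E\subset\mathbb R^3$ and $\Omega\subset\mathbb R^3$ open and bounded let $$P_s(E,\Omega)=L(E\cap\Omega,E^c\cap\Omega)+L(E\cap\Omega,E^c\cap\Omega^c)+L(E\cap\Omega^c,E^c\cap\Omega),\qquad L(A,B)=\int_A\int_B\frac{dx\,d\bar x}{|x-\bar x|^{3+s}} .$$ Let $\Sigma\subset\mathbb R^3$ be an open cone (i.e. $\lambda\Sigma=\Sigma$ for all $\lambda>0$) with nonempty boundary, of class $C^2$ away from the origin (near each $p\in\partial\Sigma\setminus\{0\}$, $\Sigma$ is the sublevel set $\{f<0\}$ of a $C^2$ function $f$ with $\nabla f(p)\neq0$). Assume that $\Sigma$ is stable for the $s$-perimeter, that is, $$\liminf_{t\to0}\frac1{t^2}\Big(P_s(\phi_X^t(\Sigma),B_1)-P_s(\Sigma,B_1)\Big)\ge0\qquad\text{for all }X\in C^\infty_c(B_1\setminus\{0\};\mathbb R^3),$$ where $\phi_X^t$ is the integral flow of $X$ at time $t$. Let $\nu_\Sigma$ be the outward unit normal to $\Sigma$, let $H^d$ be the $d$-dimensional Hausdorff measure, and put $$\gamma=\partial\Sigma\cap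 S^2,\qquad c^2_{s,\partial\Sigma}(x)=\int_{\partial\Sigma}\frac{|\nu_\Sigma(x)-\nu_\Sigma(y)|^2}{|x-y|^{3+s}}\,dH^2(y),\qquad A=\int_\gamma c^2_{s,\partial\Sigma}(\hat x)\,dH^1(\hat x),$$ and $J[\zeta,\sigma]=\int_0^\infty r^{1-2\sigma}|\zeta(r)|^2\,dr$. Then for every real-valued $\zeta\in C^2_c((0,+\infty))$, $$A\,J\big[\zeta,\tfrac{1+s}2\big]\le 2\int_0^\infty dr\,r^{-s}\int_1^\infty d\tau\,\tau\,|\zeta(r)-\zeta(r\tau)|^2\iint_{\gamma\times\gamma}\frac{dH^1(\hat x)\,dH^1(\hat y)}{|\hat x-\tau\hat y|^{3+s}},$$ all integrals being integrals of nonnegative functions with values in $[0,\infty]$. -/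

import Mathlib

open MeasureTheory Filter Topology Set
open scoped ENNReal ContDiff Pointwise

noncomputable section

/-- The interaction `L(A, B) = ∫_A ∫_B |x - y|^{-(n+s)} dx dy`, with values in `[0, ∞]`. -/
def fracInteraction {n : ℕ} (s : ℝ) (A B : Set (EuclideanSpace ℝ (Fin n))) : ℝ≥0∞ :=
  ∫⁻ x in A, ∫⁻ y in B, ENNReal.ofReal (1 / ‖x - y‖ ^ ((n : ℝ) + s))

/-- The fractional `s`-perimeter of `E` in `Ω`. -/
def fracPerimeter {n : ℕ} (s : ℝ) (E Ω : Set (EuclideanSpace ℝ (Fin n))) : ℝ≥0∞ :=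
  fracInteraction s (E ∩ Ω) (Eᶜ ∩ Ω) + fracInteraction s (E ∩ Ω) (Eᶜ ∩ Ωᶜ)
    + fracInteraction s (E ∩ Ωᶜ) (Eᶜ ∩ Ω)

/-- `φ` is the integral flow of the (autonomous) vector field `X`. -/
def IsFlowOf {n : ℕ} (X : EuclideanSpace ℝ (Fin n) → EuclideanSpace ℝ (Fin n))
    (φ : ℝ → EuclideanSpace ℝ (Fin n) → EuclideanSpace ℝ (Fin n)) : Prop :=
  ∀ x, φ 0 x = x ∧ IsIntegralCurve (fun t => φ t x) (fun _ => X)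

/-- The boundary of `S` is of class `C²` away from the origin: near each boundary point other than
the origin, `S` is the sublevel set of a `C²` function whose differential does not vanish. -/
def HasC2BoundaryAwayFromZero {n : ℕ} (S : Set (EuclideanSpace ℝ (Fin n))) : Prop :=
  ∀ p ∈ frontier S, p ≠ 0 →
    ∃ U : Set (EuclideanSpace ℝ (Fin n)), IsOpen U ∧ p ∈ U ∧
      ∃ f : EuclideanSpace ℝ (Fin n) → ℝ,
        ContDiffOn ℝ 2 f U ∧ fderiv ℝ f p ≠ 0 ∧ S ∩ U = {x ∈ U | f x < 0}

/-- `S` is a stable cone for the `s`-perimeter: an open cone with nonempty boundary, of class `C²`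
away from the origin, such that
`liminf_{t → 0} t⁻² (P_s(φ_X^t(S), B_1) - P_s(S, B_1)) ≥ 0` for all `X ∈ C^∞_c(B_1 \ {0}; ℝⁿ)`.
The lower limit is taken in `[-∞, ∞]`; both perimeters are finite because the boundary is `C²`
away from the origin. -/
structure IsStableCone {n : ℕ} (s : ℝ) (S : Set (EuclideanSpace ℝ (Fin n))) : Prop where
  isOpen : IsOpen S
  cone : ∀ c : ℝ, 0 < c → c • S = S
  nonempty_frontier : (frontier S).Nonempty
  c2_boundary : HasC2BoundaryAwayFromZero S
  stable : ∀ X : EuclideanSpace ℝ (Fin n) → EuclideanSpace ℝ (Fin n),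
    ContDiff ℝ ∞ X → HasCompactSupport X → tsupport X ⊆ Metric.ball 0 1 \ {0} →
    ∀ φ : ℝ → EuclideanSpace ℝ (Fin n) → EuclideanSpace ℝ (Fin n), IsFlowOf X φ →
      0 ≤ liminf (fun t : ℝ =>
        ((((fracPerimeter s (φ t '' S) (Metric.ball 0 1)).toReal
          - (fracPerimeter s S (Metric.ball 0 1)).toReal) / t ^ 2 : ℝ) : EReal)) (𝓝[≠] 0)

/-- `ν` is the outward unit normal to `S` at `x`: directions making an obtuse angle with `ν` enter
`S`, and directions making an acute angle with `ν` leave it. -/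
def IsOutwardUnitNormal {n : ℕ} (S : Set (EuclideanSpace ℝ (Fin n)))
    (x ν : EuclideanSpace ℝ (Fin n)) : Prop :=
  ‖ν‖ = 1 ∧
    ∀ v : EuclideanSpace ℝ (Fin n),
      (inner ℝ ν v < 0 → ∀ᶠ t : ℝ in 𝓝[>] 0, x + t • v ∈ S) ∧
      (0 < inner ℝ ν v → ∀ᶠ t : ℝ in 𝓝[>] 0, x + t • v ∉ S)

theorem IsOutwardUnitNormal.unique {n : ℕ} {S : Set (EuclideanSpace ℝ (Fin n))}
    {x ν μ : EuclideanSpace ℝ (Fin n)} (hν : IsOutwardUnitNormal S x ν)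
    (hμ : IsOutwardUnitNormal S x μ) : ν = μ := by
  by_contra hne
  have h1 : inner ℝ ν μ < 1 :=
    (inner_lt_one_iff_real_of_norm_eq_one hν.1 hμ.1).2 hne
  have hνν : inner ℝ ν ν = (1 : ℝ) := by rw [real_inner_self_eq_norm_sq, hν.1]; norm_num
  have hμμ : inner ℝ μ μ = (1 : ℝ) := by rw [real_inner_self_eq_norm_sq, hμ.1]; norm_num
  have ha := (hν.2 (μ - ν)).1 (by rw [inner_sub_right, hνν]; linarith)
  have hb := (hμ.2 (μ - ν)).2 (by
    rw [inner_sub_right, hμμ, real_inner_comm]; linarith)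
  obtain ⟨t, h, h'⟩ := (ha.and hb).exists
  exact h' h

open Classical in
/-- The outward unit normal `ν_S(x)` (and `0` where there is none). -/
def outwardNormal {n : ℕ} (S : Set (EuclideanSpace ℝ (Fin n)))
    (x : EuclideanSpace ℝ (Fin n)) : EuclideanSpace ℝ (Fin n) :=
  if h : ∃ ν, IsOutwardUnitNormal S x ν then h.choose else 0

/-- `c²_{s,∂S}(x) = ∫_{∂S} |ν_S(x) - ν_S(y)|² |x - y|^{-(3+s)} dH²(y)` for `S ⊆ ℝ³`. Here and below
`μHE[d]` is the `d`-dimensional Hausdorff measure in the usual normalization. -/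
def nonlocalCurvSq (s : ℝ) (S : Set (EuclideanSpace ℝ (Fin 3)))
    (x : EuclideanSpace ℝ (Fin 3)) : ℝ≥0∞ :=
  ∫⁻ y in frontier S,
    ENNReal.ofReal (‖outwardNormal S x - outwardNormal S y‖ ^ 2 / ‖x - y‖ ^ (3 + s)) ∂μHE[2]

/-- The trace `γ = ∂S ∩ S²` on the unit sphere. -/
def coneTrace (S : Set (EuclideanSpace ℝ (Fin 3))) : Set (EuclideanSpace ℝ (Fin 3)) :=
  frontier S ∩ Metric.sphere 0 1

/-- `J[ζ, σ] = ∫_0^∞ r^{1-2σ} |ζ(r)|² dr`. -/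
def radialJ (ζ : ℝ → ℝ) (σ : ℝ) : ℝ≥0∞ :=
  ∫⁻ r in Ioi (0 : ℝ), ENNReal.ofReal (r ^ (1 - 2 * σ) * |ζ r| ^ 2)

end

noncomputable section

/-! ### Area formula for Euclidean Hausdorff measures -/

/-! Write `K(z) = |z|^{-(3+s)}`. The inequality is the second variation of the fractional perimeter,
tested on the normal variation `ζ(|x|) ν(x)` and rewritten in polar coordinates.

Along a flow the perimeter is the integral of `K(φ_t x - φ_t y)` times two Jacobians over a fixed
set of pairs, `x` inside and `y` outside the cone, and it can be differentiated twice at `t = 0`.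
The two-sided quadratic liminf condition forces the first derivative to vanish and the second to be
nonnegative (`deriv_eq_zero_and_nonneg_of_liminf`). Since the first variation vanishes along every
admissible field, the one along `(div X) X` may be subtracted from the second variation along `X`.
What remains is an iterated divergence, once in `y` and once in `x`. Two applications of the
divergence theorem on the cone turn it into the integral over `∂Σ × ∂Σ` of `K(x - y)` times a
quadratic form in `X`, called `boundaryForm` (`IsC2Cone.integral_stabilityDensity_eq`).

If `X = c ν` on the boundary, this form is `(c(x) - c(y))² - |ν(x) - ν(y)|² (c(x)² + c(y)²) / 2`.
Nonnegativity then says that the integral of `K |ν(x) - ν(y)|² ζ(|x|)²` is at most that of `K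
(ζ(|x|) - ζ(|y|))²` (`IsStableCone.lintegral_normal_le`). On the left, the squared curvature is
homogeneous of degree `-(1+s)`, so polar coordinates split off the radial integral `J`. On the
right, symmetry restricts the radii to `r < ρ` at the cost of a factor `2`, and `ρ = r τ` gives the
stated form.

The analysis lies in justifying this. The kernel is singular, so the divergence theorem is applied
to smooth truncations, which are removed by dominated convergence. On pairs across the boundary the
majorant is `K` itself, integrable because `dist(x, ∂Σ)^{-s}` is integrable on the unit ball. On
pairs of boundary points it is `min(1, |z|²) K(z)`, because the form vanishes to second order on the
diagonal. The field `ζ ν` is only Lipschitz, so it is extended and mollified. The vertex is cut out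
in the divergence theorem. Near any other boundary point the cone is the cone over a planar subgraph
`u < g v`; these conic charts and the area formula give surface integrals and polar coordinates on
the boundary. Stability is assumed in the unit ball only; a dilation reduces general `ζ` to that
case. -/

theorem measure_le_of_locally_le {X : Type*} [TopologicalSpace X] [SecondCountableTopology X]
    [MeasurableSpace X] [OpensMeasurableSpace X] {μ ν : Measure X}
    (h : ∀ c : NNReal, 1 < c → ∀ x, ∃ U ∈ 𝓝 x, ∀ A ⊆ U, MeasurableSet A → μ A ≤ c * ν A) :
    μ ≤ ν := by
  refine Measure.le_iff.2 fun A hA => ?_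
  -- For fixed `c` countably many of the neighbourhoods cover the space; cutting `A` into disjoint
  -- pieces, each inside one of them, makes the local inequality add up. Afterwards `c` tends to
  -- `1`.
  have key : ∀ c : NNReal, 1 < c → μ A ≤ c * ν A := by
    intro c hc
    choose U hU hUA using h c hc
    have hU' : ∀ x, interior (U x) ∈ 𝓝 x := fun x => interior_mem_nhds.2 (hU x)
    obtain ⟨t, htc, ht⟩ := TopologicalSpace.countable_cover_nhds hU'
    rcases t.eq_empty_or_nonempty with rfl | hne
    · have : A = ∅ := by
        apply eq_empty_of_subset_empty
        intro x _
        have : x ∈ (univ : Set X) := mem_univ x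
        rw [← ht] at this
        simp at this
      simp [this]
    obtain ⟨f, hf⟩ := htc.exists_eq_range hne
    set V : ℕ → Set X := fun n => interior (U (f n))
    have hVm : ∀ n, MeasurableSet (V n) := fun n => isOpen_interior.measurableSet
    have hcov : ⋃ n, V n = univ := by
      rw [← ht, hf]; simp [V]
    have hdm : ∀ n, MeasurableSet (A ∩ disjointed V n) :=
      fun n => hA.inter (MeasurableSet.disjointed hVm n)
    have hA' : A = ⋃ n, A ∩ disjointed V n := by
      rw [← inter_iUnion, iUnion_disjointed, hcov, inter_univ]
    have hdis : Pairwise (Function.onFun Disjoint fun n => A ∩ disjointed V n) := fun i j hij =>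
      (disjoint_disjointed V hij).mono inter_subset_right inter_subset_right
    rw [hA', measure_iUnion hdis hdm, measure_iUnion hdis hdm, ← ENNReal.tsum_mul_left]
    refine ENNReal.tsum_le_tsum fun n => hUA (f n) _ ?_ (hdm n)
    exact inter_subset_right.trans ((disjointed_subset V n).trans interior_subset)
  rcases eq_or_ne (ν A) ∞ with htop | htop
  · simp [htop]
  have hlim : Tendsto (fun c : NNReal => (c : ℝ≥0∞) * ν A) (𝓝[>] 1) (𝓝 (1 * ν A)) := by
    refine (ENNReal.Tendsto.mul_const ?_ (Or.inr htop)).mono_left nhdsWithin_le_nhds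
    exact (ENNReal.continuous_coe.tendsto 1)
  rw [one_mul] at hlim
  exact ge_of_tendsto hlim (by filter_upwards [self_mem_nhdsWithin] with c hc using key c hc)

theorem measure_eq_of_locally_eq {X : Type*} [TopologicalSpace X] [SecondCountableTopology X]
    [MeasurableSpace X] [OpensMeasurableSpace X] {μ ν : Measure X}
    (h : ∀ x, ∃ U ∈ 𝓝 x, ∀ A ⊆ U, MeasurableSet A → μ A = ν A) : μ = ν := by
  have aux : ∀ {μ ν : Measure X}, (∀ x, ∃ U ∈ 𝓝 x, ∀ A ⊆ U, MeasurableSet A → μ A = ν A) →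
      μ ≤ ν := by
    intro μ ν h
    refine measure_le_of_locally_le fun c hc x => ?_
    obtain ⟨U, hU, hUA⟩ := h x
    refine ⟨U, hU, fun A hA hm => ?_⟩
    rw [hUA A hA hm]
    exact le_mul_of_one_le_left zero_le (by exact_mod_cast hc.le)
  refine le_antisymm (aux h) (aux fun x => ?_)
  obtain ⟨U, hU, hUA⟩ := h x
  exact ⟨U, hU, fun A hA hm => (hUA A hA hm).symm⟩

/-- The hypothesis makes `f` factor through `g` on `A` by a `C`-Lipschitz map, even where `g` is not
injective, and such a map enlarges `k`-dimensional measure by at most `C ^ k`. -/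
theorem euclideanHausdorffMeasure_image_le_of_dist_le {X Y Z : Type*} [MetricSpace Y]
    [MeasurableSpace Y] [BorelSpace Y] [MetricSpace Z] [MeasurableSpace Z] [BorelSpace Z]
    {f : X → Y} {g : X → Z} {A : Set X} {C : NNReal} (k : ℕ)
    (h : ∀ x ∈ A, ∀ y ∈ A, dist (f x) (f y) ≤ C * dist (g x) (g y)) :
    μHE[k] (f '' A) ≤ (C : ℝ≥0∞) ^ k * μHE[k] (g '' A) := by
  rcases A.eq_empty_or_nonempty with rfl | ⟨a, ha⟩
  · simp
  have : Nonempty X := ⟨a⟩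
  have hinv : ∀ x ∈ A, f (Function.invFunOn g A (g x)) = f x := by
    intro x hx
    have h1 := Function.invFunOn_mem (f := g) (s := A) ⟨x, hx, rfl⟩
    have h2 := Function.invFunOn_eq (f := g) (s := A) ⟨x, hx, rfl⟩
    have := h _ h1 _ hx
    rw [h2, dist_self, mul_zero] at this
    exact dist_le_zero.1 this
  have hL : LipschitzOnWith C (f ∘ Function.invFunOn g A) (g '' A) := by
    refine LipschitzOnWith.of_dist_le_mul ?_
    rintro _ ⟨x, hx, rfl⟩ _ ⟨y, hy, rfl⟩
    simpa [hinv x hx, hinv y hy] using h x hx y hy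
  have himg : (f ∘ Function.invFunOn g A) '' (g '' A) = f '' A := by
    rw [image_image]
    exact image_congr fun x hx => hinv x hx
  have := hL.hausdorffMeasure_image_le (d := (k : ℝ)) (by positivity)
  rw [himg, ENNReal.rpow_natCast] at this
  rw [Measure.euclideanHausdorffMeasure_def, Measure.euclideanHausdorffMeasure_def,
    Measure.smul_apply, Measure.smul_apply]
  simp only [ENNReal.smul_def, smul_eq_mul]
  calc _ ≤ _ := mul_le_mul_right this _
    _ = _ := by ring

section Area

variable {U W : Type*} [NormedAddCommGroup U] [InnerProductSpace ℝ U] [FiniteDimensional ℝ U]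
  [MeasurableSpace U] [BorelSpace U] [NormedAddCommGroup W] [InnerProductSpace ℝ W]
  [MeasurableSpace W] [BorelSpace W]

/-- Near `a` the map is compared with its derivative there. Strict differentiability and injectivity
of `Ψ'` make the error a small multiple of `dist (Ψ' x) (Ψ' y)`, so distances agree up to a factor
`η` both ways and measures of images up to `η ^ k`. For the linear map the formula is known, and `J`
varies by at most one more factor `η`. -/
theorem area_formula_local {Ψ : U → W} {Ψ' : U →L[ℝ] W} {a : U} {D : Set U}
    (hΨ : HasStrictFDerivAt Ψ Ψ' a) {J : U → ℝ} (hJc : ContinuousWithinAt J D a) (hJ0 : 0 < J a)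
    (hJ : J a = LinearMap.normDet (Ψ' : U →ₗ[ℝ] W)) {c : NNReal} (hc : 1 < c) :
    ∃ N ∈ 𝓝 a, ∀ A ⊆ N ∩ D, MeasurableSet A →
      μHE[Module.finrank ℝ U] (Ψ '' A) ≤ c * ∫⁻ x in A, ENNReal.ofReal (J x) ∧
      ∫⁻ x in A, ENNReal.ofReal (J x) ≤ c * μHE[Module.finrank ℝ U] (Ψ '' A) := by
  set k := Module.finrank ℝ U
  have hker : (Ψ' : U →ₗ[ℝ] W).ker = ⊥ := by
    by_contra hne
    have := LinearMap.normDet_eq_zero_iff_ker_ne_bot.2 hne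
    rw [← hJ] at this
    exact hJ0.ne' this
  obtain ⟨K, hK, hKL⟩ := LinearMap.exists_antilipschitzWith _ hker
  -- choose `η > 1` with `η ^ (k + 1) < c`
  obtain ⟨η, hη1, hη2⟩ : ∃ η : NNReal, 1 < η ∧ η ^ (k + 1) < c := by
    have hcont : Tendsto (fun η : NNReal => η ^ (k + 1)) (𝓝[>] 1) (𝓝 1) := by
      have : Continuous fun η : NNReal => η ^ (k + 1) := by fun_prop
      simpa using (this.tendsto 1).mono_left nhdsWithin_le_nhds
    have h1 := hcont.eventually (gt_mem_nhds hc)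
    obtain ⟨η, h⟩ := (h1.and self_mem_nhdsWithin).exists
    exact ⟨η, h.2, h.1⟩
  have hη0 : (0 : ℝ) < η := by exact_mod_cast zero_lt_one.trans hη1
  have hη1' : (1 : ℝ) < η := by exact_mod_cast hη1
  -- relative error `ε = 1 - 1/η`, so that `1 + ε ≤ η` and `1 ≤ η (1 - ε)`
  set ε : ℝ := 1 - 1 / η with hε
  have hε0 : 0 < ε := by
    rw [hε, sub_pos, div_lt_one hη0]; exact hη1'
  have hε1 : 1 + ε ≤ η := by
    have : (2 : ℝ) ≤ η + 1 / η := by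
      have : 0 ≤ (η - 1 : ℝ) ^ 2 / η := by positivity
      have e : (η - 1 : ℝ) ^ 2 / η = η + 1 / η - 2 := by field_simp; ring
      linarith
    rw [hε]; linarith
  have hε2 : (η : ℝ) * (1 - ε) = 1 := by rw [hε]; field_simp; ring
  -- The antilipschitz constant `K` of `Ψ'` turns an error of `ε / K * ‖x - y‖` into one of `ε *
  -- dist (Ψ' x) (Ψ' y)`.
  have hδ : (0 : NNReal) < Real.toNNReal (ε / K) := Real.toNNReal_pos.2 (by positivity)
  obtain ⟨N₁, hN₁, happ⟩ := hΨ.approximates_deriv_on_nhds (Or.inr hδ)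
  have hJup : ∀ᶠ x in 𝓝[D] a, J x < η * J a ∧ J a < η * J x := by
    have h1 : J a < η * J a := by nlinarith
    refine (hJc.eventually (gt_mem_nhds h1)).and ?_
    have : Tendsto (fun x => (η : ℝ) * J x) (𝓝[D] a) (𝓝 (η * J a)) := hJc.const_mul _
    exact this.eventually (lt_mem_nhds h1)
  obtain ⟨N₂, hN₂, hN₂'⟩ := mem_nhdsWithin_iff_exists_mem_nhds_inter.1 hJup
  refine ⟨N₁ ∩ N₂, inter_mem hN₁ hN₂, fun A hA hAm => ?_⟩
  have herr : ∀ x ∈ A, ∀ y ∈ A, ‖Ψ x - Ψ y - (Ψ' x - Ψ' y)‖ ≤ ε * dist (Ψ' x) (Ψ' y) := by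
    intro x hx y hy
    have h1 := happ x (hA hx).1.1 y (hA hy).1.1
    have h2 := hKL.le_mul_dist x y
    rw [← map_sub]
    refine h1.trans ?_
    rw [Real.coe_toNNReal _ (by positivity)]
    calc ε / K * ‖x - y‖ ≤ ε / K * (K * dist (Ψ' x) (Ψ' y)) := by
          rw [← dist_eq_norm]; gcongr; exact h2
      _ = ε * dist (Ψ' x) (Ψ' y) := by field_simp
  have hd1 : ∀ x ∈ A, ∀ y ∈ A, dist (Ψ x) (Ψ y) ≤ η * dist (Ψ' x) (Ψ' y) := by
    intro x hx y hy
    have h1 := herr x hx y hy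
    have h2 : dist (Ψ x) (Ψ y) ≤ ‖Ψ x - Ψ y - (Ψ' x - Ψ' y)‖ + dist (Ψ' x) (Ψ' y) := by
      rw [dist_eq_norm, dist_eq_norm]
      simpa using norm_add_le (Ψ x - Ψ y - (Ψ' x - Ψ' y)) (Ψ' x - Ψ' y)
    nlinarith [dist_nonneg (x := Ψ' x) (y := Ψ' y)]
  have hd2 : ∀ x ∈ A, ∀ y ∈ A, dist (Ψ' x) (Ψ' y) ≤ η * dist (Ψ x) (Ψ y) := by
    intro x hx y hy
    have h1 := herr x hx y hy
    have h2 : dist (Ψ' x) (Ψ' y) ≤ dist (Ψ x) (Ψ y) + ‖Ψ x - Ψ y - (Ψ' x - Ψ' y)‖ := by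
      rw [dist_eq_norm, dist_eq_norm]
      simpa using norm_sub_le (Ψ x - Ψ y) (Ψ x - Ψ y - (Ψ' x - Ψ' y))
    have h3 : (1 - ε) * dist (Ψ' x) (Ψ' y) ≤ dist (Ψ x) (Ψ y) := by linarith
    calc dist (Ψ' x) (Ψ' y) = η * ((1 - ε) * dist (Ψ' x) (Ψ' y)) := by
          rw [← mul_assoc, hε2, one_mul]
      _ ≤ _ := by gcongr
  have hA1 := euclideanHausdorffMeasure_image_le_of_dist_le (f := Ψ) (g := Ψ') k hd1
  have hA2 := euclideanHausdorffMeasure_image_le_of_dist_le (f := Ψ') (g := Ψ) k hd2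
  have hlin := LinearMap.euclideanHausdorffMeasure_image_eq_normDet_mul_volume
    (Ψ' : U →ₗ[ℝ] W) A
  rw [← hJ] at hlin
  have hlin' : μHE[k] (Ψ' '' A) = ENNReal.ofReal (J a) * volume A := hlin
  have hηc : (η : ℝ≥0∞) ^ k * η ≤ c := by
    rw [← pow_succ]; exact_mod_cast hη2.le
  have hint1 : ENNReal.ofReal (J a) * volume A ≤ η * ∫⁻ x in A, ENNReal.ofReal (J x) := by
    rw [← setLIntegral_const, ← lintegral_const_mul' _ _ ENNReal.coe_ne_top]
    refine setLIntegral_mono' hAm fun x hx => ?_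
    have := (hN₂' ⟨(hA hx).1.2, (hA hx).2⟩).2
    rw [← ENNReal.ofReal_coe_nnreal, ← ENNReal.ofReal_mul hη0.le]
    exact ENNReal.ofReal_le_ofReal this.le
  have hint2 : ∫⁻ x in A, ENNReal.ofReal (J x) ≤ η * (ENNReal.ofReal (J a) * volume A) := by
    rw [← mul_assoc, ← setLIntegral_const]
    refine setLIntegral_mono' hAm fun x hx => ?_
    have := (hN₂' ⟨(hA hx).1.2, (hA hx).2⟩).1
    rw [← ENNReal.ofReal_coe_nnreal, ← ENNReal.ofReal_mul hη0.le]
    exact ENNReal.ofReal_le_ofReal this.le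
  constructor
  · calc _ ≤ _ := hA1
      _ ≤ η ^ k * (η * ∫⁻ x in A, ENNReal.ofReal (J x)) := by rw [hlin']; gcongr
      _ = (η ^ k * η) * ∫⁻ x in A, ENNReal.ofReal (J x) := by ring
      _ ≤ _ := by gcongr
  · calc _ ≤ _ := hint2
      _ ≤ η * (η ^ k * μHE[k] (Ψ '' A)) := by rw [← hlin']; gcongr
      _ = (η ^ k * η) * μHE[k] (Ψ '' A) := by ring
      _ ≤ _ := by gcongr

/-- **Area formula** for an injective `C¹` immersion. -/
theorem area_formula {Ψ : U → W} {Ψ' : U → U →L[ℝ] W} {D : Set U} (hD : MeasurableSet D)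
    (hΨ : ∀ a ∈ D, HasStrictFDerivAt Ψ (Ψ' a) a) (hinj : InjOn Ψ D) {J : U → ℝ}
    (hJc : ContinuousOn J D) (hJ0 : ∀ a ∈ D, 0 < J a)
    (hJ : ∀ a ∈ D, J a = LinearMap.normDet (Ψ' a : U →ₗ[ℝ] W)) {A : Set U} (hA : MeasurableSet A)
    (hAD : A ⊆ D) :
    μHE[Module.finrank ℝ U] (Ψ '' A) = ∫⁻ x in A, ENNReal.ofReal (J x) := by
  have hcont : ContinuousOn Ψ D := fun a ha => (hΨ a ha).hasFDerivAt.continuousAt.continuousWithinAt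
  have he : MeasurableEmbedding (D.domRestrict Ψ) := hcont.measurableEmbedding hD hinj
  have hes : MeasurableEmbedding (Subtype.val : D → U) := MeasurableEmbedding.subtype_coe hD
  -- Injectivity makes the measure of the image a measure on `D`. It is compared with the weighted
  -- volume locally, up to every factor `c > 1`.
  set μ₁ : Measure D := Measure.comap (D.domRestrict Ψ) μHE[Module.finrank ℝ U]
  set μ₂ : Measure D := Measure.comap Subtype.val (volume.withDensity fun x => ENNReal.ofReal (J x))
  have h1 : ∀ B, μ₁ B = μHE[Module.finrank ℝ U] (Ψ '' (Subtype.val '' B)) := fun B => by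
    rw [he.comap_apply, image_image]; rfl
  have h2 : ∀ B, MeasurableSet B → μ₂ B = ∫⁻ x in Subtype.val '' B, ENNReal.ofReal (J x) :=
    fun B hB => by
      rw [hes.comap_apply, withDensity_apply _ (hes.measurableSet_image.2 hB)]
  have hloc : ∀ c : NNReal, 1 < c → ∀ x : D, ∃ N ∈ 𝓝 x, ∀ B ⊆ N, MeasurableSet B →
      μ₁ B ≤ c * μ₂ B ∧ μ₂ B ≤ c * μ₁ B := by
    intro c hc x
    obtain ⟨N, hN, hNA⟩ := area_formula_local (hΨ x x.2) (hJc x x.2) (hJ0 x x.2) (hJ x x.2) hc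
    refine ⟨Subtype.val ⁻¹' N, continuous_subtype_val.continuousAt.preimage_mem_nhds hN,
      fun B hB hBm => ?_⟩
    rw [h1, h2 B hBm]
    refine hNA _ ?_ (hes.measurableSet_image.2 hBm)
    rintro _ ⟨y, hy, rfl⟩
    exact ⟨hB hy, y.2⟩
  have heq : μ₁ = μ₂ := by
    refine le_antisymm (measure_le_of_locally_le fun c hc x => ?_)
      (measure_le_of_locally_le fun c hc x => ?_)
    · obtain ⟨N, hN, h⟩ := hloc c hc x
      exact ⟨N, hN, fun B hB hm => (h B hB hm).1⟩
    · obtain ⟨N, hN, h⟩ := hloc c hc x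
      exact ⟨N, hN, fun B hB hm => (h B hB hm).2⟩
  have hval : Subtype.val '' (Subtype.val ⁻¹' A : Set D) = A := by
    rw [Subtype.image_preimage_coe, inter_eq_right.2 hAD]
  have := congrArg (fun m : Measure D => m (Subtype.val ⁻¹' A)) heq
  rwa [h1, h2 _ (measurable_subtype_coe hA), hval] at this

/-- Knowing the area formula on all Borel sets identifies surface measure on the image with a
push-forward; integrals over the image follow from this identity. -/
theorem restrict_image_eq_map_withDensity {Ψ : U → W} {Ψ' : U → U →L[ℝ] W} {D : Set U}
    (hD : MeasurableSet D) (hΨ : ∀ a ∈ D, HasStrictFDerivAt Ψ (Ψ' a) a) (hinj : InjOn Ψ D)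
    {J : U → ℝ} (hJc : ContinuousOn J D) (hJ0 : ∀ a ∈ D, 0 < J a)
    (hJ : ∀ a ∈ D, J a = LinearMap.normDet (Ψ' a : U →ₗ[ℝ] W)) :
    (μHE[Module.finrank ℝ U]).restrict (Ψ '' D) =
      ((volume.restrict D).withDensity fun x => ENNReal.ofReal (J x)).map Ψ := by
  have hcont : ContinuousOn Ψ D := fun a ha => (hΨ a ha).hasFDerivAt.continuousAt.continuousWithinAt
  set μ : Measure U := (volume.restrict D).withDensity fun x => ENNReal.ofReal (J x)
  have hac : μ ≪ volume.restrict D := withDensity_absolutelyContinuous _ _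
  have hΨm : AEMeasurable Ψ μ := (hcont.aemeasurable hD).mono_ac hac
  ext B hB
  have hpre : MeasurableSet (D ∩ Ψ ⁻¹' B) := by
    have := (hcont.domRestrict.measurable hB)
    have h2 := (MeasurableEmbedding.subtype_coe hD).measurableSet_image.2 this
    convert h2 using 1
    ext x
    simp [Set.domRestrict, and_comm]
  rw [Measure.restrict_apply hB, Measure.map_apply_of_aemeasurable hΨm hB]
  have h1 : B ∩ Ψ '' D = Ψ '' (D ∩ Ψ ⁻¹' B) := by
    rw [image_inter_preimage, inter_comm]
  rw [h1, area_formula hD hΨ hinj hJc hJ0 hJ hpre inter_subset_left]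
  have hDc : μ Dᶜ = 0 := hac (by simp [Measure.restrict_apply hD.compl])
  have h2 : μ (Ψ ⁻¹' B) = μ (D ∩ Ψ ⁻¹' B) := by
    refine (measure_inter_conull' (measure_mono_null ?_ hDc)).symm.trans (by rw [inter_comm])
    exact fun x hx => hx.2
  rw [h2, withDensity_apply _ hpre, Measure.restrict_restrict hpre,
    inter_eq_left.2 (inter_subset_left : D ∩ Ψ ⁻¹' B ⊆ D)]

theorem lintegral_image_area_formula {Ψ : U → W} {Ψ' : U → U →L[ℝ] W} {D : Set U}
    (hD : MeasurableSet D) (hΨ : ∀ a ∈ D, HasStrictFDerivAt Ψ (Ψ' a) a) (hinj : InjOn Ψ D)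
    {J : U → ℝ} (hJc : ContinuousOn J D) (hJ0 : ∀ a ∈ D, 0 < J a)
    (hJ : ∀ a ∈ D, J a = LinearMap.normDet (Ψ' a : U →ₗ[ℝ] W)) {F : W → ℝ≥0∞}
    (hF : Measurable F) :
    ∫⁻ x in Ψ '' D, F x ∂μHE[Module.finrank ℝ U] = ∫⁻ y in D, F (Ψ y) * ENNReal.ofReal (J y) := by
  have hcont : ContinuousOn Ψ D := fun a ha => (hΨ a ha).hasFDerivAt.continuousAt.continuousWithinAt
  have hΨm : AEMeasurable Ψ (volume.restrict D) := hcont.aemeasurable hD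
  rw [restrict_image_eq_map_withDensity hD hΨ hinj hJc hJ0 hJ, lintegral_map' hF.aemeasurable
    (hΨm.mono_ac (withDensity_absolutelyContinuous _ _))]
  refine (lintegral_withDensity_eq_lintegral_mul₀ (hJc.aemeasurable hD).ennreal_ofReal
    (hF.comp_aemeasurable hΨm)).trans ?_
  exact lintegral_congr fun y => by simp [mul_comm]

theorem integral_image_area_formula {Ψ : U → W} {Ψ' : U → U →L[ℝ] W} {D : Set U}
    (hD : MeasurableSet D) (hΨ : ∀ a ∈ D, HasStrictFDerivAt Ψ (Ψ' a) a) (hinj : InjOn Ψ D)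
    {J : U → ℝ} (hJc : ContinuousOn J D) (hJ0 : ∀ a ∈ D, 0 < J a)
    (hJ : ∀ a ∈ D, J a = LinearMap.normDet (Ψ' a : U →ₗ[ℝ] W)) {F : W → ℝ}
    (hF : AEStronglyMeasurable F ((μHE[Module.finrank ℝ U]).restrict (Ψ '' D))) :
    ∫ x in Ψ '' D, F x ∂μHE[Module.finrank ℝ U] = ∫ y in D, J y * F (Ψ y) := by
  have hcont : ContinuousOn Ψ D := fun a ha => (hΨ a ha).hasFDerivAt.continuousAt.continuousWithinAt
  have hΨm : AEMeasurable Ψ (volume.restrict D) := hcont.aemeasurable hD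
  rw [restrict_image_eq_map_withDensity hD hΨ hinj hJc hJ0 hJ] at hF ⊢
  rw [integral_map (hΨm.mono_ac (withDensity_absolutelyContinuous _ _)) hF]
  refine (integral_withDensity_eq_integral_smul₀ (f := fun y => (J y).toNNReal)
    (hJc.aemeasurable hD).real_toNNReal _).trans ?_
  refine setIntegral_congr_fun hD fun y hy => ?_
  simp only [NNReal.smul_def, Real.coe_toNNReal _ (hJ0 y hy).le, smul_eq_mul]

end Area
end

noncomputable section

/-! ### Normals and conic charts of a cone with `C²` boundary -/

section Normals

variable {n : ℕ} {S : Set (EuclideanSpace ℝ (Fin n))}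

theorem IsOutwardUnitNormal.outwardNormal_eq {x ν : EuclideanSpace ℝ (Fin n)}
    (h : IsOutwardUnitNormal S x ν) : outwardNormal S x = ν := by
  have hex : ∃ ν, IsOutwardUnitNormal S x ν := ⟨ν, h⟩
  rw [outwardNormal, dif_pos hex]
  exact hex.choose_spec.unique h

theorem norm_outwardNormal_le (x : EuclideanSpace ℝ (Fin n)) : ‖outwardNormal S x‖ ≤ 1 := by
  rw [outwardNormal]
  split_ifs with h
  · exact h.choose_spec.1.le
  · simp

theorem inner_gradient_eq {f : EuclideanSpace ℝ (Fin n) → ℝ} (x v : EuclideanSpace ℝ (Fin n)) :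
    inner ℝ (gradient f x) v = fderiv ℝ f x v := by
  rw [← toDual_gradient]; rfl

theorem eventually_lt_zero_of_fderiv_neg {f : EuclideanSpace ℝ (Fin n) → ℝ}
    {x v : EuclideanSpace ℝ (Fin n)} (hf : DifferentiableAt ℝ f x) (hx : f x = 0)
    (hv : fderiv ℝ f x v < 0) : ∀ᶠ t : ℝ in 𝓝[>] 0, f (x + t • v) < 0 := by
  have h1 := hf.hasFDerivAt.hasLineDerivAt v
  have h2 := h1.tendsto_slope_zero_right
  filter_upwards [h2.eventually (gt_mem_nhds hv), self_mem_nhdsWithin] with t ht ht0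
  have ht0 : 0 < t := ht0
  rw [hx, sub_zero, smul_eq_mul] at ht
  by_contra hcon
  push Not at hcon
  have : 0 ≤ t⁻¹ * f (x + t • v) := by positivity
  linarith

theorem eventually_pos_of_fderiv_pos {f : EuclideanSpace ℝ (Fin n) → ℝ}
    {x v : EuclideanSpace ℝ (Fin n)} (hf : DifferentiableAt ℝ f x) (hx : f x = 0)
    (hv : 0 < fderiv ℝ f x v) : ∀ᶠ t : ℝ in 𝓝[>] 0, 0 < f (x + t • v) := by
  have h := eventually_lt_zero_of_fderiv_neg (f := fun y => -f y) (x := x) (v := v) hf.neg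
    (by simp [hx]) (by rw [fderiv_fun_neg]; simpa using hv)
  filter_upwards [h] with t ht
  linarith

theorem eventually_add_smul_mem {U : Set (EuclideanSpace ℝ (Fin n))}
    {x : EuclideanSpace ℝ (Fin n)} (hU : U ∈ 𝓝 x) (v : EuclideanSpace ℝ (Fin n)) :
    ∀ᶠ t : ℝ in 𝓝[>] 0, x + t • v ∈ U := by
  have hc : Continuous fun t : ℝ => x + t • v := by fun_prop
  have := hc.tendsto 0
  simp only [zero_smul, add_zero] at this
  exact (this.eventually hU).filter_mono nhdsWithin_le_nhds

/-- The sign of the derivative of `f` along `v` decides whether short steps along `v` enter or leave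
the sublevel set. -/
theorem isOutwardUnitNormal_of_sublevel {U : Set (EuclideanSpace ℝ (Fin n))}
    {f : EuclideanSpace ℝ (Fin n) → ℝ} {x : EuclideanSpace ℝ (Fin n)} (hU : U ∈ 𝓝 x)
    (hSU : ∀ y ∈ U, y ∈ S ↔ f y < 0) (hf : DifferentiableAt ℝ f x) (hx : f x = 0)
    (hne : fderiv ℝ f x ≠ 0) :
    IsOutwardUnitNormal S x (‖gradient f x‖⁻¹ • gradient f x) := by
  have hg : gradient f x ≠ 0 := by
    intro h0
    apply hne
    rw [← toDual_gradient, h0, map_zero]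
  have hpos : 0 < ‖gradient f x‖⁻¹ := inv_pos.2 (norm_pos_iff.2 hg)
  refine ⟨by rw [norm_smul, norm_inv, norm_norm, inv_mul_cancel₀ (norm_ne_zero_iff.2 hg)],
    fun v => ⟨fun hv => ?_, fun hv => ?_⟩⟩
  · rw [real_inner_smul_left, inner_gradient_eq] at hv
    have hv' : fderiv ℝ f x v < 0 := by
      by_contra hcon
      push Not at hcon
      have : 0 ≤ ‖gradient f x‖⁻¹ * fderiv ℝ f x v := by positivity
      linarith
    filter_upwards [eventually_lt_zero_of_fderiv_neg hf hx hv', eventually_add_smul_mem hU v]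
      with t h1 h2 using (hSU _ h2).2 h1
  · rw [real_inner_smul_left, inner_gradient_eq] at hv
    have hv' : 0 < fderiv ℝ f x v := pos_of_mul_pos_right hv hpos.le
    filter_upwards [eventually_pos_of_fderiv_pos hf hx hv', eventually_add_smul_mem hU v]
      with t h1 h2 h3
    exact lt_asymm h1 ((hSU _ h2).1 h3)

/-- Openness of `S` excludes `f x < 0` and continuity excludes `f x > 0`. Conversely, at a zero a
direction of descent makes `x` a limit of points of `S`. -/
theorem mem_frontier_iff_of_sublevel (hS : IsOpen S) {U : Set (EuclideanSpace ℝ (Fin n))}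
    {f : EuclideanSpace ℝ (Fin n) → ℝ} {x : EuclideanSpace ℝ (Fin n)} (hU : U ∈ 𝓝 x)
    (hSU : ∀ y ∈ U, y ∈ S ↔ f y < 0) (hf : DifferentiableAt ℝ f x) (hne : fderiv ℝ f x ≠ 0) :
    x ∈ frontier S ↔ f x = 0 := by
  rw [hS.frontier_eq]
  constructor
  · rintro ⟨hcl, hnot⟩
    have h1 : 0 ≤ f x := by
      by_contra hcon
      exact hnot ((hSU x (mem_of_mem_nhds hU)).2 (not_le.1 hcon))
    refine le_antisymm ?_ h1
    by_contra hcon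
    push Not at hcon
    have h2 : ∀ᶠ y in 𝓝 x, 0 < f y := hf.continuousAt.eventually (lt_mem_nhds hcon)
    obtain ⟨y, ⟨hy1, hy2⟩, hyS⟩ := mem_closure_iff_nhds.1 hcl _ (inter_mem h2 hU)
    exact lt_asymm hy1 ((hSU y hy2).1 hyS)
  · intro hx
    refine ⟨?_, fun hcon => ?_⟩
    · obtain ⟨v, hv⟩ : ∃ v, fderiv ℝ f x v < 0 := by
        obtain ⟨w, hw⟩ := DFunLike.exists_ne hne
        rcases lt_or_gt_of_ne hw with h | h
        · exact ⟨w, h⟩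
        · exact ⟨-w, by simpa using h⟩
      refine mem_closure_iff_nhds.2 fun N hN => ?_
      obtain ⟨t, h1, h2⟩ := ((eventually_lt_zero_of_fderiv_neg hf hx hv).and
        (eventually_add_smul_mem (inter_mem hN hU) v)).exists
      exact ⟨_, h2.1, (hSU _ h2.2).2 h1⟩
    · exact absurd hx ((hSU x (mem_of_mem_nhds hU)).1 hcon).ne

/-- Local `C²` description of the boundary, on a ball. -/
theorem HasC2BoundaryAwayFromZero.exists_ball (hC : HasC2BoundaryAwayFromZero S) (hS : IsOpen S)
    {p : EuclideanSpace ℝ (Fin n)} (hp : p ∈ frontier S) (hp0 : p ≠ 0) :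
    ∃ r > 0, ∃ f : EuclideanSpace ℝ (Fin n) → ℝ, ContDiffOn ℝ 2 f (Metric.ball p r) ∧
      (∀ x ∈ Metric.ball p r, fderiv ℝ f x ≠ 0) ∧
      (∀ x ∈ Metric.ball p r, x ∈ S ↔ f x < 0) ∧
      (∀ x ∈ Metric.ball p r, x ∈ frontier S ↔ f x = 0) ∧
      (∀ x ∈ Metric.ball p r, x ∈ frontier S →
        IsOutwardUnitNormal S x (‖gradient f x‖⁻¹ • gradient f x)) := by
  obtain ⟨U, hU, hpU, f, hf, hne, hSU⟩ := hC p hp hp0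
  have hfp : ContDiffAt ℝ 2 f p := hf.contDiffAt (hU.mem_nhds hpU)
  have hcont : ContinuousAt (fderiv ℝ f) p :=
    (hfp.fderiv_right (m := 1) (by norm_num)).continuousAt
  have hev : ∀ᶠ x in 𝓝 p, x ∈ U ∧ fderiv ℝ f x ≠ 0 := by
    filter_upwards [hU.mem_nhds hpU, hcont.eventually_ne hne] with x h1 h2 using ⟨h1, h2⟩
  obtain ⟨r, hr, hball⟩ := Metric.eventually_nhds_iff_ball.1 hev
  have hmem : ∀ x ∈ Metric.ball p r, x ∈ S ↔ f x < 0 := by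
    intro x hx
    have : x ∈ S ∩ U ↔ x ∈ {x ∈ U | f x < 0} := by rw [hSU]
    simpa [(hball x hx).1] using this
  have hdiff : ∀ x ∈ Metric.ball p r, DifferentiableAt ℝ f x := fun x hx =>
    (hf.contDiffAt (hU.mem_nhds (hball x hx).1)).differentiableAt (by norm_num)
  have hnhds : ∀ x ∈ Metric.ball p r, Metric.ball p r ∈ 𝓝 x := fun x hx =>
    Metric.isOpen_ball.mem_nhds hx
  have hfr : ∀ x ∈ Metric.ball p r, x ∈ frontier S ↔ f x = 0 := fun x hx =>
    mem_frontier_iff_of_sublevel hS (hnhds x hx) hmem (hdiff x hx) (hball x hx).2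
  exact ⟨r, hr, f, hf.mono fun x hx => (hball x hx).1, fun x hx => (hball x hx).2, hmem, hfr,
    fun x hx hxf => isOutwardUnitNormal_of_sublevel (hnhds x hx) hmem (hdiff x hx)
      ((hfr x hx).1 hxf) (hball x hx).2⟩

theorem smul_mem_iff_of_cone (hc : ∀ c : ℝ, 0 < c → c • S = S) {c : ℝ} (h : 0 < c)
    (x : EuclideanSpace ℝ (Fin n)) : c • x ∈ S ↔ x ∈ S := by
  conv_lhs => rw [← hc c h]
  exact smul_mem_smul_set_iff₀ h.ne' _ _

theorem smul_frontier_of_cone (hc : ∀ c : ℝ, 0 < c → c • S = S) {c : ℝ} (h : 0 < c) :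
    c • frontier S = frontier S := by
  rw [frontier, smul_set_sdiff₀ h.ne', ← closure_smul₀ (c := c), ← interior_smul₀ h.ne', hc c h]

theorem smul_mem_frontier_iff_of_cone (hc : ∀ c : ℝ, 0 < c → c • S = S) {c : ℝ} (h : 0 < c)
    (x : EuclideanSpace ℝ (Fin n)) : c • x ∈ frontier S ↔ x ∈ frontier S := by
  conv_lhs => rw [← smul_frontier_of_cone hc h]
  exact smul_mem_smul_set_iff₀ h.ne' _ _

theorem IsOutwardUnitNormal.smul (hc : ∀ c : ℝ, 0 < c → c • S = S) {c : ℝ} (h : 0 < c)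
    {x ν : EuclideanSpace ℝ (Fin n)} (hν : IsOutwardUnitNormal S x ν) :
    IsOutwardUnitNormal S (c • x) ν := by
  refine ⟨hν.1, fun v => ?_⟩
  have key : ∀ t : ℝ, c • x + t • v ∈ S ↔ x + t • (c⁻¹ • v) ∈ S := by
    intro t
    rw [← smul_mem_iff_of_cone hc h (x + t • (c⁻¹ • v)), smul_add, smul_comm t, smul_smul c c⁻¹,
      mul_inv_cancel₀ h.ne', one_smul]
  simp only [key]
  have := hν.2 (c⁻¹ • v)
  rw [real_inner_smul_right] at this
  refine ⟨fun hv => this.1 ?_, fun hv => this.2 ?_⟩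
  · exact mul_neg_of_pos_of_neg (inv_pos.2 h) hv
  · exact mul_pos (inv_pos.2 h) hv

theorem outwardNormal_smul (hc : ∀ c : ℝ, 0 < c → c • S = S) {c : ℝ} (h : 0 < c)
    (x : EuclideanSpace ℝ (Fin n)) : outwardNormal S (c • x) = outwardNormal S x := by
  by_cases hex : ∃ ν, IsOutwardUnitNormal S x ν
  · obtain ⟨ν, hν⟩ := hex
    rw [hν.outwardNormal_eq, (hν.smul hc h).outwardNormal_eq]
  · have hex' : ¬ ∃ ν, IsOutwardUnitNormal S (c • x) ν := by
      rintro ⟨ν, hν⟩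
      refine hex ⟨ν, ?_⟩
      have := hν.smul hc (inv_pos.2 h)
      rwa [smul_smul, inv_mul_cancel₀ h.ne', one_smul] at this
    rw [outwardNormal, outwardNormal, dif_neg hex, dif_neg hex']

theorem HasC2BoundaryAwayFromZero.isOutwardUnitNormal (hC : HasC2BoundaryAwayFromZero S)
    (hS : IsOpen S) {p : EuclideanSpace ℝ (Fin n)} (hp : p ∈ frontier S) (hp0 : p ≠ 0) :
    IsOutwardUnitNormal S p (outwardNormal S p) := by
  obtain ⟨r, hr, f, -, -, -, -, hν⟩ := hC.exists_ball hS hp hp0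
  have := hν p (Metric.mem_ball_self hr) hp
  rwa [this.outwardNormal_eq]

end Normals

/-- In the coordinates `p + u e + v τ`, the set `S` is the subgraph `u < g v` of a `C¹` function. -/
structure IsConicChart {n : ℕ} (S : Set (EuclideanSpace ℝ (Fin n)))
    (p e τ : EuclideanSpace ℝ (Fin n)) (α β κ : ℝ) (g : ℝ → ℝ) : Prop where
  α_pos : 0 < α
  β_pos : 0 < β
  κ_pos : 0 < κ
  contDiffOn : ContDiffOn ℝ 1 g (Ioo (-β) β)
  g_mem : ∀ v ∈ Ioo (-β) β, g v ∈ Ioo (-α) α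
  mem_iff : ∀ u ∈ Ioo (-α) α, ∀ v ∈ Ioo (-β) β, p + u • e + v • τ ∈ S ↔ u < g v
  frontier_iff : ∀ u ∈ Ioo (-α) α, ∀ v ∈ Ioo (-β) β, p + u • e + v • τ ∈ frontier S ↔ u = g v
  -- The distance is to the whole boundary, not only to its part in the chart. The integrability of
  -- negative powers of the distance rests on this bound.
  dist_le : ∀ u ∈ Ioo (-α) α, ∀ v ∈ Ioo (-β) β, ∀ y ∈ frontier S,
    κ * |u - g v| ≤ ‖p + u • e + v • τ - y‖
  norm_normal : ∀ v ∈ Ioo (-β) β, ‖outwardNormal S (p + g v • e + v • τ)‖ = 1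
  inner_self : ∀ v ∈ Ioo (-β) β,
    inner ℝ (outwardNormal S (p + g v • e + v • τ)) (p + g v • e + v • τ) = 0
  inner_tangent : ∀ v ∈ Ioo (-β) β,
    inner ℝ (outwardNormal S (p + g v • e + v • τ)) (deriv g v • e + τ) = 0
  inner_pos : ∀ v ∈ Ioo (-β) β, 0 < inner ℝ (outwardNormal S (p + g v • e + v • τ)) e

/-- Positive multiples of `p` stay outside `S`. Were the inner product nonzero, a short step along
`p` or `-p` would enter `S`. -/
theorem inner_outwardNormal_self {n : ℕ} {S : Set (EuclideanSpace ℝ (Fin n))}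
    (hC : HasC2BoundaryAwayFromZero S) (hS : IsOpen S) (hc : ∀ c : ℝ, 0 < c → c • S = S)
    {p : EuclideanSpace ℝ (Fin n)} (hp : p ∈ frontier S) (hp0 : p ≠ 0) :
    inner ℝ (outwardNormal S p) p = 0 := by
  have hν := hC.isOutwardUnitNormal hS hp hp0
  have hpS : p ∉ S := by
    rw [hS.frontier_eq] at hp; exact hp.2
  have key : ∀ t : ℝ, 0 < 1 + t → p + t • p ∉ S := by
    intro t ht
    have : p + t • p = (1 + t) • p := by rw [add_smul, one_smul]
    rw [this, smul_mem_iff_of_cone hc ht]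
    exact hpS
  have h1 : ∀ w : ℝ, |w| = 1 → ¬ inner ℝ (outwardNormal S p) (w • p) < 0 := by
    intro w hw hneg
    have h2 := (hν.2 (w • p)).1 hneg
    have h3 : ∀ᶠ t : ℝ in 𝓝[>] 0, t < 1 := (gt_mem_nhds one_pos).filter_mono nhdsWithin_le_nhds
    obtain ⟨t, ⟨h2, h3⟩, h4⟩ := ((h2.and h3).and self_mem_nhdsWithin).exists
    have h4 : 0 < t := h4
    rw [smul_smul] at h2
    refine key (t * w) ?_ h2
    have : |t * w| < 1 := by rw [abs_mul, hw, mul_one, abs_of_pos h4]; exact h3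
    linarith [(abs_lt.1 this).1]
  have h2 := h1 1 (by simp)
  have h3 := h1 (-1) (by simp)
  rw [real_inner_smul_right] at h2 h3
  linarith

/-- The implicit function theorem writes the zero set of `f` as `u = g v`. On a small box `f`
increases in `u` at rate at least `m`; this gives the sign of `f` on either side of the graph and,
after division by the gradient bound `Lc`, the distance estimate. -/
theorem exists_isConicChart {n : ℕ} {S : Set (EuclideanSpace ℝ (Fin n))}
    (hC : HasC2BoundaryAwayFromZero S) (hS : IsOpen S) (hc : ∀ c : ℝ, 0 < c → c • S = S)
    {p e : EuclideanSpace ℝ (Fin n)} (τ : EuclideanSpace ℝ (Fin n)) (hp : p ∈ frontier S)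
    (hp0 : p ≠ 0) (he : 0 < inner ℝ (outwardNormal S p) e) :
    ∃ α β κ g, IsConicChart S p e τ α β κ g := by
  obtain ⟨r₀, hr₀, f, hf, hne, hmem, hfr, hν⟩ := hC.exists_ball hS hp hp0
  have hpb : p ∈ Metric.ball p r₀ := Metric.mem_ball_self hr₀
  have hfat : ∀ x ∈ Metric.ball p r₀, ContDiffAt ℝ 2 f x := fun x hx =>
    hf.contDiffAt (Metric.isOpen_ball.mem_nhds hx)
  have hdiff : ∀ x ∈ Metric.ball p r₀, DifferentiableAt ℝ f x := fun x hx =>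
    (hfat x hx).differentiableAt (by norm_num)
  have hfe : 0 < fderiv ℝ f p e := by
    rw [(hν p hpb hp).outwardNormal_eq, real_inner_smul_left, inner_gradient_eq] at he
    exact pos_of_mul_pos_right he (by positivity)
  set m : ℝ := fderiv ℝ f p e / 2 with hm
  have hm0 : 0 < m := by positivity
  set Lc : ℝ := ‖fderiv ℝ f p‖ + 1 with hLc
  have hL0 : 0 < Lc := by positivity
  have hcont : ContinuousAt (fderiv ℝ f) p :=
    ((hfat p hpb).fderiv_right (m := 1) (by norm_num)).continuousAt
  have hev : ∀ᶠ x in 𝓝 p, x ∈ Metric.ball p r₀ ∧ m < fderiv ℝ f x e ∧ ‖fderiv ℝ f x‖ < Lc := by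
    have h1 : ContinuousAt (fun x => fderiv ℝ f x e) p := hcont.clm_apply continuousAt_const
    filter_upwards [Metric.isOpen_ball.mem_nhds hpb,
      h1.eventually (lt_mem_nhds (show m < fderiv ℝ f p e by rw [hm]; linarith)),
      hcont.norm.eventually (gt_mem_nhds (show ‖fderiv ℝ f p‖ < Lc by rw [hLc]; linarith))]
      with x h1 h2 h3 using ⟨h1, h2, h3⟩
  obtain ⟨r, hr, hball⟩ := Metric.eventually_nhds_iff_ball.1 hev
  -- implicit function
  set T : ℝ × ℝ → EuclideanSpace ℝ (Fin n) := fun w => p + w.2 • e + w.1 • τ with hT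
  have hTs : ContDiff ℝ 2 T := by rw [hT]; fun_prop
  have hT0 : T (0, 0) = p := by simp [hT]
  have hF : ContDiffAt ℝ 2 (fun w => f (T w)) (0, 0) := by
    have h1 : ContDiffAt ℝ 2 f (T (0, 0)) := by rw [hT0]; exact hfat p hpb
    exact h1.comp (0, 0) hTs.contDiffAt
  have hTd : ∀ w, HasFDerivAt T ((ContinuousLinearMap.snd ℝ ℝ ℝ).smulRight e
      + (ContinuousLinearMap.fst ℝ ℝ ℝ).smulRight τ) w := by
    intro w
    exact (((ContinuousLinearMap.snd ℝ ℝ ℝ).hasFDerivAt (x := w)).smul_const e).const_add p |>.add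
      (((ContinuousLinearMap.fst ℝ ℝ ℝ).hasFDerivAt (x := w)).smul_const τ)
  have hinv : (fderiv ℝ (fun w => f (T w)) (0, 0) ∘L .inr ℝ ℝ ℝ).IsInvertible := by
    have h1 : HasFDerivAt (fun w => f (T w)) _ (0, 0) :=
      HasFDerivAt.comp (0, 0) (by rw [hT0]; exact (hdiff p hpb).hasFDerivAt) (hTd (0, 0))
    rw [h1.fderiv]
    refine ⟨ContinuousLinearEquiv.unitsEquivAut ℝ (Units.mk0 (fderiv ℝ f p e) hfe.ne'), ?_⟩
    ext
    simp
  -- The equation is solved for the second component, which is why the arguments of `T` are ordered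
  -- `(v, u)`.
  set g := hF.implicitFunction (by norm_num) hinv with hg
  have hg0 : g 0 = 0 := hF.implicitFunction_apply_self (by norm_num) hinv
  have hgd : ContDiffAt ℝ 2 g 0 := hF.contDiffAt_implicitFunction (by norm_num) hinv
  have hgz : ∀ᶠ v in 𝓝 (0 : ℝ), f (T (v, g v)) = 0 := by
    have := hF.eventually_apply_implicitFunction (by norm_num) hinv
    filter_upwards [this] with v hv
    rw [hv, hT0]
    exact (hfr p hpb).1 hp
  -- sizes of the box
  obtain ⟨δ, hδ, hTδ⟩ : ∃ δ > 0, ∀ u ∈ Ioo (-δ) δ, ∀ v ∈ Ioo (-δ) δ,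
      T (v, u) ∈ Metric.ball p (r / 2) := by
    have h1 : ∀ᶠ w in 𝓝 ((0 : ℝ), (0 : ℝ)), T w ∈ Metric.ball p (r / 2) := by
      have := hTs.continuous.tendsto (0, 0)
      rw [hT0] at this
      exact this.eventually (Metric.ball_mem_nhds p (half_pos hr))
    obtain ⟨δ, hδ, h2⟩ := Metric.eventually_nhds_iff_ball.1 h1
    refine ⟨δ, hδ, fun u hu v hv => h2 _ ?_⟩
    rw [← ball_prod_same]
    exact ⟨by simpa [Real.ball_eq_Ioo] using hv, by simpa [Real.ball_eq_Ioo] using hu⟩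
  obtain ⟨β, hβ, hgβ⟩ : ∃ β > 0, ∀ v ∈ Ioo (-β) β, v ∈ Ioo (-δ) δ ∧ f (T (v, g v)) = 0 ∧
      ContDiffAt ℝ 2 g v ∧ g v ∈ Ioo (-δ) δ := by
    have h1 : ∀ᶠ v in 𝓝 (0 : ℝ), g v ∈ Ioo (-δ) δ := by
      have := hgd.continuousAt.tendsto
      rw [hg0] at this
      exact this.eventually (Ioo_mem_nhds (by linarith) hδ)
    have h2 : ∀ᶠ v in 𝓝 (0 : ℝ), ContDiffAt ℝ 2 g v := hgd.eventually (by simp)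
    have h3 : ∀ᶠ v in 𝓝 (0 : ℝ), v ∈ Ioo (-δ) δ := Ioo_mem_nhds (by linarith) hδ
    obtain ⟨β, hβ, h⟩ := Metric.eventually_nhds_iff_ball.1 (h3.and (hgz.and (h2.and h1)))
    refine ⟨β, hβ, fun v hv => ?_⟩
    have := h v (by simpa [Real.ball_eq_Ioo] using hv)
    exact ⟨this.1, this.2.1, this.2.2.1, this.2.2.2⟩
  have hTball : ∀ u ∈ Ioo (-δ) δ, ∀ v ∈ Ioo (-δ) δ, T (v, u) ∈ Metric.ball p r :=
    fun u hu v hv => Metric.ball_subset_ball (by linarith) (hTδ u hu v hv)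
  have hder : ∀ u ∈ Ioo (-δ) δ, ∀ v ∈ Ioo (-δ) δ,
      HasDerivAt (fun u => f (T (v, u))) (fderiv ℝ f (T (v, u)) e) u := by
    intro u hu v hv
    have h1 : HasDerivAt (fun u : ℝ => T (v, u)) e u := by
      have := (((hasDerivAt_id u).smul_const e).const_add p).add_const (v • τ)
      simpa [hT] using this
    exact (hdiff _ (hball _ (hTball u hu v hv)).1).hasFDerivAt.comp_hasDerivAt u h1
  have hmono : ∀ v ∈ Ioo (-δ) δ, ∀ u₁ ∈ Ioo (-δ) δ, ∀ u₂ ∈ Ioo (-δ) δ, u₁ ≤ u₂ →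
      m * (u₂ - u₁) ≤ f (T (v, u₂)) - f (T (v, u₁)) := by
    intro v hv u₁ hu₁ u₂ hu₂ h12
    refine (convex_Ioo (-δ) δ).mul_sub_le_image_sub_of_le_deriv (f := fun u => f (T (v, u))) ?_ ?_
      ?_ u₁ hu₁ u₂ hu₂ h12
    · exact fun u hu => (hder u hu v hv).continuousAt.continuousWithinAt
    · intro u hu
      rw [interior_Ioo] at hu
      exact (hder u hu v hv).differentiableAt.differentiableWithinAt
    · intro u hu
      rw [interior_Ioo] at hu
      rw [(hder u hu v hv).deriv]
      exact (hball _ (hTball u hu v hv)).2.1.le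
  have hcmp : ∀ u ∈ Ioo (-δ) δ, ∀ v ∈ Ioo (-β) β, m * |u - g v| ≤ |f (T (v, u))| ∧
      (f (T (v, u)) < 0 ↔ u < g v) ∧ (f (T (v, u)) = 0 ↔ u = g v) := by
    intro u hu v hv
    obtain ⟨hv1, hv2, -, hv4⟩ := hgβ v hv
    rcases lt_trichotomy u (g v) with h | h | h
    · have h1 := hmono v hv1 u hu _ hv4 h.le
      rw [hv2] at h1
      have h2 : 0 < m * (g v - u) := mul_pos hm0 (by linarith)
      refine ⟨?_, ⟨fun _ => h, fun _ => by linarith⟩, ⟨fun h3 => by linarith, fun h3 => by linarith⟩⟩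
      rw [abs_of_neg (by linarith), abs_of_neg (by linarith)]
      linarith
    · subst h
      simp [hv2]
    · have h1 := hmono v hv1 _ hv4 u hu h.le
      rw [hv2] at h1
      have h2 : 0 < m * (u - g v) := mul_pos hm0 (by linarith)
      refine ⟨?_, ⟨fun _ => by linarith, fun _ => by linarith⟩,
        ⟨fun h3 => by linarith, fun h3 => by linarith⟩⟩
      rw [abs_of_pos (by linarith), abs_of_pos (by linarith)]
      linarith
  have hTe : ∀ u v, T (v, u) = p + u • e + v • τ := fun u v => rfl
  have hqf : ∀ v ∈ Ioo (-β) β, p + g v • e + v • τ ∈ frontier S := by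
    intro v hv
    rw [← hTe]
    exact (hfr _ (hball _ (hTball _ (hgβ v hv).2.2.2 v (hgβ v hv).1)).1).2 (hgβ v hv).2.1
  have hqb : ∀ v ∈ Ioo (-β) β, p + g v • e + v • τ ∈ Metric.ball p r := by
    intro v hv
    rw [← hTe]
    exact hTball _ (hgβ v hv).2.2.2 v (hgβ v hv).1
  have hnu : ∀ v ∈ Ioo (-β) β, IsOutwardUnitNormal S (p + g v • e + v • τ)
      (‖gradient f (p + g v • e + v • τ)‖⁻¹ • gradient f (p + g v • e + v • τ)) := fun v hv =>
    hν _ (hball _ (hqb v hv)).1 (hqf v hv)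
  -- The bound `m / Lc` serves boundary points in the ball of radius `r` about `p`. Any other
  -- boundary point is at distance at least `r / 2` from the box, while `|u - g v| ≤ 2 * δ`; hence
  -- `r / (4 * δ)`.
  refine ⟨δ, β, min (m / Lc) (r / (4 * δ)), g, hδ, hβ, by positivity, ?_, ?_, ?_, ?_, ?_, ?_, ?_,
    ?_, ?_⟩
  · exact fun v hv => ((hgβ v hv).2.2.1.of_le (by norm_num)).contDiffWithinAt
  · exact fun v hv => (hgβ v hv).2.2.2
  · intro u hu v hv
    rw [← hTe, hmem _ (hball _ (hTball u hu v (hgβ v hv).1)).1]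
    exact (hcmp u hu v hv).2.1
  · intro u hu v hv
    rw [← hTe, hfr _ (hball _ (hTball u hu v (hgβ v hv).1)).1]
    exact (hcmp u hu v hv).2.2
  · intro u hu v hv y hy
    rw [← hTe]
    have hv1 := (hgβ v hv).1
    by_cases hyb : y ∈ Metric.ball p r
    · have hy0 : f y = 0 := (hfr y (hball y hyb).1).1 hy
      have h1 : ‖f (T (v, u)) - f y‖ ≤ Lc * ‖T (v, u) - y‖ :=
        (convex_ball p r).norm_image_sub_le_of_norm_fderiv_le
          (fun x hx => hdiff x (hball x hx).1) (fun x hx => (hball x hx).2.2.le) hyb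
          (hTball u hu v hv1)
      rw [hy0, sub_zero, Real.norm_eq_abs] at h1
      have h2 := (hcmp u hu v hv).1
      calc _ ≤ m / Lc * |u - g v| := by gcongr; exact min_le_left _ _
        _ = (m * |u - g v|) / Lc := by ring
        _ ≤ ‖T (v, u) - y‖ := by
          rw [div_le_iff₀ hL0]; linarith
    · have h1 : r ≤ dist y p := by simpa using hyb
      have h2 : dist (T (v, u)) p < r / 2 := hTδ u hu v hv1
      have h3 : dist y p ≤ dist (T (v, u)) y + dist (T (v, u)) p := by
        rw [dist_comm (T (v, u)) y]; exact dist_triangle _ _ _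
      rw [← dist_eq_norm]
      have h4 : |u - g v| ≤ 2 * δ := by
        have h5 := hu
        have h6 := (hgβ v hv).2.2.2
        rw [abs_le]
        constructor <;> linarith [h5.1, h5.2, h6.1, h6.2]
      calc _ ≤ r / (4 * δ) * |u - g v| := by gcongr; exact min_le_right _ _
        _ ≤ r / (4 * δ) * (2 * δ) := by gcongr
        _ = r / 2 := by field_simp; norm_num
        _ ≤ _ := by linarith
  · intro v hv
    rw [(hnu v hv).outwardNormal_eq]
    exact (hnu v hv).1
  · intro v hv
    by_cases h0 : p + g v • e + v • τ = 0
    · rw [h0]; simp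
    · exact inner_outwardNormal_self hC hS hc (hqf v hv) h0
  · intro v hv
    rw [(hnu v hv).outwardNormal_eq, real_inner_smul_left, inner_gradient_eq]
    have h1 : HasDerivAt (fun v => p + g v • e + v • τ) (deriv g v • e + τ) v := by
      have h2 := ((hgβ v hv).2.2.1.differentiableAt (by norm_num)).hasDerivAt.smul_const e
      have h3 := (hasDerivAt_id v).smul_const τ
      simpa using (h2.const_add p).fun_add h3
    have h2 : HasDerivAt (fun v => f (p + g v • e + v • τ)) _ v :=
      (hdiff _ (hball _ (hqb v hv)).1).hasFDerivAt.comp_hasDerivAt v h1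
    have h3 : (fun v => f (p + g v • e + v • τ)) =ᶠ[𝓝 v] fun _ => 0 := by
      filter_upwards [Ioo_mem_nhds hv.1 hv.2] with w hw
      exact (hgβ w hw).2.1
    have h4 := h2.congr_of_eventuallyEq h3.symm
    have h5 := (hasDerivAt_const v (0 : ℝ)).unique h4
    rw [← h5, mul_zero]
  · intro v hv
    rw [(hnu v hv).outwardNormal_eq, real_inner_smul_left, inner_gradient_eq]
    have h1 : 0 < fderiv ℝ f (p + g v • e + v • τ) e := hm0.trans (hball _ (hqb v hv)).2.1
    refine mul_pos (inv_pos.2 (norm_pos_iff.2 fun h0 => ?_)) h1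
    rw [← inner_gradient_eq, h0, inner_zero_left] at h1
    exact lt_irrefl _ h1
end

noncomputable section

/-! ### Hausdorff measures in conic charts and polar coordinates -/

/-- Euclidean three-space. -/
abbrev E3 := EuclideanSpace ℝ (Fin 3)

/-- The open cone over the box `|u| < α`, `|v| < β` in the coordinates given by `L`. -/
def conicBox (L : E3 ≃L[ℝ] E3) (α β : ℝ) : Set E3 :=
  {x | 0 < L.symm x 0 ∧ |L.symm x 1| < α * L.symm x 0 ∧ |L.symm x 2| < β * L.symm x 0}

theorem isOpen_conicBox (L : E3 ≃L[ℝ] E3) (α β : ℝ) : IsOpen (conicBox L α β) := by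
  have h : ∀ i, Continuous fun x => L.symm x i := fun i => by fun_prop
  exact (isOpen_lt continuous_const (h 0)).inter
    ((isOpen_lt (h 1).abs (continuous_const.mul (h 0))).inter
      (isOpen_lt (h 2).abs (continuous_const.mul (h 0))))

theorem smul_mem_conicBox {L : E3 ≃L[ℝ] E3} {α β : ℝ} {c : ℝ} (hc : 0 < c) (x : E3) :
    c • x ∈ conicBox L α β ↔ x ∈ conicBox L α β := by
  simp only [conicBox, mem_ofPred_eq, map_smul, PiLp.smul_apply, smul_eq_mul, abs_mul, abs_of_pos hc,
    mul_pos_iff_of_pos_left hc]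
  rw [show α * (c * L.symm x 0) = c * (α * L.symm x 0) by ring,
    show β * (c * L.symm x 0) = c * (β * L.symm x 0) by ring, mul_lt_mul_iff_right₀ hc,
    mul_lt_mul_iff_right₀ hc]

namespace IsConicChart

variable {S : Set E3} {p e τ : E3} {α β κ : ℝ} {g : ℝ → ℝ} {L : E3 ≃L[ℝ] E3}

theorem mono (h : IsConicChart S p e τ α β κ g) {β' : ℝ} (h0 : 0 < β') (hβ : β' ≤ β) :
    IsConicChart S p e τ α β' κ g := by
  have hs : Ioo (-β') β' ⊆ Ioo (-β) β := Ioo_subset_Ioo (by linarith) hβ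
  exact ⟨h.α_pos, h0, h.κ_pos, h.contDiffOn.mono hs, fun v hv => h.g_mem v (hs hv),
    fun u hu v hv => h.mem_iff u hu v (hs hv), fun u hu v hv => h.frontier_iff u hu v (hs hv),
    fun u hu v hv => h.dist_le u hu v (hs hv), fun v hv => h.norm_normal v (hs hv),
    fun v hv => h.inner_self v (hs hv), fun v hv => h.inner_tangent v (hs hv),
    fun v hv => h.inner_pos v (hs hv)⟩

theorem mem_conicBox_base (h : IsConicChart S p e τ α β κ g)
    (hL : ∀ y, L y = y 0 • p + y 1 • e + y 2 • τ) : p ∈ conicBox L α β := by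
  have hp : L.symm p = !₂[1, 0, 0] := by
    rw [ContinuousLinearEquiv.symm_apply_eq, hL]; simp
  simp [conicBox, hp, h.α_pos, h.β_pos]

theorem coord_div_mem {x : E3} (hx : x ∈ conicBox L α β) :
    L.symm x 1 / L.symm x 0 ∈ Ioo (-α) α ∧ L.symm x 2 / L.symm x 0 ∈ Ioo (-β) β := by
  obtain ⟨h0, h1, h2⟩ := hx
  constructor
  · rw [mem_Ioo, ← abs_lt, abs_div, abs_of_pos h0, div_lt_iff₀ h0]; exact h1
  · rw [mem_Ioo, ← abs_lt, abs_div, abs_of_pos h0, div_lt_iff₀ h0]; exact h2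

theorem eq_smul_of_mem (hL : ∀ y, L y = y 0 • p + y 1 • e + y 2 • τ) {x : E3}
    (hx : x ∈ conicBox L α β) :
    x = L.symm x 0 • (p + (L.symm x 1 / L.symm x 0) • e + (L.symm x 2 / L.symm x 0) • τ) := by
  have h0 : L.symm x 0 ≠ 0 := hx.1.ne'
  conv_lhs => rw [← L.apply_symm_apply x, hL]
  rw [smul_add, smul_add, smul_smul, smul_smul, mul_div_cancel₀ _ h0, mul_div_cancel₀ _ h0]

theorem mem_iff_conicBox (h : IsConicChart S p e τ α β κ g) (hc : ∀ c : ℝ, 0 < c → c • S = S)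
    (hL : ∀ y, L y = y 0 • p + y 1 • e + y 2 • τ) {x : E3} (hx : x ∈ conicBox L α β) :
    x ∈ S ↔ L.symm x 1 < L.symm x 0 * g (L.symm x 2 / L.symm x 0) := by
  have hd := coord_div_mem hx
  conv_lhs => rw [eq_smul_of_mem hL hx]
  rw [smul_mem_iff_of_cone hc hx.1, h.mem_iff _ hd.1 _ hd.2, div_lt_iff₀ hx.1, mul_comm]

theorem frontier_iff_conicBox (h : IsConicChart S p e τ α β κ g)
    (hc : ∀ c : ℝ, 0 < c → c • S = S)
    (hL : ∀ y, L y = y 0 • p + y 1 • e + y 2 • τ) {x : E3} (hx : x ∈ conicBox L α β) :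
    x ∈ frontier S ↔ L.symm x 1 = L.symm x 0 * g (L.symm x 2 / L.symm x 0) := by
  have hd := coord_div_mem hx
  conv_lhs => rw [eq_smul_of_mem hL hx]
  rw [smul_mem_frontier_iff_of_cone hc hx.1, h.frontier_iff _ hd.1 _ hd.2,
    div_eq_iff hx.1.ne', mul_comm]

/-- Dividing by the first coordinate moves `x` into the slice where the chart lives, and both sides
scale linearly because the boundary is a cone. -/
theorem dist_le_conicBox (h : IsConicChart S p e τ α β κ g) (hc : ∀ c : ℝ, 0 < c → c • S = S)
    (hL : ∀ y, L y = y 0 • p + y 1 • e + y 2 • τ) {x : E3} (hx : x ∈ conicBox L α β) {y : E3}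
    (hy : y ∈ frontier S) :
    κ * |L.symm x 1 - L.symm x 0 * g (L.symm x 2 / L.symm x 0)| ≤ ‖x - y‖ := by
  have hd := coord_div_mem hx
  have h0 := hx.1
  set a := L.symm x 0 with ha
  have h1 := h.dist_le _ hd.1 _ hd.2 (a⁻¹ • y)
    ((smul_mem_frontier_iff_of_cone hc (inv_pos.2 h0) y).2 hy)
  have h2 : x - y = a • (p + (L.symm x 1 / a) • e + (L.symm x 2 / a) • τ - a⁻¹ • y) := by
    rw [smul_sub, smul_smul, mul_inv_cancel₀ h0.ne', one_smul, ← eq_smul_of_mem hL hx]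
  have h3 : L.symm x 1 - a * g (L.symm x 2 / a) = a * (L.symm x 1 / a - g (L.symm x 2 / a)) := by
    field_simp
  rw [h2, h3, norm_smul, abs_mul, Real.norm_eq_abs, abs_of_pos h0]
  calc κ * (a * |L.symm x 1 / a - g (L.symm x 2 / a)|)
      = a * (κ * |L.symm x 1 / a - g (L.symm x 2 / a)|) := by ring
    _ ≤ _ := by gcongr

theorem symm_curve (hL : ∀ y, L y = y 0 • p + y 1 • e + y 2 • τ) (u v : ℝ) :
    L.symm (p + u • e + v • τ) = !₂[1, u, v] := by
  rw [ContinuousLinearEquiv.symm_apply_eq, hL]; simp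

theorem curve_mem (h : IsConicChart S p e τ α β κ g)
    (hL : ∀ y, L y = y 0 • p + y 1 • e + y 2 • τ) {v : ℝ} (hv : v ∈ Ioo (-β) β) :
    p + g v • e + v • τ ∈ conicBox L α β := by
  have h1 := h.g_mem v hv
  simp only [conicBox, mem_ofPred_eq, symm_curve hL]
  simp [abs_lt, h1.1, h1.2, hv.1, hv.2]

theorem curve_ne_zero (hL : ∀ y, L y = y 0 • p + y 1 • e + y 2 • τ) (u v : ℝ) :
    p + u • e + v • τ ≠ 0 := by
  intro h0
  have := congrArg (fun x => L.symm x 0) h0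
  simp [symm_curve hL] at this

theorem curve_frontier (h : IsConicChart S p e τ α β κ g) {v : ℝ} (hv : v ∈ Ioo (-β) β) :
    p + g v • e + v • τ ∈ frontier S :=
  (h.frontier_iff _ (h.g_mem v hv) v hv).2 rfl

theorem contDiffAt (h : IsConicChart S p e τ α β κ g) {v : ℝ} (hv : v ∈ Ioo (-β) β) :
    ContDiffAt ℝ 1 g v := h.contDiffOn.contDiffAt (Ioo_mem_nhds hv.1 hv.2)

theorem hasDerivAt_curve (h : IsConicChart S p e τ α β κ g) {v : ℝ} (hv : v ∈ Ioo (-β) β) :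
    HasDerivAt (fun v => p + g v • e + v • τ) (deriv g v • e + τ) v := by
  have h2 := ((h.contDiffAt hv).differentiableAt (by norm_num)).hasDerivAt.smul_const e
  simpa using (h2.const_add p).fun_add ((hasDerivAt_id v).smul_const τ)

theorem continuousOn_deriv (h : IsConicChart S p e τ α β κ g) :
    ContinuousOn (deriv g) (Ioo (-β) β) :=
  h.contDiffOn.continuousOn_deriv_of_isOpen isOpen_Ioo le_rfl

end IsConicChart

/-- The area of the parallelogram spanned by `x` and `y`. -/
def parallelogramArea {V : Type*} [NormedAddCommGroup V] [InnerProductSpace ℝ V] (x y : V) : ℝ :=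
  Real.sqrt (‖x‖ ^ 2 * ‖y‖ ^ 2 - inner ℝ x y ^ 2)

theorem parallelogramArea_sq_nonneg {V : Type*} [NormedAddCommGroup V] [InnerProductSpace ℝ V]
    (x y : V) : 0 ≤ ‖x‖ ^ 2 * ‖y‖ ^ 2 - inner ℝ x y ^ 2 := by
  have h := abs_real_inner_le_norm x y
  have h2 : |inner ℝ x y| ^ 2 ≤ (‖x‖ * ‖y‖) ^ 2 := by gcongr
  rw [sq_abs] at h2
  nlinarith

theorem parallelogramArea_smul_right {V : Type*} [NormedAddCommGroup V] [InnerProductSpace ℝ V]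
    (x y : V) {r : ℝ} (hr : 0 ≤ r) : parallelogramArea x (r • y) = r * parallelogramArea x y := by
  rw [parallelogramArea, parallelogramArea, norm_smul, real_inner_smul_right, Real.norm_eq_abs,
    abs_of_nonneg hr, show ‖x‖ ^ 2 * (r * ‖y‖) ^ 2 - (r * inner ℝ x y) ^ 2
      = r ^ 2 * (‖x‖ ^ 2 * ‖y‖ ^ 2 - inner ℝ x y ^ 2) by ring,
    Real.sqrt_mul (sq_nonneg r), Real.sqrt_sq hr]

theorem normDet_pair {V : Type*} [NormedAddCommGroup V] [InnerProductSpace ℝ V]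
    (T : EuclideanSpace ℝ (Fin 2) →ₗ[ℝ] V) :
    T.normDet = parallelogramArea (T (EuclideanSpace.single 0 1)) (T (EuclideanSpace.single 1 1)) := by
  have h := LinearMap.normDet_sq_eq_det_gram T (EuclideanSpace.basisFun (Fin 2) ℝ)
  simp only [Matrix.det_fin_two, Matrix.gram_apply, EuclideanSpace.basisFun_apply,
    RCLike.ofReal_real_eq_id, id] at h
  rw [parallelogramArea, ← Real.sqrt_sq T.normDet_nonneg, h, real_inner_self_eq_norm_sq,
    real_inner_self_eq_norm_sq, real_inner_comm]
  congr 1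
  ring

theorem normDet_real {V : Type*} [NormedAddCommGroup V] [InnerProductSpace ℝ V]
    (T : ℝ →ₗ[ℝ] V) : T.normDet = ‖T 1‖ := by
  have h := LinearMap.normDet_sq_eq_det_gram T (OrthonormalBasis.singleton (Fin 1) ℝ)
  simp only [Matrix.det_unique, Matrix.gram_apply,
    RCLike.ofReal_real_eq_id, id] at h
  rw [← Real.sqrt_sq T.normDet_nonneg, h]
  simp

namespace IsConicChart

variable {S : Set E3} {p e τ : E3} {α β κ : ℝ} {g : ℝ → ℝ} {L : E3 ≃L[ℝ] E3}

/-- A vanishing area is equality in the Cauchy–Schwarz inequality and makes the second vector a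
nonzero multiple of the first; but their coordinates along `p` are `0` and `1`. -/
theorem area_pos (hL : ∀ y, L y = y 0 • p + y 1 • e + y 2 • τ) (u v w : ℝ) :
    0 < parallelogramArea (p + u • e + v • τ) (w • e + τ) := by
  refine Real.sqrt_pos.2 (lt_of_le_of_ne (parallelogramArea_sq_nonneg _ _) fun h0 => ?_)
  set q := p + u • e + v • τ
  set q' := w • e + τ
  have hq : q ≠ 0 := curve_ne_zero hL u v
  have hq' : L.symm q' = !₂[0, w, 1] := by
    rw [ContinuousLinearEquiv.symm_apply_eq, hL]; simp [q']
  have h1 : |inner ℝ q q'| = ‖q‖ * ‖q'‖ := by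
    rw [← abs_of_nonneg (by positivity : 0 ≤ ‖q‖ * ‖q'‖), ← sq_eq_sq_iff_abs_eq_abs]
    linarith
  have h1' : ‖inner ℝ q q'‖ = ‖q‖ * ‖q'‖ := h1
  have h2 : q' ≠ 0 := by
    intro h
    have := congrArg (fun x => L.symm x 2) h
    simp [hq'] at this
  obtain ⟨r, hr, hrq⟩ := (norm_inner_eq_norm_iff hq h2).1 h1'
  have := congrArg (fun x => L.symm x 0) hrq
  simp only [map_smul, PiLp.smul_apply] at this
  rw [hq', symm_curve hL] at this
  simp at this
  exact hr this.symm

theorem frontier_inter_conicBox (h : IsConicChart S p e τ α β κ g)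
    (hc : ∀ c : ℝ, 0 < c → c • S = S) (hL : ∀ y, L y = y 0 • p + y 1 • e + y 2 • τ) :
    frontier S ∩ conicBox L α β =
      (fun y : EuclideanSpace ℝ (Fin 2) => y 0 • (p + g (y 1) • e + y 1 • τ)) ''
        {y | 0 < y 0 ∧ y 1 ∈ Ioo (-β) β} := by
  ext x
  constructor
  · rintro ⟨hxf, hx⟩
    refine ⟨!₂[L.symm x 0, L.symm x 2 / L.symm x 0], ⟨hx.1, (coord_div_mem hx).2⟩, ?_⟩
    have h1 := (h.frontier_iff_conicBox hc hL hx).1 hxf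
    have h2 := eq_smul_of_mem hL hx
    have h3 : L.symm x 1 / L.symm x 0 = g (L.symm x 2 / L.symm x 0) := by
      rw [div_eq_iff hx.1.ne', h1, mul_comm]
    rw [h3] at h2
    exact h2.symm
  · rintro ⟨y, ⟨hy0, hy1⟩, rfl⟩
    exact ⟨(smul_mem_frontier_iff_of_cone hc hy0 _).2 (h.curve_frontier hy1),
      (smul_mem_conicBox hy0 _).2 (h.curve_mem hL hy1)⟩

theorem measurePreserving_pair :
    MeasurePreserving (fun y : EuclideanSpace ℝ (Fin 2) => (y 0, y 1)) volume
      (volume : Measure (ℝ × ℝ)) :=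
  (volume_preserving_finTwoArrow ℝ).comp (PiLp.volume_preserving_ofLp (Fin 2))

theorem injOn_param (hL : ∀ y, L y = y 0 • p + y 1 • e + y 2 • τ) :
    InjOn (fun y : EuclideanSpace ℝ (Fin 2) => y 0 • (p + g (y 1) • e + y 1 • τ))
      {y | 0 < y 0 ∧ y 1 ∈ Ioo (-β) β} := by
  intro y hy z hz hyz
  have h1 := congrArg (fun x => L.symm x) hyz
  simp only [map_smul, symm_curve hL] at h1
  have h2 := congrArg (fun x : E3 => x 0) h1
  have h3 := congrArg (fun x : E3 => x 2) h1
  simp at h2 h3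
  ext i
  fin_cases i
  · exact h2
  · rw [h2] at h3
    exact mul_left_cancel₀ hz.1.ne' h3

/-- With `r = y 0`, `v = y 1` and `q` the curve, the partial derivatives of `r • q v` are `q v` and
`r • q' v`, so the Jacobian is `r` times the area spanned by `q v` and `q' v`. -/
theorem hasStrictFDerivAt_param (h : IsConicChart S p e τ α β κ g)
    (hL : ∀ y, L y = y 0 • p + y 1 • e + y 2 • τ) :
    ∃ Ψ' : EuclideanSpace ℝ (Fin 2) → EuclideanSpace ℝ (Fin 2) →L[ℝ] E3,
      ∀ a ∈ {y : EuclideanSpace ℝ (Fin 2) | 0 < y 0 ∧ y 1 ∈ Ioo (-β) β},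
        HasStrictFDerivAt (fun y : EuclideanSpace ℝ (Fin 2) => y 0 • (p + g (y 1) • e + y 1 • τ))
          (Ψ' a) a ∧
        0 < a 0 * parallelogramArea (p + g (a 1) • e + a 1 • τ) (deriv g (a 1) • e + τ) ∧
        a 0 * parallelogramArea (p + g (a 1) • e + a 1 • τ) (deriv g (a 1) • e + τ) =
          LinearMap.normDet (Ψ' a : EuclideanSpace ℝ (Fin 2) →ₗ[ℝ] E3) := by
  set q : ℝ → E3 := fun v => p + g v • e + v • τ with hq
  set q' : ℝ → E3 := fun v => deriv g v • e + τ with hq'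
  have hqc : ContDiffOn ℝ 1 q (Ioo (-β) β) := by
    have := h.contDiffOn
    rw [hq]; fun_prop
  refine ⟨fun y => y 0 • (EuclideanSpace.proj (𝕜 := ℝ) (1 : Fin 2)).smulRight (q' (y 1))
      + (EuclideanSpace.proj (𝕜 := ℝ) (0 : Fin 2)).smulRight (q (y 1)), fun a ha => ⟨?_, ?_, ?_⟩⟩
  · have h0 : HasStrictFDerivAt (fun y : EuclideanSpace ℝ (Fin 2) => y 0)
        (EuclideanSpace.proj (𝕜 := ℝ) (0 : Fin 2)) a :=
      (EuclideanSpace.proj (𝕜 := ℝ) (0 : Fin 2)).hasStrictFDerivAt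
    have h1 : HasStrictFDerivAt (fun y : EuclideanSpace ℝ (Fin 2) => y 1)
        (EuclideanSpace.proj (𝕜 := ℝ) (1 : Fin 2)) a :=
      (EuclideanSpace.proj (𝕜 := ℝ) (1 : Fin 2)).hasStrictFDerivAt
    have h2 : HasStrictDerivAt q (q' (a 1)) (a 1) := by
      have h3 := (hqc.contDiffAt (Ioo_mem_nhds ha.2.1 ha.2.2)).hasStrictDerivAt (by norm_num)
      rwa [(h.hasDerivAt_curve ha.2).deriv] at h3
    have h4 := h0.smul (h2.hasStrictFDerivAt.comp a h1)
    convert! h4 using 1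
  · exact mul_pos ha.1 (area_pos hL _ _ _)
  · rw [normDet_pair]
    simp only [ContinuousLinearMap.coe_coe]
    rw [← parallelogramArea_smul_right _ _ ha.1.le]
    simp [-smul_add, hq, hq']

theorem continuousOn_curve (h : IsConicChart S p e τ α β κ g) :
    ContinuousOn (fun v => p + g v • e + v • τ) (Ioo (-β) β) := by
  have := h.contDiffOn.continuousOn
  fun_prop

theorem continuousOn_area (h : IsConicChart S p e τ α β κ g) :
    ContinuousOn (fun v => parallelogramArea (p + g v • e + v • τ) (deriv g v • e + τ))
      (Ioo (-β) β) := by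
  have h1 := h.continuousOn_curve
  have h2 : ContinuousOn (fun v => deriv g v • e + τ) (Ioo (-β) β) :=
    (h.continuousOn_deriv.smul continuousOn_const).add continuousOn_const
  exact Real.continuous_sqrt.comp_continuousOn
    (((h1.norm.pow 2).mul (h2.norm.pow 2)).sub ((h1.inner h2).pow 2))

theorem isOpen_paramDomain :
    IsOpen {y : EuclideanSpace ℝ (Fin 2) | 0 < y 0 ∧ y 1 ∈ Ioo (-β) β} :=
  (isOpen_Ioi.preimage (by fun_prop : Continuous fun y : EuclideanSpace ℝ (Fin 2) => y 0)).inter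
    (isOpen_Ioo.preimage (by fun_prop : Continuous fun y : EuclideanSpace ℝ (Fin 2) => y 1))

theorem continuousOn_density (h : IsConicChart S p e τ α β κ g) :
    ContinuousOn (fun y : EuclideanSpace ℝ (Fin 2) =>
      y 0 * parallelogramArea (p + g (y 1) • e + y 1 • τ) (deriv g (y 1) • e + τ))
      {y : EuclideanSpace ℝ (Fin 2) | 0 < y 0 ∧ y 1 ∈ Ioo (-β) β} :=
  ContinuousOn.mul (by fun_prop) (h.continuousOn_area.comp (by fun_prop) fun y hy => hy.2)

theorem paramDomain_eq_preimage : {y : EuclideanSpace ℝ (Fin 2) | 0 < y 0 ∧ y 1 ∈ Ioo (-β) β} =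
    (fun y : EuclideanSpace ℝ (Fin 2) => (y 0, y 1)) ⁻¹' (Ioi 0 ×ˢ Ioo (-β) β) := by
  ext y; simp

theorem measurableEmbedding_pair :
    MeasurableEmbedding (fun y : EuclideanSpace ℝ (Fin 2) => (y 0, y 1)) :=
  ((MeasurableEquiv.toLp 2 (Fin 2 → ℝ)).symm.trans MeasurableEquiv.finTwoArrow).measurableEmbedding

theorem lintegral_frontier (h : IsConicChart S p e τ α β κ g)
    (hc : ∀ c : ℝ, 0 < c → c • S = S) (hL : ∀ y, L y = y 0 • p + y 1 • e + y 2 • τ)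
    {F : E3 → ℝ≥0∞} (hF : Measurable F) :
    ∫⁻ x in frontier S ∩ conicBox L α β, F x ∂μHE[2] =
      ∫⁻ v in Ioo (-β) β, ∫⁻ r in Ioi (0 : ℝ), F (r • (p + g v • e + v • τ)) *
        ENNReal.ofReal (r * parallelogramArea (p + g v • e + v • τ) (deriv g v • e + τ)) := by
  obtain ⟨Ψ', hΨ'⟩ := h.hasStrictFDerivAt_param hL
  have key := lintegral_image_area_formula isOpen_paramDomain.measurableSet
    (fun a ha => (hΨ' a ha).1) (injOn_param hL) h.continuousOn_density
    (fun a ha => (hΨ' a ha).2.1) (fun a ha => (hΨ' a ha).2.2) hF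
  rw [finrank_euclideanSpace_fin] at key
  rw [h.frontier_inter_conicBox hc hL]
  refine key.trans ?_
  set G : ℝ × ℝ → ℝ≥0∞ := fun z => F (z.1 • (p + g z.2 • e + z.2 • τ)) *
    ENNReal.ofReal (z.1 * parallelogramArea (p + g z.2 • e + z.2 • τ) (deriv g z.2 • e + τ)) with hG
  have hprodo : MeasurableSet ((Ioi 0 : Set ℝ) ×ˢ Ioo (-β) β) :=
    measurableSet_Ioi.prod measurableSet_Ioo
  have h5 := measurePreserving_pair.setLIntegral_comp_preimage_emb measurableEmbedding_pair G
    (Ioi 0 ×ˢ Ioo (-β) β)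
  rw [← paramDomain_eq_preimage] at h5
  refine h5.trans ?_
  have hGm : AEMeasurable G ((volume : Measure (ℝ × ℝ)).restrict (Ioi 0 ×ˢ Ioo (-β) β)) := by
    refine AEMeasurable.mul (hF.comp_aemeasurable (ContinuousOn.aemeasurable ?_ hprodo))
      (ContinuousOn.aemeasurable ?_ hprodo).ennreal_ofReal
    · exact continuousOn_fst.smul (h.continuousOn_curve.comp (by fun_prop) fun y hy => hy.2)
    · exact ContinuousOn.mul (by fun_prop)
        (h.continuousOn_area.comp (by fun_prop) fun y hy => hy.2)
  rw [Measure.volume_eq_prod] at hGm ⊢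
  rw [← Measure.prod_restrict] at hGm ⊢
  rw [lintegral_prod_symm _ hGm]

theorem integral_frontier (h : IsConicChart S p e τ α β κ g)
    (hc : ∀ c : ℝ, 0 < c → c • S = S) (hL : ∀ y, L y = y 0 • p + y 1 • e + y 2 • τ)
    {F : E3 → ℝ}
    (hF : AEStronglyMeasurable F ((μHE[2]).restrict (frontier S ∩ conicBox L α β))) :
    ∫ x in frontier S ∩ conicBox L α β, F x ∂μHE[2] =
      ∫ z in Ioi (0 : ℝ) ×ˢ Ioo (-β) β,
        z.1 * parallelogramArea (p + g z.2 • e + z.2 • τ) (deriv g z.2 • e + τ) *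
          F (z.1 • (p + g z.2 • e + z.2 • τ)) := by
  obtain ⟨Ψ', hΨ'⟩ := h.hasStrictFDerivAt_param hL
  have key := integral_image_area_formula (F := F) isOpen_paramDomain.measurableSet
    (fun a ha => (hΨ' a ha).1) (injOn_param hL) h.continuousOn_density
    (fun a ha => (hΨ' a ha).2.1) (fun a ha => (hΨ' a ha).2.2)
  rw [finrank_euclideanSpace_fin] at key
  rw [h.frontier_inter_conicBox hc hL] at hF ⊢
  refine (key hF).trans ?_
  have h5 := measurePreserving_pair.setIntegral_preimage_emb measurableEmbedding_pair
    (fun z : ℝ × ℝ => z.1 * parallelogramArea (p + g z.2 • e + z.2 • τ) (deriv g z.2 • e + τ) *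
          F (z.1 • (p + g z.2 • e + z.2 • τ))) (Ioi 0 ×ˢ Ioo (-β) β)
  rw [← paramDomain_eq_preimage] at h5
  exact h5

end IsConicChart

end

/-! ### Global charts and polar coordinates on the boundary of a cone -/

noncomputable section

/-- An open cone whose boundary is of class `C²` away from the origin. -/
structure IsC2Cone {n : ℕ} (S : Set (EuclideanSpace ℝ (Fin n))) : Prop where
  isOpen : IsOpen S
  cone : ∀ c : ℝ, 0 < c → c • S = S
  c2_boundary : HasC2BoundaryAwayFromZero S

theorem exists_frame {p e : E3} (h : LinearIndependent ℝ ![p, e]) :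
    ∃ (τ : E3) (L : E3 ≃L[ℝ] E3), ∀ y, L y = y 0 • p + y 1 • e + y 2 • τ := by
  obtain ⟨τ, hτ⟩ : ∃ τ, τ ∉ Submodule.span ℝ (range ![p, e]) := by
    by_contra hcon
    push Not at hcon
    have h1 : Submodule.span ℝ (range ![p, e]) = ⊤ := Submodule.eq_top_iff'.2 hcon
    have h2 := finrank_span_eq_card h
    rw [h1, finrank_top, finrank_euclideanSpace_fin] at h2
    simp at h2
  have h3 : LinearIndependent ℝ (Fin.snoc ![p, e] τ : Fin 3 → E3) :=
    linearIndependent_finSnoc.2 ⟨h, hτ⟩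
  set b := basisOfLinearIndependentOfCardEqFinrank h3 (by simp)
  refine ⟨τ, (EuclideanSpace.equiv (Fin 3) ℝ).trans b.equivFun.symm.toContinuousLinearEquiv,
    fun y => ?_⟩
  have : b.equivFun.symm (EuclideanSpace.equiv (Fin 3) ℝ y) = y 0 • p + y 1 • e + y 2 • τ := by
    rw [Module.Basis.equivFun_symm_apply, Fin.sum_univ_three]
    simp only [b, coe_basisOfLinearIndependentOfCardEqFinrank]
    rfl
  exact this

/-- The normal at `p` is orthogonal to `p` but not to `e`, so `p` and `e` are independent and can be
completed to a frame of the space. -/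
theorem IsC2Cone.exists_chart {S : Set E3} (hS : IsC2Cone S) {p e : E3} (hp : p ∈ frontier S)
    (hp0 : p ≠ 0) (he : 0 < inner ℝ (outwardNormal S p) e) :
    ∃ τ L α β κ g, IsConicChart S p e τ α β κ g ∧
      ∀ y, (L : E3 ≃L[ℝ] E3) y = y 0 • p + y 1 • e + y 2 • τ := by
  have hli : LinearIndependent ℝ ![p, e] := by
    rw [LinearIndependent.pair_iff]
    intro a b hab
    have h1 := congrArg (fun x => inner ℝ (outwardNormal S p) x) hab
    simp only [inner_add_right, real_inner_smul_right, inner_zero_right,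
      inner_outwardNormal_self hS.c2_boundary hS.isOpen hS.cone hp hp0, mul_zero, zero_add] at h1
    have hb : b = 0 := (mul_eq_zero.1 h1).resolve_right he.ne'
    refine ⟨?_, hb⟩
    rw [hb, zero_smul, add_zero] at hab
    exact (smul_eq_zero.1 hab).resolve_right hp0
  obtain ⟨τ, L, hL⟩ := exists_frame hli
  obtain ⟨α, β, κ, g, h⟩ := exists_isConicChart hS.c2_boundary hS.isOpen hS.cone τ hp hp0 he
  exact ⟨τ, L, α, β, κ, g, h, hL⟩

theorem IsC2Cone.norm_outwardNormal {S : Set E3} (hS : IsC2Cone S) {p : E3} (hp : p ∈ frontier S)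
    (hp0 : p ≠ 0) : ‖outwardNormal S p‖ = 1 :=
  (hS.c2_boundary.isOutwardUnitNormal hS.isOpen hp hp0).1

theorem IsC2Cone.exists_chart_normal {S : Set E3} (hS : IsC2Cone S) {p : E3}
    (hp : p ∈ frontier S) (hp0 : p ≠ 0) :
    ∃ e τ L α β κ g, IsConicChart S p e τ α β κ g ∧
      ∀ y, (L : E3 ≃L[ℝ] E3) y = y 0 • p + y 1 • e + y 2 • τ := by
  refine ⟨outwardNormal S p, hS.exists_chart hp hp0 ?_⟩
  rw [real_inner_self_eq_norm_sq, hS.norm_outwardNormal hp hp0]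
  norm_num

/-- For cones the exceptional point is the vertex, where there is no chart. It suffices that both
measures ignore it. -/
theorem measure_eq_of_locally_eq_off_singleton {X : Type*} [TopologicalSpace X] [T1Space X]
    [SecondCountableTopology X] [MeasurableSpace X] [BorelSpace X] {μ ν : Measure X} {z : X}
    (hμ : μ {z} = 0) (hν : ν {z} = 0)
    (h : ∀ x, x ≠ z → ∃ U ∈ 𝓝 x, ∀ A ⊆ U, MeasurableSet A → μ A = ν A) : μ = ν := by
  have hz : MeasurableSet ({z}ᶜ : Set X) := isOpen_compl_singleton.measurableSet
  have he : MeasurableEmbedding (Subtype.val : ({z}ᶜ : Set X) → X) :=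
    MeasurableEmbedding.subtype_coe hz
  have heq : μ.comap (Subtype.val : ({z}ᶜ : Set X) → X) = ν.comap Subtype.val := by
    refine measure_eq_of_locally_eq fun x => ?_
    obtain ⟨U, hU, hUA⟩ := h x x.2
    refine ⟨Subtype.val ⁻¹' U, continuous_subtype_val.continuousAt.preimage_mem_nhds hU,
      fun A hA hm => ?_⟩
    rw [he.comap_apply, he.comap_apply]
    exact hUA _ (image_subset_iff.2 hA) (he.measurableSet_image.2 hm)
  ext A hA
  have h1 := congrArg (fun m : Measure ({z}ᶜ : Set X) => m (Subtype.val ⁻¹' A)) heq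
  simp only [he.comap_apply, Subtype.image_preimage_coe] at h1
  have h2 : ∀ m : Measure X, m {z} = 0 → m A = m ({z}ᶜ ∩ A) := fun m hm => by
    rw [inter_comm]
    refine (measure_inter_conull' (measure_mono_null ?_ hm)).symm
    rintro x ⟨-, hx⟩
    simpa using hx
  rw [h2 μ hμ, h2 ν hν, h1]

theorem lintegral_Ioi_comp_mul_left {a : ℝ} (ha : 0 < a) (f : ℝ → ℝ≥0∞) :
    ∫⁻ r in Ioi (0 : ℝ), f (a * r) = ENNReal.ofReal a⁻¹ * ∫⁻ r in Ioi (0 : ℝ), f r := by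
  have hemb : MeasurableEmbedding (fun r : ℝ => a * r) :=
    (Homeomorph.mulLeft₀ a ha.ne').measurableEmbedding
  have h1 : (volume.restrict (Ioi (0 : ℝ))).map (fun r => a * r) =
      ENNReal.ofReal a⁻¹ • volume.restrict (Ioi (0 : ℝ)) := by
    have h2 : Ioi (0 : ℝ) = (fun r => a * r) ⁻¹' Ioi 0 := by
      ext r; simp [ha]
    conv_lhs => rw [h2]
    rw [← Measure.restrict_map hemb.measurable measurableSet_Ioi,
      Real.map_volume_mul_left ha.ne', abs_of_pos (inv_pos.2 ha), Measure.restrict_smul]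
  rw [← hemb.lintegral_map (μ := volume.restrict (Ioi (0 : ℝ))) f, h1, lintegral_smul_measure,
    smul_eq_mul]

namespace IsConicChart

variable {S : Set E3} {p e τ : E3} {α β κ : ℝ} {g : ℝ → ℝ} {L : E3 ≃L[ℝ] E3}

theorem hasDerivAt_normalize {q : ℝ → E3} {q' : E3} {v : ℝ} (hq : HasDerivAt q q' v)
    (h0 : q v ≠ 0) :
    HasDerivAt (fun v => ‖q v‖⁻¹ • q v)
      (‖q v‖⁻¹ • q' + (-(inner ℝ (q v) q' / ‖q v‖) / ‖q v‖ ^ 2) • q v) v := by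
  have hn : ‖q v‖ ≠ 0 := norm_ne_zero_iff.2 h0
  have h1 : HasDerivAt (fun v => ‖q v‖) (inner ℝ (q v) q' / ‖q v‖) v := by
    have h2 := (hq.norm_sq).sqrt (by positivity)
    simp only [Real.sqrt_sq (norm_nonneg _)] at h2
    convert! h2 using 1
    field_simp
  exact (h1.inv hn).fun_smul hq |>.congr_deriv (by rw [add_comm]) |> fun h => by
    simpa [add_comm] using h

/-- The vector is the component of `q'` orthogonal to `q`, divided by `‖q‖`, and the length of that
component is the area over `‖q‖`. This is the speed of the radial projection of a curve to the
sphere. -/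
theorem norm_normalize_deriv {q q' : E3} (h0 : q ≠ 0) :
    ‖‖q‖⁻¹ • q' + (-(inner ℝ q q' / ‖q‖) / ‖q‖ ^ 2) • q‖ = parallelogramArea q q' / ‖q‖ ^ 2 := by
  have hn : ‖q‖ ≠ 0 := norm_ne_zero_iff.2 h0
  have hnn : 0 ≤ parallelogramArea q q' / ‖q‖ ^ 2 := div_nonneg (Real.sqrt_nonneg _) (sq_nonneg _)
  rw [← sq_eq_sq₀ (norm_nonneg _) hnn, div_pow, parallelogramArea, Real.sq_sqrt (parallelogramArea_sq_nonneg _ _)]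
  rw [@norm_add_sq_real, norm_smul, norm_smul, real_inner_smul_left, real_inner_smul_right,
    real_inner_comm q q', mul_pow, mul_pow, Real.norm_eq_abs, Real.norm_eq_abs, sq_abs, sq_abs]
  field_simp
  ring

theorem coneTrace_inter_conicBox (h : IsConicChart S p e τ α β κ g)
    (hc : ∀ c : ℝ, 0 < c → c • S = S) (hL : ∀ y, L y = y 0 • p + y 1 • e + y 2 • τ) :
    coneTrace S ∩ conicBox L α β =
      (fun v => ‖p + g v • e + v • τ‖⁻¹ • (p + g v • e + v • τ)) '' Ioo (-β) β := by
  ext x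
  constructor
  · rintro ⟨⟨hxf, hx1⟩, hx⟩
    have hx' : x ∈ frontier S ∩ conicBox L α β := ⟨hxf, hx⟩
    rw [h.frontier_inter_conicBox hc hL] at hx'
    obtain ⟨y, ⟨hy0, hy1⟩, rfl⟩ := hx'
    refine ⟨y 1, hy1, ?_⟩
    have h1 : ‖y 0 • (p + g (y 1) • e + y 1 • τ)‖ = 1 := by simpa using hx1
    rw [norm_smul, Real.norm_eq_abs, abs_of_pos hy0] at h1
    simp only
    rw [inv_eq_of_mul_eq_one_left h1]
  · rintro ⟨v, hv, rfl⟩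
    have h0 := norm_pos_iff.2 (curve_ne_zero hL (g v) v)
    refine ⟨⟨(smul_mem_frontier_iff_of_cone hc (inv_pos.2 h0) _).2 (h.curve_frontier hv), ?_⟩,
      (smul_mem_conicBox (inv_pos.2 h0) _).2 (h.curve_mem hL hv)⟩
    rw [mem_sphere_zero_iff_norm, norm_smul, norm_inv, norm_norm, inv_mul_cancel₀ h0.ne']

theorem lintegral_coneTrace (h : IsConicChart S p e τ α β κ g)
    (hc : ∀ c : ℝ, 0 < c → c • S = S) (hL : ∀ y, L y = y 0 • p + y 1 • e + y 2 • τ)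
    {F : E3 → ℝ≥0∞} (hF : Measurable F) :
    ∫⁻ x in coneTrace S ∩ conicBox L α β, F x ∂μHE[1] =
      ∫⁻ v in Ioo (-β) β, F (‖p + g v • e + v • τ‖⁻¹ • (p + g v • e + v • τ)) *
        ENNReal.ofReal (parallelogramArea (p + g v • e + v • τ) (deriv g v • e + τ)
          / ‖p + g v • e + v • τ‖ ^ 2) := by
  set q : ℝ → E3 := fun v => p + g v • e + v • τ with hq
  set q' : ℝ → E3 := fun v => deriv g v • e + τ with hq'
  have hqc : ContDiffOn ℝ 1 q (Ioo (-β) β) := by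
    have := h.contDiffOn
    rw [hq]; fun_prop
  have hq0 : ∀ v, q v ≠ 0 := fun v => curve_ne_zero hL _ _
  have hqc' : ContinuousOn q' (Ioo (-β) β) :=
    (h.continuousOn_deriv.smul continuousOn_const).add continuousOn_const
  set Ψ' : ℝ → ℝ →L[ℝ] E3 := fun v => ContinuousLinearMap.toSpanSingleton ℝ
    (‖q v‖⁻¹ • q' v + (-(inner ℝ (q v) (q' v) / ‖q v‖) / ‖q v‖ ^ 2) • q v) with hΨ'
  have hstrict : ∀ v ∈ Ioo (-β) β, HasStrictFDerivAt (fun v => ‖q v‖⁻¹ • q v) (Ψ' v) v := by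
    intro v hv
    have h1 : ContDiffAt ℝ 1 q v := hqc.contDiffAt (Ioo_mem_nhds hv.1 hv.2)
    have h2 : ContDiffAt ℝ 1 (fun v => ‖q v‖⁻¹ • q v) v :=
      ((h1.norm ℝ (hq0 v)).inv (norm_ne_zero_iff.2 (hq0 v))).smul h1
    have h3 := h2.hasStrictDerivAt (by norm_num)
    rw [(hasDerivAt_normalize (h.hasDerivAt_curve hv) (hq0 v)).deriv] at h3
    exact h3.hasStrictFDerivAt
  have hinj : InjOn (fun v => ‖q v‖⁻¹ • q v) (Ioo (-β) β) := by
    intro v hv w hw hvw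
    have h1 := congrArg (fun x => L.symm x) hvw
    simp only [map_smul, q, symm_curve hL] at h1
    have h2 := congrArg (fun x : E3 => x 0) h1
    have h3 := congrArg (fun x : E3 => x 2) h1
    simp at h2 h3
    rw [h2] at h3
    exact mul_left_cancel₀ (inv_ne_zero (norm_ne_zero_iff.2 (hq0 w))) h3
  have hJc : ContinuousOn (fun v => parallelogramArea (q v) (q' v) / ‖q v‖ ^ 2) (Ioo (-β) β) := by
    have h1 := hqc.continuousOn
    refine ContinuousOn.div (Real.continuous_sqrt.comp_continuousOn
      (((h1.norm.pow 2).mul (hqc'.norm.pow 2)).sub ((h1.inner hqc').pow 2))) (h1.norm.pow 2) ?_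
    exact fun v _ => pow_ne_zero _ (norm_ne_zero_iff.2 (hq0 v))
  have hJ0 : ∀ v ∈ Ioo (-β) β, 0 < parallelogramArea (q v) (q' v) / ‖q v‖ ^ 2 := fun v _ =>
    div_pos (area_pos hL _ _ _) (pow_pos (norm_pos_iff.2 (hq0 v)) 2)
  have hJn : ∀ v ∈ Ioo (-β) β, parallelogramArea (q v) (q' v) / ‖q v‖ ^ 2 =
      LinearMap.normDet (Ψ' v : ℝ →ₗ[ℝ] E3) := by
    intro v _
    rw [normDet_real, ← norm_normalize_deriv (hq0 v)]
    simp [hΨ']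
  have key := lintegral_image_area_formula measurableSet_Ioo hstrict hinj hJc hJ0 hJn hF
  rw [Module.finrank_self] at key
  rw [h.coneTrace_inter_conicBox hc hL]
  exact key

end IsConicChart
theorem measurableSet_coneTrace (S : Set E3) : MeasurableSet (coneTrace S) :=
  (isClosed_frontier.inter Metric.isClosed_sphere).measurableSet

theorem isCompact_coneTrace (S : Set E3) : IsCompact (coneTrace S) :=
  (isCompact_sphere 0 1).inter_left isClosed_frontier

/-- By compactness one chart suffices. Halving `β` makes the arclength density continuous on a
closed interval, hence bounded. -/
theorem IsC2Cone.coneTrace_measure_lt_top {S : Set E3} (hS : IsC2Cone S) :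
    μHE[1] (coneTrace S) < (⊤ : ℝ≥0∞) := by
  refine (isCompact_coneTrace S).measure_lt_top_of_nhdsWithin fun p hp => ?_
  have hp0 : p ≠ 0 := by
    rintro rfl
    simpa using hp.2
  obtain ⟨e, τ, L, α, β, κ, g, h, hL⟩ := hS.exists_chart_normal hp.1 hp0
  have h' := h.mono (half_pos h.β_pos) (by linarith [h.β_pos] : β / 2 ≤ β)
  refine ⟨coneTrace S ∩ conicBox L α (β / 2), inter_mem_nhdsWithin _
    ((isOpen_conicBox L α (β / 2)).mem_nhds (h'.mem_conicBox_base hL)), ?_⟩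
  have h1 := h'.lintegral_coneTrace hS.cone hL (F := fun _ => 1) measurable_const
  rw [setLIntegral_one] at h1
  rw [h1]
  simp only [one_mul]
  have hsub : Icc (-(β / 2)) (β / 2) ⊆ Ioo (-β) β := fun v hv =>
    ⟨by linarith [hv.1, h.β_pos], by linarith [hv.2, h.β_pos]⟩
  have hcont : ContinuousOn (fun v => parallelogramArea (p + g v • e + v • τ) (deriv g v • e + τ)
      / ‖p + g v • e + v • τ‖ ^ 2) (Icc (-(β / 2)) (β / 2)) := by
    have h2 : ContinuousOn (fun v => p + g v • e + v • τ) (Icc (-(β / 2)) (β / 2)) := by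
      have := h.contDiffOn.continuousOn.mono hsub
      fun_prop
    have h3 : ContinuousOn (fun v => deriv g v • e + τ) (Icc (-(β / 2)) (β / 2)) :=
      ((h.continuousOn_deriv.mono hsub).smul continuousOn_const).add continuousOn_const
    refine ContinuousOn.div (Real.continuous_sqrt.comp_continuousOn
      (((h2.norm.pow 2).mul (h3.norm.pow 2)).sub ((h2.inner h3).pow 2))) (h2.norm.pow 2) ?_
    exact fun v _ => pow_ne_zero _ (norm_ne_zero_iff.2 (IsConicChart.curve_ne_zero hL _ _))
  have hint : IntegrableOn (fun v => parallelogramArea (p + g v • e + v • τ) (deriv g v • e + τ)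
      / ‖p + g v • e + v • τ‖ ^ 2) (Ioo (-(β / 2)) (β / 2)) :=
    (hcont.integrableOn_Icc).mono_set Ioo_subset_Icc_self
  have h4 := hint.lintegral_lt_top
  exact h4

/-- The polar measure `r dr ⊗ H¹` on the cone over the trace of `S`. -/
def conePolarMeasure (S : Set E3) : Measure E3 :=
  (((volume.restrict (Ioi (0 : ℝ))).withDensity ENNReal.ofReal).prod
    ((μHE[1]).restrict (coneTrace S))).map fun z : ℝ × E3 => z.1 • z.2

theorem IsC2Cone.lintegral_conePolarMeasure {S : Set E3} (hS : IsC2Cone S) {F : E3 → ℝ≥0∞}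
    (hF : Measurable F) :
    ∫⁻ x, F x ∂conePolarMeasure S = ∫⁻ r in Ioi (0 : ℝ),
      ENNReal.ofReal r * ∫⁻ x in coneTrace S, F (r • x) ∂μHE[1] := by
  have : IsFiniteMeasure ((μHE[1] : Measure E3).restrict (coneTrace S)) :=
    ⟨by rw [Measure.restrict_apply_univ]; exact hS.coneTrace_measure_lt_top⟩
  have hm : Measurable fun z : ℝ × E3 => z.1 • z.2 := by fun_prop
  have hFm : Measurable fun z : ℝ × E3 => F (z.1 • z.2) := hF.comp hm
  rw [conePolarMeasure, lintegral_map hF hm, lintegral_prod _ hFm.aemeasurable]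
  refine (lintegral_withDensity_eq_lintegral_mul _ ENNReal.measurable_ofReal
    hFm.lintegral_prod_right').trans ?_
  rfl

/-- Both measures are computed in a conic chart with curve `q`. The substitution of `r / ‖q v‖` for
`r` turns the surface density `r * w v` into the radial density `r` times the arclength density `w v
/ ‖q v‖ ^ 2` of the trace. -/
theorem IsC2Cone.conePolarMeasure_eq {S : Set E3} (hS : IsC2Cone S) :
    (μHE[2]).restrict (frontier S) = conePolarMeasure S := by
  have : IsFiniteMeasure ((μHE[1] : Measure E3).restrict (coneTrace S)) :=
    ⟨by rw [Measure.restrict_apply_univ]; exact hS.coneTrace_measure_lt_top⟩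
  have hfm : MeasurableSet (frontier S) := isClosed_frontier.measurableSet
  have happ : ∀ A, MeasurableSet A → conePolarMeasure S A = ∫⁻ r in Ioi (0 : ℝ),
      ENNReal.ofReal r * ∫⁻ x in coneTrace S, A.indicator 1 (r • x) ∂μHE[1] := fun A hA => by
    rw [← hS.lintegral_conePolarMeasure (measurable_one.indicator hA), lintegral_indicator_one hA]
  have hzero : ∀ A, MeasurableSet A → (∀ r : ℝ, 0 < r → ∀ x ∈ coneTrace S, r • x ∉ A) →
      conePolarMeasure S A = 0 := by
    intro A hA h
    rw [happ A hA]
    refine (setLIntegral_congr_fun (g := fun _ => 0) measurableSet_Ioi fun r hr => ?_).trans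
      (by simp)
    have : ∫⁻ x in coneTrace S, A.indicator (1 : E3 → ℝ≥0∞) (r • x) ∂μHE[1] = 0 := by
      refine (setLIntegral_congr_fun (g := fun _ => 0) (measurableSet_coneTrace S)
        fun x hx => ?_).trans (by simp)
      exact indicator_of_notMem (h r hr x hx) _
    simp only [this, mul_zero]
  refine measure_eq_of_locally_eq_off_singleton (z := 0) ?_ ?_ fun p hp0 => ?_
  · refine measure_mono_null inter_subset_left ?_ |> fun h => by
      rw [Measure.restrict_apply (measurableSet_singleton 0)]; exact h
    -- The zero-dimensional measure of a point is finite, so its two-dimensional measure vanishes.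
    rcases Measure.euclideanHausdorffMeasure_zero_or_top (show 0 < 2 by norm_num) ({0} : Set E3)
      with h | h
    · exact h
    · rw [Measure.euclideanHausdorffMeasure_zero] at h
      simp at h
  · refine hzero _ (measurableSet_singleton 0) fun r hr x hx h0 => ?_
    have h1 : x = 0 := (smul_eq_zero.1 (mem_singleton_iff.1 h0)).resolve_left hr.ne'
    have := hx.2
    simp [h1] at this
  · by_cases hp : p ∈ frontier S
    · obtain ⟨e, τ, L, α, β, κ, g, h, hL⟩ := hS.exists_chart_normal hp hp0
      refine ⟨conicBox L α β, (isOpen_conicBox L α β).mem_nhds (h.mem_conicBox_base hL),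
        fun A hA hAm => ?_⟩
      have hind : Measurable (A.indicator (1 : E3 → ℝ≥0∞)) := measurable_one.indicator hAm
      have hbm : MeasurableSet (conicBox L α β) := (isOpen_conicBox L α β).measurableSet
      have h1 : (μHE[2]).restrict (frontier S) A
          = ∫⁻ x in frontier S ∩ conicBox L α β, A.indicator 1 x ∂μHE[2] := by
        rw [lintegral_indicator_one hAm, Measure.restrict_apply hAm, Measure.restrict_apply hAm]
        congr 1
        ext x
        constructor
        · exact fun hx => ⟨hx.1, hx.2, hA hx.1⟩
        · exact fun hx => ⟨hx.1, hx.2.1⟩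
      set w : ℝ → ℝ := fun v => parallelogramArea (p + g v • e + v • τ) (deriv g v • e + τ)
      set q : ℝ → E3 := fun v => p + g v • e + v • τ with hq
      have hqc : ContinuousOn q (Ioo (-β) β) := by
        have := h.contDiffOn.continuousOn
        rw [hq]; fun_prop
      have hwc : ContinuousOn w (Ioo (-β) β) := by
        have h3 : ContinuousOn (fun v => deriv g v • e + τ) (Ioo (-β) β) :=
          (h.continuousOn_deriv.smul continuousOn_const).add continuousOn_const
        exact Real.continuous_sqrt.comp_continuousOn
          (((hqc.norm.pow 2).mul (h3.norm.pow 2)).sub ((hqc.inner h3).pow 2))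
      have h2 : ∀ r : ℝ, 0 < r → ∫⁻ x in coneTrace S, A.indicator (1 : E3 → ℝ≥0∞) (r • x) ∂μHE[1] =
          ∫⁻ v in Ioo (-β) β, A.indicator 1 (r • (‖q v‖⁻¹ • q v)) *
            ENNReal.ofReal (w v / ‖q v‖ ^ 2) := by
        intro r hr
        rw [← h.lintegral_coneTrace hS.cone hL
          (F := fun x => A.indicator (1 : E3 → ℝ≥0∞) (r • x)) (hind.comp (by fun_prop)),
          ← lintegral_indicator (measurableSet_coneTrace S),
          ← lintegral_indicator ((measurableSet_coneTrace S).inter hbm)]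
        refine lintegral_congr fun x => ?_
        by_cases hx : r • x ∈ A
        · have hxb := (smul_mem_conicBox hr x).1 (hA hx)
          by_cases hxt : x ∈ coneTrace S
          · rw [indicator_of_mem hxt, indicator_of_mem (mem_inter hxt hxb)]
          · rw [indicator_of_notMem hxt, indicator_of_notMem fun hh => hxt hh.1]
        · simp [indicator, hx]
      have hmeas : AEMeasurable (fun z : ℝ × ℝ => ENNReal.ofReal z.1 *
          (A.indicator (1 : E3 → ℝ≥0∞) (z.1 • (‖q z.2‖⁻¹ • q z.2)) *
            ENNReal.ofReal (w z.2 / ‖q z.2‖ ^ 2)))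
          ((volume.restrict (Ioi (0 : ℝ))).prod (volume.restrict (Ioo (-β) β))) := by
        rw [Measure.prod_restrict]
        have hprod : MeasurableSet (Ioi (0 : ℝ) ×ˢ Ioo (-β) β) :=
          measurableSet_Ioi.prod measurableSet_Ioo
        have hq2 : ContinuousOn (fun z : ℝ × ℝ => q z.2) (Ioi (0 : ℝ) ×ˢ Ioo (-β) β) :=
          hqc.comp (by fun_prop) fun y hy => hy.2
        have hw2 : ContinuousOn (fun z : ℝ × ℝ => w z.2) (Ioi (0 : ℝ) ×ˢ Ioo (-β) β) :=
          hwc.comp (by fun_prop) fun y hy => hy.2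
        have hq0 : ∀ z ∈ Ioi (0 : ℝ) ×ˢ Ioo (-β) β, ‖q z.2‖ ≠ 0 := fun z _ =>
          norm_ne_zero_iff.2 (IsConicChart.curve_ne_zero hL _ _)
        refine AEMeasurable.mul (by fun_prop) (AEMeasurable.mul
          (hind.comp_aemeasurable (ContinuousOn.aemeasurable ?_ hprod))
          (ContinuousOn.aemeasurable ?_ hprod).ennreal_ofReal)
        · exact continuousOn_fst.smul ((hq2.norm.inv₀ hq0).smul hq2)
        · exact hw2.div (hq2.norm.pow 2) fun z hz => pow_ne_zero _ (hq0 z hz)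
      rw [h1, h.lintegral_frontier hS.cone hL hind, happ A hAm,
        setLIntegral_congr_fun measurableSet_Ioi fun r hr => by rw [h2 r hr]]
      have h3 : ∀ r : ℝ, ENNReal.ofReal r * ∫⁻ v in Ioo (-β) β,
          A.indicator (1 : E3 → ℝ≥0∞) (r • (‖q v‖⁻¹ • q v)) * ENNReal.ofReal (w v / ‖q v‖ ^ 2) =
          ∫⁻ v in Ioo (-β) β, ENNReal.ofReal r * (A.indicator 1 (r • (‖q v‖⁻¹ • q v)) *
            ENNReal.ofReal (w v / ‖q v‖ ^ 2)) := fun r =>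
        (lintegral_const_mul' _ _ ENNReal.ofReal_ne_top).symm
      simp_rw [h3]
      refine Eq.trans ?_ (lintegral_lintegral_swap hmeas).symm
      refine setLIntegral_congr_fun measurableSet_Ioo fun v hv => ?_
      have hn : 0 < ‖q v‖ := norm_pos_iff.2 (IsConicChart.curve_ne_zero hL _ _)
      have hw0 : 0 < w v := IsConicChart.area_pos hL _ _ _
      have h4 := lintegral_Ioi_comp_mul_left (inv_pos.2 hn) fun r =>
        A.indicator (1 : E3 → ℝ≥0∞) (r • q v) * ENNReal.ofReal (r * w v)
      rw [inv_inv] at h4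
      have h5 : ∫⁻ r in Ioi (0 : ℝ), A.indicator (1 : E3 → ℝ≥0∞) (r • q v) * ENNReal.ofReal (r * w v)
          = ENNReal.ofReal ‖q v‖⁻¹ * ∫⁻ r in Ioi (0 : ℝ), A.indicator (1 : E3 → ℝ≥0∞)
            ((‖q v‖⁻¹ * r) • q v) * ENNReal.ofReal (‖q v‖⁻¹ * r * w v) := by
        rw [h4, ← mul_assoc, ← ENNReal.ofReal_mul (by positivity), inv_mul_cancel₀ hn.ne',
          ENNReal.ofReal_one, one_mul]
      refine h5.trans ?_
      rw [← lintegral_const_mul' _ _ ENNReal.ofReal_ne_top]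
      refine setLIntegral_congr_fun measurableSet_Ioi fun r hr => ?_
      have hr : 0 < r := hr
      rw [smul_smul, mul_comm r ‖q v‖⁻¹, mul_left_comm, mul_left_comm (ENNReal.ofReal r),
        ← ENNReal.ofReal_mul (by positivity), ← ENNReal.ofReal_mul hr.le]
      congr 2
      field_simp
    · refine ⟨(frontier S)ᶜ, isClosed_frontier.isOpen_compl.mem_nhds hp, fun A hA hAm => ?_⟩
      rw [hzero A hAm, Measure.restrict_apply hAm]
      · have : A ∩ frontier S = ∅ := by
          rw [← disjoint_iff_inter_eq_empty]
          exact disjoint_compl_left.mono_left hA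
        rw [this, measure_empty]
      · intro r hr x hx hrx
        exact hA hrx ((smul_mem_frontier_iff_of_cone hS.cone hr x).2 hx.1)

/-- **Polar coordinates** on the boundary of a cone. -/
theorem IsC2Cone.lintegral_frontier {S : Set E3} (hS : IsC2Cone S) {F : E3 → ℝ≥0∞}
    (hF : Measurable F) :
    ∫⁻ x in frontier S, F x ∂μHE[2] = ∫⁻ r in Ioi (0 : ℝ),
      ENNReal.ofReal r * ∫⁻ x in coneTrace S, F (r • x) ∂μHE[1] := by
  rw [hS.conePolarMeasure_eq, hS.lintegral_conePolarMeasure hF]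

theorem IsC2Cone.isFiniteMeasure_coneTrace {S : Set E3} (hS : IsC2Cone S) :
    IsFiniteMeasure ((μHE[1] : Measure E3).restrict (coneTrace S)) :=
  ⟨by rw [Measure.restrict_apply_univ]; exact hS.coneTrace_measure_lt_top⟩

/-- In polar coordinates the integrand is at most `R` times the length of the trace, for radii
between `0` and `R`. -/
theorem IsC2Cone.isFiniteMeasureOnCompacts {S : Set E3} (hS : IsC2Cone S) (R : ℝ) :
    μHE[2] (frontier S ∩ Metric.ball 0 R) < (⊤ : ℝ≥0∞) := by
  have := hS.isFiniteMeasure_coneTrace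
  have hm : MeasurableSet (Metric.ball (0 : E3) R) := Metric.isOpen_ball.measurableSet
  have h1 : μHE[2] (frontier S ∩ Metric.ball 0 R) =
      ∫⁻ x in frontier S, (Metric.ball (0 : E3) R).indicator 1 x ∂μHE[2] := by
    rw [lintegral_indicator_one hm, Measure.restrict_apply hm, inter_comm]
  rw [h1, hS.lintegral_frontier (measurable_one.indicator hm)]
  have h2 : ∀ r ∈ Ioi (0 : ℝ), ENNReal.ofReal r * ∫⁻ x in coneTrace S,
      (Metric.ball (0 : E3) R).indicator 1 (r • x) ∂μHE[1] ≤
      (Ioo 0 R).indicator (fun _ => ENNReal.ofReal R * μHE[1] (coneTrace S)) r := by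
    intro r hr
    have hr : 0 < r := hr
    by_cases hrR : r < R
    · rw [indicator_of_mem (mem_Ioo.2 ⟨hr, hrR⟩)]
      gcongr
      have h3 : ∀ x, (Metric.ball (0 : E3) R).indicator (1 : E3 → ℝ≥0∞) (r • x) ≤ 1 := fun x =>
        indicator_le_self' (f := (1 : E3 → ℝ≥0∞)) (by simp) _
      exact (lintegral_mono h3).trans (by simp)
    · rw [indicator_of_notMem fun h => hrR h.2, nonpos_iff_eq_zero]
      have : ∫⁻ x in coneTrace S, (Metric.ball (0 : E3) R).indicator (1 : E3 → ℝ≥0∞) (r • x) ∂μHE[1]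
          = 0 := by
        refine (setLIntegral_congr_fun (g := fun _ => 0) (measurableSet_coneTrace S)
          fun x hx => ?_).trans (by simp)
        refine indicator_of_notMem ?_ _
        have hx1 : ‖x‖ = 1 := by simpa using hx.2
        rw [mem_ball_zero_iff, norm_smul, hx1, mul_one, Real.norm_eq_abs, abs_of_pos hr]
        exact hrR
      rw [this, mul_zero]
  refine (setLIntegral_mono' measurableSet_Ioi h2).trans_lt ?_
  refine (setLIntegral_le_lintegral _ _).trans_lt ?_
  rw [lintegral_indicator measurableSet_Ioo, setLIntegral_const]
  exact ENNReal.mul_lt_top (ENNReal.mul_lt_top ENNReal.ofReal_lt_top hS.coneTrace_measure_lt_top)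
    (by simp)

end

noncomputable section

/-! ### The divergence theorem on a cone -/

theorem exists_finite_partition {C : Set E3} (hC : IsCompact C) {U : E3 → Set E3}
    (hU : ∀ x ∈ C, IsOpen (U x) ∧ x ∈ U x) :
    ∃ (t : Finset E3) (χ : E3 → E3 → ℝ), (∀ i ∈ t, i ∈ C) ∧ (∀ i, ContDiff ℝ ∞ (χ i)) ∧
      (∀ i ∈ t, tsupport (χ i) ⊆ U i) ∧ ∀ x ∈ C, ∑ i ∈ t, χ i x = 1 := by
  classical
  obtain ⟨t, htC, ht⟩ := hC.elim_nhds_subcover U fun x hx => (hU x hx).1.mem_nhds (hU x hx).2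
  have hcov : C ⊆ ⋃ i : t, U i := by
    intro x hx
    obtain ⟨i, hi, hxi⟩ := mem_iUnion₂.1 (ht hx)
    exact mem_iUnion.2 ⟨⟨i, hi⟩, hxi⟩
  obtain ⟨f, hf⟩ := SmoothPartitionOfUnity.exists_isSubordinate (modelWithCornersSelf ℝ E3)
    hC.isClosed (fun i : t => U i) (fun i => (hU i (htC i i.2)).1) hcov
  refine ⟨t, fun i => if hi : i ∈ t then f ⟨i, hi⟩ else 0, htC, fun i => ?_, fun i hi => ?_,
    fun x hx => ?_⟩
  · dsimp only
    split_ifs with hi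
    · exact (f ⟨i, hi⟩).contMDiff.contDiff
    · exact contDiff_const
  · simp only [hi, dif_pos]
    exact hf ⟨i, hi⟩
  · rw [← f.sum_eq_one hx, finsum_eq_sum_of_fintype, ← Finset.sum_coe_sort]
    refine Finset.sum_congr rfl fun i _ => ?_
    simp

theorem integral_eq_abs_det_mul_integral_comp (L : E3 ≃L[ℝ] E3) (F : E3 → ℝ) :
    ∫ x, F x = |LinearMap.det (L : E3 →ₗ[ℝ] E3)| * ∫ y, F (L y) := by
  have hdet : LinearMap.det (L : E3 →ₗ[ℝ] E3) ≠ 0 := L.toLinearEquiv.isUnit_det'.ne_zero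
  have h := Measure.map_linearMap_addHaar_eq_smul_addHaar (volume : Measure E3) hdet
  have hemb : MeasurableEmbedding L := L.toHomeomorph.measurableEmbedding
  have h1 : ∫ y, F (L y) = ∫ x, F x ∂(Measure.map L volume) := (hemb.integral_map F).symm
  have h2 : Measure.map L volume =
      ENNReal.ofReal |(LinearMap.det (L : E3 →ₗ[ℝ] E3))⁻¹| • (volume : Measure E3) := h
  rw [h1, h2, integral_smul_measure, ENNReal.toReal_ofReal (abs_nonneg _), smul_eq_mul,
    ← mul_assoc, ← abs_mul, mul_inv_cancel₀ hdet, abs_one, one_mul]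

/-- Coordinate `1` is the one along `e` in a chart; singling it out lets Fubini integrate first in
the direction transversal to the boundary. -/
theorem measurePreserving_split :
    MeasurePreserving (fun y : E3 => (y 1, (y 0, y 2))) volume
      (volume : Measure (ℝ × ℝ × ℝ)) := by
  have h1 := volume_preserving_piFinSuccAbove (fun _ : Fin 3 => ℝ) 1
  have h2 := h1.comp (PiLp.volume_preserving_ofLp (Fin 3))
  exact ((MeasurePreserving.id volume).prod (volume_preserving_finTwoArrow ℝ)).comp h2

theorem measurableEmbedding_split : MeasurableEmbedding fun y : E3 => (y 1, (y 0, y 2)) :=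
  ((MeasurableEquiv.toLp 2 (Fin 3 → ℝ)).symm.trans
    ((MeasurableEquiv.piFinSuccAbove (fun _ : Fin 3 => ℝ) 1).trans
      (MeasurableEquiv.prodCongr (MeasurableEquiv.refl ℝ)
        MeasurableEquiv.finTwoArrow))).measurableEmbedding

theorem det_frame {L : E3 ≃L[ℝ] E3} {p e τ : E3}
    (hL : ∀ y, L y = y 0 • p + y 1 • e + y 2 • τ) :
    LinearMap.det (L : E3 →ₗ[ℝ] E3) = p 0 * e 1 * τ 2 - p 0 * τ 1 * e 2 - e 0 * p 1 * τ 2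
      + e 0 * τ 1 * p 2 + τ 0 * p 1 * e 2 - τ 0 * e 1 * p 2 := by
  rw [← LinearMap.det_toMatrix (EuclideanSpace.basisFun (Fin 3) ℝ).toBasis, Matrix.det_fin_three]
  simp [LinearMap.toMatrix_apply, hL]

/-- As `n` is a unit vector orthogonal to `q` and `q'`, their cross product is plus or minus the
area times `n`, and its inner product with `e` is the determinant of the three vectors. -/
theorem inner_mul_parallelogramArea {n q q' e : E3} (hn : ‖n‖ = 1) (hq : inner ℝ n q = 0)
    (hq' : inner ℝ n q' = 0) (he : 0 ≤ inner ℝ n e) :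
    parallelogramArea q q' * inner ℝ n e =
      |(q 1 * q' 2 - q 2 * q' 1) * e 0 + (q 2 * q' 0 - q 0 * q' 2) * e 1
        + (q 0 * q' 1 - q 1 * q' 0) * e 2| := by
  have hn2 : ‖n‖ ^ 2 = 1 := by rw [hn]; norm_num
  have hne : ∀ x y : E3, inner ℝ x y = x 0 * y 0 + x 1 * y 1 + x 2 * y 2 := by
    intro x y
    simp [PiLp.inner_apply, Fin.sum_univ_three]
    ring
  have hnn : ∀ x : E3, ‖x‖ ^ 2 = x 0 ^ 2 + x 1 ^ 2 + x 2 ^ 2 := by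
    intro x
    rw [← real_inner_self_eq_norm_sq, hne]; ring
  rw [hne] at hq hq'
  rw [hnn] at hn2
  have habs : parallelogramArea q q' * inner ℝ n e = |parallelogramArea q q' * inner ℝ n e| :=
    (abs_of_nonneg (mul_nonneg (Real.sqrt_nonneg _) he)).symm
  rw [habs, ← sq_eq_sq_iff_abs_eq_abs, mul_pow, parallelogramArea,
    Real.sq_sqrt (parallelogramArea_sq_nonneg _ _), hnn, hnn, hne, hne]
  set N0 := q 1 * q' 2 - q 2 * q' 1 with hN0
  set N1 := q 2 * q' 0 - q 0 * q' 2 with hN1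
  set N2 := q 0 * q' 1 - q 1 * q' 0 with hN2
  -- The cross product `(N0, N1, N2)` is parallel to `n`; the factor is `m`.
  have c01 : N0 * n 1 = N1 * n 0 := by
    rw [hN0, hN1]; linear_combination q' 2 * hq - q 2 * hq'
  have c02 : N0 * n 2 = N2 * n 0 := by
    rw [hN0, hN2]; linear_combination -q' 1 * hq + q 1 * hq'
  have c12 : N1 * n 2 = N2 * n 1 := by
    rw [hN1, hN2]; linear_combination q' 0 * hq - q 0 * hq'
  have hgram : (q 0 ^ 2 + q 1 ^ 2 + q 2 ^ 2) * (q' 0 ^ 2 + q' 1 ^ 2 + q' 2 ^ 2)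
      - (q 0 * q' 0 + q 1 * q' 1 + q 2 * q' 2) ^ 2 = N0 ^ 2 + N1 ^ 2 + N2 ^ 2 := by
    rw [hN0, hN1, hN2]; ring
  rw [hgram]
  set m := N0 * n 0 + N1 * n 1 + N2 * n 2 with hm
  have e0 : N0 = m * n 0 := by rw [hm]; linear_combination (-N0) * hn2 + n 1 * c01 + n 2 * c02
  have e1 : N1 = m * n 1 := by rw [hm]; linear_combination (-N1) * hn2 - n 0 * c01 + n 2 * c12
  have e2 : N2 = m * n 2 := by rw [hm]; linear_combination (-N2) * hn2 - n 0 * c02 - n 1 * c12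
  clear_value m N0 N1 N2
  rw [e0, e1, e2]
  linear_combination (m ^ 2 * (n 0 * e 0 + n 1 * e 1 + n 2 * e 2) ^ 2) * hn2

/-- The map `(a, v) ↦ (a, a * v)` has Jacobian `a`. It carries the chart parameters to the
projection of the conic box along `e`. -/
theorem integral_conic_region {β : ℝ} (G : ℝ × ℝ → ℝ) :
    ∫ z in {z : ℝ × ℝ | 0 < z.1 ∧ |z.2| < β * z.1}, G z =
      ∫ z in Ioi (0 : ℝ) ×ˢ Ioo (-β) β, z.1 * G (z.1, z.1 * z.2) := by
  have himg : {z : ℝ × ℝ | 0 < z.1 ∧ |z.2| < β * z.1} =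
      (fun z : ℝ × ℝ => (z.1, z.1 * z.2)) '' (Ioi (0 : ℝ) ×ˢ Ioo (-β) β) := by
    ext z
    constructor
    · rintro ⟨h0, h1⟩
      refine ⟨(z.1, z.2 / z.1), ⟨h0, ?_⟩, ?_⟩
      · rw [mem_Ioo, ← abs_lt, abs_div, abs_of_pos h0, div_lt_iff₀ h0]; exact h1
      · ext
        · rfl
        · simp [mul_div_cancel₀ _ h0.ne']
    · rintro ⟨w, ⟨h0, h1⟩, rfl⟩
      have h0 : 0 < w.1 := h0
      refine ⟨h0, ?_⟩
      rw [abs_mul, abs_of_pos h0, mul_comm β]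
      exact mul_lt_mul_of_pos_left (abs_lt.2 h1) h0
  have hder : ∀ z ∈ Ioi (0 : ℝ) ×ˢ Ioo (-β) β, HasFDerivWithinAt
      (fun z : ℝ × ℝ => (z.1, z.1 * z.2))
      (LinearMap.toContinuousLinearMap (Matrix.toLin (Module.Basis.finTwoProd ℝ)
        (Module.Basis.finTwoProd ℝ) !![1, 0; z.2, z.1])) (Ioi (0 : ℝ) ×ˢ Ioo (-β) β) z := by
    intro z _
    rw [Matrix.toLin_finTwoProd_toContinuousLinearMap]
    have h1 : HasFDerivAt (fun z : ℝ × ℝ => z.1) (ContinuousLinearMap.fst ℝ ℝ ℝ) z :=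
      hasFDerivAt_fst
    have h2 : HasFDerivAt (fun z : ℝ × ℝ => z.2) (ContinuousLinearMap.snd ℝ ℝ ℝ) z :=
      hasFDerivAt_snd
    have h := (h1.prodMk (h1.fun_mul h2)).hasFDerivWithinAt (s := Ioi (0 : ℝ) ×ˢ Ioo (-β) β)
    convert! h using 2 <;> simp [add_comm]
  have hinj : InjOn (fun z : ℝ × ℝ => (z.1, z.1 * z.2)) (Ioi (0 : ℝ) ×ˢ Ioo (-β) β) := by
    rintro z ⟨hz, -⟩ w ⟨-, -⟩ hzw
    have h1 := congrArg Prod.fst hzw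
    have h2 := congrArg Prod.snd hzw
    simp only at h1 h2
    rw [← h1] at h2
    exact Prod.ext h1 (mul_left_cancel₀ (ne_of_gt hz) h2)
  rw [himg, integral_image_eq_integral_abs_det_fderiv_smul volume
    (measurableSet_Ioi.prod measurableSet_Ioo) hder hinj]
  refine setIntegral_congr_fun (measurableSet_Ioi.prod measurableSet_Ioo) fun z hz => ?_
  have hz0 : 0 < z.1 := hz.1
  simp [LinearMap.det_toContinuousLinearMap, LinearMap.det_toLin, abs_of_pos hz0]

/-- The outward normal, set to zero off the regular part of the boundary, is measurable. -/
theorem IsC2Cone.continuousOn_outwardNormal {S : Set E3} (hS : IsC2Cone S) :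
    ContinuousOn (outwardNormal S) (frontier S \ {0}) := by
  rintro p ⟨hp, hp0⟩
  obtain ⟨r, hr, f, hf, hne, -, -, hν⟩ := hS.c2_boundary.exists_ball hS.isOpen hp hp0
  have hg : ContinuousAt (fun x => ‖gradient f x‖⁻¹ • gradient f x) p := by
    have h1 : ContDiffAt ℝ 2 f p := hf.contDiffAt (Metric.ball_mem_nhds p hr)
    have h2 : ContinuousAt (fderiv ℝ f) p := (h1.fderiv_right (m := 1) (by norm_num)).continuousAt
    have h3 : ContinuousAt (gradient f) p :=
      (InnerProductSpace.toDual ℝ E3).symm.continuous.continuousAt.comp h2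
    refine (h3.norm.inv₀ (norm_ne_zero_iff.2 fun h0 => ?_)).smul h3
    apply hne p (Metric.mem_ball_self hr)
    rw [← toDual_gradient, h0, map_zero]
  refine hg.continuousWithinAt.congr_of_eventuallyEq ?_
    (hν p (Metric.mem_ball_self hr) hp).outwardNormal_eq
  filter_upwards [self_mem_nhdsWithin, mem_nhdsWithin_of_mem_nhds (Metric.ball_mem_nhds p hr)]
    with x hx1 hx2
  exact (hν x hx2 hx1.1).outwardNormal_eq

theorem measurableSet_frontier_diff (S : Set E3) : MeasurableSet (frontier S \ {0}) :=
  isClosed_frontier.measurableSet.diff (measurableSet_singleton 0)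

theorem IsC2Cone.ae_ne_zero {S : Set E3} (hS : IsC2Cone S) :
    ∀ᵐ x ∂(μHE[2] : Measure E3).restrict (frontier S), x ∈ frontier S \ {0} := by
  have h1 : ∀ᵐ x ∂(μHE[2] : Measure E3).restrict (frontier S), x ∈ frontier S :=
    ae_restrict_mem isClosed_frontier.measurableSet
  have h2 : ∀ᵐ x ∂(μHE[2] : Measure E3).restrict (frontier S), x ≠ 0 := by
    rw [hS.conePolarMeasure_eq, ae_iff]
    have := hS.lintegral_conePolarMeasure (F := ({0} : Set E3).indicator 1)
      (measurable_one.indicator (measurableSet_singleton 0))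
    rw [lintegral_indicator_one (measurableSet_singleton 0)] at this
    simp only [ne_eq, not_not]
    refine this.trans ?_
    refine (setLIntegral_congr_fun (g := fun _ => 0) measurableSet_Ioi fun r hr => ?_).trans
      (by simp)
    have : ∫⁻ x in coneTrace S, ({0} : Set E3).indicator (1 : E3 → ℝ≥0∞) (r • x) ∂μHE[1] = 0 := by
      refine (setLIntegral_congr_fun (g := fun _ => 0) (measurableSet_coneTrace S)
        fun x hx => ?_).trans (by simp)
      refine indicator_of_notMem (fun h0 => ?_) _
      have h1 : x = 0 := (smul_eq_zero.1 (mem_singleton_iff.1 h0)).resolve_left (ne_of_gt hr)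
      have := hx.2
      simp [h1] at this
    simp only [this, mul_zero]
  filter_upwards [h1, h2] with x hx1 hx2 using ⟨hx1, hx2⟩

theorem IsC2Cone.aestronglyMeasurable_outwardNormal {S : Set E3} (hS : IsC2Cone S) :
    AEStronglyMeasurable (outwardNormal S) ((μHE[2] : Measure E3).restrict (frontier S)) := by
  have h1 := hS.continuousOn_outwardNormal.aestronglyMeasurable (μ := (μHE[2] : Measure E3))
    (measurableSet_frontier_diff S)
  have h2 : (μHE[2] : Measure E3).restrict (frontier S \ {0}) =
      (μHE[2] : Measure E3).restrict (frontier S) := by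
    have h3 := Measure.restrict_eq_self_of_ae_mem hS.ae_ne_zero
    rwa [Measure.restrict_restrict (measurableSet_frontier_diff S),
      inter_eq_left.2 sdiff_subset] at h3
  rwa [h2] at h1

end

/-! ### Integration by parts in a chart, and its globalization -/

noncomputable section

namespace IsConicChart

variable {S : Set E3} {p e τ : E3} {α β κ : ℝ} {g : ℝ → ℝ} {L : E3 ≃L[ℝ] E3}

/-- The left side is the volume spanned by the curve point, the tangent vector and `e`. These differ
from `p`, `τ` and `e` by multiples of `e` and `τ` which do not change the determinant, so the
product does not depend on `v`. -/
theorem area_mul_inner (h : IsConicChart S p e τ α β κ g)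
    (hL : ∀ y, L y = y 0 • p + y 1 • e + y 2 • τ) {v : ℝ} (hv : v ∈ Ioo (-β) β) :
    parallelogramArea (p + g v • e + v • τ) (deriv g v • e + τ) *
      inner ℝ (outwardNormal S (p + g v • e + v • τ)) e =
      |LinearMap.det (L : E3 →ₗ[ℝ] E3)| := by
  rw [inner_mul_parallelogramArea (h.norm_normal v hv) (h.inner_self v hv) (h.inner_tangent v hv)
    (h.inner_pos v hv).le, det_frame hL, ← abs_neg]
  congr 1
  simp only [PiLp.add_apply, PiLp.smul_apply, smul_eq_mul]
  ring

/-- This is the fundamental theorem of calculus on a line in direction `e`: inside the box, `S` is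
the half line below the graph, and the compact support of `f` removes the contribution at the lower
end. -/
theorem fiber_integral (h : IsConicChart S p e τ α β κ g) (hc : ∀ c : ℝ, 0 < c → c • S = S)
    (hL : ∀ y, L y = y 0 • p + y 1 • e + y 2 • τ) {f : E3 → ℝ} (hf : ContDiff ℝ 1 f)
    (hfc : HasCompactSupport f) (hfs : tsupport f ⊆ conicBox L α β) (w : ℝ × ℝ) :
    ∫ b, S.indicator (fun x => fderiv ℝ f x e) (L !₂[w.1, b, w.2]) =
      {z : ℝ × ℝ | 0 < z.1 ∧ |z.2| < β * z.1}.indicator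
        (fun z => f (L !₂[z.1, z.1 * g (z.2 / z.1), z.2])) w := by
  have hsymm : ∀ b, L.symm (L !₂[w.1, b, w.2]) = !₂[w.1, b, w.2] := fun b =>
    L.symm_apply_apply _
  have hzero : ∀ x, x ∉ conicBox L α β → fderiv ℝ f x e = 0 := fun x hx => by
    rw [image_eq_zero_of_notMem_tsupport fun h' => hx (hfs (tsupport_fderiv_subset ℝ h'))]
    rfl
  by_cases hw : w ∈ {z : ℝ × ℝ | 0 < z.1 ∧ |z.2| < β * z.1}
  · rw [indicator_of_mem hw]
    set ψ : ℝ → ℝ := fun b => f (L !₂[w.1, b, w.2]) with hψ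
    have hline : ∀ b : ℝ, L !₂[w.1, b, w.2] = (w.1 • p + w.2 • τ) + b • e := fun b => by
      rw [hL]
      simp
      abel
    have hψ1 : ContDiff ℝ 1 ψ := by
      have : ψ = fun b => f ((w.1 • p + w.2 • τ) + b • e) := funext fun b => by rw [hψ, ← hline]
      rw [this]
      exact hf.comp (by fun_prop)
    have hder : ∀ b, deriv ψ b = fderiv ℝ f (L !₂[w.1, b, w.2]) e := fun b => by
      have h1 : HasDerivAt (fun b : ℝ => (w.1 • p + w.2 • τ) + b • e) e b := by
        simpa using ((hasDerivAt_id b).smul_const e).const_add (w.1 • p + w.2 • τ)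
      have h2 := ((hf.differentiable (by norm_num) ((w.1 • p + w.2 • τ) + b • e)).hasFDerivAt
        ).comp_hasDerivAt b h1
      have : ψ = fun b => f ((w.1 • p + w.2 • τ) + b • e) := funext fun b => by rw [hψ, ← hline]
      rw [this, hline]
      exact h2.deriv
    have hψc : HasCompactSupport ψ := by
      have hemb : IsClosedEmbedding fun b : ℝ => L !₂[w.1, b, w.2] := by
        refine L.toHomeomorph.isClosedEmbedding.comp ?_
        refine IsClosedEmbedding.of_continuous_injective_isClosedMap (by fun_prop)
          (fun b b' hb => by simpa using congrArg (fun y : E3 => y 1) hb) ?_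
        have hinv : Function.LeftInverse (fun y : E3 => y 1) fun b : ℝ => !₂[w.1, b, w.2] :=
          fun b => by simp
        exact (hinv.isClosedEmbedding (by fun_prop) (by fun_prop)).isClosedMap
      exact hfc.comp_isClosedEmbedding hemb
    have hind : (fun b => S.indicator (fun x => fderiv ℝ f x e) (L !₂[w.1, b, w.2])) =
        (Iio (w.1 * g (w.2 / w.1))).indicator (deriv ψ) := by
      funext b
      by_cases hb : L !₂[w.1, b, w.2] ∈ conicBox L α β
      · have hm := h.mem_iff_conicBox hc hL hb
        rw [hsymm] at hm
        simp only [Matrix.cons_val] at hm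
        by_cases hS : L !₂[w.1, b, w.2] ∈ S
        · rw [indicator_of_mem hS, indicator_of_mem (mem_Iio.2 (hm.1 hS)), hder]
        · rw [indicator_of_notMem hS, 
            indicator_of_notMem fun h' : b ∈ Iio _ => hS (hm.2 h')]
      · have h0 := hzero _ hb
        have h1 : deriv ψ b = 0 := by rw [hder, h0]
        simp only [indicator, h0, h1, ite_self]
    rw [hind, integral_indicator measurableSet_Iio, ← integral_Iic_eq_integral_Iio,
      hψc.integral_Iic_deriv_eq hψ1]
  · rw [indicator_of_notMem hw]
    refine integral_eq_zero_of_ae (Eventually.of_forall fun b => ?_)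
    have hb : L !₂[w.1, b, w.2] ∉ conicBox L α β := fun hb => hw (by
      have := hb.2.2
      have h0 := hb.1
      rw [hsymm] at this h0
      exact ⟨by simpa using h0, by simpa using this⟩)
    simp only [indicator, hzero _ hb, ite_self, Pi.zero_apply]

/-- Integrating along `e` leaves the values of `f` on the graph, integrated against planar measure
of the projection. By `area_mul_inner` that measure, up to the determinant of the frame, is surface
measure weighted by the inner product of the normal with `e`. -/
theorem integral_fderiv (h : IsConicChart S p e τ α β κ g) (hS : IsC2Cone S)
    (hL : ∀ y, L y = y 0 • p + y 1 • e + y 2 • τ) {f : E3 → ℝ} (hf : ContDiff ℝ 1 f)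
    (hfc : HasCompactSupport f) (hfs : tsupport f ⊆ conicBox L α β) :
    ∫ x in S, fderiv ℝ f x e =
      ∫ x in frontier S, f x * inner ℝ (outwardNormal S x) e ∂μHE[2] := by
  have hcone := hS.cone
  have hcont : Continuous fun x => fderiv ℝ f x e := (hf.continuous_fderiv (by norm_num)).clm_apply
    continuous_const
  have hcs : HasCompactSupport fun x => fderiv ℝ f x e := hfc.fderiv_apply (𝕜 := ℝ) e
  set G : ℝ × ℝ × ℝ → ℝ := fun z =>
    S.indicator (fun x => fderiv ℝ f x e) (L !₂[z.2.1, z.1, z.2.2]) with hG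
  have hGsplit : (fun y : E3 => S.indicator (fun x => fderiv ℝ f x e) (L y)) =
      fun y => G (y 1, (y 0, y 2)) := by
    funext y
    have : y = !₂[y 0, y 1, y 2] := by
      ext i; fin_cases i <;> rfl
    simp only [hG]
    rw [← this]
  have hint : Integrable G volume := by
    rw [← measurePreserving_split.integrable_comp_emb measurableEmbedding_split]
    have h1 : G ∘ (fun y : E3 => (y 1, (y 0, y 2))) =
        (L ⁻¹' S).indicator fun y => fderiv ℝ f (L y) e := by
      rw [show G ∘ (fun y : E3 => (y 1, (y 0, y 2))) = fun y => G (y 1, (y 0, y 2)) from rfl,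
        ← hGsplit]
      rfl
    rw [h1]
    refine Integrable.indicator ?_ (L.continuous.measurable hS.isOpen.measurableSet)
    exact (hcont.comp L.continuous).integrable_of_hasCompactSupport
      (hcs.comp_homeomorph L.toHomeomorph)
  have hleft : ∫ x in S, fderiv ℝ f x e = |LinearMap.det (L : E3 →ₗ[ℝ] E3)| *
      ∫ z in Ioi (0 : ℝ) ×ˢ Ioo (-β) β, z.1 * f (z.1 • (p + g z.2 • e + z.2 • τ)) := by
    rw [← integral_indicator hS.isOpen.measurableSet,
      integral_eq_abs_det_mul_integral_comp L, hGsplit,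
      measurePreserving_split.integral_comp measurableEmbedding_split G]
    congr 1
    rw [Measure.volume_eq_prod] at hint ⊢
    rw [integral_prod_symm _ hint]
    simp only [hG]
    rw [integral_congr_ae (Eventually.of_forall fun w => h.fiber_integral hcone hL hf hfc hfs w)]
    have hms : MeasurableSet {z : ℝ × ℝ | 0 < z.1 ∧ |z.2| < β * z.1} :=
      (measurableSet_lt measurable_const measurable_fst).inter
        (measurableSet_lt (f := fun z : ℝ × ℝ => |z.2|) (by fun_prop) (by fun_prop))
    rw [integral_indicator hms, integral_conic_region]
    refine setIntegral_congr_fun (measurableSet_Ioi.prod measurableSet_Ioo) fun z hz => ?_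
    have hz0 : z.1 ≠ 0 := ne_of_gt hz.1
    simp only
    rw [hL, mul_div_cancel_left₀ _ hz0]
    simp [smul_add, smul_smul]
  have hright : ∫ x in frontier S, f x * inner ℝ (outwardNormal S x) e ∂μHE[2] =
      ∫ x in frontier S ∩ conicBox L α β, f x * inner ℝ (outwardNormal S x) e ∂μHE[2] := by
    refine (setIntegral_eq_of_subset_of_forall_sdiff_eq_zero isClosed_frontier.measurableSet
      inter_subset_left fun x hx => ?_)
    rw [image_eq_zero_of_notMem_tsupport fun h' => hx.2 ⟨hx.1, hfs h'⟩, zero_mul]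
  have hmeas : AEStronglyMeasurable (fun x => f x * inner ℝ (outwardNormal S x) e)
      ((μHE[2]).restrict (frontier S ∩ conicBox L α β)) := by
    refine AEStronglyMeasurable.mono_measure ?_ (Measure.restrict_mono inter_subset_left le_rfl)
    exact hf.continuous.aestronglyMeasurable.mul
      (hS.aestronglyMeasurable_outwardNormal.inner aestronglyMeasurable_const)
  rw [hleft, hright, h.integral_frontier hcone hL hmeas, ← integral_const_mul]
  refine setIntegral_congr_fun (measurableSet_Ioi.prod measurableSet_Ioo) fun z hz => ?_
  have hz0 : 0 < z.1 := hz.1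
  rw [outwardNormal_smul hcone hz0, ← h.area_mul_inner hL hz.2]
  ring

end IsConicChart


theorem IsC2Cone.isFiniteMeasureOnCompacts_frontier {S : Set E3} (hS : IsC2Cone S) :
    IsFiniteMeasureOnCompacts ((μHE[2] : Measure E3).restrict (frontier S)) := by
  refine ⟨fun K hK => ?_⟩
  obtain ⟨R, hR⟩ := hK.isBounded.subset_ball 0
  rw [Measure.restrict_apply hK.measurableSet]
  refine (measure_mono ?_).trans_lt (hS.isFiniteMeasureOnCompacts R)
  exact fun x hx => ⟨hx.2, hR hx.1⟩

theorem IsC2Cone.integrable_mul_inner_outwardNormal {S : Set E3} (hS : IsC2Cone S) {f : E3 → ℝ}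
    (hf : Continuous f) (hfc : HasCompactSupport f) (w : E3) :
    Integrable (fun x => f x * inner ℝ (outwardNormal S x) w)
      ((μHE[2] : Measure E3).restrict (frontier S)) := by
  have := hS.isFiniteMeasureOnCompacts_frontier
  refine (hf.integrable_of_hasCompactSupport hfc).mul_bdd (c := ‖w‖)
    (hS.aestronglyMeasurable_outwardNormal.inner aestronglyMeasurable_const) ?_
  filter_upwards [hS.ae_ne_zero] with x hx
  refine (norm_inner_le_norm _ _).trans ?_
  rw [hS.norm_outwardNormal hx.1 hx.2, one_mul]

theorem integrable_fderiv_apply {f : E3 → ℝ} (hf : ContDiff ℝ 1 f) (hfc : HasCompactSupport f)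
    (w : E3) : Integrable fun x => fderiv ℝ f x w :=
  ((hf.continuous_fderiv (by norm_num)).clm_apply continuous_const).integrable_of_hasCompactSupport
    (hfc.fderiv_apply (𝕜 := ℝ) w)

theorem integral_fderiv_apply_eq_zero {f : E3 → ℝ} (hf : ContDiff ℝ 1 f)
    (hfc : HasCompactSupport f) (w : E3) : ∫ x, fderiv ℝ f x w = 0 := by
  have h := integral_bilinear_hasLineDerivAt_right_eq_neg_left_of_integrable
    (μ := (volume : Measure E3)) (f := fun _ => (1 : ℝ)) (f' := fun _ => 0) (g := f)
    (g' := fun x => fderiv ℝ f x w) (v := w) (B := ContinuousLinearMap.mul ℝ ℝ) (by simp)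
    (by simpa using integrable_fderiv_apply hf hfc w)
    (by simpa using hf.continuous.integrable_of_hasCompactSupport hfc)
    (fun x _ => by simpa using (hasFDerivAt_const (𝕜 := ℝ) (1 : ℝ) x).hasLineDerivAt w)
    (fun x _ => ((hf.differentiable (by norm_num) x).hasFDerivAt).hasLineDerivAt w)
  simpa using h

theorem IsC2Cone.exists_nhds_integral_fderiv {S : Set E3} (hS : IsC2Cone S) (w : E3) {x : E3}
    (hx : x ≠ 0) : ∃ U : Set E3, IsOpen U ∧ x ∈ U ∧ ∀ f : E3 → ℝ, ContDiff ℝ 1 f →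
      HasCompactSupport f → tsupport f ⊆ U →
      ∫ x in S, fderiv ℝ f x w =
        ∫ x in frontier S, f x * inner ℝ (outwardNormal S x) w ∂μHE[2] := by
  by_cases hxf : x ∈ frontier S
  · set ν := outwardNormal S x with hν
    have hνν : inner ℝ ν ν = (1 : ℝ) := by
      rw [real_inner_self_eq_norm_sq, hS.norm_outwardNormal hxf hx]; norm_num
    -- The direction `w` may be tangent to the boundary or point inwards. It is the difference of `w
    -- + c • ν` and `c • ν`, and this `c` makes both point strictly outwards.
    set c : ℝ := |inner ℝ ν w| + 1 with hc
    have hc0 : 0 < c := by positivity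
    obtain ⟨τ, L, α, β, κ, g, h, hL⟩ := hS.exists_chart (e := w + c • ν) hxf hx (by
      rw [inner_add_right, real_inner_smul_right, hνν]
      linarith [neg_abs_le (inner ℝ ν w)])
    obtain ⟨τ', L', α', β', κ', g', h', hL'⟩ := hS.exists_chart (e := c • ν) hxf hx (by
      rw [real_inner_smul_right, hνν]; linarith)
    refine ⟨conicBox L α β ∩ conicBox L' α' β', (isOpen_conicBox _ _ _).inter
      (isOpen_conicBox _ _ _), ⟨h.mem_conicBox_base hL, h'.mem_conicBox_base hL'⟩,
      fun f hf hfc hfs => ?_⟩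
    have h1 := h.integral_fderiv hS hL hf hfc (hfs.trans inter_subset_left)
    have h2 := h'.integral_fderiv hS hL' hf hfc (hfs.trans inter_subset_right)
    have e1 : ∫ x in S, fderiv ℝ f x w =
        (∫ x in S, fderiv ℝ f x (w + c • ν)) - ∫ x in S, fderiv ℝ f x (c • ν) := by
      rw [← integral_sub (integrable_fderiv_apply hf hfc _).integrableOn
        (integrable_fderiv_apply hf hfc _).integrableOn]
      refine integral_congr_ae (Eventually.of_forall fun x => ?_)
      simp only [map_add, add_sub_cancel_right]
    rw [e1, h1, h2, ← integral_sub (hS.integrable_mul_inner_outwardNormal hf.continuous hfc _)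
      (hS.integrable_mul_inner_outwardNormal hf.continuous hfc _)]
    refine integral_congr_ae (Eventually.of_forall fun x => ?_)
    simp only [inner_add_right]
    ring
  · have hfr : ∀ f : E3 → ℝ, (∀ y ∈ frontier S, f y = 0) →
        ∫ x in frontier S, f x * inner ℝ (outwardNormal S x) w ∂μHE[2] = 0 := fun f hf =>
      setIntegral_eq_zero_of_forall_eq_zero fun y hy => by rw [hf y hy, zero_mul]
    have hSf : Disjoint S (frontier S) := (disjoint_frontier_iff_isOpen.2 hS.isOpen).symm
    by_cases hxS : x ∈ S
    · refine ⟨S, hS.isOpen, hxS, fun f hf hfc hfs => ?_⟩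
      rw [hfr f fun y hy => image_eq_zero_of_notMem_tsupport fun h =>
        hSf.le_bot ⟨hfs h, hy⟩, ← integral_fderiv_apply_eq_zero hf hfc w]
      refine setIntegral_eq_integral_of_forall_compl_eq_zero fun y hy => ?_
      rw [image_eq_zero_of_notMem_tsupport fun h => hy (hfs (tsupport_fderiv_subset ℝ h))]
      rfl
    · have hxc : x ∉ closure S := fun h => hxf (by rw [hS.isOpen.frontier_eq]; exact ⟨h, hxS⟩)
      refine ⟨(closure S)ᶜ, isClosed_closure.isOpen_compl, hxc, fun f hf hfc hfs => ?_⟩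
      rw [hfr f fun y hy => image_eq_zero_of_notMem_tsupport fun h =>
        hfs h (frontier_subset_closure hy)]
      refine setIntegral_eq_zero_of_forall_eq_zero fun y hy => ?_
      rw [image_eq_zero_of_notMem_tsupport fun h =>
        hfs (tsupport_fderiv_subset ℝ h) (subset_closure hy)]
      rfl

/-- A partition of unity on the support of `f` reduces to the local statement, since both sides are
linear in `f`. -/
theorem IsC2Cone.integral_fderiv_of_zero_notMem {S : Set E3} (hS : IsC2Cone S) (w : E3)
    {f : E3 → ℝ} (hf : ContDiff ℝ 1 f) (hfc : HasCompactSupport f) (hf0 : (0 : E3) ∉ tsupport f) :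
    ∫ x in S, fderiv ℝ f x w =
      ∫ x in frontier S, f x * inner ℝ (outwardNormal S x) w ∂μHE[2] := by
  classical
  have hex : ∀ x : E3, ∃ U : Set E3, x ≠ 0 → IsOpen U ∧ x ∈ U ∧ ∀ f : E3 → ℝ, ContDiff ℝ 1 f →
      HasCompactSupport f → tsupport f ⊆ U →
      ∫ x in S, fderiv ℝ f x w =
        ∫ x in frontier S, f x * inner ℝ (outwardNormal S x) w ∂μHE[2] := fun x => by
    by_cases hx : x = 0
    · exact ⟨∅, fun h => absurd hx h⟩
    · obtain ⟨U, hU⟩ := hS.exists_nhds_integral_fderiv w hx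
      exact ⟨U, fun _ => hU⟩
  choose U hU using hex
  have hne : ∀ x ∈ tsupport f, x ≠ 0 := fun x hx h0 => hf0 (h0 ▸ hx)
  obtain ⟨t, χ, htC, hχ, hχs, hsum⟩ := exists_finite_partition (C := tsupport f) hfc
    (U := U) fun x hx => ⟨(hU x (hne x hx)).1, (hU x (hne x hx)).2.1⟩
  have hg : ∀ i, ContDiff ℝ 1 fun x => χ i x * f x := fun i =>
    ((hχ i).of_le (by exact_mod_cast le_top)).mul hf
  have hgc : ∀ i, HasCompactSupport fun x => χ i x * f x := fun i => hfc.mul_left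
  have hfsum : ∀ x, f x = ∑ i ∈ t, χ i x * f x := fun x => by
    rw [← Finset.sum_mul]
    by_cases hx : x ∈ tsupport f
    · rw [hsum x hx, one_mul]
    · rw [image_eq_zero_of_notMem_tsupport hx, mul_zero]
  have hDsum : ∀ x, fderiv ℝ f x w = ∑ i ∈ t, fderiv ℝ (fun x => χ i x * f x) x w := fun x => by
    have h1 : f = fun x => ∑ i ∈ t, χ i x * f x := funext hfsum
    conv_lhs => rw [h1]
    rw [fderiv_fun_sum fun i _ => (hg i).differentiable (by norm_num) x,
      sum_apply]
  calc ∫ x in S, fderiv ℝ f x w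
      = ∑ i ∈ t, ∫ x in S, fderiv ℝ (fun x => χ i x * f x) x w := by
        rw [← integral_finsetSum _ fun i _ =>
          (integrable_fderiv_apply (hg i) (hgc i) w).integrableOn]
        exact integral_congr_ae (Eventually.of_forall hDsum)
    _ = ∑ i ∈ t, ∫ x in frontier S, χ i x * f x * inner ℝ (outwardNormal S x) w ∂μHE[2] := by
        refine Finset.sum_congr rfl fun i hi => ?_
        exact (hU i (hne i (htC i hi))).2.2 _ (hg i) (hgc i)
          ((tsupport_mul_subset_left).trans (hχs i hi))
    _ = _ := by
        rw [← integral_finsetSum _ fun i _ =>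
          hS.integrable_mul_inner_outwardNormal (hg i).continuous (hgc i) w]
        refine integral_congr_ae (Eventually.of_forall fun x => ?_)
        simp only
        rw [← Finset.sum_mul, ← hfsum x]

/-- The divergence theorem on a cone whose boundary is smooth away from the vertex. -/
theorem IsC2Cone.integral_fderiv {S : Set E3} (hS : IsC2Cone S) (w : E3)
    {f : E3 → ℝ} (hf : ContDiff ℝ 1 f) (hfc : HasCompactSupport f) :
    ∫ x in S, fderiv ℝ f x w =
      ∫ x in frontier S, f x * inner ℝ (outwardNormal S x) w ∂μHE[2] := by
  set ρ : ContDiffBump (0 : E3) := ⟨1, 2, by norm_num, by norm_num⟩ with hρ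
  have hρ1 : ContDiff ℝ 1 (ρ : E3 → ℝ) := ρ.contDiff
  -- `χ n` vanishes near the vertex and tends to `1` everywhere else.
  set χ : ℕ → E3 → ℝ := fun n x => 1 - ρ (((n : ℝ) + 1) • x) with hχ
  have hn0 : ∀ n : ℕ, (0 : ℝ) < (n : ℝ) + 1 := fun n => by positivity
  have hχ1 : ∀ n, ContDiff ℝ 1 (χ n) := fun n => contDiff_const.sub (hρ1.comp (by fun_prop))
  have hχb : ∀ n x, |χ n x| ≤ 1 := fun n x => by
    have h1 := ρ.nonneg (x := ((n : ℝ) + 1) • x)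
    have h2 := ρ.le_one (x := ((n : ℝ) + 1) • x)
    rw [abs_le]; constructor <;> simp only [hχ] <;> linarith
  have hχlim : ∀ x : E3, x ≠ 0 → Tendsto (fun n => χ n x) atTop (𝓝 1) := fun x hx => by
    have h1 : Tendsto (fun n : ℕ => ((n : ℝ) + 1) * ‖x‖) atTop atTop :=
      (tendsto_atTop_add_const_right _ _ tendsto_natCast_atTop_atTop).atTop_mul_const
        (norm_pos_iff.2 hx)
    refine tendsto_const_nhds.congr' ?_
    filter_upwards [h1.eventually_ge_atTop 2] with n hn
    simp only [hχ]
    rw [ρ.zero_of_le_dist, sub_zero]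
    rw [dist_zero_right, norm_smul, Real.norm_eq_abs, abs_of_pos (hn0 n)]
    exact hn
  set F : ℕ → E3 → ℝ := fun n x => χ n x * f x with hF
  have hF1 : ∀ n, ContDiff ℝ 1 (F n) := fun n => (hχ1 n).mul hf
  have hFc : ∀ n, HasCompactSupport (F n) := fun n => hfc.mul_left
  have hF0 : ∀ n, (0 : E3) ∉ tsupport (F n) := fun n => by
    rw [notMem_tsupport_iff_eventuallyEq]
    have h1 : Tendsto (fun x : E3 => ((n : ℝ) + 1) • x) (𝓝 0) (𝓝 0) := by
      have : Continuous fun x : E3 => ((n : ℝ) + 1) • x := by fun_prop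
      simpa using this.tendsto 0
    filter_upwards [h1.eventually (Metric.closedBall_mem_nhds (0 : E3) one_pos)] with x hx
    simp only [hF, hχ, Pi.zero_apply]
    rw [ρ.one_of_mem_closedBall hx, sub_self, zero_mul]
  have key : ∀ n, ∫ x in S, fderiv ℝ (F n) x w =
      ∫ x in frontier S, F n x * inner ℝ (outwardNormal S x) w ∂μHE[2] := fun n =>
    hS.integral_fderiv_of_zero_notMem w (hF1 n) (hFc n) (hF0 n)
  have hfi := hS.integrable_mul_inner_outwardNormal hf.continuous hfc w
  have hright : Tendsto (fun n => ∫ x in frontier S, F n x * inner ℝ (outwardNormal S x) w ∂μHE[2])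
      atTop (𝓝 (∫ x in frontier S, f x * inner ℝ (outwardNormal S x) w ∂μHE[2])) := by
    refine tendsto_integral_of_dominated_convergence
      (fun x => |f x * inner ℝ (outwardNormal S x) w|) (fun n =>
        (hS.integrable_mul_inner_outwardNormal (hF1 n).continuous (hFc n) w).1) hfi.abs ?_ ?_
    · intro n
      refine Eventually.of_forall fun x => ?_
      simp only [hF, Real.norm_eq_abs, mul_assoc]
      rw [abs_mul]
      exact mul_le_of_le_one_left (abs_nonneg _) (hχb n x)
    · filter_upwards [hS.ae_ne_zero] with x hx
      have := ((hχlim x hx.2).mul_const (f x)).mul_const (inner ℝ (outwardNormal S x) w)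
      simpa using this
  have hDf := integrable_fderiv_apply hf hfc w
  have hfderiv : ∀ n x, fderiv ℝ (F n) x w = χ n x * fderiv ℝ f x w -
      f x * (((n : ℝ) + 1) * fderiv ℝ (ρ : E3 → ℝ) (((n : ℝ) + 1) • x) w) := fun n x => by
    have h1 : HasFDerivAt (fun x : E3 => ρ (((n : ℝ) + 1) • x))
        ((fderiv ℝ (ρ : E3 → ℝ) (((n : ℝ) + 1) • x)).comp
          (((n : ℝ) + 1) • ContinuousLinearMap.id ℝ E3)) x :=
      ((hρ1.differentiable (by norm_num) _).hasFDerivAt).comp x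
        ((hasFDerivAt_id x).const_smul ((n : ℝ) + 1))
    have h2 := (h1.const_sub 1).mul (hf.differentiable (by norm_num) x).hasFDerivAt
    have h3 : HasFDerivAt (F n) _ x := h2
    rw [h3.fderiv]
    simp [hχ]
    ring
  have hleft1 : Tendsto (fun n => ∫ x in S, χ n x * fderiv ℝ f x w) atTop
      (𝓝 (∫ x in S, fderiv ℝ f x w)) := by
    refine tendsto_integral_of_dominated_convergence (fun x => |fderiv ℝ f x w|) (fun n =>
      (hχ1 n).continuous.aestronglyMeasurable.mul hDf.integrableOn.1) hDf.abs.integrableOn ?_ ?_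
    · intro n
      refine Eventually.of_forall fun x => ?_
      rw [Real.norm_eq_abs, abs_mul]
      exact mul_le_of_le_one_left (abs_nonneg _) (hχb n x)
    · have h0 : ∀ᵐ x : E3, x ≠ 0 := by simp [ae_iff]
      filter_upwards [ae_restrict_of_ae h0] with x hx
      simpa using (hχlim x hx).mul_const (fderiv ℝ f x w)
  have hDρ := integrable_fderiv_apply hρ1 ρ.hasCompactSupport w
  obtain ⟨M, hM⟩ := hf.continuous.bounded_above_of_compact_support hfc
  have hint2 : ∀ n : ℕ, Integrable fun x => f x *
      (((n : ℝ) + 1) * fderiv ℝ (ρ : E3 → ℝ) (((n : ℝ) + 1) • x) w) := fun n =>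
    ((hDρ.comp_smul (hn0 n).ne').const_mul _).bdd_mul hf.continuous.aestronglyMeasurable
      (Eventually.of_forall hM)
  -- The derivative of the cutoff has size `n + 1` on a set of volume of order `(n + 1) ^ (-3)`, so
  -- the error is `O((n + 1) ^ (-2))`.
  have hleft2 : Tendsto (fun n : ℕ => ∫ x in S, f x *
      (((n : ℝ) + 1) * fderiv ℝ (ρ : E3 → ℝ) (((n : ℝ) + 1) • x) w)) atTop (𝓝 0) := by
    have hbound : ∀ n : ℕ, ‖∫ x in S, f x *
        (((n : ℝ) + 1) * fderiv ℝ (ρ : E3 → ℝ) (((n : ℝ) + 1) • x) w)‖ ≤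
        (M * ∫ x, |fderiv ℝ (ρ : E3 → ℝ) x w|) * (1 / ((n : ℝ) + 1)) := fun n => by
      have hM0 : 0 ≤ M := (norm_nonneg _).trans (hM 0)
      have hcs : ∫ x, |fderiv ℝ (ρ : E3 → ℝ) (((n : ℝ) + 1) • x) w| =
          (((n : ℝ) + 1) ^ 3)⁻¹ * ∫ x, |fderiv ℝ (ρ : E3 → ℝ) x w| := by
        rw [Measure.integral_comp_smul volume (fun x => |fderiv ℝ (ρ : E3 → ℝ) x w|)]
        rw [finrank_euclideanSpace_fin, abs_of_pos (by have := hn0 n; positivity), smul_eq_mul]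
      have hI : 0 ≤ ∫ x, |fderiv ℝ (ρ : E3 → ℝ) x w| := integral_nonneg fun _ => abs_nonneg _
      calc _ ≤ ∫ x in S, |f x *
            (((n : ℝ) + 1) * fderiv ℝ (ρ : E3 → ℝ) (((n : ℝ) + 1) • x) w)| :=
            norm_integral_le_integral_norm _
        _ ≤ ∫ x, |f x * (((n : ℝ) + 1) * fderiv ℝ (ρ : E3 → ℝ) (((n : ℝ) + 1) • x) w)| :=
            setIntegral_le_integral (hint2 n).abs (Eventually.of_forall fun _ => abs_nonneg _)
        _ ≤ ∫ x, M * ((n : ℝ) + 1) * |fderiv ℝ (ρ : E3 → ℝ) (((n : ℝ) + 1) • x) w| := by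
            refine integral_mono (hint2 n).abs
              ((hDρ.comp_smul (hn0 n).ne').abs.const_mul _) fun x => ?_
            simp only
            rw [abs_mul, abs_mul, abs_of_pos (hn0 n), mul_assoc]
            exact mul_le_mul_of_nonneg_right (hM x) (by have := hn0 n; positivity)
        _ = (M * ∫ x, |fderiv ℝ (ρ : E3 → ℝ) x w|) * (1 / ((n : ℝ) + 1) ^ 2) := by
            rw [integral_const_mul, hcs]
            have := (hn0 n).ne'
            field_simp
        _ ≤ _ := by
            refine mul_le_mul_of_nonneg_left ?_ (mul_nonneg hM0 hI)
            have h1 : (1 : ℝ) ≤ (n : ℝ) + 1 := by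
              have : (0 : ℝ) ≤ n := by positivity
              linarith
            exact one_div_le_one_div_of_le (hn0 n) (by nlinarith)
    refine squeeze_zero_norm hbound ?_
    simpa using tendsto_one_div_add_atTop_nhds_zero_nat.const_mul
      (M * ∫ x, |fderiv ℝ (ρ : E3 → ℝ) x w|)
  have hleft : Tendsto (fun n => ∫ x in S, fderiv ℝ (F n) x w) atTop
      (𝓝 (∫ x in S, fderiv ℝ f x w)) := by
    have := hleft1.sub hleft2
    rw [sub_zero] at this
    refine this.congr fun n => ?_
    rw [← integral_sub (hDf.bdd_mul (hχ1 n).continuous.aestronglyMeasurable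
      (Eventually.of_forall fun x => hχb n x)).integrableOn (hint2 n).integrableOn]
    exact integral_congr_ae (Eventually.of_forall fun x => (hfderiv n x).symm)
  exact tendsto_nhds_unique (hleft.congr key) hright

end

noncomputable section

/-! ### Finiteness of the fractional perimeter -/

theorem lintegral_comp_smul_eq (f : E3 → ℝ≥0∞) {c : ℝ} (hc : 0 < c) :
    ∫⁻ x, f (c • x) = ENNReal.ofReal ((c ^ 3)⁻¹) * ∫⁻ x, f x := by
  have h := Measure.map_addHaar_smul (volume : Measure E3) hc.ne'
  have hemb : MeasurableEmbedding fun x : E3 => c • x :=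
    (Homeomorph.smulOfNeZero c hc.ne').measurableEmbedding
  rw [← hemb.lintegral_map f]
  have h2 : Measure.map (fun x : E3 => c • x) volume = ENNReal.ofReal ((c ^ 3)⁻¹) • volume := by
    have := h
    rw [finrank_euclideanSpace_fin, abs_of_pos (by positivity)] at this
    exact this
  rw [h2, lintegral_smul_measure, smul_eq_mul]

/-- Where `d ≤ ‖x - y‖` one has `‖x - y‖ ≥ (d + ‖x - y‖) / 2`, so the kernel is dominated by an
integrable one without singularity. Translation by `x` and scaling by `d` extract the power `d ^
(-s)`. -/
theorem exists_lintegral_kernel_le {s : ℝ} (hs : 0 < s) :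
    ∃ C : ℝ≥0∞, C ≠ 0 ∧ C ≠ ⊤ ∧ ∀ (x : E3) (d : ℝ), 0 ≤ d →
      ∫⁻ y in {y | d ≤ ‖x - y‖}, ENNReal.ofReal (1 / ‖x - y‖ ^ (3 + s)) ≤
        C * ENNReal.ofReal d ^ (-s) := by
  set I : ℝ≥0∞ := ∫⁻ z : E3, ENNReal.ofReal ((1 + ‖z‖) ^ (-(3 + s))) with hI
  have hIfin : I < ⊤ := finite_integral_one_add_norm (by
    rw [finrank_euclideanSpace_fin]; push_cast; linarith)
  -- The summand `1` keeps the constant visibly nonzero: for `d = 0` the right side has to be `∞`.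
  refine ⟨ENNReal.ofReal (2 ^ (3 + s)) * I + 1, by simp, ?_, fun x d hd => ?_⟩
  · exact ENNReal.add_ne_top.2 ⟨ENNReal.mul_ne_top ENNReal.ofReal_ne_top hIfin.ne,
      ENNReal.one_ne_top⟩
  rcases hd.eq_or_lt with rfl | hd
  · simp [ENNReal.zero_rpow_of_neg (neg_neg_of_pos hs)]
  have hms : MeasurableSet {y : E3 | d ≤ ‖x - y‖} :=
    measurableSet_le measurable_const (by fun_prop)
  have hpt : ∀ y ∈ {y : E3 | d ≤ ‖x - y‖}, ENNReal.ofReal (1 / ‖x - y‖ ^ (3 + s)) ≤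
      ENNReal.ofReal (2 ^ (3 + s) * d ^ (-(3 + s))) *
        ENNReal.ofReal ((1 + ‖d⁻¹ • (y - x)‖) ^ (-(3 + s))) := by
    intro y hy
    have hy : d ≤ ‖x - y‖ := hy
    have hpos : 0 < ‖x - y‖ := hd.trans_le hy
    rw [← ENNReal.ofReal_mul (by positivity)]
    apply ENNReal.ofReal_le_ofReal
    rw [norm_smul, norm_inv, Real.norm_eq_abs, abs_of_pos hd, norm_sub_rev y x, one_div,
      ← Real.rpow_neg hpos.le, mul_assoc, ← Real.mul_rpow hd.le (by positivity),
      show d * (1 + d⁻¹ * ‖x - y‖) = d + ‖x - y‖ by field_simp,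
      ← inv_inv ((2 : ℝ) ^ (3 + s)), ← Real.rpow_neg (by norm_num),
      ← Real.inv_rpow (by norm_num), ← Real.mul_rpow (by norm_num) (by positivity)]
    apply Real.rpow_le_rpow_of_nonpos (by positivity) _ (by linarith)
    linarith
  calc _ ≤ ∫⁻ y in {y : E3 | d ≤ ‖x - y‖}, ENNReal.ofReal (2 ^ (3 + s) * d ^ (-(3 + s))) *
        ENNReal.ofReal ((1 + ‖d⁻¹ • (y - x)‖) ^ (-(3 + s))) := setLIntegral_mono' hms hpt
    _ ≤ ∫⁻ y, ENNReal.ofReal (2 ^ (3 + s) * d ^ (-(3 + s))) *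
        ENNReal.ofReal ((1 + ‖d⁻¹ • (y - x)‖) ^ (-(3 + s))) := setLIntegral_le_lintegral _ _
    _ = ENNReal.ofReal (2 ^ (3 + s) * d ^ (-(3 + s))) * (ENNReal.ofReal (((d⁻¹) ^ 3)⁻¹) * I) := by
        rw [lintegral_const_mul' _ _ ENNReal.ofReal_ne_top,
          lintegral_sub_right_eq_self (fun y : E3 =>
            ENNReal.ofReal ((1 + ‖d⁻¹ • y‖) ^ (-(3 + s)))) x,
          lintegral_comp_smul_eq (fun y : E3 => ENNReal.ofReal ((1 + ‖y‖) ^ (-(3 + s))))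
            (inv_pos.2 hd)]
    _ = ENNReal.ofReal (2 ^ (3 + s)) * I * ENNReal.ofReal d ^ (-s) := by
        rw [ENNReal.ofReal_rpow_of_pos hd, mul_right_comm, ← mul_assoc,
          ← ENNReal.ofReal_mul (by positivity), ← ENNReal.ofReal_mul (by positivity)]
        congr 2
        rw [inv_pow, inv_inv, neg_add, Real.rpow_add hd, mul_assoc, mul_assoc]
        congr 1
        rw [mul_left_comm, Real.rpow_neg hd.le 3, show (3 : ℝ) = ((3 : ℕ) : ℝ) by norm_num,
          Real.rpow_natCast, inv_mul_cancel₀ (by positivity), mul_one]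
    _ ≤ _ := by gcongr; exact le_self_add

/-- The bound is uniform in `t`: where `|b - t| < 1`, translation reduces to a power singularity at
`0` of exponent less than one, and elsewhere the integrand is at most `1`. -/
theorem exists_lintegral_abs_rpow_le {s : ℝ} (hs0 : 0 < s) (hs1 : s < 1) (M : ℝ) :
    ∃ C : ℝ≥0∞, C ≠ ⊤ ∧ ∀ t : ℝ,
      ∫⁻ b in Icc (-M) M, ENNReal.ofReal |b - t| ^ (-s) ≤ C := by
  set J : ℝ≥0∞ := ∫⁻ b in Ioo (0 : ℝ) 1, ENNReal.ofReal (b ^ (-s)) with hJ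
  have hJfin : J < ⊤ := by
    have h1 := (intervalIntegral.intervalIntegrable_rpow' (a := 0) (b := 1)
      (by linarith : -1 < -s)).1.mono_set Ioo_subset_Ioc_self
    exact h1.lintegral_lt_top
  have habs : ∫⁻ b in Ioo (-1 : ℝ) 1, ENNReal.ofReal |b| ^ (-s) ≤ J + J := by
    have hpos : ∫⁻ b in Ioo (0 : ℝ) 1, ENNReal.ofReal |b| ^ (-s) = J :=
      setLIntegral_congr_fun measurableSet_Ioo fun b hb => by
        rw [abs_of_pos hb.1, ENNReal.ofReal_rpow_of_pos hb.1]
    have hneg : ∫⁻ b in Ioo (-1 : ℝ) 0, ENNReal.ofReal |b| ^ (-s) = J := by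
      rw [← hpos]
      have h := (Measure.measurePreserving_neg (volume : Measure ℝ)).setLIntegral_comp_preimage_emb
        (Homeomorph.neg ℝ).measurableEmbedding (fun b => ENNReal.ofReal |b| ^ (-s)) (Ioo (0 : ℝ) 1)
      simpa using h
    have hsub : Ioo (-1 : ℝ) 1 ⊆ (Ioo (-1 : ℝ) 0 ∪ Ioo 0 1) ∪ {0} := by
      intro b hb
      rcases lt_trichotomy b 0 with h | h | h
      · exact Or.inl (Or.inl ⟨hb.1, h⟩)
      · exact Or.inr h
      · exact Or.inl (Or.inr ⟨h, hb.2⟩)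
    refine (lintegral_mono_set hsub).trans ((lintegral_union_le _ _ _).trans ?_)
    rw [setLIntegral_measure_zero ({0} : Set ℝ) _ (by simp), add_zero]
    refine (lintegral_union_le _ _ _).trans ?_
    rw [hneg, hpos]
  refine ⟨ENNReal.ofReal (M - -M) + (J + J), ENNReal.add_ne_top.2 ⟨ENNReal.ofReal_ne_top,
    ENNReal.add_ne_top.2 ⟨hJfin.ne, hJfin.ne⟩⟩, fun t => ?_⟩
  have hpt : ∀ b : ℝ, ENNReal.ofReal |b - t| ^ (-s) ≤
      1 + (Ioo (-1 : ℝ) 1).indicator (fun b => ENNReal.ofReal |b| ^ (-s)) (b - t) := fun b => by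
    by_cases hb : b - t ∈ Ioo (-1 : ℝ) 1
    · rw [indicator_of_mem hb]; exact le_add_self
    · rw [indicator_of_notMem hb, add_zero]
      have h1 : 1 ≤ |b - t| := by
        by_contra hcon
        exact hb (abs_lt.1 (not_le.1 hcon))
      exact ENNReal.rpow_le_one_of_one_le_of_neg (by
        rw [← ENNReal.ofReal_one]; exact ENNReal.ofReal_le_ofReal h1) (by linarith)
  calc _ ≤ ∫⁻ b in Icc (-M) M, (1 +
        (Ioo (-1 : ℝ) 1).indicator (fun b => ENNReal.ofReal |b| ^ (-s)) (b - t)) :=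
        lintegral_mono hpt
    _ = ENNReal.ofReal (M - -M) + ∫⁻ b in Icc (-M) M,
        (Ioo (-1 : ℝ) 1).indicator (fun b => ENNReal.ofReal |b| ^ (-s)) (b - t) := by
        rw [lintegral_add_left measurable_const, lintegral_one, Measure.restrict_apply_univ,
          Real.volume_Icc]
    _ ≤ ENNReal.ofReal (M - -M) + ∫⁻ b,
        (Ioo (-1 : ℝ) 1).indicator (fun b => ENNReal.ofReal |b| ^ (-s)) (b - t) := by
        exact add_le_add le_rfl (setLIntegral_le_lintegral _ _)
    _ ≤ _ := by
        rw [lintegral_sub_right_eq_self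
          (fun b => (Ioo (-1 : ℝ) 1).indicator (fun b => ENNReal.ofReal |b| ^ (-s)) b) t,
          lintegral_indicator measurableSet_Ioo]
        gcongr

theorem lintegral_eq_det_mul_lintegral_comp (L : E3 ≃L[ℝ] E3) (F : E3 → ℝ≥0∞) :
    ∃ C : ℝ≥0∞, C ≠ ⊤ ∧ ∫⁻ x, F x = C * ∫⁻ y, F (L y) := by
  have hdet : LinearMap.det (L : E3 →ₗ[ℝ] E3) ≠ 0 := L.toLinearEquiv.isUnit_det'.ne_zero
  have h := Measure.map_linearMap_addHaar_eq_smul_addHaar (volume : Measure E3) hdet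
  have hemb : MeasurableEmbedding L := L.toHomeomorph.measurableEmbedding
  have h1 : ∫⁻ y, F (L y) = ∫⁻ x, F x ∂(Measure.map L volume) := (hemb.lintegral_map F).symm
  have h2 : Measure.map L volume =
      ENNReal.ofReal |(LinearMap.det (L : E3 →ₗ[ℝ] E3))⁻¹| • (volume : Measure E3) := h
  have hpos : 0 < |(LinearMap.det (L : E3 →ₗ[ℝ] E3))⁻¹| := abs_pos.2 (inv_ne_zero hdet)
  refine ⟨(ENNReal.ofReal |(LinearMap.det (L : E3 →ₗ[ℝ] E3))⁻¹|)⁻¹, by simpa using hdet, ?_⟩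
  rw [h1, h2, lintegral_smul_measure, smul_eq_mul, ← mul_assoc, ENNReal.inv_mul_cancel
    (ENNReal.ofReal_pos.2 hpos).ne' ENNReal.ofReal_ne_top, one_mul]

/-- With coordinates `0` and `2` fixed, the bound is a negative power of the distance to one point
of a line. Its integral is bounded independently of that point, so nothing about the function `θ`
enters. -/
theorem lintegral_lt_top_of_le_graph_rpow {s : ℝ} (hs0 : 0 < s) (hs1 : s < 1) (L : E3 ≃L[ℝ] E3)
    {F : E3 → ℝ≥0∞} (hF : Measurable F) {M : ℝ} (hFM : ∀ x, F x ≠ 0 → ‖L.symm x‖ ≤ M)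
    {C : ℝ≥0∞} (hC : C ≠ ⊤) (θ : ℝ → ℝ → ℝ)
    (hle : ∀ x, F x ≤ C * ENNReal.ofReal |L.symm x 1 - θ (L.symm x 0) (L.symm x 2)| ^ (-s)) :
    ∫⁻ x, F x < ⊤ := by
  obtain ⟨D, hD, hDF⟩ := lintegral_eq_det_mul_lintegral_comp L F
  obtain ⟨C', hC', hbound⟩ := exists_lintegral_abs_rpow_le hs0 hs1 M
  rw [hDF]
  refine ENNReal.mul_lt_top hD.lt_top ?_
  set G : ℝ × ℝ × ℝ → ℝ≥0∞ := fun z => F (L !₂[z.2.1, z.1, z.2.2]) with hG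
  have hGm : Measurable G := hF.comp (by fun_prop)
  have hGsplit : (fun y : E3 => F (L y)) = fun y => G (y 1, (y 0, y 2)) := by
    funext y
    have : y = !₂[y 0, y 1, y 2] := by
      ext i; fin_cases i <;> rfl
    simp only [hG]
    rw [← this]
  rw [hGsplit, measurePreserving_split.lintegral_comp hGm, Measure.volume_eq_prod,
    lintegral_prod_symm _ hGm.aemeasurable]
  have hcoord : ∀ (z : ℝ × ℝ × ℝ), G z ≠ 0 → |z.1| ≤ M ∧ |z.2.1| ≤ M ∧ |z.2.2| ≤ M := fun z hz => by
    have h1 := hFM _ hz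
    rw [L.symm_apply_apply] at h1
    have h2 := fun i => (PiLp.norm_apply_le (p := 2) !₂[z.2.1, z.1, z.2.2] i).trans h1
    exact ⟨by simpa using h2 1, by simpa using h2 0, by simpa using h2 2⟩
  have hin : ∀ w : ℝ × ℝ, ∫⁻ b, G (b, w) ≤
      (Icc (-M) M ×ˢ Icc (-M) M).indicator (fun _ => C * C') w := fun w => by
    by_cases hw : w ∈ Icc (-M) M ×ˢ Icc (-M) M
    · rw [indicator_of_mem hw]
      have hpt : ∀ b, G (b, w) ≤ (Icc (-M) M).indicator
          (fun b => C * ENNReal.ofReal |b - θ w.1 w.2| ^ (-s)) b := fun b => by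
        by_cases hb : b ∈ Icc (-M) M
        · rw [indicator_of_mem hb]
          have := hle (L !₂[w.1, b, w.2])
          rw [L.symm_apply_apply] at this
          simpa [hG] using this
        · rw [indicator_of_notMem hb]
          by_contra hcon
          exact hb (abs_le.1 (hcoord (b, w) (fun h0 => hcon h0.le)).1)
      refine (lintegral_mono hpt).trans ?_
      rw [lintegral_indicator measurableSet_Icc, lintegral_const_mul' _ _ hC]
      gcongr
      exact hbound _
    · rw [indicator_of_notMem hw]
      refine le_of_eq ?_
      have : ∀ b, G (b, w) = 0 := fun b => by
        by_contra hcon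
        have h := hcoord (b, w) hcon
        exact hw ⟨abs_le.1 h.2.1, abs_le.1 h.2.2⟩
      simp [this]
  refine (lintegral_mono hin).trans_lt ?_
  rw [lintegral_indicator_const (measurableSet_Icc.prod measurableSet_Icc)]
  refine ENNReal.mul_lt_top (ENNReal.mul_lt_top hC.lt_top hC'.lt_top) ?_
  exact (isCompact_Icc.prod isCompact_Icc).measure_lt_top

theorem mul_infDist_le_of_cone {T : Set E3} (hT : T.Nonempty)
    (hc : ∀ c : ℝ, 0 < c → ∀ x ∈ T, c • x ∈ T) {c : ℝ} (h : 0 < c) (x : E3) :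
    c * Metric.infDist x T ≤ Metric.infDist (c • x) T := by
  rw [Metric.le_infDist hT]
  intro y hy
  have h1 := Metric.infDist_le_dist_of_mem (x := x) (hc c⁻¹ (inv_pos.2 h) y hy)
  calc c * Metric.infDist x T ≤ c * dist x (c⁻¹ • y) := by gcongr
    _ = dist (c • x) y := by
        rw [dist_eq_norm, dist_eq_norm, ← abs_of_pos h, ← Real.norm_eq_abs, ← norm_smul,
          smul_sub, smul_smul, Real.norm_eq_abs, abs_of_pos h, mul_inv_cancel₀ h.ne', one_smul]

/-- Finitely many open cones cover the ball up to its centre. Around a boundary direction a chart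
bounds the distance below by `κ` times the height over the graph. Around any other direction the
distance is at least `κ * ‖x‖`, which dominates a multiple of the single coordinate `x 1`, that is,
the height over a plane. -/
theorem IsC2Cone.lintegral_infDist_rpow_lt_top {S : Set E3} (hS : IsC2Cone S)
    (hne : (frontier S).Nonempty) {s : ℝ} (hs0 : 0 < s) (hs1 : s < 1) :
    ∫⁻ x in Metric.ball (0 : E3) 1,
      ENNReal.ofReal (Metric.infDist x (frontier S)) ^ (-s) < ⊤ := by
  have hcone : ∀ c : ℝ, 0 < c → ∀ x ∈ frontier S, c • x ∈ frontier S := fun c hc x hx =>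
    (smul_mem_frontier_iff_of_cone hS.cone hc x).2 hx
  set D : E3 → ℝ≥0∞ := fun x => ENNReal.ofReal (Metric.infDist x (frontier S)) ^ (-s) with hD
  have hDm : Measurable D := by
    have : Measurable fun x : E3 => Metric.infDist x (frontier S) :=
      (Metric.continuous_infDist_pt _).measurable
    fun_prop
  have hrpow : ∀ (κ u d : ℝ), 0 < κ → κ * |u| ≤ d →
      ENNReal.ofReal d ^ (-s) ≤ ENNReal.ofReal κ ^ (-s) * ENNReal.ofReal |u| ^ (-s) := by
    intro κ u d hκ hd
    have h1 : ENNReal.ofReal κ * ENNReal.ofReal |u| ≤ ENNReal.ofReal d := by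
      rw [← ENNReal.ofReal_mul hκ.le]; exact ENNReal.ofReal_le_ofReal hd
    rw [← ENNReal.mul_rpow_of_ne_top ENNReal.ofReal_ne_top ENNReal.ofReal_ne_top]
    rw [ENNReal.rpow_neg, ENNReal.rpow_neg, ENNReal.inv_le_inv]
    exact ENNReal.rpow_le_rpow h1 hs0.le
  have hloc : ∀ u ∈ Metric.sphere (0 : E3) 1, ∃ W : Set E3, IsOpen W ∧ u ∈ W ∧
      (∀ c : ℝ, 0 < c → ∀ x ∈ W, c • x ∈ W) ∧ ∫⁻ x in W ∩ Metric.ball 0 1, D x < ⊤ := by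
    intro u hu
    have hu1 : ‖u‖ = 1 := by simpa using hu
    by_cases huf : u ∈ frontier S
    · have hu0 : u ≠ 0 := fun h => by simp [h] at hu1
      obtain ⟨e, τ, L, α, β, κ, g, h, hL⟩ := hS.exists_chart_normal huf hu0
      refine ⟨conicBox L α β, isOpen_conicBox _ _ _, h.mem_conicBox_base hL,
        fun c hc x hx => (smul_mem_conicBox hc x).2 hx, ?_⟩
      have hms : MeasurableSet (conicBox L α β ∩ Metric.ball 0 1) :=
        ((isOpen_conicBox _ _ _).inter Metric.isOpen_ball).measurableSet
      rw [← lintegral_indicator hms]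
      refine lintegral_lt_top_of_le_graph_rpow hs0 hs1 L (hDm.indicator hms)
        (M := ‖(L.symm : E3 →L[ℝ] E3)‖) (C := ENNReal.ofReal κ ^ (-s)) ?_ ?_
        (fun a c => a * g (c / a)) ?_
      · intro x hx
        have hx1 : x ∈ conicBox L α β ∩ Metric.ball 0 1 := by
          by_contra hcon; exact hx (indicator_of_notMem hcon _)
        have hx2 : ‖x‖ ≤ 1 := by simpa using (Metric.mem_ball.1 hx1.2).le
        refine ((L.symm : E3 →L[ℝ] E3).le_opNorm x).trans ?_
        exact mul_le_of_le_one_right (norm_nonneg _) hx2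
      · exact ENNReal.rpow_ne_top_of_ne_zero (by simpa using h.κ_pos) ENNReal.ofReal_ne_top
      · intro x
        by_cases hx : x ∈ conicBox L α β ∩ Metric.ball 0 1
        · rw [indicator_of_mem hx]
          refine hrpow _ _ _ h.κ_pos ?_
          rw [Metric.le_infDist hne]
          intro y hy
          rw [dist_eq_norm]
          exact h.dist_le_conicBox hS.cone hL hx.1 hy
        · rw [indicator_of_notMem hx]; exact zero_le
    · have hd0 : 0 < Metric.infDist u (frontier S) :=
        (isClosed_frontier.notMem_iff_infDist_pos hne).1 huf
      set κ := Metric.infDist u (frontier S) / 2 with hκ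
      have hκ0 : 0 < κ := by positivity
      set W : Set E3 := {x | κ * ‖x‖ < Metric.infDist x (frontier S)} with hW
      have hWo : IsOpen W := isOpen_lt (by fun_prop) (Metric.continuous_infDist_pt _)
      refine ⟨W, hWo, ?_, ?_, ?_⟩
      · change κ * ‖u‖ < _
        rw [hu1]; linarith
      · intro c hc x hx
        have hx : κ * ‖x‖ < Metric.infDist x (frontier S) := hx
        change κ * ‖c • x‖ < _
        refine lt_of_lt_of_le ?_ (mul_infDist_le_of_cone hne hcone hc x)
        rw [norm_smul, Real.norm_eq_abs, abs_of_pos hc, mul_left_comm]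
        exact mul_lt_mul_of_pos_left hx hc
      · have hms : MeasurableSet (W ∩ Metric.ball 0 1) :=
          (hWo.inter Metric.isOpen_ball).measurableSet
        rw [← lintegral_indicator hms]
        refine lintegral_lt_top_of_le_graph_rpow hs0 hs1 (ContinuousLinearEquiv.refl ℝ E3)
          (hDm.indicator hms) (M := 1) (C := ENNReal.ofReal κ ^ (-s)) ?_ ?_ (fun _ _ => 0) ?_
        · intro x hx
          have hx1 : x ∈ W ∩ Metric.ball 0 1 := by
            by_contra hcon; exact hx (indicator_of_notMem hcon _)
          simpa using (Metric.mem_ball.1 hx1.2).le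
        · exact ENNReal.rpow_ne_top_of_ne_zero (by simpa using hκ0) ENNReal.ofReal_ne_top
        · intro x
          by_cases hx : x ∈ W ∩ Metric.ball 0 1
          · rw [indicator_of_mem hx]
            refine hrpow _ _ _ hκ0 (le_trans ?_ (le_of_lt hx.1))
            gcongr
            simpa using PiLp.norm_apply_le x 1
          · rw [indicator_of_notMem hx]; exact zero_le
  choose! W hWo hWu hWc hWi using hloc
  obtain ⟨t, ht, htc⟩ := (isCompact_sphere (0 : E3) 1).elim_nhds_subcover W
    fun u hu => (hWo u hu).mem_nhds (hWu u hu)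
  have hcov : Metric.ball (0 : E3) 1 ⊆ (⋃ u ∈ t, W u ∩ Metric.ball 0 1) ∪ {0} := by
    intro x hx
    by_cases hx0 : x = 0
    · exact Or.inr hx0
    · have hn : 0 < ‖x‖ := norm_pos_iff.2 hx0
      have hxs : ‖x‖⁻¹ • x ∈ Metric.sphere (0 : E3) 1 := by
        simp [norm_smul, hn.ne']
      obtain ⟨u, hu, hxu⟩ := mem_iUnion₂.1 (htc hxs)
      have := hWc u (ht u hu) ‖x‖ hn _ hxu
      rw [smul_smul, mul_inv_cancel₀ hn.ne', one_smul] at this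
      exact Or.inl (mem_iUnion₂.2 ⟨u, hu, this, hx⟩)
  refine (lintegral_mono_set hcov).trans_lt ((lintegral_union_le _ _ _).trans_lt ?_)
  rw [setLIntegral_measure_zero ({0} : Set E3) _ (by simp), add_zero]
  have hU : (⋃ u ∈ t, W u ∩ Metric.ball (0 : E3) 1) = ⋃ u : t, W u ∩ Metric.ball (0 : E3) 1 := by
    rw [iUnion_subtype]
  rw [hU]
  refine (lintegral_iUnion_le _ _).trans_lt ?_
  rw [tsum_fintype]
  exact ENNReal.sum_lt_top.2 fun u _ => hWi u (ht u u.2)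

/-- The segment from `x` to `y` is connected and must meet the boundary. -/
theorem infDist_frontier_le_of_mem_of_notMem {S : Set E3} {x y : E3} (hx : x ∈ S) (hy : y ∉ S) :
    Metric.infDist x (frontier S) ≤ ‖x - y‖ ∧ Metric.infDist y (frontier S) ≤ ‖x - y‖ := by
  obtain ⟨z, hz, hzf⟩ : (segment ℝ x y ∩ frontier S).Nonempty := by
    by_contra hcon
    rw [not_nonempty_iff_eq_empty] at hcon
    have hpre : IsPreconnected (segment ℝ x y) := (convex_segment x y).isPreconnected
    have hno : ∀ z ∈ segment ℝ x y, z ∉ frontier S := fun z hz hzf => by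
      have : z ∈ segment ℝ x y ∩ frontier S := ⟨hz, hzf⟩
      rw [hcon] at this; exact this
    have hcov : segment ℝ x y ⊆ interior S ∪ (closure S)ᶜ := fun z hz => by
      by_contra hn
      rw [mem_union, not_or, notMem_compl_iff] at hn
      exact hno z hz ⟨hn.2, hn.1⟩
    have hxi : x ∈ interior S := by
      by_contra hn
      exact hno x (left_mem_segment ℝ x y) ⟨subset_closure hx, hn⟩
    have hsub := hpre.subset_left_of_subset_union isOpen_interior isClosed_closure.isOpen_compl
      (disjoint_compl_right_iff_subset.2 (interior_subset.trans subset_closure)) hcov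
      ⟨x, left_mem_segment ℝ x y, hxi⟩
    exact hy (interior_subset (hsub (right_mem_segment ℝ x y)))
  have h1 := Metric.infDist_le_dist_of_mem (x := x) hzf
  have h2 := Metric.infDist_le_dist_of_mem (x := y) hzf
  have h3 := dist_add_dist_of_mem_segment hz
  rw [dist_eq_norm x y] at h3
  constructor
  · linarith [dist_nonneg (x := z) (y := y)]
  · rw [dist_comm] at h2; linarith [dist_nonneg (x := x) (y := z)]

/-- The pairs of points, one inside and one outside of `S`, not both outside of the unit ball. -/
def interactionSet (S : Set E3) : Set (E3 × E3) :=
  {z | z.1 ∈ S ∧ z.2 ∉ S ∧ (z.1 ∈ Metric.ball 0 1 ∨ z.2 ∈ Metric.ball 0 1)}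

theorem measurableSet_interactionSet {S : Set E3} (hS : MeasurableSet S) :
    MeasurableSet (interactionSet S) := by
  have hb : MeasurableSet (Metric.ball (0 : E3) 1) := measurableSet_ball
  exact (measurable_fst hS).inter ((measurable_snd hS.compl).inter
    ((measurable_fst hb).union (measurable_snd hb)))

theorem measurable_kernel (s : ℝ) :
    Measurable fun z : E3 × E3 => ENNReal.ofReal (1 / ‖z.1 - z.2‖ ^ (3 + s)) := by
  fun_prop

/-- Fix the point that lies in the unit ball. The other point is at least as far away as the
boundary, so the inner integral is at most a multiple of the distance to the boundary to the power
`-s`. -/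
theorem IsC2Cone.lintegral_interactionSet_lt_top {S : Set E3} (hS : IsC2Cone S)
    (hne : (frontier S).Nonempty) {s : ℝ} (hs0 : 0 < s) (hs1 : s < 1) :
    ∫⁻ z in interactionSet S, ENNReal.ofReal (1 / ‖z.1 - z.2‖ ^ (3 + s)) < ⊤ := by
  obtain ⟨C, hC0, hC, hbound⟩ := exists_lintegral_kernel_le hs0
  have hfin := hS.lintegral_infDist_rpow_lt_top hne hs0 hs1
  set B := Metric.ball (0 : E3) 1 with hB
  have hBm : MeasurableSet B := measurableSet_ball
  have hSm := hS.isOpen.measurableSet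
  have hsub : interactionSet S ⊆ (S ∩ B) ×ˢ Sᶜ ∪ S ×ˢ (Sᶜ ∩ B) := by
    rintro z ⟨h1, h2, h3 | h3⟩
    · exact Or.inl ⟨⟨h1, h3⟩, h2⟩
    · exact Or.inr ⟨h1, h2, h3⟩
  have hm := measurable_kernel s
  have e1 : ∀ x ∈ S ∩ B, ∫⁻ y in Sᶜ, ENNReal.ofReal (1 / ‖x - y‖ ^ (3 + s)) ≤
      C * ENNReal.ofReal (Metric.infDist x (frontier S)) ^ (-s) := fun x hx =>
    (lintegral_mono_set fun y hy => (infDist_frontier_le_of_mem_of_notMem hx.1 hy).1).trans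
      (hbound x _ Metric.infDist_nonneg)
  have e2 : ∀ y ∈ Sᶜ ∩ B, ∫⁻ x in S, ENNReal.ofReal (1 / ‖x - y‖ ^ (3 + s)) ≤
      C * ENNReal.ofReal (Metric.infDist y (frontier S)) ^ (-s) := fun y hy => by
    refine le_trans (le_of_eq ?_) ((lintegral_mono_set fun x hx => ?_).trans
      (hbound y _ Metric.infDist_nonneg) :
      ∫⁻ x in S, ENNReal.ofReal (1 / ‖y - x‖ ^ (3 + s)) ≤ _)
    · simp only [norm_sub_rev]
    · have := (infDist_frontier_le_of_mem_of_notMem hx hy.1).2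
      rwa [norm_sub_rev] at this
  refine (lintegral_mono_set hsub).trans_lt ((lintegral_union_le _ _ _).trans_lt ?_)
  refine ENNReal.add_lt_top.2 ⟨?_, ?_⟩
  · rw [Measure.volume_eq_prod, ← Measure.prod_restrict, lintegral_prod _ hm.aemeasurable]
    refine (setLIntegral_mono' (hSm.inter hBm) e1).trans_lt ?_
    rw [lintegral_const_mul' _ _ hC]
    exact ENNReal.mul_lt_top hC.lt_top ((lintegral_mono_set inter_subset_right).trans_lt hfin)
  · rw [Measure.volume_eq_prod, ← Measure.prod_restrict, lintegral_prod_symm _ hm.aemeasurable]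
    refine (setLIntegral_mono' (hSm.compl.inter hBm) e2).trans_lt ?_
    rw [lintegral_const_mul' _ _ hC]
    exact ENNReal.mul_lt_top hC.lt_top ((lintegral_mono_set inter_subset_right).trans_lt hfin)

theorem fracPerimeter_eq_lintegral_interactionSet (s : ℝ) {S : Set E3} (hS : MeasurableSet S) :
    fracPerimeter s S (Metric.ball 0 1) =
      ∫⁻ z in interactionSet S, ENNReal.ofReal (1 / ‖z.1 - z.2‖ ^ (3 + s)) := by
  set B := Metric.ball (0 : E3) 1 with hB
  have hBm : MeasurableSet B := measurableSet_ball
  have hm := measurable_kernel s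
  have hint : ∀ A A' : Set E3, fracInteraction s A A' =
      ∫⁻ z in A ×ˢ A', ENNReal.ofReal (1 / ‖z.1 - z.2‖ ^ (3 + s)) := fun A A' => by
    rw [Measure.volume_eq_prod, ← Measure.prod_restrict, lintegral_prod _ hm.aemeasurable,
      fracInteraction]
    simp
  have hset : interactionSet S = ((S ∩ B) ×ˢ (Sᶜ ∩ B) ∪ (S ∩ B) ×ˢ (Sᶜ ∩ Bᶜ)) ∪
      (S ∩ Bᶜ) ×ˢ (Sᶜ ∩ B) := by
    ext z
    simp only [interactionSet, mem_ofPred_eq, mem_union, mem_prod, mem_inter_iff, mem_compl_iff]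
    tauto
  have m1 := (hS.inter hBm).prod (hS.compl.inter hBm)
  have m2 := (hS.inter hBm).prod (hS.compl.inter hBm.compl)
  have m3 := (hS.inter hBm.compl).prod (hS.compl.inter hBm)
  rw [fracPerimeter, hint, hint, hint, hset, lintegral_union m3, lintegral_union m2]
  · refine disjoint_left.2 fun z h1 h2 => h2.2.2 h1.2.2
  · refine disjoint_left.2 fun z h1 h2 => h2.1.2 ?_
    rcases h1 with h1 | h1
    · exact h1.1.2
    · exact h1.1.2

end

noncomputable section

/-! ### The flow of a compactly supported vector field -/

-- As `X` is bounded and Lipschitz, the Picard–Lindelöf theorem applies on every interval `[-a, a]`.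
-- Uniqueness makes these solutions compatible, and the value at time `t` is read off from the one
-- with `a = |t| + 1`.
open scoped NNReal in
theorem exists_isFlowOf {X : E3 → E3} {K : ℝ≥0} (hK : LipschitzWith K X) {M : ℝ≥0}
    (hM : ∀ x, ‖X x‖ ≤ M) : ∃ φ : ℝ → E3 → E3, IsFlowOf X φ := by
  have hloc : ∀ (x : E3) (a : ℝ), ∃ γ : ℝ → E3, 0 < a → γ 0 = x ∧
      ∀ t ∈ Ioo (-a) a, HasDerivAt γ (X (γ t)) t := by
    intro x a
    by_cases ha : 0 < a
    · have h0 : (0 : ℝ) ∈ Icc (-a) a := ⟨by linarith, ha.le⟩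
      have hP : IsPicardLindelof (fun _ => X) (⟨0, h0⟩ : Icc (-a) a) x (M * a.toNNReal) 0 M K := by
        refine IsPicardLindelof.of_time_independent (fun y _ => hM y) hK.lipschitzOnWith ?_
        simp [ha.le]
      obtain ⟨γ, hγ0, hγ⟩ := hP.exists_eq_forall_mem_Icc_hasDerivWithinAt₀
      exact ⟨γ, fun _ => ⟨hγ0, fun t ht =>
        (hγ t (Ioo_subset_Icc_self ht)).hasDerivAt (Icc_mem_nhds ht.1 ht.2)⟩⟩
    · exact ⟨0, fun h => absurd h ha⟩
  choose γ hγ using hloc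
  have hpos : ∀ t : ℝ, 0 < |t| + 1 := fun t => by positivity
  have heq : ∀ x a b, 0 < a → a ≤ b → ∀ t ∈ Ioo (-a) a, γ x a t = γ x b t := by
    intro x a b ha hab t ht
    have hsub : Ioo (-a) a ⊆ Ioo (-b) b := Ioo_subset_Ioo (by linarith) hab
    exact ODE_solution_unique_of_mem_Ioo (v := fun _ => X) (s := fun _ => univ) (K := K)
      (fun t _ => hK.lipschitzOnWith) (t₀ := 0) ⟨by linarith, ha⟩
      (fun t ht => ⟨(hγ x a ha).2 t ht, trivial⟩)
      (fun t ht => ⟨(hγ x b (ha.trans_le hab)).2 t (hsub ht), trivial⟩)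
      (by rw [(hγ x a ha).1, (hγ x b (ha.trans_le hab)).1]) ht
  refine ⟨fun t x => γ x (|t| + 1) t, fun x => ⟨(hγ x _ (hpos 0)).1, fun t => ?_⟩⟩
  have hb : 0 < |t| + 2 := by positivity
  have ht : t ∈ Ioo (-(|t| + 2)) (|t| + 2) :=
    ⟨by linarith [neg_abs_le t], by linarith [le_abs_self t]⟩
  have ht1 : t ∈ Ioo (-(|t| + 1)) (|t| + 1) :=
    ⟨by linarith [neg_abs_le t], by linarith [le_abs_self t]⟩
  have hval : γ x (|t| + 1) t = γ x (|t| + 2) t :=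
    heq x _ _ (hpos t) (by linarith) t ht1
  change HasDerivAt (fun r => γ x (|r| + 1) r) (X (γ x (|t| + 1) t)) t
  rw [hval]
  refine ((hγ x _ hb).2 t ht).congr_of_eventuallyEq ?_
  have hnear : ∀ᶠ r in 𝓝 t, |r| < |t| + 1 :=
    continuous_abs.continuousAt.eventually_lt continuousAt_const (by linarith)
  filter_upwards [hnear] with r hr
  exact heq x _ _ (hpos r) (by linarith) r
    ⟨by linarith [neg_abs_le r], by linarith [le_abs_self r]⟩

/-- The divergence of a vector field. -/
def divergence (X : E3 → E3) (x : E3) : ℝ :=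
  ∑ i, fderiv ℝ X x (EuclideanSpace.single i 1) i

theorem divergence_eq_zero_of_notMem {X : E3 → E3} {x : E3} (hx : x ∉ tsupport X) :
    divergence X x = 0 := by
  have : fderiv ℝ X x = 0 :=
    image_eq_zero_of_notMem_tsupport fun h => hx (tsupport_fderiv_subset ℝ h)
  simp [divergence, this]

theorem contDiff_divergence {X : E3 → E3} (hX : ContDiff ℝ ∞ X) : ContDiff ℝ ∞ (divergence X) := by
  have h1 : ContDiff ℝ ∞ (fderiv ℝ X) := hX.fderiv_right (by norm_num)
  unfold divergence
  refine ContDiff.sum fun i _ => ?_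
  exact (EuclideanSpace.proj (𝕜 := ℝ) i).contDiff.comp (h1.clm_apply contDiff_const)

theorem hasCompactSupport_divergence {X : E3 → E3} (hX : HasCompactSupport X) :
    HasCompactSupport (divergence X) :=
  hX.of_isClosed_subset (isClosed_tsupport _) (closure_minimal (fun x hx => by
    by_contra h; exact hx (divergence_eq_zero_of_notMem h)) (isClosed_tsupport _))

/-- The Jacobian of a flow. -/
def flowJacobian (X : E3 → E3) (φ : ℝ → E3 → E3) (t : ℝ) (x : E3) : ℝ :=
  Real.exp (∫ r in (0 : ℝ)..t, divergence X (φ r x))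

namespace IsFlowOf

open scoped NNReal

variable {X : E3 → E3} {φ : ℝ → E3 → E3} {K M : ℝ≥0}

theorem hasDerivAt (hφ : IsFlowOf X φ) (x : E3) (t : ℝ) :
    HasDerivAt (fun t => φ t x) (X (φ t x)) t := (hφ x).2 t

theorem zero_apply (hφ : IsFlowOf X φ) (x : E3) : φ 0 x = x := (hφ x).1

theorem eq_of_hasDerivAt (hφ : IsFlowOf X φ) (hK : LipschitzWith K X) {γ : ℝ → E3}
    (hγ : ∀ t, HasDerivAt γ (X (γ t)) t) (t : ℝ) : γ t = φ t (γ 0) := by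
  have h := ODE_solution_unique_univ (v := fun _ => X) (s := fun _ => univ) (K := K) (f := γ)
    (g := fun t => φ t (γ 0)) (t₀ := 0) (fun _ => hK.lipschitzOnWith) (fun t => ⟨hγ t, trivial⟩)
    (fun t => ⟨hφ.hasDerivAt _ t, trivial⟩) (hφ.zero_apply _).symm
  exact congrFun h t

theorem add_apply (hφ : IsFlowOf X φ) (hK : LipschitzWith K X) (t r : ℝ) (x : E3) :
    φ (t + r) x = φ t (φ r x) := by
  have h := hφ.eq_of_hasDerivAt hK (γ := fun t => φ (t + r) x)
    (fun t => (hφ.hasDerivAt x (t + r)).comp_add_const t r) t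
  simpa using h

theorem neg_apply (hφ : IsFlowOf X φ) (hK : LipschitzWith K X) (t : ℝ) (x : E3) :
    φ (-t) (φ t x) = x := by
  rw [← hφ.add_apply hK, neg_add_cancel, hφ.zero_apply]

theorem apply_neg (hφ : IsFlowOf X φ) (hK : LipschitzWith K X) (t : ℝ) (x : E3) :
    φ t (φ (-t) x) = x := by
  rw [← hφ.add_apply hK, add_neg_cancel, hφ.zero_apply]

theorem neg (hφ : IsFlowOf X φ) : IsFlowOf (fun x => -X x) fun t => φ (-t) := fun x => by
  refine ⟨by simp [hφ.zero_apply], fun t => ?_⟩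
  have h := (hφ.hasDerivAt x (-t)).scomp t (hasDerivAt_neg t)
  rw [neg_one_smul] at h
  exact h

theorem dist_le_of_nonneg (hφ : IsFlowOf X φ) (hK : LipschitzWith K X) {t : ℝ} (ht : 0 ≤ t)
    (x y : E3) : dist (φ t x) (φ t y) ≤ dist x y * Real.exp (K * t) := by
  have h := dist_le_of_trajectories_ODE (v := fun _ => X) (K := K) (a := 0) (b := t)
    (f := fun t => φ t x) (g := fun t => φ t y) (fun _ => hK)
    (fun r _ => (hφ.hasDerivAt x r).continuousAt.continuousWithinAt)
    (fun r _ => (hφ.hasDerivAt x r).hasDerivWithinAt)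
    (fun r _ => (hφ.hasDerivAt y r).continuousAt.continuousWithinAt)
    (fun r _ => (hφ.hasDerivAt y r).hasDerivWithinAt) (δ := dist x y)
    (by rw [hφ.zero_apply, hφ.zero_apply]) t ⟨ht, le_rfl⟩
  simpa using h

theorem dist_le (hφ : IsFlowOf X φ) (hK : LipschitzWith K X) (t : ℝ) (x y : E3) :
    dist (φ t x) (φ t y) ≤ dist x y * Real.exp (K * |t|) := by
  rcases le_total 0 t with ht | ht
  · rw [abs_of_nonneg ht]; exact hφ.dist_le_of_nonneg hK ht x y
  · rw [abs_of_nonpos ht]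
    have h := hφ.neg.dist_le_of_nonneg (K := K) hK.neg (neg_nonneg.2 ht) x y
    simpa using h

theorem le_dist (hφ : IsFlowOf X φ) (hK : LipschitzWith K X) (t : ℝ) (x y : E3) :
    dist x y ≤ dist (φ t x) (φ t y) * Real.exp (K * |t|) := by
  have h := hφ.dist_le hK (-t) (φ t x) (φ t y)
  rwa [hφ.neg_apply hK, hφ.neg_apply hK, abs_neg] at h

theorem lipschitzWith (hφ : IsFlowOf X φ) (hK : LipschitzWith K X) (t : ℝ) :
    LipschitzWith (Real.exp (K * |t|)).toNNReal (φ t) :=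
  LipschitzWith.of_dist_le_mul fun x y => by
    rw [Real.coe_toNNReal _ (Real.exp_pos _).le, mul_comm]
    exact hφ.dist_le hK t x y

theorem lipschitzWith_time (hφ : IsFlowOf X φ) (hM : ∀ x, ‖X x‖ ≤ M) (x : E3) :
    LipschitzWith M fun t => φ t x :=
  lipschitzWith_of_nnnorm_deriv_le (fun t => (hφ.hasDerivAt x t).differentiableAt) fun t => by
    rw [(hφ.hasDerivAt x t).deriv]; exact hM _

theorem continuous_uncurry (hφ : IsFlowOf X φ) (hK : LipschitzWith K X) (hM : ∀ x, ‖X x‖ ≤ M) :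
    Continuous fun z : ℝ × E3 => φ z.1 z.2 :=
  continuous_prod_of_continuous_lipschitzWith (fun z : ℝ × E3 => φ z.1 z.2) M
    (fun t => (hφ.lipschitzWith hK t).continuous) (fun x => hφ.lipschitzWith_time hM x)

theorem apply_eq_self (hφ : IsFlowOf X φ) (hK : LipschitzWith K X) {x : E3} (hx : X x = 0)
    (t : ℝ) : φ t x = x :=
  (hφ.eq_of_hasDerivAt hK (γ := fun _ => x) (fun t => by rw [hx]; exact hasDerivAt_const t x)
    t).symm

theorem apply_notMem_tsupport (hφ : IsFlowOf X φ) (hK : LipschitzWith K X) {x : E3}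
    (hx : x ∉ tsupport X) (t : ℝ) : φ t x = x :=
  hφ.apply_eq_self hK (image_eq_zero_of_notMem_tsupport hx) t

/-- A point outside the support of `X` is fixed by the flow, so no trajectory can lead from `B` to
the outside. -/
theorem apply_mem_iff (hφ : IsFlowOf X φ) (hK : LipschitzWith K X) {B : Set E3}
    (hB : tsupport X ⊆ B) (t : ℝ) (x : E3) : φ t x ∈ B ↔ x ∈ B := by
  have key : ∀ t x, x ∈ B → φ t x ∈ B := fun t x hx => by
    by_contra h
    have h1 := hφ.apply_notMem_tsupport hK (fun h' => h (hB h')) (-t)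
    rw [hφ.neg_apply hK] at h1
    exact h (h1 ▸ hx)
  exact ⟨fun h => by simpa [hφ.neg_apply hK] using key (-t) _ h, key t x⟩

/-- The flow at a fixed time as a homeomorphism. -/
def homeomorph (hφ : IsFlowOf X φ) (hK : LipschitzWith K X) (t : ℝ) : E3 ≃ₜ E3 where
  toFun := φ t
  invFun := φ (-t)
  left_inv := hφ.neg_apply hK t
  right_inv := hφ.apply_neg hK t
  continuous_toFun := (hφ.lipschitzWith hK t).continuous
  continuous_invFun := (hφ.lipschitzWith hK (-t)).continuous

section Jacobian

theorem continuous_divergence_comp (hφ : IsFlowOf X φ) (hX : ContDiff ℝ ∞ X) (x : E3) :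
    Continuous fun r => divergence X (φ r x) :=
  (contDiff_divergence hX).continuous.comp
    (continuous_iff_continuousAt.2 fun t => (hφ.hasDerivAt x t).continuousAt)

theorem flowJacobian_pos (t : ℝ) (x : E3) : 0 < flowJacobian X φ t x := Real.exp_pos _

theorem flowJacobian_zero (x : E3) : flowJacobian X φ 0 x = 1 := by simp [flowJacobian]

/-- Since `flowJacobian` is given by Liouville's formula, its chain rule is additivity of the
integral in time, and no spatial derivative of the flow is involved. -/
theorem flowJacobian_add (hφ : IsFlowOf X φ) (hX : ContDiff ℝ ∞ X) (hK : LipschitzWith K X)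
    (t r : ℝ) (x : E3) :
    flowJacobian X φ (t + r) x = flowJacobian X φ t (φ r x) * flowJacobian X φ r x := by
  have hc := hφ.continuous_divergence_comp hX x
  rw [flowJacobian, flowJacobian, flowJacobian, ← Real.exp_add]
  congr 1
  have h1 : ∫ u in (0 : ℝ)..t, divergence X (φ u (φ r x)) =
      ∫ u in r..(t + r), divergence X (φ u x) := by
    simp only [← hφ.add_apply hK]
    rw [intervalIntegral.integral_comp_add_right (fun u => divergence X (φ u x)), zero_add]
  rw [h1, add_comm (∫ u in r..(t + r), divergence X (φ u x)), intervalIntegral.integral_add_adjacent_intervals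
    (hc.intervalIntegrable _ _) (hc.intervalIntegrable _ _)]

theorem hasDerivAt_flowJacobian (hφ : IsFlowOf X φ) (hX : ContDiff ℝ ∞ X) (x : E3) (t : ℝ) :
    HasDerivAt (fun t => flowJacobian X φ t x)
      (divergence X (φ t x) * flowJacobian X φ t x) t := by
  have h := (intervalIntegral.integral_hasDerivAt_right
    ((hφ.continuous_divergence_comp hX x).intervalIntegrable 0 t)
    ((hφ.continuous_divergence_comp hX x).stronglyMeasurableAtFilter _ _)
    (hφ.continuous_divergence_comp hX x).continuousAt).exp
  rw [mul_comm] at h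
  exact h

theorem abs_integral_divergence_le {D : ℝ} (hD : ∀ x, |divergence X x| ≤ D) (t : ℝ) (x : E3) :
    |∫ r in (0 : ℝ)..t, divergence X (φ r x)| ≤ D * |t| := by
  have h := intervalIntegral.norm_integral_le_of_norm_le_const (a := 0) (b := t) (C := D)
    (f := fun r => divergence X (φ r x)) fun r _ => hD _
  simpa using h

theorem flowJacobian_le {D : ℝ} (hD : ∀ x, |divergence X x| ≤ D) (t : ℝ) (x : E3) :
    flowJacobian X φ t x ≤ Real.exp (D * |t|) :=
  Real.exp_le_exp.2 ((le_abs_self _).trans (abs_integral_divergence_le hD t x))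

theorem continuous_flowJacobian (hφ : IsFlowOf X φ) (hX : ContDiff ℝ ∞ X)
    (hK : LipschitzWith K X) (hM : ∀ x, ‖X x‖ ≤ M) :
    Continuous fun z : ℝ × E3 => flowJacobian X φ z.1 z.2 := by
  refine Real.continuous_exp.comp ?_
  have hc : Continuous (Function.uncurry fun (z : ℝ × E3) (r : ℝ) =>
      divergence X (φ r z.2)) :=
    (contDiff_divergence hX).continuous.comp ((hφ.continuous_uncurry hK hM).comp
      (by fun_prop : Continuous fun w : (ℝ × E3) × ℝ => (w.2, w.1.2)))
  exact intervalIntegral.continuous_parametric_intervalIntegral_of_continuous hc continuous_fst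

theorem flowJacobian_notMem_tsupport (hφ : IsFlowOf X φ) (hK : LipschitzWith K X) {x : E3}
    (hx : x ∉ tsupport X) (t : ℝ) : flowJacobian X φ t x = 1 := by
  simp [flowJacobian, hφ.apply_notMem_tsupport hK hx, divergence_eq_zero_of_notMem hx]

theorem abs_exp_sub_exp_le {a b c : ℝ} (ha : a ≤ c) (hb : b ≤ c) :
    |Real.exp a - Real.exp b| ≤ Real.exp c * |a - b| := by
  have h := Convex.norm_image_sub_le_of_norm_hasDerivWithin_le (f := Real.exp) (f' := Real.exp)
    (s := Iic c) (C := Real.exp c) (fun x _ => (Real.hasDerivAt_exp x).hasDerivWithinAt)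
    (fun x hx => by rw [Real.norm_eq_abs, Real.abs_exp]; exact Real.exp_le_exp.2 hx)
    (convex_Iic c) hb ha
  simpa using h

/-- The exponent integrates a Lipschitz function along trajectories that separate at most
exponentially. With this, `(g ∘ φ t)` times the Jacobian is again a Lipschitz test function. -/
theorem lipschitzWith_flowJacobian (hφ : IsFlowOf X φ) (hX : ContDiff ℝ ∞ X)
    (hXc : HasCompactSupport X) (hK : LipschitzWith K X) (t : ℝ) :
    ∃ C, LipschitzWith C (flowJacobian X φ t) := by
  obtain ⟨D, hD⟩ := (contDiff_divergence hX).continuous.bounded_above_of_compact_support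
    (hasCompactSupport_divergence hXc)
  obtain ⟨K', hK'⟩ := ContDiff.lipschitzWith_of_hasCompactSupport
    (hasCompactSupport_divergence hXc) (contDiff_divergence hX) (by simp)
  set C : ℝ := Real.exp (D * |t|) * (K' * Real.exp (K * |t|) * |t|) with hC
  refine ⟨C.toNNReal, LipschitzWith.of_dist_le_mul fun x y => ?_⟩
  rw [Real.coe_toNNReal _ (by positivity), Real.dist_eq]
  have hle := fun x => (le_abs_self _).trans (abs_integral_divergence_le (φ := φ) hD t x)
  refine (abs_exp_sub_exp_le (hle x) (hle y)).trans ?_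
  rw [hC, mul_assoc]
  gcongr
  rw [← intervalIntegral.integral_sub
    ((hφ.continuous_divergence_comp hX x).intervalIntegrable _ _)
    ((hφ.continuous_divergence_comp hX y).intervalIntegrable _ _)]
  have h := intervalIntegral.norm_integral_le_of_norm_le_const (a := 0) (b := t)
    (C := K' * (Real.exp (K * |t|) * dist x y))
    (f := fun r => divergence X (φ r x) - divergence X (φ r y)) fun r hr => by
      rw [← dist_eq_norm]
      refine (hK'.dist_le_mul _ _).trans ?_
      have hrt : |r| ≤ |t| := by
        rcases le_total 0 t with ht | ht
        · rw [uIoc_of_le ht] at hr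
          rw [abs_of_pos hr.1, abs_of_nonneg ht]; exact hr.2
        · rw [uIoc_of_ge ht] at hr
          rw [abs_of_nonpos hr.2, abs_of_nonpos ht]; linarith [hr.1]
      have h1 := (hφ.dist_le hK r x y).trans (mul_le_mul_of_nonneg_left
        (Real.exp_le_exp.2 (mul_le_mul_of_nonneg_left hrt K.2)) dist_nonneg)
      rw [mul_comm (dist x y)] at h1
      exact mul_le_mul_of_nonneg_left h1 K'.2
  rw [Real.norm_eq_abs, sub_zero] at h
  calc _ ≤ _ := h
    _ = _ := by ring

end Jacobian

end IsFlowOf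

end

noncomputable section

/-! ### Change of variables along a flow -/

open scoped NNReal

/-- By Rademacher's theorem the integrand is almost everywhere the divergence of `G • X`, and
integration by parts is valid for Lipschitz functions. -/
theorem integral_fderiv_apply_add_mul_divergence {X : E3 → E3} (hX : ContDiff ℝ ∞ X)
    (hXc : HasCompactSupport X) {G : E3 → ℝ} {C : ℝ≥0} (hG : LipschitzWith C G) :
    ∫ x, (fderiv ℝ G x (X x) + G x * divergence X x) = 0 := by
  set b : Fin 3 → E3 := fun i => EuclideanSpace.single i 1 with hb
  have hXi : ∀ i, ContDiff ℝ ∞ fun x => X x i := fun i =>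
    (EuclideanSpace.proj (𝕜 := ℝ) i).contDiff.comp hX
  have hXic : ∀ i, HasCompactSupport fun x => X x i := fun i =>
    hXc.comp_left (g := fun y : E3 => y i) rfl
  have hlip : ∀ i, ∃ D, LipschitzWith D fun x => X x i := fun i =>
    ContDiff.lipschitzWith_of_hasCompactSupport (hXic i) (hXi i) (by simp)
  have hpart : ∀ i, ∫ x, lineDeriv ℝ G x (b i) * X x i =
      -∫ x, fderiv ℝ X x (b i) i * G x := fun i => by
    obtain ⟨D, hD⟩ := hlip i
    rw [hG.integral_lineDeriv_mul_eq hD (hXic i), ← integral_neg]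
    refine integral_congr_ae (Eventually.of_forall fun x => ?_)
    have h1 : HasFDerivAt (fun x => X x i)
        ((EuclideanSpace.proj (𝕜 := ℝ) i).comp (fderiv ℝ X x)) x :=
      (EuclideanSpace.proj (𝕜 := ℝ) i).hasFDerivAt.comp x
        ((hX.differentiable (by simp) x).hasFDerivAt)
    simp only
    rw [(h1.hasLineDerivAt (-b i)).lineDeriv]
    simp
  have hi1 : ∀ i, Integrable fun x => lineDeriv ℝ G x (b i) * X x i := fun i => by
    obtain ⟨D, hD⟩ := hlip i
    exact ((hXi i).continuous.integrable_of_hasCompactSupport (hXic i)).bdd_mul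
      (aestronglyMeasurable_lineDeriv hG.continuous _)
      (Eventually.of_forall fun x => norm_lineDeriv_le_of_lipschitz ℝ hG)
  have hi2 : ∀ i, Integrable fun x => fderiv ℝ X x (b i) i * G x := fun i => by
    refine Continuous.integrable_of_hasCompactSupport ?_ ?_
    · exact (((EuclideanSpace.proj (𝕜 := ℝ) i).continuous.comp
        ((hX.continuous_fderiv (by simp)).clm_apply continuous_const))).mul hG.continuous
    · exact ((hXc.fderiv_apply (𝕜 := ℝ) (b i)).comp_left (g := fun y : E3 => y i) rfl).mul_right
  have hae : (fun x => fderiv ℝ G x (X x) + G x * divergence X x) =ᵐ[volume]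
      fun x => ∑ i, (lineDeriv ℝ G x (b i) * X x i + fderiv ℝ X x (b i) i * G x) := by
    filter_upwards [hG.ae_differentiableAt (μ := volume)] with x hx
    have hXx : X x = ∑ i, X x i • b i := by
      have := (EuclideanSpace.basisFun (Fin 3) ℝ).sum_repr (X x)
      simpa [hb] using this.symm
    rw [Finset.sum_add_distrib, divergence, Finset.mul_sum]
    congr 1
    · conv_lhs => rw [hXx]
      rw [map_sum]
      refine Finset.sum_congr rfl fun i _ => ?_
      rw [map_smul, smul_eq_mul, hx.lineDeriv_eq_fderiv, mul_comm]
    · exact Finset.sum_congr rfl fun i _ => mul_comm _ _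
  have hi3 : ∀ i, Integrable fun x => lineDeriv ℝ G x (b i) * X x i + fderiv ℝ X x (b i) i * G x :=
    fun i => (hi1 i).add (hi2 i)
  rw [integral_congr_ae hae, integral_finsetSum _ fun i _ => hi3 i]
  refine Finset.sum_eq_zero fun i _ => ?_
  rw [integral_add (hi1 i) (hi2 i), hpart i, neg_add_cancel]

/-- Indicators of compact sets are decreasing limits of Lipschitz cutoffs, and the closed sets
inside balls determine the measures. -/
theorem measure_eq_of_forall_integral_lipschitz_eq {μ ν : Measure E3}
    [IsFiniteMeasureOnCompacts μ] [IsFiniteMeasureOnCompacts ν]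
    (h : ∀ (g : E3 → ℝ) (C : ℝ≥0), LipschitzWith C g → HasCompactSupport g →
      ∫ x, g x ∂μ = ∫ x, g x ∂ν) : μ = ν := by
  have hcompact : ∀ F : Set E3, IsCompact F → μ F = ν F := by
    intro F hF
    rcases F.eq_empty_or_nonempty with rfl | hne
    · simp
    set g : ℕ → E3 → ℝ := fun n x => max 0 (1 - ((n : ℝ) + 1) * Metric.infDist x F) with hg
    have hn : ∀ n : ℕ, (1 : ℝ) ≤ (n : ℝ) + 1 := fun n => by
      have : (0 : ℝ) ≤ n := by positivity
      linarith
    have hglip : ∀ n, ∃ C, LipschitzWith C (g n) := fun n => by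
      refine ⟨((n : ℝ) + 1).toNNReal, LipschitzWith.of_dist_le_mul fun x y => ?_⟩
      have h1 := (Metric.lipschitz_infDist_pt F).dist_le_mul x y
      rw [Real.dist_eq] at h1
      have h0 : (0 : ℝ) ≤ (n : ℝ) + 1 := by positivity
      rw [Real.coe_toNNReal _ h0, Real.dist_eq]
      refine (abs_max_sub_max_le_max _ _ _ _).trans ?_
      rw [sub_self, abs_zero, max_eq_right (abs_nonneg _), sub_sub_sub_cancel_left, ← mul_sub,
        abs_mul, abs_of_nonneg h0, abs_sub_comm]
      refine mul_le_mul_of_nonneg_left ?_ h0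
      simpa using h1
    have hgc : ∀ n, HasCompactSupport (g n) := fun n => by
      refine HasCompactSupport.intro (hF.cthickening (r := 1)) fun x hx => ?_
      rw [Metric.mem_cthickening_iff, not_le, ENNReal.ofReal_lt_iff_lt_toReal zero_le_one
        (Metric.infEDist_ne_top hne)] at hx
      have hx : 1 < Metric.infDist x F := hx
      simp only [hg]
      rw [max_eq_left]
      nlinarith [hn n]
    have hlim : ∀ (ρ : Measure E3) [IsFiniteMeasureOnCompacts ρ],
        Tendsto (fun n => ∫ x, g n x ∂ρ) atTop (𝓝 (ρ.real F)) := by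
      intro ρ _
      have h1 : ρ.real F = ∫ x, F.indicator 1 x ∂ρ := (integral_indicator_one
        hF.measurableSet).symm
      rw [h1]
      refine tendsto_integral_of_dominated_convergence (g 0) (fun n =>
        (hglip n).choose_spec.continuous.aestronglyMeasurable)
        ((hglip 0).choose_spec.continuous.integrable_of_hasCompactSupport (hgc 0)) ?_ ?_
      · refine fun n => Eventually.of_forall fun x => ?_
        rw [Real.norm_eq_abs, abs_of_nonneg (le_max_left _ _)]
        have := hn n
        have h0 := Metric.infDist_nonneg (x := x) (s := F)
        refine max_le_max le_rfl ?_
        push_cast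
        nlinarith
      · refine Eventually.of_forall fun x => ?_
        by_cases hx : x ∈ F
        · have : ∀ n, g n x = 1 := fun n => by simp [hg, Metric.infDist_zero_of_mem hx]
          simp [this, hx]
        · have hpos := (hF.isClosed.notMem_iff_infDist_pos hne).1 hx
          rw [indicator_of_notMem hx]
          refine tendsto_const_nhds.congr' ?_
          have ht : Tendsto (fun n : ℕ => ((n : ℝ) + 1) * Metric.infDist x F) atTop atTop :=
            (tendsto_atTop_add_const_right _ _ tendsto_natCast_atTop_atTop).atTop_mul_const hpos
          filter_upwards [ht.eventually_ge_atTop 1] with n hn'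
          simp only [hg]
          rw [max_eq_left (by linarith)]
    have h1 : μ.real F = ν.real F := by
      refine tendsto_nhds_unique (hlim μ) ((hlim ν).congr fun n => ?_)
      obtain ⟨C, hC⟩ := hglip n
      exact (h _ C hC (hgc n)).symm
    exact (measureReal_eq_measureReal_iff hF.measure_lt_top.ne hF.measure_lt_top.ne).1 h1
  rw [Measure.ext_iff_of_iUnion_eq_univ (Metric.iUnion_closedBall_nat (0 : E3))]
  intro n
  have hB := isCompact_closedBall (0 : E3) (n : ℝ)
  have : IsFiniteMeasure (μ.restrict (Metric.closedBall 0 n)) :=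
    ⟨by rw [Measure.restrict_apply_univ]; exact hB.measure_lt_top⟩
  refine ext_of_generate_finite _ (BorelSpace.measurable_eq.trans borel_eq_generateFrom_isClosed)
    isPiSystem_isClosed (fun F hF => ?_) ?_
  · have hF : IsClosed F := hF
    rw [Measure.restrict_apply hF.measurableSet, Measure.restrict_apply hF.measurableSet]
    exact hcompact _ (hB.inter_left hF)
  · rw [Measure.restrict_apply_univ, Measure.restrict_apply_univ]
    exact hcompact _ hB

namespace IsFlowOf

variable {X : E3 → E3} {φ : ℝ → E3 → E3} {K : ℝ≥0}

/-- Differentiation under the integral sign yields the integral of the divergence of `G • X`, which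
is zero. -/
theorem hasDerivAt_integral_zero (hφ : IsFlowOf X φ) (hX : ContDiff ℝ ∞ X)
    (hXc : HasCompactSupport X) (hK : LipschitzWith K X) {G : E3 → ℝ} {C : ℝ≥0}
    (hG : LipschitzWith C G) (hGc : HasCompactSupport G) :
    HasDerivAt (fun t => ∫ x, G (φ t x) * flowJacobian X φ t x) 0 0 := by
  obtain ⟨D, hD⟩ := (contDiff_divergence hX).continuous.bounded_above_of_compact_support
    (hasCompactSupport_divergence hXc)
  obtain ⟨M', hM'⟩ := hX.continuous.bounded_above_of_compact_support hXc
  obtain ⟨N, hN⟩ := hG.continuous.bounded_above_of_compact_support hGc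
  have hM0 : 0 ≤ M' := (norm_nonneg _).trans (hM' 0)
  have hN0 : 0 ≤ N := (norm_nonneg _).trans (hN 0)
  have hD0 : 0 ≤ D := (norm_nonneg _).trans (hD 0)
  set M : ℝ≥0 := M'.toNNReal with hMdef
  have hM : ∀ x, ‖X x‖ ≤ M := fun x => by rw [hMdef, Real.coe_toNNReal _ hM0]; exact hM' x
  have hcJ := hφ.continuous_flowJacobian hX hK hM
  have hcφ := hφ.continuous_uncurry hK hM
  have hcF : ∀ t, Continuous fun x => G (φ t x) * flowJacobian X φ t x := fun t =>
    (hG.continuous.comp (hφ.lipschitzWith hK t).continuous).mul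
      (hcJ.comp (by fun_prop : Continuous fun x : E3 => (t, x)))
  set B : ℝ := C * M * Real.exp D + N * (D * Real.exp D) with hB
  have hB0 : 0 ≤ B := by positivity
  have key := hasDerivAt_integral_of_dominated_loc_of_lip (μ := (volume : Measure E3))
    (F := fun t x => G (φ t x) * flowJacobian X φ t x) (x₀ := (0 : ℝ))
    (F' := fun x => fderiv ℝ G x (X x) + G x * divergence X x) (s := Icc (-1) 1)
    (bound := (tsupport X).indicator fun _ => B) (Icc_mem_nhds (by norm_num) (by norm_num))
    (Eventually.of_forall fun t => (hcF t).aestronglyMeasurable)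
    (by simpa [hφ.zero_apply, flowJacobian_zero] using
      hG.continuous.integrable_of_hasCompactSupport hGc)
    (((ContinuousLinearMap.measurable_apply₂.comp
      ((measurable_fderiv ℝ G).prodMk hX.continuous.measurable)).add
      (hG.continuous.measurable.mul (contDiff_divergence hX).continuous.measurable)
      ).aestronglyMeasurable)
    (Eventually.of_forall fun x => ?_) ?_ ?_
  · rw [integral_fderiv_apply_add_mul_divergence hX hXc hG] at key
    exact key.2
  · by_cases hx : x ∈ tsupport X
    · rw [indicator_of_mem hx]
      refine LipschitzOnWith.of_dist_le_mul fun t ht r hr => ?_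
      rw [Real.coe_nnabs, abs_of_nonneg hB0, Real.dist_eq]
      have ht1 : |t| ≤ 1 := abs_le.2 ht
      have hJ : flowJacobian X φ t x ≤ Real.exp D := (flowJacobian_le hD t x).trans
        (Real.exp_le_exp.2 (mul_le_of_le_one_right hD0 ht1))
      have hJd : |flowJacobian X φ t x - flowJacobian X φ r x| ≤ D * Real.exp D * |t - r| := by
        have h := Convex.norm_image_sub_le_of_norm_hasDerivWithin_le
          (f := fun t => flowJacobian X φ t x)
          (f' := fun t => divergence X (φ t x) * flowJacobian X φ t x)
          (s := Icc (-1) 1) (C := D * Real.exp D)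
          (fun u _ => (hφ.hasDerivAt_flowJacobian hX x u).hasDerivWithinAt)
          (fun u hu => by
            rw [norm_mul, Real.norm_of_nonneg (flowJacobian_pos u x).le]
            refine mul_le_mul (hD _) ?_ (flowJacobian_pos u x).le hD0
            exact (flowJacobian_le hD u x).trans
              (Real.exp_le_exp.2 (mul_le_of_le_one_right hD0 (abs_le.2 hu))))
          (convex_Icc _ _) hr ht
        simpa using h
      have hGd : |G (φ t x) - G (φ r x)| ≤ C * M * |t - r| := by
        have h1 := hG.dist_le_mul (φ t x) (φ r x)
        have h2 := (hφ.lipschitzWith_time hM x).dist_le_mul t r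
        rw [Real.dist_eq] at h1 h2
        calc _ ≤ _ := h1
          _ ≤ C * (M * |t - r|) := mul_le_mul_of_nonneg_left h2 C.2
          _ = _ := by ring
      have heq : G (φ t x) * flowJacobian X φ t x - G (φ r x) * flowJacobian X φ r x =
          (G (φ t x) - G (φ r x)) * flowJacobian X φ t x +
            G (φ r x) * (flowJacobian X φ t x - flowJacobian X φ r x) := by ring
      rw [heq, Real.dist_eq]
      calc _ ≤ |(G (φ t x) - G (φ r x)) * flowJacobian X φ t x| +
            |G (φ r x) * (flowJacobian X φ t x - flowJacobian X φ r x)| := abs_add_le _ _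
        _ ≤ (C * M * |t - r|) * Real.exp D + N * (D * Real.exp D * |t - r|) := by
            rw [abs_mul, abs_mul, abs_of_pos (flowJacobian_pos t x)]
            refine add_le_add ?_ ?_
            · exact mul_le_mul hGd hJ (flowJacobian_pos t x).le (by positivity)
            · exact mul_le_mul (hN _) hJd (abs_nonneg _) hN0
        _ = _ := by rw [hB]; ring
    · refine LipschitzOnWith.of_dist_le_mul fun t ht r hr => ?_
      simp only [hφ.apply_notMem_tsupport hK hx, hφ.flowJacobian_notMem_tsupport hK hx, dist_self]
      positivity
  · have hm : MeasurableSet (tsupport X) := (isClosed_tsupport X).measurableSet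
    rw [integrable_indicator_iff hm]
    exact integrableOn_const hXc.measure_lt_top.ne
  · filter_upwards [hG.ae_differentiableAt (μ := volume)] with x hx
    have h1 : HasDerivAt (fun t => G (φ t x)) (fderiv ℝ G x (X x)) 0 := by
      have h2 := hφ.hasDerivAt x 0
      have h3 : HasFDerivAt G (fderiv ℝ G x) (φ 0 x) := by
        rw [hφ.zero_apply]; exact hx.hasFDerivAt
      have := h3.comp_hasDerivAt (0 : ℝ) h2
      rw [hφ.zero_apply] at this
      exact this
    have h2 := h1.fun_mul (hφ.hasDerivAt_flowJacobian hX x 0)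
    simpa [hφ.zero_apply, flowJacobian_zero] using h2

/-- The integral is constant in time: by the group law its derivative at `t` is the derivative at
`0` formed with `(g ∘ φ t)` times the Jacobian, again Lipschitz with compact support. Lipschitz
regularity of the flow in space is all that is used. -/
theorem integral_comp_mul_flowJacobian (hφ : IsFlowOf X φ) (hX : ContDiff ℝ ∞ X)
    (hXc : HasCompactSupport X) (hK : LipschitzWith K X) {g : E3 → ℝ} {C : ℝ≥0}
    (hg : LipschitzWith C g) (hgc : HasCompactSupport g) (t : ℝ) :
    ∫ x, g (φ t x) * flowJacobian X φ t x = ∫ x, g x := by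
  have hder : ∀ t, HasDerivAt (fun t => ∫ x, g (φ t x) * flowJacobian X φ t x) 0 t := by
    intro t
    set G : E3 → ℝ := fun x => g (φ t x) * flowJacobian X φ t x with hGdef
    have hcomp : HasCompactSupport fun x => g (φ t x) := hgc.comp_homeomorph (hφ.homeomorph hK t)
    have hGc : HasCompactSupport G := hcomp.mul_right
    obtain ⟨D, hD⟩ := (contDiff_divergence hX).continuous.bounded_above_of_compact_support
      (hasCompactSupport_divergence hXc)
    obtain ⟨CJ, hCJ⟩ := hφ.lipschitzWith_flowJacobian hX hXc hK t
    obtain ⟨N, hN⟩ := hg.continuous.bounded_above_of_compact_support hgc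
    have hN0 : 0 ≤ N := (norm_nonneg _).trans (hN 0)
    have hcl : LipschitzWith (C * (Real.exp (K * |t|)).toNNReal) fun x => g (φ t x) :=
      hg.comp (hφ.lipschitzWith hK t)
    set C1 : ℝ≥0 := C * (Real.exp (K * |t|)).toNNReal
    set B : ℝ := C1 * Real.exp (D * |t|) + N * CJ with hB
    have hB0 : 0 ≤ B := by positivity
    have hGl : LipschitzWith B.toNNReal G := by
      refine LipschitzWith.of_dist_le_mul fun x y => ?_
      rw [Real.coe_toNNReal _ hB0, Real.dist_eq]
      have h1 := hcl.dist_le_mul x y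
      have h2 := hCJ.dist_le_mul x y
      rw [Real.dist_eq] at h1 h2
      have heq : G x - G y = (g (φ t x) - g (φ t y)) * flowJacobian X φ t x +
          g (φ t y) * (flowJacobian X φ t x - flowJacobian X φ t y) := by
        simp only [hGdef]; ring
      rw [heq]
      calc _ ≤ |(g (φ t x) - g (φ t y)) * flowJacobian X φ t x| +
            |g (φ t y) * (flowJacobian X φ t x - flowJacobian X φ t y)| := abs_add_le _ _
        _ ≤ (C1 * dist x y) * Real.exp (D * |t|) + N * (CJ * dist x y) := by
            rw [abs_mul, abs_mul, abs_of_pos (flowJacobian_pos t x)]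
            refine add_le_add ?_ ?_
            · exact mul_le_mul h1 (flowJacobian_le hD t x) (flowJacobian_pos t x).le
                (by positivity)
            · exact mul_le_mul (hN _) h2 (abs_nonneg _) hN0
        _ = _ := by rw [hB]; ring
    have h := hφ.hasDerivAt_integral_zero hX hXc hK hGl hGc
    have h0 : (0 : ℝ) = t - t := (sub_self t).symm
    rw [h0] at h
    have h1 := h.comp_sub_const t t
    rw [sub_self] at h1
    refine h1.congr_of_eventuallyEq (Eventually.of_forall fun r => ?_)
    refine integral_congr_ae (Eventually.of_forall fun x => ?_)
    simp only [hGdef]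
    rw [← hφ.add_apply hK, mul_assoc, ← hφ.flowJacobian_add hX hK, add_sub_cancel]
  have hconst := is_const_of_deriv_eq_zero (fun t => (hder t).differentiableAt)
    (fun t => (hder t).deriv) t 0
  simpa [hφ.zero_apply, flowJacobian_zero] using hconst

theorem map_withDensity_flowJacobian (hφ : IsFlowOf X φ) (hX : ContDiff ℝ ∞ X)
    (hXc : HasCompactSupport X) (hK : LipschitzWith K X) (t : ℝ) :
    (volume.withDensity fun x => ENNReal.ofReal (flowJacobian X φ t x)).map (φ t) = volume := by
  obtain ⟨CJ, hCJ⟩ := hφ.lipschitzWith_flowJacobian hX hXc hK t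
  have hJm : Measurable (flowJacobian X φ t) := hCJ.continuous.measurable
  have hφm : Measurable (φ t) := (hφ.lipschitzWith hK t).continuous.measurable
  have hcont : Continuous fun x => (flowJacobian X φ t x).toNNReal :=
    continuous_real_toNNReal.comp hCJ.continuous
  have hloc : IsLocallyFiniteMeasure
      (volume.withDensity fun x => ENNReal.ofReal (flowJacobian X φ t x)) :=
    IsLocallyFiniteMeasure.withDensity_coe hcont
  have hfin : IsFiniteMeasureOnCompacts
      ((volume.withDensity fun x => ENNReal.ofReal (flowJacobian X φ t x)).map (φ t)) :=
    Measure.IsFiniteMeasureOnCompacts.map _ (hφ.homeomorph hK t)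
  refine measure_eq_of_forall_integral_lipschitz_eq fun g C hg hgc => ?_
  rw [← hφ.integral_comp_mul_flowJacobian hX hXc hK hg hgc t,
    integral_map hφm.aemeasurable hg.continuous.aestronglyMeasurable]
  have h := integral_withDensity_eq_integral_smul (μ := (volume : Measure E3))
    hJm.real_toNNReal (fun x => g (φ t x))
  refine h.trans (integral_congr_ae (Eventually.of_forall fun x => ?_))
  simp only [NNReal.smul_def, smul_eq_mul]
  rw [Real.coe_toNNReal _ (flowJacobian_pos t x).le, mul_comm]

end IsFlowOf

end

noncomputable section

/-! ### Second variation of the fractional perimeter -/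

/-- The density of the first variation of the interaction energy with kernel `h (|x - y|²)`. -/
def firstVarDensity (h h₁ : ℝ → ℝ) (X : E3 → E3) (z : E3 × E3) : ℝ :=
  (divergence X z.1 + divergence X z.2) * h (‖z.1 - z.2‖ ^ 2) +
    2 * h₁ (‖z.1 - z.2‖ ^ 2) * inner ℝ (X z.1 - X z.2) (z.1 - z.2)

/-- The density of the second variation of the interaction energy with kernel `h (|x - y|²)`. -/
def secondVarDensity (h h₁ h₂ : ℝ → ℝ) (X : E3 → E3) (z : E3 × E3) : ℝ :=
  (fderiv ℝ (divergence X) z.1 (X z.1) + fderiv ℝ (divergence X) z.2 (X z.2)) *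
      h (‖z.1 - z.2‖ ^ 2) +
    4 * (divergence X z.1 + divergence X z.2) * h₁ (‖z.1 - z.2‖ ^ 2) *
      inner ℝ (X z.1 - X z.2) (z.1 - z.2) +
    4 * h₂ (‖z.1 - z.2‖ ^ 2) * inner ℝ (X z.1 - X z.2) (z.1 - z.2) ^ 2 +
    2 * h₁ (‖z.1 - z.2‖ ^ 2) *
      (inner ℝ (fderiv ℝ X z.1 (X z.1) - fderiv ℝ X z.2 (X z.2)) (z.1 - z.2) +
        ‖X z.1 - X z.2‖ ^ 2) +
    (divergence X z.1 + divergence X z.2) ^ 2 * h (‖z.1 - z.2‖ ^ 2)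

/-- The density of the second variation, minus that of the first variation along
`(div X) X`. -/
def stabilityDensity (h h₁ h₂ : ℝ → ℝ) (X : E3 → E3) (z : E3 × E3) : ℝ :=
  4 * (divergence X z.1 + divergence X z.2) * h₁ (‖z.1 - z.2‖ ^ 2) *
      inner ℝ (X z.1 - X z.2) (z.1 - z.2) +
    4 * h₂ (‖z.1 - z.2‖ ^ 2) * inner ℝ (X z.1 - X z.2) (z.1 - z.2) ^ 2 +
    2 * h₁ (‖z.1 - z.2‖ ^ 2) *
      (inner ℝ (fderiv ℝ X z.1 (X z.1) - fderiv ℝ X z.2 (X z.2)) (z.1 - z.2) +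
        ‖X z.1 - X z.2‖ ^ 2) +
    2 * divergence X z.1 * divergence X z.2 * h (‖z.1 - z.2‖ ^ 2) -
    2 * h₁ (‖z.1 - z.2‖ ^ 2) *
      inner ℝ (divergence X z.1 • X z.1 - divergence X z.2 • X z.2) (z.1 - z.2)

theorem divergence_divergence_smul {X : E3 → E3} (hX : ContDiff ℝ ∞ X) (x : E3) :
    divergence (fun x => divergence X x • X x) x =
      fderiv ℝ (divergence X) x (X x) + divergence X x ^ 2 := by
  have h1 : HasFDerivAt (fun x => divergence X x • X x) _ x :=
    (((contDiff_divergence hX).differentiable (by simp) x).hasFDerivAt).smul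
      ((hX.differentiable (by simp) x).hasFDerivAt)
  rw [divergence, h1.fderiv]
  simp only [add_apply, smul_apply,
    ContinuousLinearMap.smulRight_apply, PiLp.add_apply, PiLp.smul_apply, smul_eq_mul,
    Finset.sum_add_distrib, ← Finset.mul_sum]
  rw [add_comm, sq]
  congr 1
  have hXx : X x = ∑ i, X x i • EuclideanSpace.single i (1 : ℝ) := by
    have := (EuclideanSpace.basisFun (Fin 3) ℝ).sum_repr (X x)
    simpa using this.symm
  conv_rhs => rw [hXx]
  rw [map_sum]
  refine Finset.sum_congr rfl fun i _ => ?_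
  rw [map_smul, smul_eq_mul, mul_comm]

/-- The subtraction removes the derivatives of `div X` and the squares of `div X`, leaving their
cross term. The result is an iterated divergence, by `divergence_stabilityField` and
`divergence_mul_form`. -/
theorem secondVarDensity_sub_firstVarDensity {X : E3 → E3} (hX : ContDiff ℝ ∞ X)
    (h h₁ h₂ : ℝ → ℝ) (z : E3 × E3) :
    secondVarDensity h h₁ h₂ X z - firstVarDensity h h₁ (fun x => divergence X x • X x) z =
      stabilityDensity h h₁ h₂ X z := by
  rw [secondVarDensity, firstVarDensity, stabilityDensity, divergence_divergence_smul hX,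
    divergence_divergence_smul hX]
  ring

/-- Here `u` is `‖x - y‖ ^ 2`; `q`, `a` and `b` are the inner products of `x - y` with the
differences of `X`, of `DX(X)` and of `(div X) X`; and `m` is `‖X x - X y‖ ^ 2`. Each derivative of
the kernel costs a factor `1 / u`, and it comes with one of these quantities, all of order `u`. -/
theorem abs_varDensity_le_of_bounds {D D' K A B k u d₁ d₂ e q a b m H H₁ H₂ : ℝ} (hD : 0 ≤ D)
    (hD' : 0 ≤ D') (hK : 0 ≤ K) (hA : 0 ≤ A) (hB : 0 ≤ B) (hd₁ : |d₁| ≤ D)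
    (hd₂ : |d₂| ≤ D) (he : |e| ≤ 2 * D') (hq : |q| ≤ K * u) (ha : |a| ≤ A * u) (hb : |b| ≤ B * u)
    (hm : |m| ≤ K ^ 2 * u) (hk : |H| ≤ k) (hk₁ : u * |H₁| ≤ k) (hk₂ : u ^ 2 * |H₂| ≤ k) :
    |(d₁ + d₂) * H + 2 * H₁ * q| ≤ (2 * D + 2 * K) * k ∧
      |e * H + 4 * (d₁ + d₂) * H₁ * q + 4 * H₂ * q ^ 2 + 2 * H₁ * (a + m) + (d₁ + d₂) ^ 2 * H| ≤
        (2 * D' + 8 * D * K + 4 * K ^ 2 + 2 * (A + K ^ 2) + 4 * D ^ 2) * k ∧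
      |4 * (d₁ + d₂) * H₁ * q + 4 * H₂ * q ^ 2 + 2 * H₁ * (a + m) + 2 * d₁ * d₂ * H -
        2 * H₁ * b| ≤ (8 * D * K + 4 * K ^ 2 + 2 * (A + K ^ 2) + 2 * D ^ 2 + 2 * B) * k := by
  have hk0 : 0 ≤ k := (abs_nonneg _).trans hk
  have hd : |d₁ + d₂| ≤ 2 * D := (abs_add_le _ _).trans (by linarith)
  have t1 : |(d₁ + d₂) * H| ≤ 2 * D * k := by
    rw [abs_mul]; exact mul_le_mul hd hk (abs_nonneg _) (by positivity)
  have t2 : ∀ (p L : ℝ), 0 ≤ L → |p| ≤ L * u → |2 * H₁ * p| ≤ 2 * L * k := by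
    intro p L hL hp
    rw [abs_mul, abs_mul, abs_two]
    calc 2 * |H₁| * |p| ≤ 2 * |H₁| * (L * u) := by gcongr
      _ = 2 * L * (u * |H₁|) := by ring
      _ ≤ _ := by gcongr
  have t3 : |4 * (d₁ + d₂) * H₁ * q| ≤ 8 * D * K * k := by
    have h1 := t2 q K hK hq
    have h2 : 4 * (d₁ + d₂) * H₁ * q = 2 * (d₁ + d₂) * (2 * H₁ * q) := by ring
    rw [h2, abs_mul, abs_mul, abs_two]
    calc 2 * |d₁ + d₂| * |2 * H₁ * q| ≤ 2 * (2 * D) * (2 * K * k) := by gcongr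
      _ = _ := by ring
  have t4 : |4 * H₂ * q ^ 2| ≤ 4 * K ^ 2 * k := by
    rw [abs_mul, abs_mul, abs_of_pos (by norm_num : (0 : ℝ) < 4), abs_pow]
    calc 4 * |H₂| * |q| ^ 2 ≤ 4 * |H₂| * (K * u) ^ 2 := by gcongr
      _ = 4 * K ^ 2 * (u ^ 2 * |H₂|) := by ring
      _ ≤ _ := by gcongr
  have t5 : |2 * H₁ * (a + m)| ≤ 2 * (A + K ^ 2) * k :=
    t2 _ _ (by positivity) ((abs_add_le _ _).trans (by linarith))
  have t6 : |(d₁ + d₂) ^ 2 * H| ≤ 4 * D ^ 2 * k := by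
    rw [abs_mul, abs_pow]
    calc |d₁ + d₂| ^ 2 * |H| ≤ (2 * D) ^ 2 * k := by gcongr
      _ = _ := by ring
  have t7 : |e * H| ≤ 2 * D' * k := by
    rw [abs_mul]
    exact mul_le_mul he hk (abs_nonneg _) (by positivity)
  have t8 : |2 * d₁ * d₂ * H| ≤ 2 * D ^ 2 * k := by
    rw [abs_mul, abs_mul, abs_mul, abs_two]
    calc 2 * |d₁| * |d₂| * |H| ≤ 2 * D * D * k := by gcongr
      _ = _ := by ring
  have t9 := t2 b B hB hb
  have t10 := t2 q K hK hq
  refine ⟨?_, ?_, ?_⟩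
  · refine (abs_add_le _ _).trans ?_
    linarith
  · refine (abs_add_le _ _).trans ((add_le_add_left ((abs_add_le _ _).trans (add_le_add_left
      ((abs_add_le _ _).trans (add_le_add_left (abs_add_le _ _) _)) _)) _).trans ?_)
    linarith
  · refine (abs_sub _ _).trans ((add_le_add_left ((abs_add_le _ _).trans (add_le_add_left
      ((abs_add_le _ _).trans (add_le_add_left (abs_add_le _ _) _)) _)) _).trans ?_)
    linarith

theorem LipschitzWith.abs_inner_sub_le {Y : E3 → E3} {L : NNReal} (hY : LipschitzWith L Y)
    (x y : E3) : |inner ℝ (Y x - Y y) (x - y)| ≤ L * ‖x - y‖ ^ 2 := by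
  have h1 := hY.dist_le_mul x y
  rw [dist_eq_norm, dist_eq_norm] at h1
  calc _ ≤ ‖Y x - Y y‖ * ‖x - y‖ := abs_real_inner_le_norm _ _
    _ ≤ L * ‖x - y‖ * ‖x - y‖ := by gcongr
    _ = _ := by ring

/-- The constant depends on `X` alone and not on the kernel, so one bound serves the singular kernel
and all of its truncations. -/
theorem exists_abs_varDensity_le {X : E3 → E3} (hX : ContDiff ℝ ∞ X)
    (hXc : HasCompactSupport X) : ∃ C : ℝ, 0 ≤ C ∧ ∀ (h h₁ h₂ : ℝ → ℝ) (z : E3 × E3) (k : ℝ),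
      |h (‖z.1 - z.2‖ ^ 2)| ≤ k → ‖z.1 - z.2‖ ^ 2 * |h₁ (‖z.1 - z.2‖ ^ 2)| ≤ k →
      (‖z.1 - z.2‖ ^ 2) ^ 2 * |h₂ (‖z.1 - z.2‖ ^ 2)| ≤ k →
      |firstVarDensity h h₁ X z| ≤ C * k ∧ |secondVarDensity h h₁ h₂ X z| ≤ C * k ∧
        |stabilityDensity h h₁ h₂ X z| ≤ C * k := by
  have hdX := contDiff_divergence hX
  have hdc := hasCompactSupport_divergence hXc
  have hDX : ContDiff ℝ ∞ fun x => fderiv ℝ X x (X x) :=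
    (hX.fderiv_right (m := ∞) (by norm_num)).clm_apply hX
  have hDXc : HasCompactSupport fun x => fderiv ℝ X x (X x) :=
    HasCompactSupport.intro hXc fun x hx => by
      rw [image_eq_zero_of_notMem_tsupport hx, ContinuousLinearMap.map_zero]
  have hDd : Continuous fun x => fderiv ℝ (divergence X) x (X x) :=
    ((hdX.fderiv_right (m := ∞) (by norm_num)).clm_apply hX).continuous
  have hDdc : HasCompactSupport fun x => fderiv ℝ (divergence X) x (X x) :=
    HasCompactSupport.intro hXc fun x hx => by
      rw [image_eq_zero_of_notMem_tsupport hx, ContinuousLinearMap.map_zero]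
  have hdsX : ContDiff ℝ ∞ fun x => divergence X x • X x := hdX.smul hX
  have hdsXc : HasCompactSupport fun x => divergence X x • X x :=
    HasCompactSupport.intro hXc fun x hx => by
      rw [image_eq_zero_of_notMem_tsupport hx, smul_zero]
  obtain ⟨K, hK⟩ := ContDiff.lipschitzWith_of_hasCompactSupport hXc hX (by simp)
  obtain ⟨A, hA⟩ := ContDiff.lipschitzWith_of_hasCompactSupport hDXc hDX (by simp)
  obtain ⟨B, hB⟩ := ContDiff.lipschitzWith_of_hasCompactSupport hdsXc hdsX (by simp)
  obtain ⟨D, hD⟩ := hdX.continuous.bounded_above_of_compact_support hdc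
  obtain ⟨D', hD'⟩ := hDd.bounded_above_of_compact_support hDdc
  have hD0 : 0 ≤ D := (norm_nonneg _).trans (hD 0)
  have hD0' : 0 ≤ D' := (norm_nonneg _).trans (hD' 0)
  have hK0 : (0 : ℝ) ≤ K := K.2
  have hA0 : (0 : ℝ) ≤ A := A.2
  have hB0 : (0 : ℝ) ≤ B := B.2
  set C₁ : ℝ := 2 * D + 2 * K with hC₁
  set C₂ : ℝ := 2 * D' + 8 * D * K + 4 * K ^ 2 + 2 * (A + K ^ 2) + 4 * D ^ 2 with hC₂
  set C₃ : ℝ := 8 * D * K + 4 * K ^ 2 + 2 * (A + K ^ 2) + 2 * D ^ 2 + 2 * B with hC₃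
  have h1 : 0 ≤ C₁ := by positivity
  have h2 : 0 ≤ C₂ := by positivity
  have h3 : 0 ≤ C₃ := by positivity
  refine ⟨C₁ + C₂ + C₃, by positivity, ?_⟩
  intro h h₁ h₂ z k hk hk₁ hk₂
  have hk0 : 0 ≤ k := (abs_nonneg _).trans hk
  have hn : |‖X z.1 - X z.2‖ ^ 2| ≤ K ^ 2 * ‖z.1 - z.2‖ ^ 2 := by
    have h1 := hK.dist_le_mul z.1 z.2
    rw [dist_eq_norm, dist_eq_norm] at h1
    rw [abs_of_nonneg (sq_nonneg _), ← mul_pow]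
    gcongr
  obtain ⟨b₁, b₂, b₃⟩ := abs_varDensity_le_of_bounds hD0 hD0' hK0 hA0 hB0
    (hD z.1) (hD z.2)
    ((abs_add_le _ _).trans ((add_le_add (hD' z.1) (hD' z.2)).trans (two_mul D').ge))
    (hK.abs_inner_sub_le z.1 z.2) (hA.abs_inner_sub_le z.1 z.2) (hB.abs_inner_sub_le z.1 z.2)
    hn hk hk₁ hk₂
  have p1 := mul_nonneg h1 hk0
  have p2 := mul_nonneg h2 hk0
  have p3 := mul_nonneg h3 hk0
  exact ⟨b₁.trans (by rw [add_mul, add_mul]; linarith),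
    b₂.trans (by rw [add_mul, add_mul]; linarith),
    b₃.trans (by rw [add_mul, add_mul]; linarith)⟩

namespace IsFlowOf

open scoped NNReal

variable {X : E3 → E3} {φ : ℝ → E3 → E3} {K M : ℝ≥0} {h h₁ h₂ : ℝ → ℝ}

theorem apply_ne (hφ : IsFlowOf X φ) (hK : LipschitzWith K X) {x y : E3} (hxy : x ≠ y) (t : ℝ) :
    φ t x ≠ φ t y := fun h => hxy ((hφ.homeomorph hK t).injective h)

theorem hasDerivAt_norm_sq (hφ : IsFlowOf X φ) (x y : E3) (t : ℝ) :
    HasDerivAt (fun t => ‖φ t x - φ t y‖ ^ 2)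
      (2 * inner ℝ (X (φ t x) - X (φ t y)) (φ t x - φ t y)) t := by
  have h := ((hφ.hasDerivAt x t).fun_sub (hφ.hasDerivAt y t)).norm_sq
  rwa [real_inner_comm] at h

theorem hasDerivAt_jacobian_mul (hφ : IsFlowOf X φ) (hX : ContDiff ℝ ∞ X) (x y : E3) (t : ℝ) :
    HasDerivAt (fun t => flowJacobian X φ t x * flowJacobian X φ t y)
      ((divergence X (φ t x) + divergence X (φ t y)) *
        (flowJacobian X φ t x * flowJacobian X φ t y)) t := by
  convert! (hφ.hasDerivAt_flowJacobian hX x t).fun_mul (hφ.hasDerivAt_flowJacobian hX y t) using 1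
  ring

theorem hasDerivAt_kernel (hφ : IsFlowOf X φ) (hX : ContDiff ℝ ∞ X) (hK : LipschitzWith K X)
    (hh : ∀ u, 0 < u → HasDerivAt h (h₁ u) u) {x y : E3} (hxy : x ≠ y) (t : ℝ) :
    HasDerivAt (fun t => h (‖φ t x - φ t y‖ ^ 2) * (flowJacobian X φ t x * flowJacobian X φ t y))
      (firstVarDensity h h₁ X (φ t x, φ t y) *
        (flowJacobian X φ t x * flowJacobian X φ t y)) t := by
  have hpos : 0 < ‖φ t x - φ t y‖ ^ 2 := by
    have := norm_pos_iff.2 (sub_ne_zero.2 (hφ.apply_ne hK hxy t))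
    positivity
  have h1 := (hh _ hpos).comp t (hφ.hasDerivAt_norm_sq x y t)
  convert! h1.fun_mul (hφ.hasDerivAt_jacobian_mul hX x y t) using 1
  simp only [firstVarDensity, Function.comp_apply]
  ring

theorem hasDerivAt_firstVarDensity (hφ : IsFlowOf X φ) (hX : ContDiff ℝ ∞ X)
    (hK : LipschitzWith K X) (hh : ∀ u, 0 < u → HasDerivAt h (h₁ u) u)
    (hh₁ : ∀ u, 0 < u → HasDerivAt h₁ (h₂ u) u) {x y : E3} (hxy : x ≠ y) (t : ℝ) :
    HasDerivAt (fun t => firstVarDensity h h₁ X (φ t x, φ t y) *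
        (flowJacobian X φ t x * flowJacobian X φ t y))
      (secondVarDensity h h₁ h₂ X (φ t x, φ t y) *
        (flowJacobian X φ t x * flowJacobian X φ t y)) t := by
  have hpos : 0 < ‖φ t x - φ t y‖ ^ 2 := by
    have := norm_pos_iff.2 (sub_ne_zero.2 (hφ.apply_ne hK hxy t))
    positivity
  have h0 := (hh _ hpos).comp t (hφ.hasDerivAt_norm_sq x y t)
  have h1 := (hh₁ _ hpos).comp t (hφ.hasDerivAt_norm_sq x y t)
  have hd : ∀ x, HasDerivAt (fun t => divergence X (φ t x))
      (fderiv ℝ (divergence X) (φ t x) (X (φ t x))) t := fun x =>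
    (((contDiff_divergence hX).differentiable (by simp) _).hasFDerivAt).comp_hasDerivAt t
      (hφ.hasDerivAt x t)
  have hx : ∀ x, HasDerivAt (fun t => X (φ t x)) (fderiv ℝ X (φ t x) (X (φ t x))) t := fun x =>
    ((hX.differentiable (by simp) _).hasFDerivAt).comp_hasDerivAt t (hφ.hasDerivAt x t)
  have hq := ((hx x).fun_sub (hx y)).inner ℝ ((hφ.hasDerivAt x t).fun_sub (hφ.hasDerivAt y t))
  have hG := (((hd x).fun_add (hd y)).fun_mul h0).fun_add ((h1.const_mul 2).fun_mul hq)
  convert! hG.fun_mul (hφ.hasDerivAt_jacobian_mul hX x y t) using 1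
  simp only [secondVarDensity, Function.comp_apply, real_inner_self_eq_norm_sq]
  ring

end IsFlowOf

/-- The kernel `|z|^{-(3+s)}` as a function of `|z|²`. -/
def kernelProfile (s u : ℝ) : ℝ := u ^ (-((3 + s) / 2))

/-- The derivative of `kernelProfile`. -/
def kernelProfile₁ (s u : ℝ) : ℝ := -((3 + s) / 2) * u ^ (-((3 + s) / 2) - 1)

/-- The second derivative of `kernelProfile`. -/
def kernelProfile₂ (s u : ℝ) : ℝ :=
  -((3 + s) / 2) * ((-((3 + s) / 2) - 1) * u ^ (-((3 + s) / 2) - 1 - 1))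

theorem kernelProfile_norm_sq (s : ℝ) (z : E3) :
    kernelProfile s (‖z‖ ^ 2) = 1 / ‖z‖ ^ (3 + s) := by
  rw [kernelProfile, ← Real.rpow_natCast, ← Real.rpow_mul (norm_nonneg _), one_div,
    ← Real.rpow_neg (norm_nonneg _)]
  congr 1
  push_cast
  ring

theorem hasDerivAt_kernelProfile (s : ℝ) {u : ℝ} (hu : 0 < u) :
    HasDerivAt (kernelProfile s) (kernelProfile₁ s u) u :=
  Real.hasDerivAt_rpow_const (Or.inl hu.ne')

theorem hasDerivAt_kernelProfile₁ (s : ℝ) {u : ℝ} (hu : 0 < u) :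
    HasDerivAt (kernelProfile₁ s) (kernelProfile₂ s u) u :=
  (Real.hasDerivAt_rpow_const (Or.inl hu.ne')).const_mul _

theorem kernelProfile_nonneg (s : ℝ) {u : ℝ} (hu : 0 ≤ u) : 0 ≤ kernelProfile s u :=
  Real.rpow_nonneg hu _

/-- With `p = (3 + s) / 2 < 2` the three ratios are `1`, `p` and `p * (p + 1) < 6`. -/
theorem kernelProfile_bounds {s : ℝ} (hs0 : 0 < s) (hs1 : s < 1) {u : ℝ} (hu : 0 < u) :
    |kernelProfile s u| ≤ 6 * kernelProfile s u ∧
      u * |kernelProfile₁ s u| ≤ 6 * kernelProfile s u ∧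
      u ^ 2 * |kernelProfile₂ s u| ≤ 6 * kernelProfile s u := by
  have hp := Real.rpow_pos_of_pos hu (-((3 + s) / 2))
  have e1 : u ^ (-((3 + s) / 2) - 1) = u ^ (-((3 + s) / 2)) / u := Real.rpow_sub_one hu.ne' _
  have e2 : u ^ (-((3 + s) / 2) - 1 - 1) = u ^ (-((3 + s) / 2)) / u / u := by
    rw [Real.rpow_sub_one hu.ne', e1]
  rw [kernelProfile, kernelProfile₁, kernelProfile₂, e1, e2]
  set r := u ^ (-((3 + s) / 2)) with hr
  have e3 : -((3 + s) / 2) * (r / u) = -((3 + s) / 2 * (r / u)) := by ring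
  have e4 : -((3 + s) / 2) * ((-((3 + s) / 2) - 1) * (r / u / u)) =
      (3 + s) / 2 * (((3 + s) / 2 + 1) * (r / u / u)) := by ring
  rw [e3, e4, abs_neg, abs_of_pos hp, abs_of_pos (by positivity), abs_of_pos (by positivity)]
  refine ⟨by linarith, ?_, ?_⟩
  · have : u * ((3 + s) / 2 * (r / u)) = (3 + s) / 2 * r := by field_simp
    rw [this]
    nlinarith
  · have : u ^ 2 * ((3 + s) / 2 * (((3 + s) / 2 + 1) * (r / u / u))) =
        (3 + s) / 2 * ((3 + s) / 2 + 1) * r := by field_simp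
    rw [this]
    nlinarith [mul_pos hs0 hp]

theorem measurable_kernelProfile (s : ℝ) : Measurable (kernelProfile s) := by
  unfold kernelProfile; fun_prop

theorem measurable_kernelProfile₁ (s : ℝ) : Measurable (kernelProfile₁ s) := by
  unfold kernelProfile₁; fun_prop

theorem measurable_kernelProfile₂ (s : ℝ) : Measurable (kernelProfile₂ s) := by
  unfold kernelProfile₂; fun_prop

theorem IsC2Cone.integrableOn_kernelProfile {S : Set E3} (hS : IsC2Cone S)
    (hne : (frontier S).Nonempty) {s : ℝ} (hs0 : 0 < s) (hs1 : s < 1) :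
    IntegrableOn (fun z : E3 × E3 => kernelProfile s (‖z.1 - z.2‖ ^ 2)) (interactionSet S) := by
  refine ⟨((measurable_kernelProfile s).comp (by fun_prop)).aestronglyMeasurable, ?_⟩
  rw [hasFiniteIntegral_iff_ofReal (Eventually.of_forall fun z =>
    kernelProfile_nonneg s (sq_nonneg _))]
  simp only [kernelProfile_norm_sq s]
  exact hS.lintegral_interactionSet_lt_top hne hs0 hs1

end

/-! ### Differentiating the perimeter twice along a flow -/

noncomputable section

theorem measurable_firstVarDensity {X : E3 → E3} (hX : ContDiff ℝ ∞ X) {h h₁ : ℝ → ℝ}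
    (hh : Measurable h) (hh₁ : Measurable h₁) : Measurable (firstVarDensity h h₁ X) := by
  have hd := (contDiff_divergence hX).continuous.measurable
  have hXm := hX.continuous.measurable
  have hn : Measurable fun z : E3 × E3 => ‖z.1 - z.2‖ ^ 2 := by fun_prop
  have hq : Measurable fun z : E3 × E3 => inner ℝ (X z.1 - X z.2) (z.1 - z.2) :=
    ((hXm.comp measurable_fst).sub (hXm.comp measurable_snd)).inner
      (measurable_fst.sub measurable_snd)
  exact (((hd.comp measurable_fst).add (hd.comp measurable_snd)).mul (hh.comp hn)).add
    (((hh₁.comp hn).const_mul 2).mul hq)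

theorem measurable_secondVarDensity {X : E3 → E3} (hX : ContDiff ℝ ∞ X) {h h₁ h₂ : ℝ → ℝ}
    (hh : Measurable h) (hh₁ : Measurable h₁) (hh₂ : Measurable h₂) :
    Measurable (secondVarDensity h h₁ h₂ X) := by
  have hd := (contDiff_divergence hX).continuous.measurable
  have hXm := hX.continuous.measurable
  have hn : Measurable fun z : E3 × E3 => ‖z.1 - z.2‖ ^ 2 := by fun_prop
  have hDX : Measurable fun x => fderiv ℝ X x (X x) :=
    ((hX.fderiv_right (m := ∞) (by norm_num)).clm_apply hX).continuous.measurable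
  have hDd : Measurable fun x => fderiv ℝ (divergence X) x (X x) :=
    (((contDiff_divergence hX).fderiv_right (m := ∞) (by norm_num)).clm_apply
      hX).continuous.measurable
  have hX2 := (hXm.comp measurable_fst).sub (hXm.comp (measurable_snd (α := E3)))
  have hz : Measurable fun z : E3 × E3 => z.1 - z.2 := measurable_fst.sub measurable_snd
  have hq : Measurable fun z : E3 × E3 => inner ℝ (X z.1 - X z.2) (z.1 - z.2) := hX2.inner hz
  have ha : Measurable fun z : E3 × E3 =>
      inner ℝ (fderiv ℝ X z.1 (X z.1) - fderiv ℝ X z.2 (X z.2)) (z.1 - z.2) :=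
    ((hDX.comp measurable_fst).sub (hDX.comp measurable_snd)).inner hz
  have hd2 : Measurable fun z : E3 × E3 => divergence X z.1 + divergence X z.2 :=
    (hd.comp measurable_fst).add (hd.comp measurable_snd)
  have hm : Measurable fun z : E3 × E3 => ‖X z.1 - X z.2‖ ^ 2 := hX2.norm.pow_const 2
  have he : Measurable fun z : E3 × E3 =>
      fderiv ℝ (divergence X) z.1 (X z.1) + fderiv ℝ (divergence X) z.2 (X z.2) :=
    (hDd.comp measurable_fst).add (hDd.comp measurable_snd)
  exact ((((he.mul (hh.comp hn)).add (((hd2.const_mul 4).mul (hh₁.comp hn)).mul hq)).add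
    (((hh₂.comp hn).const_mul 4).mul (hq.pow_const 2))).add
      (((hh₁.comp hn).const_mul 2).mul (ha.add hm))).add ((hd2.pow_const 2).mul (hh.comp hn))

theorem ne_of_mem_interactionSet {S : Set E3} {z : E3 × E3} (hz : z ∈ interactionSet S) :
    z.1 ≠ z.2 := fun h => hz.2.1 (h ▸ hz.1)

namespace IsFlowOf

open scoped NNReal

variable {X : E3 → E3} {φ : ℝ → E3 → E3} {K : ℝ≥0}

theorem preimage_interactionSet (hφ : IsFlowOf X φ) (hK : LipschitzWith K X)
    (hX1 : tsupport X ⊆ Metric.ball 0 1) (S : Set E3) (t : ℝ) :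
    Prod.map (φ t) (φ t) ⁻¹' interactionSet (φ t '' S) = interactionSet S := by
  have hinj : Function.Injective (φ t) := (hφ.homeomorph hK t).injective
  ext z
  simp only [interactionSet, mem_preimage, mem_ofPred_eq, Prod.map_fst, Prod.map_snd,
    hinj.mem_set_image, hφ.apply_mem_iff hK hX1]

/-- Changing variables by the flow in both points moves the time dependence from the domain into the
integrand; the domain is fixed because the flow preserves the unit ball. -/
theorem fracPerimeter_image (hφ : IsFlowOf X φ) (hX : ContDiff ℝ ∞ X)
    (hXc : HasCompactSupport X) (hX1 : tsupport X ⊆ Metric.ball 0 1) (hK : LipschitzWith K X)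
    (s : ℝ) {S : Set E3} (hS : IsOpen S) (t : ℝ) :
    (fracPerimeter s (φ t '' S) (Metric.ball 0 1)).toReal =
      ∫ z in interactionSet S, kernelProfile s (‖φ t z.1 - φ t z.2‖ ^ 2) *
        (flowJacobian X φ t z.1 * flowJacobian X φ t z.2) := by
  have hSt : IsOpen (φ t '' S) := (hφ.homeomorph hK t).isOpenMap S hS
  obtain ⟨CJ, hCJ⟩ := hφ.lipschitzWith_flowJacobian hX hXc hK t
  have hJm : Measurable (flowJacobian X φ t) := hCJ.continuous.measurable
  have hφm : Measurable (φ t) := (hφ.lipschitzWith hK t).continuous.measurable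
  have hJe : Measurable fun x => ENNReal.ofReal (flowJacobian X φ t x) := hJm.ennreal_ofReal
  have hR := measurableSet_interactionSet hSt.measurableSet
  have hR0 := measurableSet_interactionSet hS.measurableSet
  have hvol : (volume : Measure (E3 × E3)) = ((volume : Measure (E3 × E3)).withDensity fun z =>
      ENNReal.ofReal (flowJacobian X φ t z.1) * ENNReal.ofReal (flowJacobian X φ t z.2)).map
        (Prod.map (φ t) (φ t)) := by
    rw [Measure.volume_eq_prod, ← prod_withDensity hJe hJe, ← Measure.map_prod_map _ _ hφm hφm,
      hφ.map_withDensity_flowJacobian hX hXc hK]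
  have hkm := measurable_kernel s
  have hmm : Measurable (Prod.map (φ t) (φ t)) := hφm.prodMap hφm
  have hw : Measurable fun z : E3 × E3 =>
      ENNReal.ofReal (flowJacobian X φ t z.1) * ENNReal.ofReal (flowJacobian X φ t z.2) :=
    (hJe.comp measurable_fst).mul (hJe.comp measurable_snd)
  rw [integral_eq_lintegral_of_nonneg_ae, fracPerimeter_eq_lintegral_interactionSet s
    hSt.measurableSet]
  · congr 1
    conv_lhs => rw [hvol]
    rw [setLIntegral_map hR hkm hmm, hφ.preimage_interactionSet hK hX1]
    refine (setLIntegral_withDensity_eq_setLIntegral_mul _ hw (hkm.comp hmm) hR0).trans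
      (lintegral_congr fun z => ?_)
    simp only [Pi.mul_apply, Prod.map_fst, Prod.map_snd, kernelProfile_norm_sq,
      Function.comp_apply]
    rw [ENNReal.ofReal_mul (by positivity), ENNReal.ofReal_mul (flowJacobian_pos t _).le, mul_comm]
  · exact Eventually.of_forall fun z => mul_nonneg (kernelProfile_nonneg s (sq_nonneg _))
      (mul_nonneg (flowJacobian_pos t _).le (flowJacobian_pos t _).le)
  · refine Measurable.aestronglyMeasurable ?_
    exact ((measurable_kernelProfile s).comp (((hφm.comp measurable_fst).sub
      (hφm.comp measurable_snd)).norm.pow_const 2)).mul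
        ((hJm.comp measurable_fst).mul (hJm.comp measurable_snd))

/-- For `|t| ≤ 1` the flow shrinks distances by a factor of at most `exp K`. -/
theorem kernelProfile_comp_le (hφ : IsFlowOf X φ) (hK : LipschitzWith K X) {s : ℝ} (hs : 0 < s)
    {t : ℝ} (ht : |t| ≤ 1) {x y : E3} (hxy : x ≠ y) :
    kernelProfile s (‖φ t x - φ t y‖ ^ 2) ≤
      Real.exp (K * (3 + s)) * kernelProfile s (‖x - y‖ ^ 2) := by
  have h1 := hφ.le_dist hK t x y
  rw [dist_eq_norm, dist_eq_norm] at h1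
  have hpos : 0 < ‖x - y‖ := norm_pos_iff.2 (sub_ne_zero.2 hxy)
  have hpos' : 0 < ‖φ t x - φ t y‖ := norm_pos_iff.2 (sub_ne_zero.2 (hφ.apply_ne hK hxy t))
  have h2 : ‖x - y‖ ≤ ‖φ t x - φ t y‖ * Real.exp K :=
    h1.trans (mul_le_mul_of_nonneg_left (Real.exp_le_exp.2 (mul_le_of_le_one_right K.2 ht))
      hpos'.le)
  rw [kernelProfile_norm_sq, kernelProfile_norm_sq, mul_one_div, Real.exp_mul,
    div_le_div_iff₀ (by positivity) (by positivity), one_mul,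
    ← Real.mul_rpow (Real.exp_pos _).le hpos'.le]
  exact Real.rpow_le_rpow hpos.le (h2.trans (mul_comm _ _).le) (by linarith)

/-- Differentiation under the integral sign, twice. For `|t| < 1` the integrand and its two time
derivatives are dominated by a multiple of the kernel at time `0`, which is integrable because the
perimeter is finite. -/
theorem exists_hasDerivAt_fracPerimeter (hφ : IsFlowOf X φ) (hX : ContDiff ℝ ∞ X)
    (hXc : HasCompactSupport X) (hX1 : tsupport X ⊆ Metric.ball 0 1) {s : ℝ} (hs0 : 0 < s)
    (hs1 : s < 1) {S : Set E3} (hS : IsC2Cone S) (hne : (frontier S).Nonempty) :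
    ∃ P' : ℝ → ℝ, (∀ t ∈ Ioo (-1 : ℝ) 1, HasDerivAt
        (fun t => (fracPerimeter s (φ t '' S) (Metric.ball 0 1)).toReal) (P' t) t) ∧
      P' 0 = ∫ z in interactionSet S, firstVarDensity (kernelProfile s) (kernelProfile₁ s) X z ∧
      HasDerivAt P' (∫ z in interactionSet S, secondVarDensity (kernelProfile s)
        (kernelProfile₁ s) (kernelProfile₂ s) X z) 0 := by
  obtain ⟨K, hK⟩ := ContDiff.lipschitzWith_of_hasCompactSupport hXc hX (by simp)
  obtain ⟨D, hD⟩ := (contDiff_divergence hX).continuous.bounded_above_of_compact_support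
    (hasCompactSupport_divergence hXc)
  have hD0 : 0 ≤ D := (norm_nonneg _).trans (hD 0)
  obtain ⟨C, hC0, hC⟩ := exists_abs_varDensity_le hX hXc
  have hmφ : ∀ t, Measurable (φ t) := fun t => (hφ.lipschitzWith hK t).continuous.measurable
  have hmJ : ∀ t, Measurable (flowJacobian X φ t) := fun t => by
    obtain ⟨CJ, hCJ⟩ := hφ.lipschitzWith_flowJacobian hX hXc hK t
    exact hCJ.continuous.measurable
  have hmJ2 : ∀ t, Measurable fun z : E3 × E3 =>
      flowJacobian X φ t z.1 * flowJacobian X φ t z.2 := fun t =>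
    ((hmJ t).comp measurable_fst).mul ((hmJ t).comp measurable_snd)
  have hmφ2 : ∀ t, Measurable fun z : E3 × E3 => (φ t z.1, φ t z.2) := fun t =>
    ((hmφ t).comp measurable_fst).prodMk ((hmφ t).comp measurable_snd)
  set F₀ : ℝ → E3 × E3 → ℝ := fun t z => kernelProfile s (‖φ t z.1 - φ t z.2‖ ^ 2) *
    (flowJacobian X φ t z.1 * flowJacobian X φ t z.2) with hF₀
  set F₁ : ℝ → E3 × E3 → ℝ := fun t z =>
    firstVarDensity (kernelProfile s) (kernelProfile₁ s) X (φ t z.1, φ t z.2) *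
    (flowJacobian X φ t z.1 * flowJacobian X φ t z.2) with hF₁
  set F₂ : ℝ → E3 × E3 → ℝ := fun t z =>
    secondVarDensity (kernelProfile s) (kernelProfile₁ s) (kernelProfile₂ s) X
      (φ t z.1, φ t z.2) *
    (flowJacobian X φ t z.1 * flowJacobian X φ t z.2) with hF₂
  have hmF₀ : ∀ t, Measurable (F₀ t) := fun t =>
    ((measurable_kernelProfile s).comp (((hmφ t).comp measurable_fst).sub
      ((hmφ t).comp measurable_snd) |>.norm.pow_const 2)).mul (hmJ2 t)
  have hmF₁ : ∀ t, Measurable (F₁ t) := fun t =>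
    ((measurable_firstVarDensity hX (measurable_kernelProfile s)
      (measurable_kernelProfile₁ s)).comp (hmφ2 t)).mul (hmJ2 t)
  have hmF₂ : ∀ t, Measurable (F₂ t) := fun t =>
    ((measurable_secondVarDensity hX (measurable_kernelProfile s)
      (measurable_kernelProfile₁ s) (measurable_kernelProfile₂ s)).comp (hmφ2 t)).mul (hmJ2 t)
  -- The common majorant. Writing `C + 1` covers the kernel itself besides the two variations; the
  -- exponentials bound the distortion of distances and the two Jacobians.
  set k : E3 × E3 → ℝ := fun z => (C + 1) * (6 * (Real.exp (K * (3 + s)) *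
    kernelProfile s (‖z.1 - z.2‖ ^ 2))) * (Real.exp D * Real.exp D) with hk
  have hkint : Integrable k (volume.restrict (interactionSet S)) :=
    ((((hS.integrableOn_kernelProfile hne hs0 hs1).const_mul _).const_mul 6).const_mul
      (C + 1)).mul_const _
  have hbound : ∀ t ∈ Ioo (-1 : ℝ) 1, ∀ z ∈ interactionSet S,
      ‖F₀ t z‖ ≤ k z ∧ ‖F₁ t z‖ ≤ k z ∧ ‖F₂ t z‖ ≤ k z := by
    intro t ht z hz
    have ht1 : |t| ≤ 1 := abs_le.2 ⟨ht.1.le, ht.2.le⟩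
    have hzne := ne_of_mem_interactionSet hz
    have hpos : 0 < ‖φ t z.1 - φ t z.2‖ ^ 2 := by
      have := norm_pos_iff.2 (sub_ne_zero.2 (hφ.apply_ne hK hzne t))
      positivity
    obtain ⟨b₀, b₁, b₂⟩ := kernelProfile_bounds hs0 hs1 hpos
    have hle := hφ.kernelProfile_comp_le hK hs0 ht1 hzne
    have hle6 := mul_le_mul_of_nonneg_left hle (by norm_num : (0 : ℝ) ≤ 6)
    obtain ⟨c₁, c₂, -⟩ := hC (kernelProfile s) (kernelProfile₁ s) (kernelProfile₂ s)
      (φ t z.1, φ t z.2) _ (b₀.trans hle6) (b₁.trans hle6) (b₂.trans hle6)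
    have hJ : ∀ x, flowJacobian X φ t x ≤ Real.exp D := fun x => (flowJacobian_le hD t x).trans
        (Real.exp_le_exp.2 (mul_le_of_le_one_right hD0 ht1))
    have hJ2 : |flowJacobian X φ t z.1 * flowJacobian X φ t z.2| ≤ Real.exp D * Real.exp D := by
      rw [abs_of_pos (mul_pos (flowJacobian_pos t _) (flowJacobian_pos t _))]
      exact mul_le_mul (hJ _) (hJ _) (flowJacobian_pos t _).le (Real.exp_pos _).le
    have hq : 0 ≤ 6 * (Real.exp (K * (3 + s)) * kernelProfile s (‖z.1 - z.2‖ ^ 2)) :=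
      mul_nonneg (by norm_num) (mul_nonneg (Real.exp_pos _).le
        (kernelProfile_nonneg s (sq_nonneg _)))
    set q := 6 * (Real.exp (K * (3 + s)) * kernelProfile s (‖z.1 - z.2‖ ^ 2)) with hqdef
    have hfin : ∀ a : ℝ, |a| ≤ (C + 1) * q →
        ‖a * (flowJacobian X φ t z.1 * flowJacobian X φ t z.2)‖ ≤ k z := fun a ha => by
      rw [norm_mul]
      exact mul_le_mul ha hJ2 (abs_nonneg _) (by positivity)
    refine ⟨hfin _ ?_, hfin _ ?_, hfin _ ?_⟩
    · refine (b₀.trans hle6).trans ?_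
      nlinarith [mul_nonneg hC0 hq]
    · exact c₁.trans (by nlinarith)
    · exact c₂.trans (by nlinarith)
  have hRm := measurableSet_interactionSet hS.isOpen.measurableSet
  have hae : ∀ᵐ z ∂(volume : Measure (E3 × E3)).restrict (interactionSet S),
      z ∈ interactionSet S := ae_restrict_mem hRm
  have hint : ∀ t ∈ Ioo (-1 : ℝ) 1, Integrable (F₀ t) (volume.restrict (interactionSet S)) ∧
      Integrable (F₁ t) (volume.restrict (interactionSet S)) := fun t ht =>
    ⟨hkint.mono' (hmF₀ t).aestronglyMeasurable (hae.mono fun z hz => (hbound t ht z hz).1),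
      hkint.mono' (hmF₁ t).aestronglyMeasurable (hae.mono fun z hz => (hbound t ht z hz).2.1)⟩
  have hP : ∀ t ∈ Ioo (-1 : ℝ) 1, HasDerivAt (fun t => ∫ z in interactionSet S, F₀ t z)
      (∫ z in interactionSet S, F₁ t z) t := fun t ht =>
    (hasDerivAt_integral_of_dominated_loc_of_deriv_le (F' := F₁) (Ioo_mem_nhds ht.1 ht.2)
      (Eventually.of_forall fun t => (hmF₀ t).aestronglyMeasurable) (hint t ht).1
      (hmF₁ t).aestronglyMeasurable (hae.mono fun z hz t ht => (hbound t ht z hz).2.1) hkint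
      (hae.mono fun z hz t _ => hφ.hasDerivAt_kernel hX hK
        (fun u hu => hasDerivAt_kernelProfile s hu) (ne_of_mem_interactionSet hz) t)).2
  have h0 : (0 : ℝ) ∈ Ioo (-1 : ℝ) 1 := ⟨by norm_num, by norm_num⟩
  have hP' : HasDerivAt (fun t => ∫ z in interactionSet S, F₁ t z)
      (∫ z in interactionSet S, F₂ 0 z) 0 :=
    (hasDerivAt_integral_of_dominated_loc_of_deriv_le (F' := F₂) (Ioo_mem_nhds h0.1 h0.2)
      (Eventually.of_forall fun t => (hmF₁ t).aestronglyMeasurable) (hint 0 h0).2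
      (hmF₂ 0).aestronglyMeasurable (hae.mono fun z hz t ht => (hbound t ht z hz).2.2) hkint
      (hae.mono fun z hz t _ => hφ.hasDerivAt_firstVarDensity hX hK
        (fun u hu => hasDerivAt_kernelProfile s hu) (fun u hu => hasDerivAt_kernelProfile₁ s hu)
        (ne_of_mem_interactionSet hz) t)).2
  refine ⟨fun t => ∫ z in interactionSet S, F₁ t z, fun t ht => ?_, ?_, ?_⟩
  · have heq : (fun t => (fracPerimeter s (φ t '' S) (Metric.ball 0 1)).toReal) =
        fun t => ∫ z in interactionSet S, F₀ t z := funext fun t =>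
      hφ.fracPerimeter_image hX hXc hX1 hK s hS.isOpen t
    rw [heq]
    exact hP t ht
  · simp [hF₁, hφ.zero_apply, flowJacobian_zero]
  · simpa [hF₂, hφ.zero_apply, flowJacobian_zero] using hP'

end IsFlowOf

/-- A nonnegative lower limit allows `P` to drop below `P 0` by at most `ε * t ^ 2` near `0`, and
the added term makes up for this. -/
theorem eventually_nonneg_of_liminf_nonneg {P : ℝ → ℝ}
    (h : 0 ≤ liminf (fun t : ℝ => (((P t - P 0) / t ^ 2 : ℝ) : EReal)) (𝓝[≠] 0)) {ε : ℝ}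
    (hε : 0 < ε) : IsLocalMin (fun t => P t + ε * t ^ 2) 0 := by
  have h1 : ((-ε : ℝ) : EReal) < liminf (fun t : ℝ => (((P t - P 0) / t ^ 2 : ℝ) : EReal))
      (𝓝[≠] 0) := lt_of_lt_of_le (by exact_mod_cast neg_neg_of_pos hε) h
  have h2 := eventually_lt_of_lt_liminf h1
  rw [eventually_nhdsWithin_iff] at h2
  filter_upwards [h2] with t ht
  by_cases h0 : t = 0
  · simp [h0]
  · have ht2 : 0 < t ^ 2 := by positivity
    have h3 : -ε < (P t - P 0) / t ^ 2 := by exact_mod_cast ht h0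
    rw [lt_div_iff₀ ht2] at h3
    nlinarith

/-- Adding `ε * t ^ 2` makes `0` a two-sided local minimum, so the first derivative vanishes. A
negative second derivative would, for small `ε`, make `0` a local maximum too; the function would be
locally constant and yet have nonzero second derivative. -/
theorem deriv_eq_zero_and_nonneg_of_liminf {P P' : ℝ → ℝ} {P'' : ℝ}
    (h : 0 ≤ liminf (fun t : ℝ => (((P t - P 0) / t ^ 2 : ℝ) : EReal)) (𝓝[≠] 0))
    (hP : ∀ t ∈ Ioo (-1 : ℝ) 1, HasDerivAt P (P' t) t) (hP' : HasDerivAt P' P'' 0) :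
    P' 0 = 0 ∧ 0 ≤ P'' := by
  have h0 : (0 : ℝ) ∈ Ioo (-1 : ℝ) 1 := ⟨by norm_num, by norm_num⟩
  have hd : ∀ ε : ℝ, ∀ t ∈ Ioo (-1 : ℝ) 1,
      HasDerivAt (fun t => P t + ε * t ^ 2) (P' t + ε * (2 * t)) t := fun ε t ht => by
    have := (hP t ht).fun_add ((hasDerivAt_pow 2 t).const_mul ε)
    simpa using this
  have hP'0 : P' 0 = 0 := by
    have := (eventually_nonneg_of_liminf_nonneg h one_pos).hasDerivAt_eq_zero (hd 1 0 h0)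
    simpa using this
  refine ⟨hP'0, ?_⟩
  by_contra hneg
  push Not at hneg
  -- With this value the second derivative of `P t + ε * t ^ 2` at `0` is `P'' / 2 < 0`.
  set ε := -P'' / 4 with hε
  have hε0 : 0 < ε := by rw [hε]; linarith
  have hmin := eventually_nonneg_of_liminf_nonneg h hε0
  have hev : ∀ᶠ t in 𝓝 (0 : ℝ), t ∈ Ioo (-1 : ℝ) 1 := Ioo_mem_nhds h0.1 h0.2
  have hderiv : deriv (fun t => P t + ε * t ^ 2) =ᶠ[𝓝 0] fun t => P' t + ε * (2 * t) := by
    filter_upwards [hev] with t ht using (hd ε t ht).deriv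
  have hdd : HasDerivAt (deriv fun t => P t + ε * t ^ 2) (P'' + 2 * ε) 0 := by
    refine HasDerivAt.congr_of_eventuallyEq ?_ hderiv
    have := hP'.fun_add (((hasDerivAt_id (0 : ℝ)).const_mul 2).const_mul ε)
    convert! this using 1
    simp [mul_comm]
  have hmax : IsLocalMax (fun t => P t + ε * t ^ 2) 0 :=
    isLocalMax_of_deriv_deriv_neg (by rw [hdd.deriv, hε]; linarith)
      (by rw [(hd ε 0 h0).deriv, hP'0]; simp) (hd ε 0 h0).continuousAt
  have hconst : (fun t => P t + ε * t ^ 2) =ᶠ[𝓝 0] fun _ => P 0 + ε * 0 ^ 2 := by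
    filter_upwards [hmin, hmax] with t h1 h2 using le_antisymm h2 h1
  have hdz : deriv (fun t => P t + ε * t ^ 2) =ᶠ[𝓝 0] fun _ => 0 :=
    hconst.deriv.trans (by simp)
  have := hdz.deriv_eq
  rw [hdd.deriv, deriv_const, hε] at this
  linarith

/-- The second variation of the fractional perimeter of a stable cone is nonnegative. -/
theorem IsStableCone.integral_stabilityDensity_nonneg {s : ℝ} (hs0 : 0 < s) (hs1 : s < 1)
    {S : Set E3} (hS : IsStableCone s S) {X : E3 → E3} (hX : ContDiff ℝ ∞ X)
    (hXc : HasCompactSupport X) (hX1 : tsupport X ⊆ Metric.ball 0 1 \ {0}) :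
    0 ≤ ∫ z in interactionSet S, stabilityDensity (kernelProfile s) (kernelProfile₁ s)
      (kernelProfile₂ s) X z := by
  have hC : IsC2Cone S := ⟨hS.isOpen, hS.cone, hS.c2_boundary⟩
  have key : ∀ {Y : E3 → E3}, ContDiff ℝ ∞ Y → HasCompactSupport Y →
      tsupport Y ⊆ Metric.ball 0 1 \ {0} →
      (∫ z in interactionSet S, firstVarDensity (kernelProfile s) (kernelProfile₁ s) Y z) = 0 ∧
      0 ≤ ∫ z in interactionSet S, secondVarDensity (kernelProfile s) (kernelProfile₁ s)
        (kernelProfile₂ s) Y z := by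
    intro Y hY hYc hY1
    obtain ⟨K, hK⟩ := ContDiff.lipschitzWith_of_hasCompactSupport hYc hY (by simp)
    obtain ⟨M, hM⟩ := hY.continuous.bounded_above_of_compact_support hYc
    obtain ⟨φ, hφ⟩ := exists_isFlowOf hK (M := M.toNNReal) fun x => by
      rw [Real.coe_toNNReal _ ((norm_nonneg _).trans (hM 0))]; exact hM x
    obtain ⟨P', hP, hP'0, hP''⟩ := hφ.exists_hasDerivAt_fracPerimeter hY hYc
      (hY1.trans sdiff_subset) hs0 hs1 hC hS.nonempty_frontier
    have hst := hS.stable Y hY hYc hY1 φ hφ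
    have himg : φ 0 '' S = S := by
      rw [show φ 0 = id from funext hφ.zero_apply, image_id]
    have h := deriv_eq_zero_and_nonneg_of_liminf
      (P := fun t => (fracPerimeter s (φ t '' S) (Metric.ball 0 1)).toReal)
      (by simpa only [himg] using hst) hP hP''
    exact ⟨hP'0 ▸ h.1, h.2⟩
  -- The first variation vanishes also along `(div X) X`, whose support lies in that of `X`, so
  -- subtracting it does not change the second variation.
  have hdX := contDiff_divergence hX
  have hY : ContDiff ℝ ∞ fun x => divergence X x • X x := hdX.smul hX
  have hYs : tsupport (fun x => divergence X x • X x) ⊆ tsupport X :=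
    closure_minimal (fun x hx => by
      by_contra h
      exact hx (by simp only [image_eq_zero_of_notMem_tsupport h, smul_zero]))
      (isClosed_tsupport X)
  have hYc : HasCompactSupport fun x => divergence X x • X x :=
    hXc.of_isClosed_subset (isClosed_tsupport _) hYs
  have h1 := (key hX hXc hX1).2
  have h2 := (key hY hYc (hYs.trans hX1)).1
  have hRm := measurableSet_interactionSet (S := S) hS.isOpen.measurableSet
  have hint := hC.integrableOn_kernelProfile hS.nonempty_frontier hs0 hs1
  have hbd : ∀ z ∈ interactionSet S, 0 < ‖z.1 - z.2‖ ^ 2 := fun z hz => by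
    have := norm_pos_iff.2 (sub_ne_zero.2 (ne_of_mem_interactionSet hz))
    positivity
  obtain ⟨C, -, hCb⟩ := exists_abs_varDensity_le hX hXc
  obtain ⟨C', -, hCb'⟩ := exists_abs_varDensity_le hY hYc
  have i2 : IntegrableOn (secondVarDensity (kernelProfile s) (kernelProfile₁ s)
      (kernelProfile₂ s) X) (interactionSet S) := by
    refine Integrable.mono' ((hint.const_mul 6).const_mul C) (measurable_secondVarDensity hX
      (measurable_kernelProfile s) (measurable_kernelProfile₁ s)
      (measurable_kernelProfile₂ s)).aestronglyMeasurable ?_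
    filter_upwards [ae_restrict_mem hRm] with z hz
    obtain ⟨b₀, b₁, b₂⟩ := kernelProfile_bounds hs0 hs1 (hbd z hz)
    exact (hCb _ _ _ z _ b₀ b₁ b₂).2.1
  have i1 : IntegrableOn (firstVarDensity (kernelProfile s) (kernelProfile₁ s)
      fun x => divergence X x • X x) (interactionSet S) := by
    refine Integrable.mono' ((hint.const_mul 6).const_mul C') (measurable_firstVarDensity hY
      (measurable_kernelProfile s) (measurable_kernelProfile₁ s)).aestronglyMeasurable ?_
    filter_upwards [ae_restrict_mem hRm] with z hz
    obtain ⟨b₀, b₁, b₂⟩ := kernelProfile_bounds hs0 hs1 (hbd z hz)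
    exact (hCb' _ _ _ z _ b₀ b₁ b₂).1
  have heq : ∫ z in interactionSet S, stabilityDensity (kernelProfile s) (kernelProfile₁ s)
      (kernelProfile₂ s) X z =
      (∫ z in interactionSet S, secondVarDensity (kernelProfile s) (kernelProfile₁ s)
        (kernelProfile₂ s) X z) -
      ∫ z in interactionSet S, firstVarDensity (kernelProfile s) (kernelProfile₁ s)
        (fun x => divergence X x • X x) z := by
    rw [← integral_sub i2 i1]
    exact integral_congr_ae (Eventually.of_forall fun z =>
      (secondVarDensity_sub_firstVarDensity hX _ _ _ z).symm)
  rw [heq, h2, sub_zero]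
  exact h1

end

noncomputable section

/-! ### The second variation as a boundary integral -/

theorem divergence_smul {f : E3 → ℝ} {F : E3 → E3} {x : E3} (hf : DifferentiableAt ℝ f x)
    (hF : DifferentiableAt ℝ F x) :
    divergence (fun x => f x • F x) x = fderiv ℝ f x (F x) + f x * divergence F x := by
  have h1 : HasFDerivAt (fun x => f x • F x) _ x := hf.hasFDerivAt.smul hF.hasFDerivAt
  rw [divergence, h1.fderiv]
  simp only [add_apply, smul_apply,
    ContinuousLinearMap.smulRight_apply, PiLp.add_apply, PiLp.smul_apply, smul_eq_mul,
    Finset.sum_add_distrib, ← Finset.mul_sum]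
  rw [add_comm]
  congr 1
  have hXx : F x = ∑ i, F x i • EuclideanSpace.single i (1 : ℝ) := by
    have := (EuclideanSpace.basisFun (Fin 3) ℝ).sum_repr (F x)
    simpa using this.symm
  conv_rhs => rw [hXx]
  rw [map_sum]
  refine Finset.sum_congr rfl fun i _ => ?_
  rw [map_smul, smul_eq_mul, mul_comm]

theorem divergence_add {F G : E3 → E3} {x : E3} (hF : DifferentiableAt ℝ F x)
    (hG : DifferentiableAt ℝ G x) :
    divergence (fun x => F x + G x) x = divergence F x + divergence G x := by
  simp [divergence, fderiv_fun_add hF hG, Finset.sum_add_distrib]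

theorem divergence_sub {F G : E3 → E3} {x : E3} (hF : DifferentiableAt ℝ F x)
    (hG : DifferentiableAt ℝ G x) :
    divergence (fun x => F x - G x) x = divergence F x - divergence G x := by
  simp [divergence, fderiv_fun_sub hF hG, Finset.sum_sub_distrib]

theorem divergence_const (c x : E3) : divergence (fun _ => c) x = 0 := by
  simp [divergence]

theorem divergence_const_smul {F : E3 → E3} {x : E3} (c : ℝ) (hF : DifferentiableAt ℝ F x) :
    divergence (fun x => c • F x) x = c * divergence F x := by
  rw [divergence_smul (f := fun _ => c) (by fun_prop) hF]
  simp

/-- The divergence theorem is summed over components. On the complement the flux changes sign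
because the divergence has total integral zero. -/
theorem IsC2Cone.integral_divergence {S : Set E3} (hS : IsC2Cone S) {F : E3 → E3}
    (hF : ContDiff ℝ 1 F) (hFc : HasCompactSupport F) :
    ∫ x in S, divergence F x = ∫ x in frontier S, inner ℝ (F x) (outwardNormal S x) ∂μHE[2] ∧
    ∫ x in Sᶜ, divergence F x =
      -∫ x in frontier S, inner ℝ (F x) (outwardNormal S x) ∂μHE[2] := by
  set b : Fin 3 → E3 := fun i => EuclideanSpace.single i 1 with hb
  have hFi : ∀ i, ContDiff ℝ 1 fun x => F x i := fun i =>
    (EuclideanSpace.proj (𝕜 := ℝ) i).contDiff.comp hF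
  have hFic : ∀ i, HasCompactSupport fun x => F x i := fun i =>
    hFc.comp_left (g := fun y : E3 => y i) rfl
  have hdiv : divergence F = fun x => ∑ i, fderiv ℝ (fun x => F x i) x (b i) := by
    funext x
    refine Finset.sum_congr rfl fun i _ => ?_
    have h1 : HasFDerivAt (fun x => F x i)
        ((EuclideanSpace.proj (𝕜 := ℝ) i).comp (fderiv ℝ F x)) x :=
      (EuclideanSpace.proj (𝕜 := ℝ) i).hasFDerivAt.comp x
        ((hF.differentiable (by simp) x).hasFDerivAt)
    rw [h1.fderiv]
    rfl
  have hint : ∀ i, Integrable fun x => fderiv ℝ (fun x => F x i) x (b i) := fun i =>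
    integrable_fderiv_apply (hFi i) (hFic i) _
  have h1 : ∫ x in S, divergence F x =
      ∫ x in frontier S, inner ℝ (F x) (outwardNormal S x) ∂μHE[2] := by
    rw [hdiv, integral_finsetSum _ fun i _ => (hint i).integrableOn]
    rw [Finset.sum_congr rfl fun i _ => hS.integral_fderiv (b i) (hFi i) (hFic i),
      ← integral_finsetSum _ fun i _ =>
        hS.integrable_mul_inner_outwardNormal (hFi i).continuous (hFic i) (b i)]
    refine integral_congr_ae (Eventually.of_forall fun x => ?_)
    simp only [hb, PiLp.inner_apply]
    refine Finset.sum_congr rfl fun i _ => ?_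
    simp [mul_comm]
  have h2 : ∫ x, divergence F x = 0 := by
    rw [hdiv, integral_finsetSum _ fun i _ => hint i]
    exact Finset.sum_eq_zero fun i _ => integral_fderiv_apply_eq_zero (hFi i) (hFic i) _
  have hdi : Integrable (divergence F) := by
    rw [hdiv]; exact integrable_finsetSum _ fun i _ => hint i
  refine ⟨h1, ?_⟩
  have h3 := integral_add_compl hS.isOpen.measurableSet hdi
  rw [h2, h1] at h3
  linarith

/-- The vector field in the variable `y` whose divergence is the stability density. -/
def stabilityField (H H₁ : ℝ → ℝ) (X : E3 → E3) (x y : E3) : E3 :=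
  H (‖x - y‖ ^ 2) • (divergence X x • X x + fderiv ℝ X x (X x) - (2 * divergence X x) • X y) +
    (2 * H₁ (‖x - y‖ ^ 2)) • (inner ℝ (X x) (x - y) • X x + inner ℝ (X y) (x - y) • X y -
      (2 * inner ℝ (X x) (x - y)) • X y)

/-- The integrand of the second variation as a boundary integral, up to the kernel. -/
def boundaryForm (S : Set E3) (X : E3 → E3) (x y : E3) : ℝ :=
  inner ℝ (X x) (outwardNormal S y) * inner ℝ (X x) (outwardNormal S x) +
    inner ℝ (X y) (outwardNormal S y) * inner ℝ (X y) (outwardNormal S x) -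
    2 * inner ℝ (X y) (outwardNormal S y) * inner ℝ (X x) (outwardNormal S x)

theorem hasFDerivAt_norm_sub_sq_left (x y : E3) :
    HasFDerivAt (fun x => ‖x - y‖ ^ 2) (2 • (innerSL ℝ (x - y))) x := by
  have h := ((hasFDerivAt_id x).sub_const y).norm_sq
  simpa using h

theorem hasFDerivAt_norm_sub_sq_right (x y : E3) :
    HasFDerivAt (fun y => ‖x - y‖ ^ 2) (-(2 • (innerSL ℝ (x - y)))) y := by
  have h : HasFDerivAt (fun y => x - y) (-(ContinuousLinearMap.id ℝ E3)) y :=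
    (hasFDerivAt_id y).const_sub x
  refine h.norm_sq.congr_fderiv ?_
  ext v
  simp
  ring

theorem fderiv_comp_norm_sub_sq_left {H : ℝ → ℝ} (hH : Differentiable ℝ H) (x y v : E3) :
    fderiv ℝ (fun x => H (‖x - y‖ ^ 2)) x v =
      2 * deriv H (‖x - y‖ ^ 2) * inner ℝ (x - y) v := by
  have h := (hH (‖x - y‖ ^ 2)).hasDerivAt.comp_hasFDerivAt x (hasFDerivAt_norm_sub_sq_left x y)
  have h' : HasFDerivAt (fun x => H (‖x - y‖ ^ 2)) _ x := h
  rw [h'.fderiv]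
  simp [inner_sub_left]
  ring

theorem fderiv_comp_norm_sub_sq_right {H : ℝ → ℝ} (hH : Differentiable ℝ H) (x y v : E3) :
    fderiv ℝ (fun y => H (‖x - y‖ ^ 2)) y v =
      -(2 * deriv H (‖x - y‖ ^ 2) * inner ℝ (x - y) v) := by
  have h := (hH (‖x - y‖ ^ 2)).hasDerivAt.comp_hasFDerivAt y (hasFDerivAt_norm_sub_sq_right x y)
  have h' : HasFDerivAt (fun y => H (‖x - y‖ ^ 2)) _ y := h
  rw [h'.fderiv]
  simp [inner_sub_left]
  ring

section

variable {X : E3 → E3} {H : ℝ → ℝ}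

/-- One of the two divergences: integration over `y` outside `S` leaves a flux of `stabilityField`
through the boundary. The verification is the product rule. -/
theorem divergence_stabilityField (hX : ContDiff ℝ ∞ X) (hH : ContDiff ℝ ∞ H) (x y : E3) :
    divergence (stabilityField H (deriv H) X x) y =
      -stabilityDensity H (deriv H) (deriv (deriv H)) X (x, y) := by
  have hXd : Differentiable ℝ X := hX.differentiable (by simp)
  have hHd : Differentiable ℝ H := hH.differentiable (by simp)
  have hH1 : ContDiff ℝ ∞ (deriv H) := (contDiff_infty_iff_deriv.1 hH).2
  have hH1d : Differentiable ℝ (deriv H) := hH1.differentiable (by simp)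
  have hHn : Differentiable ℝ fun y => H (‖x - y‖ ^ 2) :=
    fun y => (hHd _).comp y (hasFDerivAt_norm_sub_sq_right x y).differentiableAt
  have hH1n : Differentiable ℝ fun y => deriv H (‖x - y‖ ^ 2) :=
    fun y => (hH1d _).comp y (hasFDerivAt_norm_sub_sq_right x y).differentiableAt
  have hp : Differentiable ℝ fun y => inner ℝ (X x) (x - y) := fun y =>
    (differentiableAt_const _).inner ℝ (by fun_prop)
  have hp' : Differentiable ℝ fun y => inner ℝ (X y) (x - y) := by
    intro y
    exact (hXd y).inner ℝ (by fun_prop)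
  have d1 : divergence (fun y => divergence X x • X x + fderiv ℝ X x (X x) -
      (2 * divergence X x) • X y) y = -(2 * divergence X x * divergence X y) := by
    rw [divergence_sub (differentiableAt_const _) ((hXd y).fun_const_smul _), divergence_const,
      divergence_const_smul _ (hXd y), zero_sub]
  have h1 : HasFDerivAt (fun y => x - y) (-(ContinuousLinearMap.id ℝ E3)) y :=
    (hasFDerivAt_id y).const_sub x
  have dv : ∀ v, fderiv ℝ (fun y => inner ℝ (X x) (x - y)) y v = -inner ℝ (X x) v := by
    intro v
    rw [fderiv_inner_apply ℝ (differentiableAt_const _) h1.differentiableAt, h1.fderiv]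
    simp
  have dp' : fderiv ℝ (fun y => inner ℝ (X y) (x - y)) y (X y) =
      inner ℝ (fderiv ℝ X y (X y)) (x - y) - ‖X y‖ ^ 2 := by
    rw [fderiv_inner_apply ℝ (hXd y) h1.differentiableAt, h1.fderiv]
    simp
    ring
  have dG : divergence (fun y => inner ℝ (X x) (x - y) • X x + inner ℝ (X y) (x - y) • X y -
      (2 * inner ℝ (X x) (x - y)) • X y) y =
      -‖X x‖ ^ 2 + (inner ℝ (fderiv ℝ X y (X y)) (x - y) - ‖X y‖ ^ 2 +
        inner ℝ (X y) (x - y) * divergence X y) -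
        (-(2 * inner ℝ (X x) (X y)) + 2 * inner ℝ (X x) (x - y) * divergence X y) := by
    have e1 := divergence_smul (hp y) (differentiableAt_const (𝕜 := ℝ) (x := y) (X x))
    have e2 := divergence_smul (hp' y) (hXd y)
    have e3 := divergence_smul ((hp y).const_mul 2) (hXd y)
    rw [divergence_sub (((hp y).fun_smul (differentiableAt_const _)).fun_add ((hp' y).fun_smul (hXd y)))
      (((hp y).const_mul 2).fun_smul (hXd y)), divergence_add ((hp y).fun_smul (differentiableAt_const _))
      ((hp' y).fun_smul (hXd y)), e1, e2, e3, divergence_const, dv, dp', fderiv_const_mul (hp y)]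
    simp only [smul_apply, dv, smul_eq_mul, real_inner_self_eq_norm_sq]
    ring
  have hG : DifferentiableAt ℝ (fun y => inner ℝ (X x) (x - y) • X x +
      inner ℝ (X y) (x - y) • X y - (2 * inner ℝ (X x) (x - y)) • X y) y :=
    (((hp y).fun_smul (differentiableAt_const _)).fun_add ((hp' y).fun_smul (hXd y))).fun_sub
      (((hp y).const_mul 2).fun_smul (hXd y))
  have hA : DifferentiableAt ℝ (fun y => divergence X x • X x + fderiv ℝ X x (X x) -
      (2 * divergence X x) • X y) y := (differentiableAt_const _).fun_sub ((hXd y).fun_const_smul _)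
  have e4 := divergence_smul (hHn y) hA
  have e5 := divergence_smul ((hH1n y).const_mul 2) hG
  have hadd := divergence_add ((hHn y).fun_smul hA) (((hH1n y).const_mul 2).fun_smul hG)
  refine hadd.trans ?_
  rw [e4, e5, d1, dG, fderiv_const_mul (hH1n y), smul_apply, smul_eq_mul,
    fderiv_comp_norm_sub_sq_right hHd, fderiv_comp_norm_sub_sq_right hH1d, stabilityDensity]
  simp only [inner_add_right, inner_sub_right, real_inner_smul_right, inner_sub_left,
    real_inner_smul_left, @norm_sub_sq_real]
  simp only [real_inner_comm]
  ring

/-- The other divergence. With `w` the normal at `y`, the flux density of `stabilityField` is itself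
a divergence in `x`, of a field whose normal component at `x` is the kernel times `boundaryForm`. -/
theorem divergence_mul_form (hX : ContDiff ℝ ∞ X) (hH : ContDiff ℝ ∞ H) (x y w : E3) :
    divergence (fun x => H (‖x - y‖ ^ 2) • (inner ℝ (X x) w • X x + inner ℝ (X y) w • X y -
      (2 * inner ℝ (X y) w) • X x)) x = inner ℝ (stabilityField H (deriv H) X x y) w := by
  have hXd : Differentiable ℝ X := hX.differentiable (by simp)
  have hHd : Differentiable ℝ H := hH.differentiable (by simp)
  have hHn : Differentiable ℝ fun x => H (‖x - y‖ ^ 2) :=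
    fun x => (hHd _).comp x (hasFDerivAt_norm_sub_sq_left x y).differentiableAt
  have hp : Differentiable ℝ fun x => inner ℝ (X x) w := fun x =>
    (hXd x).inner ℝ (differentiableAt_const _)
  have dp : fderiv ℝ (fun x => inner ℝ (X x) w) x (X x) = inner ℝ (fderiv ℝ X x (X x)) w := by
    rw [fderiv_inner_apply ℝ (hXd x) (differentiableAt_const _)]
    simp
  have hF : DifferentiableAt ℝ (fun x => inner ℝ (X x) w • X x + inner ℝ (X y) w • X y -
      (2 * inner ℝ (X y) w) • X x) x :=
    (((hp x).fun_smul (hXd x)).fun_add (differentiableAt_const _)).fun_sub ((hXd x).fun_const_smul _)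
  have dF : divergence (fun x => inner ℝ (X x) w • X x + inner ℝ (X y) w • X y -
      (2 * inner ℝ (X y) w) • X x) x = inner ℝ (fderiv ℝ X x (X x)) w +
        inner ℝ (X x) w * divergence X x - 2 * inner ℝ (X y) w * divergence X x := by
    rw [divergence_sub (((hp x).fun_smul (hXd x)).fun_add (differentiableAt_const _))
      ((hXd x).fun_const_smul _), divergence_add ((hp x).fun_smul (hXd x)) (differentiableAt_const _),
      divergence_smul (hp x) (hXd x), divergence_const, divergence_const_smul _ (hXd x), dp]
    ring
  rw [divergence_smul (hHn x) hF, dF, fderiv_comp_norm_sub_sq_left hHd, stabilityField]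
  simp only [inner_add_right, inner_sub_right, real_inner_smul_right, inner_sub_left,
    real_inner_smul_left, inner_add_left]
  simp only [real_inner_comm]
  ring

end

end

/-! ### The divergence theorem in both variables, for smooth kernels -/

noncomputable section

theorem IsC2Cone.sigmaFinite_frontier {S : Set E3} (hS : IsC2Cone S) :
    SigmaFinite ((μHE[2] : Measure E3).restrict (frontier S)) := by
  have := hS.isFiniteMeasureOnCompacts_frontier
  have : IsLocallyFiniteMeasure ((μHE[2] : Measure E3).restrict (frontier S)) :=
    isLocallyFiniteMeasure_of_isFiniteMeasureOnCompacts
  infer_instance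

theorem stabilityDensity_eq_zero_of_notMem (H H₁ H₂ : ℝ → ℝ) {X : E3 → E3} {x y : E3}
    (hx : x ∉ tsupport X) (hy : y ∉ tsupport X) : stabilityDensity H H₁ H₂ X (x, y) = 0 := by
  simp [stabilityDensity, divergence_eq_zero_of_notMem hx, divergence_eq_zero_of_notMem hy,
    image_eq_zero_of_notMem_tsupport hx, image_eq_zero_of_notMem_tsupport hy]

theorem continuous_stabilityDensity {X : E3 → E3} (hX : ContDiff ℝ ∞ X) {H H₁ H₂ : ℝ → ℝ}
    (hH : Continuous H) (hH₁ : Continuous H₁) (hH₂ : Continuous H₂) :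
    Continuous (stabilityDensity H H₁ H₂ X) := by
  have hd := (contDiff_divergence hX).continuous
  have hXc := hX.continuous
  have hD : Continuous fun x => fderiv ℝ X x (X x) :=
    (hX.continuous_fderiv (by simp)).clm_apply hXc
  have hn : Continuous fun z : E3 × E3 => ‖z.1 - z.2‖ ^ 2 := by fun_prop
  have d1 := hd.comp (continuous_fst (X := E3) (Y := E3))
  have d2 := hd.comp (continuous_snd (X := E3) (Y := E3))
  have x1 := hXc.comp (continuous_fst (X := E3) (Y := E3))
  have x2 := hXc.comp (continuous_snd (X := E3) (Y := E3))
  have D1 := hD.comp (continuous_fst (X := E3) (Y := E3))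
  have D2 := hD.comp (continuous_snd (X := E3) (Y := E3))
  have hz : Continuous fun z : E3 × E3 => z.1 - z.2 := by fun_prop
  have hq := (x1.sub x2).inner (𝕜 := ℝ) hz
  have c0 := hH.comp hn
  have c1 := hH₁.comp hn
  have c2 := hH₂.comp hn
  exact (((((((continuous_const.mul (d1.add d2)).mul c1).mul hq).add
    ((continuous_const.mul c2).mul (hq.pow 2))).add ((continuous_const.mul c1).mul
      (((D1.sub D2).inner hz).add ((x1.sub x2).norm.pow 2)))).add
    (((continuous_const.mul d1).mul d2).mul c0)).sub ((continuous_const.mul c1).mul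
      (((d1.smul x1).sub (d2.smul x2)).inner hz)))

theorem continuous_stabilityField {X : E3 → E3} (hX : ContDiff ℝ ∞ X) {H H₁ : ℝ → ℝ}
    (hH : Continuous H) (hH₁ : Continuous H₁) :
    Continuous fun z : E3 × E3 => stabilityField H H₁ X z.1 z.2 := by
  have hd := (contDiff_divergence hX).continuous
  have hXc := hX.continuous
  have hD : Continuous fun x => fderiv ℝ X x (X x) :=
    (hX.continuous_fderiv (by simp)).clm_apply hXc
  have hn : Continuous fun z : E3 × E3 => ‖z.1 - z.2‖ ^ 2 := by fun_prop
  have d1 := hd.comp (continuous_fst (X := E3) (Y := E3))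
  have x1 := hXc.comp (continuous_fst (X := E3) (Y := E3))
  have x2 := hXc.comp (continuous_snd (X := E3) (Y := E3))
  have D1 := hD.comp (continuous_fst (X := E3) (Y := E3))
  have hz : Continuous fun z : E3 × E3 => z.1 - z.2 := by fun_prop
  have q1 := x1.inner (𝕜 := ℝ) hz
  have q2 := x2.inner (𝕜 := ℝ) hz
  exact ((hH.comp hn).smul (((d1.smul x1).add D1).sub ((continuous_const.mul d1).smul x2))).add
    ((continuous_const.mul (hH₁.comp hn)).smul (((q1.smul x1).add (q2.smul x2)).sub
      ((continuous_const.mul q1).smul x2)))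

theorem contDiff_comp_norm_sub_sq {H : ℝ → ℝ} (hH : ContDiff ℝ ∞ H) (x : E3) :
    ContDiff ℝ ∞ (fun y : E3 => H (‖x - y‖ ^ 2)) :=
  hH.comp ((contDiff_const.sub contDiff_id).norm_sq ℝ)

theorem contDiff_stabilityField {X : E3 → E3} (hX : ContDiff ℝ ∞ X) {H H₁ : ℝ → ℝ}
    (hH : ContDiff ℝ ∞ H) (hH₁ : ContDiff ℝ ∞ H₁) (x : E3) :
    ContDiff ℝ ∞ (stabilityField H H₁ X x) := by
  have h1 := contDiff_comp_norm_sub_sq hH x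
  have h2 := contDiff_comp_norm_sub_sq hH₁ x
  have h3 : ContDiff ℝ ∞ fun y => inner ℝ (X x) (x - y) :=
    contDiff_const.inner ℝ (contDiff_const.sub contDiff_id)
  have h4 : ContDiff ℝ ∞ fun y => inner ℝ (X y) (x - y) :=
    hX.inner ℝ (contDiff_const.sub contDiff_id)
  have h5 := h1.fun_smul (contDiff_const.sub (contDiff_const.fun_smul hX) :
    ContDiff ℝ ∞ fun y => divergence X x • X x + fderiv ℝ X x (X x) - (2 * divergence X x) • X y)
  have h6 : ContDiff ℝ ∞ fun y => 2 * H₁ (‖x - y‖ ^ 2) := contDiff_const.mul h2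
  have h7 : ContDiff ℝ ∞ fun y => 2 * inner ℝ (X x) (x - y) := contDiff_const.mul h3
  exact h5.add (h6.fun_smul (((h3.fun_smul contDiff_const).add (h4.fun_smul hX)).sub
    (h7.fun_smul hX)))

/-- If `H` is supported in `[-M, M]`, the two-point expressions built from `H (|x - y|²)` and a field
supported in the unit ball are supported in the ball of radius `2 + M`. -/
theorem comp_norm_sub_sq_eq_zero_or {X : E3 → E3} {H : ℝ → ℝ} {M : ℝ} (hM : 0 ≤ M)
    (hX1 : tsupport X ⊆ Metric.ball 0 1) (hH : tsupport H ⊆ Metric.closedBall 0 M) {x y : E3}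
    (hz : 2 + M < ‖x‖ ∨ 2 + M < ‖y‖) :
    (H (‖x - y‖ ^ 2) = 0 ∧ deriv H (‖x - y‖ ^ 2) = 0 ∧ deriv (deriv H) (‖x - y‖ ^ 2) = 0) ∨
      (x ∉ tsupport X ∧ y ∉ tsupport X) := by
  by_cases h : x ∉ tsupport X ∧ y ∉ tsupport X
  · exact Or.inr h
  left
  -- One of the points is in the unit ball and the other beyond radius `2 + M`. Then `‖x - y‖ ^ 2`
  -- is at least `(1 + M) ^ 2 > M`.
  have hxy : 1 + M ≤ ‖x - y‖ := by
    have h1 := norm_sub_norm_le x y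
    have h2 := norm_sub_norm_le y x
    rw [norm_sub_rev] at h2
    have hb : ∀ v ∈ tsupport X, ‖v‖ < 1 := fun v hv => by simpa using hX1 hv
    rcases hz with hz | hz
    · have : y ∈ tsupport X := by
        by_contra hy
        refine h ⟨fun hx => ?_, hy⟩
        linarith [hb _ hx]
      linarith [hb _ this]
    · have : x ∈ tsupport X := by
        by_contra hx
        refine h ⟨hx, fun hy => ?_⟩
        linarith [hb _ hy]
      linarith [hb _ this]
  have hu : ‖x - y‖ ^ 2 ∉ tsupport H := fun hu => by
    have h1 := hH hu
    rw [mem_closedBall_zero_iff, Real.norm_of_nonneg (by positivity)] at h1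
    nlinarith
  have hu1 : ‖x - y‖ ^ 2 ∉ tsupport (deriv H) := fun h => hu (tsupport_deriv_subset h)
  exact ⟨image_eq_zero_of_notMem_tsupport hu, image_eq_zero_of_notMem_tsupport hu1,
    image_eq_zero_of_notMem_tsupport fun h => hu1 (tsupport_deriv_subset h)⟩

/-- The second variation for a smooth compactly supported kernel, as a boundary integral. -/
theorem IsC2Cone.integral_stabilityDensity_eq {S : Set E3} (hS : IsC2Cone S) {X : E3 → E3}
    (hX : ContDiff ℝ ∞ X) (hX1 : tsupport X ⊆ Metric.ball 0 1) {H : ℝ → ℝ}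
    (hH : ContDiff ℝ ∞ H) (hHc : HasCompactSupport H) :
    ∫ z in interactionSet S, stabilityDensity H (deriv H) (deriv (deriv H)) X z =
      ∫ y in frontier S, ∫ x in frontier S, H (‖x - y‖ ^ 2) * boundaryForm S X x y
        ∂μHE[2] ∂μHE[2] := by
  have hfin := hS.isFiniteMeasureOnCompacts_frontier
  have hsig := hS.sigmaFinite_frontier
  have hH1 : ContDiff ℝ ∞ (deriv H) := (contDiff_infty_iff_deriv.1 hH).2
  have hH2 : ContDiff ℝ ∞ (deriv (deriv H)) := (contDiff_infty_iff_deriv.1 hH1).2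
  obtain ⟨M, hM0, hM⟩ : ∃ M : ℝ, 0 ≤ M ∧ tsupport H ⊆ Metric.closedBall 0 M := by
    obtain ⟨M, hM⟩ := hHc.isCompact.isBounded.subset_closedBall 0
    exact ⟨max M 0, le_max_right _ _, hM.trans (Metric.closedBall_subset_closedBall (le_max_left _ _))⟩
  have hor := fun x y => comp_norm_sub_sq_eq_zero_or (x := x) (y := y) hM0 hX1 hM
  have hprod : ∀ z : E3 × E3, z ∉ Metric.closedBall (0 : E3 × E3) (2 + M) →
      2 + M < ‖z.1‖ ∨ 2 + M < ‖z.2‖ := by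
    intro z hz
    rw [mem_closedBall_zero_iff, not_le, Prod.norm_def] at hz
    exact lt_max_iff.1 hz
  have hfield0 : ∀ x y, 2 + M < ‖x‖ ∨ 2 + M < ‖y‖ → stabilityField H (deriv H) X x y = 0 := by
    intro x y h
    rcases hor x y h with ⟨h0, h1, -⟩ | ⟨hx, hy⟩
    · simp [stabilityField, h0, h1]
    · simp [stabilityField, divergence_eq_zero_of_notMem hx, image_eq_zero_of_notMem_tsupport hx,
        image_eq_zero_of_notMem_tsupport hy]
  have hdens : HasCompactSupport (stabilityDensity H (deriv H) (deriv (deriv H)) X) := by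
    refine HasCompactSupport.intro (isCompact_closedBall (0 : E3 × E3) (2 + M)) fun z hz => ?_
    rcases hor z.1 z.2 (hprod z hz) with ⟨h0, h1, h2⟩ | ⟨hx, hy⟩
    · simp [stabilityDensity, h0, h1, h2]
    · exact stabilityDensity_eq_zero_of_notMem _ _ _ hx hy
  have hdint : Integrable (stabilityDensity H (deriv H) (deriv (deriv H)) X) :=
    (continuous_stabilityDensity hX hH.continuous hH1.continuous
      hH2.continuous).integrable_of_hasCompactSupport hdens
  -- The density vanishes when both points are outside the unit ball, so the set of pairs may be
  -- enlarged to a product.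
  have e1 : ∫ z in interactionSet S, stabilityDensity H (deriv H) (deriv (deriv H)) X z =
      ∫ z in S ×ˢ Sᶜ, stabilityDensity H (deriv H) (deriv (deriv H)) X z := by
    refine (setIntegral_eq_of_subset_of_forall_sdiff_eq_zero
      (hS.isOpen.measurableSet.prod hS.isOpen.measurableSet.compl)
      (fun z hz => ⟨hz.1, hz.2.1⟩) fun z hz => ?_).symm
    have h : z.1 ∉ Metric.ball (0 : E3) 1 ∧ z.2 ∉ Metric.ball (0 : E3) 1 := by
      have := hz.2
      simp only [interactionSet, mem_ofPred_eq, not_and, not_or] at this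
      exact this hz.1.1 hz.1.2
    exact stabilityDensity_eq_zero_of_notMem _ _ _ (fun h' => h.1 (hX1 h')) fun h' => h.2 (hX1 h')
  -- The flux out of the complement has the opposite sign, which cancels the sign in
  -- `divergence_stabilityField`.
  have e2 : ∀ x, ∫ y in Sᶜ, stabilityDensity H (deriv H) (deriv (deriv H)) X (x, y) =
      ∫ y in frontier S, inner ℝ (stabilityField H (deriv H) X x y) (outwardNormal S y)
        ∂μHE[2] := by
    intro x
    have hc : HasCompactSupport (stabilityField H (deriv H) X x) :=
      HasCompactSupport.intro (isCompact_closedBall (0 : E3) (2 + M)) fun y hy =>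
        hfield0 x y (Or.inr (by simpa using hy))
    have h := (hS.integral_divergence ((contDiff_stabilityField hX hH hH1 x).of_le (by simp))
      hc).2
    simp only [divergence_stabilityField hX hH, integral_neg] at h
    linarith
  have hFc : HasCompactSupport fun z : E3 × E3 => stabilityField H (deriv H) X z.1 z.2 :=
    HasCompactSupport.intro (isCompact_closedBall (0 : E3 × E3) (2 + M)) fun z hz =>
        hfield0 z.1 z.2 (hprod z hz)
  have hFcont := continuous_stabilityField hX hH.continuous hH1.continuous
  have hFint : Integrable (Function.uncurry fun x y =>
      inner ℝ (stabilityField H (deriv H) X x y) (outwardNormal S y))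
      ((volume.restrict S).prod ((μHE[2] : Measure E3).restrict (frontier S))) := by
    have h1 := (hFcont.integrable_of_hasCompactSupport
      (μ := (volume.restrict S).prod ((μHE[2] : Measure E3).restrict (frontier S))) hFc)
    refine Integrable.mono h1 (h1.aestronglyMeasurable.inner
      hS.aestronglyMeasurable_outwardNormal.comp_snd) (Eventually.of_forall fun z => ?_)
    refine (norm_inner_le_norm _ _).trans ?_
    exact mul_le_of_le_one_right (norm_nonneg _) (norm_outwardNormal_le _)
  -- For fixed `y` the normal at `y` is a constant vector, and the second divergence is integrated
  -- in `x` over `S` itself.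
  have e3 : ∀ y, ∫ x in S, inner ℝ (stabilityField H (deriv H) X x y) (outwardNormal S y) =
      ∫ x in frontier S, H (‖x - y‖ ^ 2) * boundaryForm S X x y ∂μHE[2] := by
    intro y
    set w := outwardNormal S y with hw
    have hc : HasCompactSupport fun x => H (‖x - y‖ ^ 2) • (inner ℝ (X x) w • X x +
        inner ℝ (X y) w • X y - (2 * inner ℝ (X y) w) • X x) :=
      HasCompactSupport.intro (isCompact_closedBall (0 : E3) (2 + M)) fun x hx => by
        rcases hor x y (Or.inl (by simpa using hx)) with ⟨h0, -⟩ | ⟨hx, hy⟩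
        · simp [h0]
        · simp [image_eq_zero_of_notMem_tsupport hx, image_eq_zero_of_notMem_tsupport hy]
    have hd : ContDiff ℝ ∞ fun x => H (‖x - y‖ ^ 2) • (inner ℝ (X x) w • X x +
        inner ℝ (X y) w • X y - (2 * inner ℝ (X y) w) • X x) := by
      have h1 : ContDiff ℝ ∞ fun x => H (‖x - y‖ ^ 2) :=
        hH.comp ((contDiff_id.sub contDiff_const).norm_sq ℝ)
      have h2 : ContDiff ℝ ∞ fun x => inner ℝ (X x) w := hX.inner ℝ contDiff_const
      exact h1.fun_smul (((h2.fun_smul hX).add contDiff_const).sub (contDiff_const.fun_smul hX))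
    have h := (hS.integral_divergence (hd.of_le (by simp)) hc).1
    simp only [divergence_mul_form hX hH] at h
    rw [h]
    refine integral_congr_ae (Eventually.of_forall fun x => ?_)
    simp only [boundaryForm, inner_add_left, inner_sub_left, real_inner_smul_left, ← hw]
  rw [e1, Measure.volume_eq_prod, setIntegral_prod _ hdint.integrableOn]
  simp only [e2]
  rw [integral_integral_swap hFint]
  simp only [e3]

end

noncomputable section

/-! ### Truncation of the kernel -/

/-- A smooth bump on the line, equal to `1` on `[-1, 1]` and supported in `[-2, 2]`. -/
def lineBump : ContDiffBump (0 : ℝ) := ⟨1, 2, one_pos, one_lt_two⟩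

/-- The kernel profile, truncated smoothly to `|log u| ≤ 2 / ε`. -/
def cutoffKernel (s ε u : ℝ) : ℝ :=
  if 0 < u then kernelProfile s u * lineBump (ε * Real.log u) else 0

section

variable {s ε u : ℝ}

theorem cutoffKernel_nonneg : 0 ≤ cutoffKernel s ε u := by
  rw [cutoffKernel]
  split_ifs with h
  · exact mul_nonneg (kernelProfile_nonneg s h.le) lineBump.nonneg
  · exact le_rfl

theorem cutoffKernel_le (hu : 0 ≤ u) : cutoffKernel s ε u ≤ kernelProfile s u := by
  rw [cutoffKernel]
  split_ifs with h
  · exact mul_le_of_le_one_right (kernelProfile_nonneg s h.le) lineBump.le_one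
  · exact kernelProfile_nonneg s hu

theorem lineBump_eq_zero {t : ℝ} (ht : 2 ≤ |t|) : lineBump t = 0 :=
  lineBump.zero_of_le_dist (by simpa [lineBump] using ht)

theorem cutoffKernel_eq_zero_of_lt (hε : 0 < ε) (hu : u < Real.exp (-(2 / ε))) :
    cutoffKernel s ε u = 0 := by
  rw [cutoffKernel]
  split_ifs with h
  · have h1 : Real.log u < -(2 / ε) := (Real.log_lt_iff_lt_exp h).2 hu
    have h2 : ε * Real.log u < -2 := by
      have := mul_lt_mul_of_pos_left h1 hε
      rwa [mul_neg, mul_div_cancel₀ _ hε.ne'] at this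
    rw [lineBump_eq_zero (by rw [abs_of_neg (by linarith)]; linarith), mul_zero]
  · rfl

theorem cutoffKernel_eq_zero_of_gt (hε : 0 < ε) (hu : Real.exp (2 / ε) < u) :
    cutoffKernel s ε u = 0 := by
  have h : 0 < u := (Real.exp_pos _).trans hu
  rw [cutoffKernel, if_pos h]
  have h1 : 2 / ε < Real.log u := (Real.lt_log_iff_exp_lt h).2 hu
  have h2 : 2 < ε * Real.log u := by
    have := mul_lt_mul_of_pos_left h1 hε
    rwa [mul_div_cancel₀ _ hε.ne'] at this
  rw [lineBump_eq_zero (by rw [abs_of_pos (by linarith)]; exact h2.le), mul_zero]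

/-- The only doubtful points are `u ≤ 0`, and there the function vanishes on a whole neighbourhood.
-/
theorem contDiff_cutoffKernel (hε : 0 < ε) : ContDiff ℝ ∞ (cutoffKernel s ε) := by
  rw [contDiff_iff_contDiffAt]
  intro u
  by_cases hu : 0 < u
  · have h1 : cutoffKernel s ε =ᶠ[𝓝 u] fun u => kernelProfile s u * lineBump (ε * Real.log u) := by
      filter_upwards [lt_mem_nhds hu] with v hv
      rw [cutoffKernel, if_pos hv]
    refine ContDiffAt.congr_of_eventuallyEq ?_ h1
    have h2 : ContDiffAt ℝ ∞ (kernelProfile s) u := Real.contDiffAt_rpow_const_of_ne hu.ne'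
    have h3 : ContDiffAt ℝ ∞ (fun u => ε * Real.log u) u :=
      contDiffAt_const.mul (Real.contDiffAt_log.2 hu.ne')
    exact h2.mul ((lineBump.contDiff (n := ⊤)).contDiffAt.comp u h3)
  · have h1 : cutoffKernel s ε =ᶠ[𝓝 u] fun _ => 0 := by
      filter_upwards [gt_mem_nhds ((not_lt.1 hu).trans_lt (Real.exp_pos (-(2 / ε))))] with v hv
      exact cutoffKernel_eq_zero_of_lt hε hv
    exact contDiffAt_const.congr_of_eventuallyEq h1

theorem hasCompactSupport_cutoffKernel (hε : 0 < ε) : HasCompactSupport (cutoffKernel s ε) := by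
  refine HasCompactSupport.intro (isCompact_Icc (a := 0) (b := Real.exp (2 / ε))) fun u hu => ?_
  by_cases h : 0 ≤ u
  · exact cutoffKernel_eq_zero_of_gt hε (not_le.1 fun h' => hu ⟨h, h'⟩)
  · exact cutoffKernel_eq_zero_of_lt hε ((not_le.1 h).trans (Real.exp_pos _))

theorem hasDerivAt_comp_log {f : ℝ → ℝ} (hf : Differentiable ℝ f) (hu : 0 < u) :
    HasDerivAt (fun u => f (ε * Real.log u)) (deriv f (ε * Real.log u) * (ε / u)) u := by
  have h1 : HasDerivAt (fun u => ε * Real.log u) (ε / u) u := by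
    simpa [div_eq_mul_inv] using (Real.hasDerivAt_log hu.ne').const_mul ε
  exact (hf _).hasDerivAt.comp u h1

theorem deriv_cutoffKernel (hu : 0 < u) : deriv (cutoffKernel s ε) u =
    kernelProfile₁ s u * lineBump (ε * Real.log u) +
      kernelProfile s u * (deriv lineBump (ε * Real.log u) * (ε / u)) := by
  have h1 : cutoffKernel s ε =ᶠ[𝓝 u] fun u => kernelProfile s u * lineBump (ε * Real.log u) := by
    filter_upwards [lt_mem_nhds hu] with v hv
    rw [cutoffKernel, if_pos hv]
  rw [h1.deriv_eq]
  exact ((hasDerivAt_kernelProfile s hu).fun_mul (hasDerivAt_comp_log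
    ((lineBump.contDiff (n := 1)).differentiable one_ne_zero) hu)).deriv

theorem deriv_deriv_cutoffKernel (hu : 0 < u) : deriv (deriv (cutoffKernel s ε)) u =
    (kernelProfile₂ s u * lineBump (ε * Real.log u) +
      kernelProfile₁ s u * (deriv lineBump (ε * Real.log u) * (ε / u))) +
    (kernelProfile₁ s u * (deriv lineBump (ε * Real.log u) * (ε / u)) +
      kernelProfile s u * (deriv (deriv lineBump) (ε * Real.log u) * (ε / u) * (ε / u) +
        deriv lineBump (ε * Real.log u) * (-ε / u ^ 2))) := by
  have h1 : deriv (cutoffKernel s ε) =ᶠ[𝓝 u] fun u => kernelProfile₁ s u *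
      lineBump (ε * Real.log u) + kernelProfile s u * (deriv lineBump (ε * Real.log u) * (ε / u)) := by
    filter_upwards [lt_mem_nhds hu] with v hv
    exact deriv_cutoffKernel hv
  rw [h1.deriv_eq]
  have hd : Differentiable ℝ (deriv lineBump) :=
    ((contDiff_infty_iff_deriv.1 (lineBump.contDiff (n := ⊤))).2).differentiable (by simp)
  have h2 : HasDerivAt (fun u => ε / u) (-ε / u ^ 2) u := by
    have := (hasDerivAt_inv hu.ne').const_mul ε
    simp only [div_eq_mul_inv]
    exact this.congr_deriv (by ring)
  exact (((hasDerivAt_kernelProfile₁ s hu).fun_mul (hasDerivAt_comp_log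
    ((lineBump.contDiff (n := 1)).differentiable one_ne_zero) hu)).fun_add
    ((hasDerivAt_kernelProfile s hu).fun_mul
      ((hasDerivAt_comp_log hd hu).fun_mul h2))).deriv

/-- The cutoff is a function of `ε * log u`, so differentiating it produces factors `ε / u`, and `1
/ u ^ 2` up to `ε` at second order. For `ε ≤ 1` the truncated kernels thus obey the scale-invariant
bounds of the kernel, uniformly in `ε`. -/
theorem exists_cutoffKernel_bounds {s : ℝ} (hs0 : 0 < s) (hs1 : s < 1) :
    ∃ C : ℝ, 0 ≤ C ∧ ∀ ε u : ℝ, 0 < ε → ε ≤ 1 → 0 < u →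
      |cutoffKernel s ε u| ≤ C * kernelProfile s u ∧
      u * |deriv (cutoffKernel s ε) u| ≤ C * kernelProfile s u ∧
      u ^ 2 * |deriv (deriv (cutoffKernel s ε)) u| ≤ C * kernelProfile s u := by
  have hc1 : HasCompactSupport (deriv lineBump) := lineBump.hasCompactSupport.deriv
  have hd1 : ContDiff ℝ ∞ (deriv lineBump) :=
    (contDiff_infty_iff_deriv.1 (lineBump.contDiff (n := ⊤))).2
  have hd2 : ContDiff ℝ ∞ (deriv (deriv lineBump)) := (contDiff_infty_iff_deriv.1 hd1).2
  obtain ⟨D, hD⟩ := hd1.continuous.bounded_above_of_compact_support hc1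
  obtain ⟨D', hD'⟩ := hd2.continuous.bounded_above_of_compact_support hc1.deriv
  have hD0 : 0 ≤ D := (norm_nonneg _).trans (hD 0)
  have hD'0 : 0 ≤ D' := (norm_nonneg _).trans (hD' 0)
  -- In the second derivative, `6` comes from the undifferentiated cutoff, `6 + 6 + 1` from the
  -- terms with its first derivative and `1` from the term with its second.
  refine ⟨6 + 13 * D + D', by positivity, fun ε u hε hε1 hu => ?_⟩
  obtain ⟨b0, b1, b2⟩ := kernelProfile_bounds hs0 hs1 hu
  have hk := kernelProfile_nonneg s hu.le
  set k := kernelProfile s u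
  have hl0 : |lineBump (ε * Real.log u)| ≤ 1 := by
    rw [abs_of_nonneg lineBump.nonneg]; exact lineBump.le_one
  have hl1 : |deriv lineBump (ε * Real.log u)| ≤ D := hD _
  have hl2 : |deriv (deriv lineBump) (ε * Real.log u)| ≤ D' := hD' _
  set l0 := lineBump (ε * Real.log u)
  set l1 := deriv lineBump (ε * Real.log u)
  set l2 := deriv (deriv lineBump) (ε * Real.log u)
  set k1 := kernelProfile₁ s u
  set k2 := kernelProfile₂ s u
  have a0 : |u ^ 2 * k2 * l0| ≤ 6 * k := by
    rw [abs_mul, abs_mul, abs_of_pos (pow_pos hu 2)]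
    exact (mul_le_of_le_one_right (by positivity) hl0).trans b2
  have a1 : |u * k1 * l0| ≤ 6 * k := by
    rw [abs_mul, abs_mul, abs_of_pos hu]
    exact (mul_le_of_le_one_right (by positivity) hl0).trans b1
  have a2 : |u * k1 * (l1 * ε)| ≤ 6 * k * D := by
    rw [abs_mul, abs_mul, abs_of_pos hu]
    refine mul_le_mul b1 ?_ (abs_nonneg _) (by positivity)
    rw [abs_mul, abs_of_pos hε]
    exact (mul_le_of_le_one_right (abs_nonneg _) hε1).trans hl1
  have a3 : |k * (l1 * ε)| ≤ k * D := by
    rw [abs_mul, abs_of_nonneg hk]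
    gcongr
    rw [abs_mul, abs_of_pos hε]
    exact (mul_le_of_le_one_right (abs_nonneg _) hε1).trans hl1
  have a4 : |k * (l2 * ε * ε)| ≤ k * D' := by
    rw [abs_mul, abs_of_nonneg hk]
    gcongr
    rw [abs_mul, abs_mul, abs_of_pos hε]
    exact (mul_le_of_le_one_right (by positivity) hε1).trans
      ((mul_le_of_le_one_right (abs_nonneg _) hε1).trans hl2)
  have hab : ∀ c x : ℝ, 0 < c → c * |x| = |c * x| := fun c x hc => by
    rw [abs_mul, abs_of_pos hc]
  have hkD := mul_nonneg hk hD0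
  have hkD' := mul_nonneg hk hD'0
  refine ⟨?_, ?_, ?_⟩
  · rw [abs_of_nonneg cutoffKernel_nonneg]
    refine (cutoffKernel_le hu.le).trans ?_
    nlinarith
  · rw [deriv_cutoffKernel hu, hab _ _ hu]
    have : u * (k1 * l0 + k * (l1 * (ε / u))) = u * k1 * l0 + k * (l1 * ε) := by
      field_simp
    rw [this]
    refine (abs_add_le _ _).trans ?_
    nlinarith
  · have hu2 := pow_pos hu 2
    rw [deriv_deriv_cutoffKernel hu, hab _ _ hu2]
    have : u ^ 2 * (k2 * l0 + k1 * (l1 * (ε / u)) + (k1 * (l1 * (ε / u)) +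
        k * (l2 * (ε / u) * (ε / u) + l1 * (-ε / u ^ 2)))) =
        u ^ 2 * k2 * l0 + u * k1 * (l1 * ε) + (u * k1 * (l1 * ε) + (k * (l2 * ε * ε) -
          k * (l1 * ε))) := by
      field_simp
      ring
    rw [this]
    refine (abs_add_le _ _).trans ((add_le_add (abs_add_le _ _) ((abs_add_le _ _).trans
      (add_le_add_right (abs_sub _ _) _))).trans ?_)
    nlinarith

/-- The truncated kernels agree eventually with the kernel, with their derivatives. -/
theorem eventually_cutoffKernel_eq (s : ℝ) {u : ℝ} (hu : 0 < u) :
    ∀ᶠ n : ℕ in atTop, cutoffKernel s (1 / ((n : ℝ) + 1)) u = kernelProfile s u ∧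
      deriv (cutoffKernel s (1 / ((n : ℝ) + 1))) u = kernelProfile₁ s u ∧
      deriv (deriv (cutoffKernel s (1 / ((n : ℝ) + 1)))) u = kernelProfile₂ s u := by
  have ht : Tendsto (fun n : ℕ => 1 / ((n : ℝ) + 1) * Real.log u) atTop (𝓝 0) := by
    simpa using tendsto_one_div_add_atTop_nhds_zero_nat.mul_const (Real.log u)
  have hball : ∀ t ∈ Metric.ball (0 : ℝ) 1, lineBump =ᶠ[𝓝 t] fun _ => 1 := fun t ht => by
    filter_upwards [Metric.isOpen_ball.mem_nhds ht] with v hv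
    exact lineBump.one_of_mem_closedBall (Metric.ball_subset_closedBall hv)
  filter_upwards [ht.eventually (Metric.ball_mem_nhds 0 one_pos)] with n hn
  have e0 := (hball _ hn).eq_of_nhds
  have e1 : deriv lineBump =ᶠ[𝓝 (1 / ((n : ℝ) + 1) * Real.log u)] fun _ => 0 := by
    simpa using (hball _ hn).deriv
  have e2 : deriv (deriv lineBump) (1 / ((n : ℝ) + 1) * Real.log u) = 0 := by
    rw [e1.deriv_eq]; simp
  refine ⟨?_, ?_, ?_⟩
  · rw [cutoffKernel, if_pos hu, e0, mul_one]
  · rw [deriv_cutoffKernel hu, e0, e1.eq_of_nhds]; ring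
  · rw [deriv_deriv_cutoffKernel hu, e0, e1.eq_of_nhds, e2]; ring

end

/-- Stability of a cone, as a statement on boundary integrals with truncated kernels. -/
theorem IsStableCone.exists_tendsto_boundary {S : Set E3} {s : ℝ} (hs0 : 0 < s) (hs1 : s < 1)
    (hS : IsStableCone s S) {X : E3 → E3} (hX : ContDiff ℝ ∞ X) (hXc : HasCompactSupport X)
    (hX1 : tsupport X ⊆ Metric.ball 0 1 \ {0}) :
    ∃ l : ℝ, 0 ≤ l ∧ Tendsto (fun n : ℕ => ∫ y in frontier S, ∫ x in frontier S,
      cutoffKernel s (1 / ((n : ℝ) + 1)) (‖x - y‖ ^ 2) * boundaryForm S X x y ∂μHE[2] ∂μHE[2])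
      atTop (𝓝 l) := by
  have hS' : IsC2Cone S := ⟨hS.isOpen, hS.cone, hS.c2_boundary⟩
  -- The limit is the second variation for the singular kernel. Each boundary integral equals the
  -- corresponding integral over pairs across the boundary, where the kernel itself is a majorant.
  refine ⟨_, hS.integral_stabilityDensity_nonneg hs0 hs1 hX hXc hX1, ?_⟩
  have hε : ∀ n : ℕ, 0 < 1 / ((n : ℝ) + 1) := fun n => by positivity
  have hε1 : ∀ n : ℕ, 1 / ((n : ℝ) + 1) ≤ 1 := fun n => by
    rw [div_le_one (by positivity)]; simp
  simp only [← fun n => hS'.integral_stabilityDensity_eq hX (hX1.trans sdiff_subset)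
    (contDiff_cutoffKernel (s := s) (hε n)) (hasCompactSupport_cutoffKernel (hε n))]
  obtain ⟨C, hC0, hC⟩ := exists_abs_varDensity_le hX hXc
  obtain ⟨B, hB0, hB⟩ := exists_cutoffKernel_bounds hs0 hs1
  have hpos : ∀ z ∈ interactionSet S, 0 < ‖z.1 - z.2‖ ^ 2 := fun z hz => by
    have := sub_ne_zero.2 (ne_of_mem_interactionSet hz)
    positivity
  have hm := measurableSet_interactionSet hS.isOpen.measurableSet
  refine tendsto_integral_of_dominated_convergence
    (fun z => C * (B * kernelProfile s (‖z.1 - z.2‖ ^ 2))) (fun n => ?_)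
    (((hS'.integrableOn_kernelProfile hS.nonempty_frontier hs0 hs1).const_mul B).const_mul C)
    (fun n => ?_) ?_
  · have h0 := contDiff_cutoffKernel (s := s) (hε n)
    have h1 := (contDiff_infty_iff_deriv.1 h0).2
    have h2 := (contDiff_infty_iff_deriv.1 h1).2
    exact (continuous_stabilityDensity hX h0.continuous h1.continuous
      h2.continuous).aestronglyMeasurable
  · filter_upwards [ae_restrict_mem hm] with z hz
    obtain ⟨b0, b1, b2⟩ := hB _ _ (hε n) (hε1 n) (hpos z hz)
    exact (hC _ _ _ z _ b0 b1 b2).2.2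
  · filter_upwards [ae_restrict_mem hm] with z hz
    refine tendsto_const_nhds.congr' ?_
    filter_upwards [eventually_cutoffKernel_eq s (hpos z hz)] with n hn
    simp only [stabilityDensity, hn.1, hn.2.1, hn.2.2]

end

noncomputable section

/-! ### Riesz potentials of the boundary measure -/

theorem EuclideanSpace.abs_apply_le_norm (x : E3) (i : Fin 3) : |x i| ≤ ‖x‖ := by
  simpa using PiLp.norm_apply_le x i

namespace IsConicChart

variable {S : Set E3} {p e τ : E3} {α β κ : ℝ} {g : ℝ → ℝ} {L : E3 ≃L[ℝ] E3}

/-- On the trace the curve parameter is a Lipschitz function of the point, and it extends to the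
whole space. Hence `|v - V x| ≤ K * ‖x - c‖` for the curve point `c` with parameter `v` and every
`x`, on the trace or not, which reduces potentials of the trace to potentials on a line. -/
theorem exists_lipschitzWith_coord (h : IsConicChart S p e τ α β κ g)
    (hc : ∀ c : ℝ, 0 < c → c • S = S) (hL : ∀ y, L y = y 0 • p + y 1 • e + y 2 • τ) :
    ∃ (K : NNReal) (V : E3 → ℝ), LipschitzWith K V ∧ ∀ v ∈ Ioo (-β) β,
      V (‖p + g v • e + v • τ‖⁻¹ • (p + g v • e + v • τ)) = v := by
  set Q : ℝ := ‖p‖ + α * ‖e‖ + β * ‖τ‖ with hQ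
  have hQ0 : 0 ≤ Q := by have := h.α_pos; have := h.β_pos; positivity
  set N : ℝ := ‖(L.symm : E3 →L[ℝ] E3)‖ with hN
  have hβ := h.β_pos
  have hlip : LipschitzOnWith (Q * ((1 + β) * N)).toNNReal
      (fun x => L.symm x 2 / L.symm x 0) (coneTrace S ∩ conicBox L α β) := by
    refine LipschitzOnWith.of_dist_le_mul fun x hx y hy => ?_
    rw [Real.coe_toNNReal _ (by positivity), Real.dist_eq, dist_eq_norm]
    have hx0 : 0 < L.symm x 0 := hx.2.1
    have hy0 : 0 < L.symm y 0 := hy.2.1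
    -- A unit vector in the box is its first coordinate times a vector of norm at most `Q`.
    have hinv : (L.symm x 0)⁻¹ ≤ Q := by
      have h1 : ‖x‖ = 1 := by simpa using hx.1.2
      obtain ⟨hu, hv⟩ := coord_div_mem hx.2
      rw [eq_smul_of_mem hL hx.2, norm_smul, Real.norm_of_nonneg hx0.le] at h1
      rw [inv_eq_of_mul_eq_one_right h1]
      refine (norm_add_le _ _).trans (add_le_add ((norm_add_le _ _).trans ?_) ?_)
      · gcongr
        rw [norm_smul]
        gcongr
        exact (abs_lt.2 hu).le
      · rw [norm_smul]
        gcongr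
        exact (abs_lt.2 hv).le
    obtain ⟨-, hvy⟩ := coord_div_mem hy.2
    have hvy' : |L.symm y 2 / L.symm y 0| ≤ β := (abs_lt.2 hvy).le
    have hd : ∀ i, |L.symm x i - L.symm y i| ≤ N * ‖x - y‖ := fun i => by
      have h1 := (EuclideanSpace.abs_apply_le_norm (L.symm (x - y)) i).trans
        ((L.symm : E3 →L[ℝ] E3).le_opNorm (x - y))
      rwa [map_sub, PiLp.sub_apply] at h1
    have heq : L.symm x 2 / L.symm x 0 - L.symm y 2 / L.symm y 0 = (L.symm x 0)⁻¹ *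
        ((L.symm x 2 - L.symm y 2) - L.symm y 2 / L.symm y 0 * (L.symm x 0 - L.symm y 0)) := by
      field_simp
      ring
    rw [heq, abs_mul, abs_of_pos (inv_pos.2 hx0), mul_assoc Q]
    refine mul_le_mul hinv ?_ (abs_nonneg _) hQ0
    refine (abs_sub _ _).trans ?_
    rw [abs_mul]
    calc _ ≤ N * ‖x - y‖ + β * (N * ‖x - y‖) := by
          gcongr
          · exact hd 2
          · exact hd 0
      _ = _ := by ring
  obtain ⟨V, hV, hVe⟩ := hlip.extend_real
  refine ⟨_, V, hV, fun v hv => ?_⟩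
  have h0 := norm_ne_zero_iff.2 (curve_ne_zero hL (g v) v)
  rw [← hVe (by rw [h.coneTrace_inter_conicBox hc hL]; exact ⟨v, hv, rfl⟩)]
  simp only [map_smul, symm_curve hL]
  simp
  field_simp

theorem exists_lintegral_rpow_le (h : IsConicChart S p e τ α β κ g)
    (hc : ∀ c : ℝ, 0 < c → c • S = S) (hL : ∀ y, L y = y 0 • p + y 1 • e + y 2 • τ)
    {q : ℝ} (hq0 : 0 < q) (hq1 : q < 1) :
    ∃ C : ℝ≥0∞, C ≠ ⊤ ∧ ∀ x, ∫⁻ y in coneTrace S ∩ conicBox L α (β / 2),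
      ENNReal.ofReal ‖x - y‖ ^ (-q) ∂μHE[1] ≤ C := by
  have h' := h.mono (half_pos h.β_pos) (by linarith [h.β_pos] : β / 2 ≤ β)
  obtain ⟨K, V, hV, hVe⟩ := h'.exists_lipschitzWith_coord hc hL
  have hsub : Icc (-(β / 2)) (β / 2) ⊆ Ioo (-β) β := fun v hv =>
    ⟨by linarith [hv.1, h.β_pos], by linarith [hv.2, h.β_pos]⟩
  have hcont : ContinuousOn (fun v => parallelogramArea (p + g v • e + v • τ) (deriv g v • e + τ)
      / ‖p + g v • e + v • τ‖ ^ 2) (Icc (-(β / 2)) (β / 2)) := by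
    have h2 : ContinuousOn (fun v => p + g v • e + v • τ) (Icc (-(β / 2)) (β / 2)) := by
      have := h.contDiffOn.continuousOn.mono hsub
      fun_prop
    have h3 : ContinuousOn (fun v => deriv g v • e + τ) (Icc (-(β / 2)) (β / 2)) :=
      ((h.continuousOn_deriv.mono hsub).smul continuousOn_const).add continuousOn_const
    refine ContinuousOn.div (Real.continuous_sqrt.comp_continuousOn
      (((h2.norm.pow 2).mul (h3.norm.pow 2)).sub ((h2.inner h3).pow 2))) (h2.norm.pow 2) ?_
    exact fun v _ => pow_ne_zero _ (norm_ne_zero_iff.2 (curve_ne_zero hL _ _))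
  obtain ⟨J, hJ⟩ := isCompact_Icc.exists_bound_of_continuousOn hcont
  obtain ⟨C, hC, hCb⟩ := exists_lintegral_abs_rpow_le hq0 hq1 (β / 2)
  -- The factor is `K + 1` rather than `K` so that it is nonzero and can be moved across a negative
  -- power in `[0, ∞]`.
  refine ⟨(K + 1 : ℝ≥0∞) ^ q * ENNReal.ofReal J * C, ENNReal.mul_ne_top (ENNReal.mul_ne_top
    (ENNReal.rpow_ne_top_of_nonneg hq0.le (by simp)) ENNReal.ofReal_ne_top) hC, fun x => ?_⟩
  have hm : Measurable fun y : E3 => ENNReal.ofReal ‖x - y‖ ^ (-q) := by fun_prop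
  rw [h'.lintegral_coneTrace hc hL hm]
  calc _ ≤ ∫⁻ v in Ioo (-(β / 2)) (β / 2), (K + 1 : ℝ≥0∞) ^ q * ENNReal.ofReal J *
        ENNReal.ofReal |v - V x| ^ (-q) := by
        refine setLIntegral_mono' measurableSet_Ioo fun v hv => ?_
        set c := ‖p + g v • e + v • τ‖⁻¹ • (p + g v • e + v • τ) with hcdef
        have h1 : |v - V x| ≤ (K + 1) * ‖x - c‖ := by
          have := hV.dist_le_mul c x
          rw [hVe v hv, Real.dist_eq, dist_eq_norm, norm_sub_rev] at this
          nlinarith [norm_nonneg (x - c)]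
        have h2 : ENNReal.ofReal |v - V x| ≤ (K + 1 : ℝ≥0∞) * ENNReal.ofReal ‖x - c‖ := by
          refine (ENNReal.ofReal_le_ofReal h1).trans (le_of_eq ?_)
          rw [ENNReal.ofReal_mul (by positivity), ENNReal.ofReal_add (by positivity) zero_le_one]
          simp
        have h3 : ENNReal.ofReal ‖x - c‖ ^ (-q) ≤
            (K + 1 : ℝ≥0∞) ^ q * ENNReal.ofReal |v - V x| ^ (-q) := by
          have h4 : ((K + 1 : ℝ≥0∞) * ENNReal.ofReal ‖x - c‖) ^ (-q) ≤
              ENNReal.ofReal |v - V x| ^ (-q) := by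
            rw [ENNReal.rpow_neg, ENNReal.rpow_neg]
            exact ENNReal.inv_le_inv.2 (ENNReal.rpow_le_rpow h2 hq0.le)
          have hK0 : (K + 1 : ℝ≥0∞) ≠ 0 := by simp
          have hK1 : (K + 1 : ℝ≥0∞) ≠ ⊤ := by simp
          refine le_trans (le_of_eq ?_) (mul_le_mul_right h4 ((K + 1 : ℝ≥0∞) ^ q))
          rw [ENNReal.mul_rpow_of_ne_top hK1 ENNReal.ofReal_ne_top, ← mul_assoc,
            ← ENNReal.rpow_add _ _ hK0 hK1]
          simp
        have h5 : ENNReal.ofReal (parallelogramArea (p + g v • e + v • τ) (deriv g v • e + τ)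
            / ‖p + g v • e + v • τ‖ ^ 2) ≤ ENNReal.ofReal J :=
          ENNReal.ofReal_le_ofReal ((le_abs_self _).trans (hJ v (Ioo_subset_Icc_self hv)))
        refine (mul_le_mul' h3 h5).trans (le_of_eq ?_)
        ring
    _ ≤ ∫⁻ v in Icc (-(β / 2)) (β / 2), (K + 1 : ℝ≥0∞) ^ q * ENNReal.ofReal J *
        ENNReal.ofReal |v - V x| ^ (-q) := lintegral_mono_set Ioo_subset_Icc_self
    _ ≤ _ := by
        rw [lintegral_const_mul _ (by fun_prop)]
        gcongr
        exact hCb _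

end IsConicChart

/-- The trace is compact and the local bounds hold for every `x` in space, so finitely many of them
add up. -/
theorem IsC2Cone.exists_lintegral_coneTrace_rpow_le {S : Set E3} (hS : IsC2Cone S) {q : ℝ}
    (hq0 : 0 < q) (hq1 : q < 1) : ∃ C : ℝ≥0∞, C ≠ ⊤ ∧ ∀ x,
      ∫⁻ y in coneTrace S, ENNReal.ofReal ‖x - y‖ ^ (-q) ∂μHE[1] ≤ C := by
  have key := (isCompact_coneTrace S).induction_on (p := fun T => ∃ C : ℝ≥0∞, C ≠ ⊤ ∧ ∀ x,
      ∫⁻ y in coneTrace S ∩ T, ENNReal.ofReal ‖x - y‖ ^ (-q) ∂μHE[1] ≤ C) ⟨0, by simp, by simp⟩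
    (fun T T' hT ⟨C, hC, h⟩ => ⟨C, hC, fun x =>
      (lintegral_mono_set (inter_subset_inter_right _ hT)).trans (h x)⟩)
    (fun T T' ⟨C, hC, h⟩ ⟨C', hC', h'⟩ => ⟨C + C', ENNReal.add_ne_top.2 ⟨hC, hC'⟩, fun x => by
      rw [inter_union_distrib_left]
      exact (lintegral_union_le _ _ _).trans (add_le_add (h x) (h' x))⟩)
    (fun p hp => by
      have hp0 : p ≠ 0 := by
        rintro rfl
        simpa using hp.2
      obtain ⟨e, τ, L, α, β, κ, g, h, hL⟩ := hS.exists_chart_normal hp.1 hp0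
      have h' := h.mono (half_pos h.β_pos) (by linarith [h.β_pos] : β / 2 ≤ β)
      exact ⟨conicBox L α (β / 2), mem_nhdsWithin_of_mem_nhds
        ((isOpen_conicBox L α (β / 2)).mem_nhds (h'.mem_conicBox_base hL)),
        h.exists_lintegral_rpow_le hS.cone hL hq0 hq1⟩)
  simpa using key

end

/-! ### Integrability on the boundary of the kernel damped near the diagonal -/

noncomputable section

/-- The kernel, damped near the diagonal: `min(1, |z|²) |z|^{-(3+s)}` as a function of `u = |z|²`. -/
def dampedKernel (s u : ℝ) : ℝ := min 1 u * kernelProfile s u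

theorem dampedKernel_nonneg (s : ℝ) {u : ℝ} (hu : 0 ≤ u) : 0 ≤ dampedKernel s u :=
  mul_nonneg (le_min zero_le_one hu) (kernelProfile_nonneg s hu)

theorem measurable_dampedKernel (s : ℝ) : Measurable (dampedKernel s) :=
  (measurable_const.min measurable_id).mul (measurable_kernelProfile s)

theorem dampedKernel_le_of_le_norm {s : ℝ} (hs : 0 < s) {d : ℝ} (hd : 0 < d) {z : E3}
    (hz : d ≤ ‖z‖) : dampedKernel s (‖z‖ ^ 2) ≤ d ^ (-(3 + s)) := by
  have h1 : dampedKernel s (‖z‖ ^ 2) ≤ kernelProfile s (‖z‖ ^ 2) :=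
    mul_le_of_le_one_left (kernelProfile_nonneg s (sq_nonneg _)) (min_le_left _ _)
  refine h1.trans ?_
  rw [kernelProfile_norm_sq, one_div, Real.rpow_neg hd.le]
  gcongr

theorem ENNReal.rpow_neg_le_rpow_neg {a b : ℝ≥0∞} (hab : a ≤ b) {q : ℝ} (hq : 0 ≤ q) :
    b ^ (-q) ≤ a ^ (-q) := by
  rw [ENNReal.rpow_neg, ENNReal.rpow_neg]
  exact ENNReal.inv_le_inv.2 (ENNReal.rpow_le_rpow hab hq)

/-- Damping leaves `‖z‖ ^ (-(1 + s))`, which is not integrable on a line. It is split into two equal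
powers of exponent `(1 + s) / 2 < 1`, one to be charged to the radial variable and one to the
position on the trace. -/
theorem ofReal_dampedKernel_le {s : ℝ} (hs : 0 < s) {a b : ℝ} {z : E3} (ha : a ≤ ‖z‖)
    (hb : b ≤ ‖z‖) : ENNReal.ofReal (dampedKernel s (‖z‖ ^ 2)) ≤
      ENNReal.ofReal a ^ (-((1 + s) / 2)) * ENNReal.ofReal b ^ (-((1 + s) / 2)) := by
  by_cases hz : z = 0
  · simp [hz, dampedKernel]
  have hz0 : 0 < ‖z‖ := norm_pos_iff.2 hz
  have h1 : dampedKernel s (‖z‖ ^ 2) ≤ ‖z‖ ^ (-((1 + s) / 2)) * ‖z‖ ^ (-((1 + s) / 2)) := by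
    have h2 : dampedKernel s (‖z‖ ^ 2) ≤ ‖z‖ ^ 2 * kernelProfile s (‖z‖ ^ 2) :=
      mul_le_mul_of_nonneg_right (min_le_right _ _) (kernelProfile_nonneg s (sq_nonneg _))
    refine h2.trans (le_of_eq ?_)
    rw [kernelProfile_norm_sq, one_div, ← Real.rpow_neg hz0.le, ← Real.rpow_natCast,
      ← Real.rpow_add hz0, ← Real.rpow_add hz0]
    congr 1
    push_cast
    ring
  refine (ENNReal.ofReal_le_ofReal h1).trans ?_
  rw [ENNReal.ofReal_mul (by positivity), ← ENNReal.ofReal_rpow_of_pos hz0]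
  exact mul_le_mul' (ENNReal.rpow_neg_le_rpow_neg (ENNReal.ofReal_le_ofReal ha) (by linarith))
    (ENNReal.rpow_neg_le_rpow_neg (ENNReal.ofReal_le_ofReal hb) (by linarith))

/-- The law of cosines in a form that shows both lower bounds at once: by the difference of the
radii and by a multiple of the distance on the sphere. -/
theorem norm_smul_sub_smul_sq {x y : E3} (hx : ‖x‖ = 1) (hy : ‖y‖ = 1) (R r : ℝ) :
    ‖R • x - r • y‖ ^ 2 = (R - r) ^ 2 + R * r * ‖x - y‖ ^ 2 := by
  rw [@norm_sub_sq_real, @norm_sub_sq_real, norm_smul, norm_smul, real_inner_smul_left,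
    real_inner_smul_right, hx, hy, mul_one, mul_one, Real.norm_eq_abs, Real.norm_eq_abs, sq_abs,
    sq_abs]
  ring

/-- For `r ≤ a / 2` and for `r ≥ 2 * b` the two points are apart by at least `a / 2` and `r / 2`
respectively. In between, `ofReal_dampedKernel_le` is used with the lower bounds `|r - R|` and `a /
2 * ‖x - y‖`. -/
theorem ofReal_dampedKernel_polar_le {s : ℝ} (hs : 0 < s) {a b R r : ℝ} (ha : 0 < a)
    (haR : a ≤ R) (hRb : R ≤ b) (hr : 0 < r) {x y : E3} (hx : ‖x‖ = 1) (hy : ‖y‖ = 1) :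
    ENNReal.ofReal r * ENNReal.ofReal (dampedKernel s (‖R • x - r • y‖ ^ 2)) ≤
      ((Ioo 0 (2 * b)).indicator (fun _ => ENNReal.ofReal (2 * b * (a / 2) ^ (-(3 + s)))) r +
        (Ici (2 * b)).indicator (fun r => ENNReal.ofReal (2 ^ (3 + s) * r ^ (-(2 + s)))) r) +
      (Ioo 0 (2 * b)).indicator (fun r => ENNReal.ofReal (2 * b) *
        ENNReal.ofReal (a / 2) ^ (-((1 + s) / 2)) * ENNReal.ofReal |r - R| ^ (-((1 + s) / 2))) r *
        ENNReal.ofReal ‖x - y‖ ^ (-((1 + s) / 2)) := by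
  have hR : 0 < R := ha.trans_le haR
  have hdist : |r - R| ≤ ‖R • x - r • y‖ := by
    refine abs_le_of_sq_le_sq ?_ (norm_nonneg _)
    rw [norm_smul_sub_smul_sq hx hy]
    nlinarith [mul_nonneg (mul_pos hR hr).le (sq_nonneg ‖x - y‖)]
  by_cases hrb : r < 2 * b
  · rw [indicator_of_mem (mem_Ioo.2 ⟨hr, hrb⟩), indicator_of_mem (mem_Ioo.2 ⟨hr, hrb⟩)]
    by_cases hra : r ≤ a / 2
    · refine le_trans ?_ le_self_add
      refine le_trans ?_ le_self_add
      rw [← ENNReal.ofReal_mul hr.le]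
      refine ENNReal.ofReal_le_ofReal (mul_le_mul hrb.le (dampedKernel_le_of_le_norm hs
        (half_pos ha) (le_trans ?_ hdist)) (dampedKernel_nonneg s (sq_nonneg _)) (by linarith))
      rw [abs_of_neg (by linarith)]
      linarith
    · refine le_trans ?_ le_add_self
      have hB : a / 2 * ‖x - y‖ ≤ ‖R • x - r • y‖ := by
        refine le_of_sq_le_sq ?_ (norm_nonneg _)
        rw [norm_smul_sub_smul_sq hx hy, mul_pow]
        have : (a / 2) ^ 2 ≤ R * r := by nlinarith
        nlinarith [mul_le_mul_of_nonneg_right this (sq_nonneg ‖x - y‖), sq_nonneg (R - r)]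
      have h1 := ofReal_dampedKernel_le hs hdist hB
      rw [ENNReal.ofReal_mul (half_pos ha).le, ENNReal.mul_rpow_of_ne_top ENNReal.ofReal_ne_top
        ENNReal.ofReal_ne_top] at h1
      refine (mul_le_mul' (ENNReal.ofReal_le_ofReal hrb.le) h1).trans (le_of_eq ?_)
      ring
  · refine le_trans ?_ le_self_add
    refine le_trans ?_ le_add_self
    rw [indicator_of_mem (mem_Ici.2 (not_lt.1 hrb)), ← ENNReal.ofReal_mul hr.le]
    have h1 : dampedKernel s (‖R • x - r • y‖ ^ 2) ≤ (r / 2) ^ (-(3 + s)) := by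
      refine dampedKernel_le_of_le_norm hs (half_pos hr) (le_trans ?_ hdist)
      refine le_trans ?_ (le_abs_self _)
      linarith
    refine ENNReal.ofReal_le_ofReal ((mul_le_mul_of_nonneg_left h1 hr.le).trans (le_of_eq ?_))
    rw [Real.div_rpow hr.le two_pos.le, Real.rpow_neg two_pos.le, div_inv_eq_mul, mul_comm _ (2 ^ _),
      mul_left_comm]
    congr 1
    conv_lhs => rw [← Real.rpow_one r]
    rw [← Real.rpow_mul hr.le, one_mul, ← Real.rpow_add hr]
    congr 1
    ring

/-- In polar coordinates the majorant has three parts: a constant on a bounded interval, a tail `r ^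
(-(2 + s))`, and a product of a one-dimensional potential in `r` with a potential of the trace. -/
theorem IsC2Cone.exists_lintegral_dampedKernel_le {S : Set E3} (hS : IsC2Cone S) {s : ℝ}
    (hs0 : 0 < s) (hs1 : s < 1) {a b : ℝ} (ha : 0 < a) (hab : a ≤ b) :
    ∃ C : ℝ≥0∞, C ≠ ⊤ ∧ ∀ x : E3, a ≤ ‖x‖ → ‖x‖ ≤ b →
      ∫⁻ y in frontier S, ENNReal.ofReal (dampedKernel s (‖x - y‖ ^ 2)) ∂μHE[2] ≤ C := by
  have hfin := hS.isFiniteMeasure_coneTrace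
  obtain ⟨C, hC, hCb⟩ := hS.exists_lintegral_coneTrace_rpow_le (q := (1 + s) / 2)
    (by linarith) (by linarith)
  obtain ⟨D, hD, hDb⟩ := exists_lintegral_abs_rpow_le (s := (1 + s) / 2)
    (by linarith) (by linarith) (2 * b)
  set m := (μHE[1] : Measure E3) (coneTrace S) with hm
  have hmfin : m ≠ ⊤ := hS.coneTrace_measure_lt_top.ne
  set I := ∫⁻ r in Ici (2 * b), ENNReal.ofReal (2 ^ (3 + s) * r ^ (-(2 + s))) with hI
  have hIfin : I ≠ ⊤ := by
    have h1 : IntegrableOn (fun r : ℝ => 2 ^ (3 + s) * r ^ (-(2 + s))) (Ici (2 * b)) := by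
      rw [integrableOn_Ici_iff_integrableOn_Ioi]
      exact (integrableOn_Ioi_rpow_of_lt (by linarith) (by linarith)).const_mul _
    exact h1.lintegral_lt_top.ne
  set A := ENNReal.ofReal (2 * b * (a / 2) ^ (-(3 + s))) with hA
  set B := ENNReal.ofReal (2 * b) * ENNReal.ofReal (a / 2) ^ (-((1 + s) / 2)) with hB
  have hBfin : B ≠ ⊤ := ENNReal.mul_ne_top ENNReal.ofReal_ne_top
    (ENNReal.rpow_ne_top_of_ne_zero (by simpa using ha) ENNReal.ofReal_ne_top)
  refine ⟨(A * ENNReal.ofReal (2 * b) + I) * m + B * D * C, ENNReal.add_ne_top.2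
    ⟨ENNReal.mul_ne_top (ENNReal.add_ne_top.2 ⟨ENNReal.mul_ne_top ENNReal.ofReal_ne_top
      ENNReal.ofReal_ne_top, hIfin⟩) hmfin, ENNReal.mul_ne_top (ENNReal.mul_ne_top hBfin hD) hC⟩,
    fun x hax hxb => ?_⟩
  have hR : 0 < ‖x‖ := ha.trans_le hax
  set e := ‖x‖⁻¹ • x with he
  have he1 : ‖e‖ = 1 := by
    rw [he, norm_smul, norm_inv, norm_norm, inv_mul_cancel₀ hR.ne']
  have hxe : x = ‖x‖ • e := by rw [he, smul_smul, mul_inv_cancel₀ hR.ne', one_smul]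
  have hmeas : Measurable fun y : E3 => ENNReal.ofReal (dampedKernel s (‖x - y‖ ^ 2)) :=
    ((measurable_dampedKernel s).comp (by fun_prop)).ennreal_ofReal
  rw [hS.lintegral_frontier hmeas]
  set g₁ : ℝ → ℝ≥0∞ := fun r => (Ioo 0 (2 * b)).indicator (fun _ => A) r +
    (Ici (2 * b)).indicator (fun r => ENNReal.ofReal (2 ^ (3 + s) * r ^ (-(2 + s)))) r with hg₁
  set g₂ : ℝ → ℝ≥0∞ := (Ioo 0 (2 * b)).indicator
    (fun r => B * ENNReal.ofReal |r - ‖x‖| ^ (-((1 + s) / 2))) with hg₂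
  have hg₁m : Measurable g₁ := by
    refine (measurable_const.indicator measurableSet_Ioo).add
      (Measurable.indicator (by fun_prop) measurableSet_Ici)
  have hg₂m : Measurable g₂ := Measurable.indicator (by fun_prop) measurableSet_Ioo
  have step1 : ∀ r ∈ Ioi (0 : ℝ), ENNReal.ofReal r * ∫⁻ y in coneTrace S,
      ENNReal.ofReal (dampedKernel s (‖x - r • y‖ ^ 2)) ∂μHE[1] ≤ g₁ r * m + g₂ r * C := by
    intro r hr
    have hmr : Measurable fun y : E3 => ENNReal.ofReal (dampedKernel s (‖x - r • y‖ ^ 2)) :=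
      ((measurable_dampedKernel s).comp (by fun_prop)).ennreal_ofReal
    rw [← lintegral_const_mul _ hmr]
    calc _ ≤ ∫⁻ y in coneTrace S, (g₁ r + g₂ r * ENNReal.ofReal ‖e - y‖ ^ (-((1 + s) / 2)))
          ∂μHE[1] := by
          refine setLIntegral_mono' (measurableSet_coneTrace S) fun y hy => ?_
          have hy1 : ‖y‖ = 1 := by simpa using hy.2
          have h := ofReal_dampedKernel_polar_le hs0 ha hax hxb hr he1 hy1
          rwa [← hxe] at h
      _ = g₁ r * m + g₂ r * ∫⁻ y in coneTrace S, ENNReal.ofReal ‖e - y‖ ^ (-((1 + s) / 2))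
          ∂μHE[1] := by
          rw [lintegral_add_left measurable_const, lintegral_const, Measure.restrict_apply_univ,
            lintegral_const_mul _ (by fun_prop)]
      _ ≤ _ := by
          gcongr
          exact hCb e
  refine (setLIntegral_mono' measurableSet_Ioi step1).trans ?_
  rw [lintegral_add_left (hg₁m.mul_const m), lintegral_mul_const _ hg₁m,
    lintegral_mul_const _ hg₂m]
  refine add_le_add ?_ ?_
  · gcongr
    rw [lintegral_add_left (measurable_const.indicator measurableSet_Ioo)]
    refine add_le_add ?_ ?_
    · refine (setLIntegral_le_lintegral _ _).trans ?_
      rw [lintegral_indicator measurableSet_Ioo, setLIntegral_const, Real.volume_Ioo, sub_zero]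
    · refine (setLIntegral_le_lintegral _ _).trans ?_
      rw [lintegral_indicator measurableSet_Ici]
  · gcongr
    refine (setLIntegral_le_lintegral _ _).trans ?_
    rw [hg₂, lintegral_indicator measurableSet_Ioo, lintegral_const_mul _ (by fun_prop)]
    gcongr
    have hsub : Ioo 0 (2 * b) ⊆ Icc (-(2 * b)) (2 * b) := fun r hr =>
      ⟨by linarith [hr.1, hr.2], hr.2.le⟩
    exact (lintegral_mono_set hsub).trans (hDb ‖x‖)

/-- The closed annulus `a ≤ |x| ≤ b`. -/
def annulus (a b : ℝ) : Set E3 := {x | a ≤ ‖x‖ ∧ ‖x‖ ≤ b}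

theorem isClosed_annulus (a b : ℝ) : IsClosed (annulus a b) :=
  (isClosed_le continuous_const continuous_norm).inter
    (isClosed_le continuous_norm continuous_const)

theorem isCompact_annulus (a b : ℝ) : IsCompact (annulus a b) :=
  (isCompact_closedBall (0 : E3) b).of_isClosed_subset (isClosed_annulus a b)
    fun x hx => by simpa using hx.2

/-- The variations are supported in an annulus, so at least one point of each relevant pair lies
there. The two indicators are exchanged by swapping the points. -/
theorem IsC2Cone.integrable_dampedKernel {S : Set E3} (hS : IsC2Cone S) {s : ℝ}
    (hs0 : 0 < s) (hs1 : s < 1) {a b : ℝ} (ha : 0 < a) (hab : a ≤ b) :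
    Integrable (fun z : E3 × E3 => ((annulus a b).indicator (fun _ => (1 : ℝ)) z.1 +
      (annulus a b).indicator (fun _ => (1 : ℝ)) z.2) * dampedKernel s (‖z.1 - z.2‖ ^ 2))
      (((μHE[2] : Measure E3).restrict (frontier S)).prod
        ((μHE[2] : Measure E3).restrict (frontier S))) := by
  have hsig := hS.sigmaFinite_frontier
  have hfinc := hS.isFiniteMeasureOnCompacts_frontier
  set μ := (μHE[2] : Measure E3).restrict (frontier S)
  have hAm := (isClosed_annulus a b).measurableSet
  have hK : Measurable fun z : E3 × E3 => dampedKernel s (‖z.1 - z.2‖ ^ 2) :=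
    (measurable_dampedKernel s).comp (by fun_prop)
  have hind : Measurable fun z : E3 × E3 => (annulus a b).indicator (fun _ => (1 : ℝ)) z.1 :=
    (measurable_const.indicator hAm).comp measurable_fst
  have h1 : Integrable (fun z : E3 × E3 => (annulus a b).indicator (fun _ => (1 : ℝ)) z.1 *
      dampedKernel s (‖z.1 - z.2‖ ^ 2)) (μ.prod μ) := by
    refine ⟨(hind.fun_mul hK).aestronglyMeasurable, ?_⟩
    have hnn : ∀ z : E3 × E3, 0 ≤ (annulus a b).indicator (fun _ => (1 : ℝ)) z.1 *
        dampedKernel s (‖z.1 - z.2‖ ^ 2) := fun z =>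
      mul_nonneg (indicator_nonneg (fun _ _ => zero_le_one) _) (dampedKernel_nonneg s (sq_nonneg _))
    rw [hasFiniteIntegral_iff_ofReal (Eventually.of_forall hnn),
      lintegral_prod _ (hind.fun_mul hK).ennreal_ofReal.aemeasurable]
    obtain ⟨C, hC, hCb⟩ := hS.exists_lintegral_dampedKernel_le hs0 hs1 ha hab
    calc _ ≤ ∫⁻ x, (annulus a b).indicator (fun _ => C) x ∂μ := by
          refine lintegral_mono fun x => ?_
          by_cases hx : x ∈ annulus a b
          · simp only [indicator_of_mem hx, one_mul]
            exact hCb x hx.1 hx.2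
          · simp [indicator_of_notMem hx]
      _ = C * μ (annulus a b) := lintegral_indicator_const hAm C
      _ < ⊤ := ENNReal.mul_lt_top hC.lt_top (isCompact_annulus a b).measure_lt_top
  have h2 := h1.swap
  refine (h1.add h2).congr (Eventually.of_forall fun z => ?_)
  simp only [Pi.add_apply, Function.comp_apply, Prod.fst_swap, Prod.snd_swap, norm_sub_rev z.2 z.1]
  ring

end

noncomputable section

open scoped Convolution

/-! ### Normal variations -/

/-- Near a point of the compact annular piece the normal extends to a `C¹` field. A boundary point
outside that neighbourhood is at distance at least `ρ / 2`, and there the trivial bound `2` on the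
difference of normals suffices. -/
theorem IsC2Cone.exists_outwardNormal_lipschitz {S : Set E3} (hS : IsC2Cone S) {a : ℝ}
    (ha : 0 < a) (b : ℝ) : ∃ M : ℝ, 0 ≤ M ∧ ∀ x ∈ frontier S ∩ annulus a b,
      ∀ y ∈ frontier S \ {0}, ‖outwardNormal S x - outwardNormal S y‖ ≤ M * ‖x - y‖ := by
  have hK : IsCompact (frontier S ∩ annulus a b) := (isCompact_annulus a b).inter_left isClosed_frontier
  have key := hK.induction_on (p := fun T => ∃ M : ℝ, 0 ≤ M ∧ ∀ x ∈ frontier S ∩ annulus a b,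
      x ∈ T → ∀ y ∈ frontier S \ {0}, ‖outwardNormal S x - outwardNormal S y‖ ≤ M * ‖x - y‖)
    ⟨0, le_rfl, by simp⟩
    (fun T T' hT ⟨M, hM, h⟩ => ⟨M, hM, fun x hx hxT => h x hx (hT hxT)⟩)
    (fun T T' ⟨M, hM, h⟩ ⟨M', hM', h'⟩ => ⟨M + M', add_nonneg hM hM', fun x hx hxT y hy => by
      have := norm_nonneg (x - y)
      rcases hxT with hxT | hxT
      · nlinarith [h x hx hxT y hy]
      · nlinarith [h' x hx hxT y hy]⟩)
    (fun p hp => by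
      have hp0 : p ≠ 0 := by
        rintro rfl
        have := hp.2.1
        rw [norm_zero] at this
        linarith
      obtain ⟨r, hr, f, hf, hne, -, -, hν⟩ := hS.c2_boundary.exists_ball hS.isOpen hp.1 hp0
      have hN : ContDiffAt ℝ 1 (fun x => ‖gradient f x‖⁻¹ • gradient f x) p := by
        have h1 : ContDiffAt ℝ 2 f p := hf.contDiffAt (Metric.ball_mem_nhds p hr)
        have h2 : ContDiffAt ℝ 1 (fderiv ℝ f) p := h1.fderiv_right (by norm_num)
        have h3 : ContDiffAt ℝ 1 (gradient f) p :=
          (InnerProductSpace.toDual ℝ E3).symm.contDiff.contDiffAt.comp p h2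
        have h4 : gradient f p ≠ 0 := fun h0 => by
          apply hne p (Metric.mem_ball_self hr)
          rw [← toDual_gradient, h0, map_zero]
        exact ((h3.norm ℝ h4).inv (norm_ne_zero_iff.2 h4)).smul h3
      obtain ⟨K, t, ht, hlip⟩ := hN.exists_lipschitzOnWith
      obtain ⟨ρ, hρ, hball⟩ := Metric.mem_nhds_iff.1 (inter_mem ht (Metric.ball_mem_nhds p hr))
      refine ⟨Metric.ball p (ρ / 2), mem_nhdsWithin_of_mem_nhds
        (Metric.ball_mem_nhds p (half_pos hρ)), K + 4 / ρ, by positivity,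
        fun x hx hxT y hy => ?_⟩
      have hxb : x ∈ Metric.ball p ρ := Metric.ball_subset_ball (by linarith) hxT
      by_cases hyb : y ∈ Metric.ball p ρ
      · rw [(hν x (hball hxb).2 hx.1).outwardNormal_eq, (hν y (hball hyb).2 hy.1).outwardNormal_eq]
        have := hlip.dist_le_mul x (hball hxb).1 y (hball hyb).1
        rw [dist_eq_norm, dist_eq_norm] at this
        refine this.trans ?_
        gcongr
        linarith [div_pos four_pos hρ]
      · have hd : ρ / 2 ≤ ‖x - y‖ := by
          rw [Metric.mem_ball, dist_eq_norm] at hxT hyb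
          have h1 : ‖y - p‖ ≤ ‖x - p‖ + ‖x - y‖ := by
            have := norm_sub_le (x - p) (x - y)
            simpa using this
          linarith
        calc _ ≤ ‖outwardNormal S x‖ + ‖outwardNormal S y‖ := norm_sub_le _ _
          _ ≤ 2 := by linarith [norm_outwardNormal_le (S := S) x, norm_outwardNormal_le (S := S) y]
          _ = 4 / ρ * (ρ / 2) := by field_simp; norm_num
          _ ≤ (K + 4 / ρ) * ‖x - y‖ := by
            gcongr
            linarith [K.coe_nonneg])
  obtain ⟨M, hM, h⟩ := key
  exact ⟨M, hM, fun x hx => h x hx hx⟩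

/-- The form is the inner product of `X x - X y` with a vector that also consists of differences.
For Lipschitz fields it therefore vanishes to second order on the diagonal, which makes it
integrable against the singular kernel on the boundary. -/
theorem abs_boundaryForm_le (S : Set E3) (X : E3 → E3) (x y : E3) :
    |boundaryForm S X x y| ≤ ‖X x - X y‖ * (‖X x - X y‖ +
      2 * ‖X y‖ * ‖outwardNormal S x - outwardNormal S y‖) := by
  set n := outwardNormal S x
  set n' := outwardNormal S y
  have hn : ‖n‖ ≤ 1 := norm_outwardNormal_le x
  have hn' : ‖n'‖ ≤ 1 := norm_outwardNormal_le y
  have h1 : boundaryForm S X x y = inner ℝ (X x - X y) (inner ℝ (X x - X y) n • n' +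
      inner ℝ (X y) (n - n') • n' - inner ℝ (X y) n' • (n - n')) := by
    simp only [boundaryForm, inner_sub_left, inner_sub_right, inner_add_right,
      real_inner_smul_right]
    ring
  rw [h1]
  refine (abs_real_inner_le_norm _ _).trans ?_
  gcongr
  have e1 : ‖inner ℝ (X x - X y) n • n'‖ ≤ ‖X x - X y‖ := by
    rw [norm_smul]
    refine (mul_le_of_le_one_right (norm_nonneg _) hn').trans ?_
    exact (norm_inner_le_norm _ _).trans (mul_le_of_le_one_right (norm_nonneg _) hn)
  have e2 : ‖inner ℝ (X y) (n - n') • n'‖ ≤ ‖X y‖ * ‖n - n'‖ := by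
    rw [norm_smul]
    exact (mul_le_of_le_one_right (norm_nonneg _) hn').trans (norm_inner_le_norm _ _)
  have e3 : ‖inner ℝ (X y) n' • (n - n')‖ ≤ ‖X y‖ * ‖n - n'‖ := by
    rw [norm_smul]
    gcongr
    exact (norm_inner_le_norm _ _).trans (mul_le_of_le_one_right (norm_nonneg _) hn')
  refine (norm_sub_le _ _).trans ?_
  linarith [norm_add_le (inner ℝ (X x - X y) n • n') (inner ℝ (X y) (n - n') • n')]

theorem le_mul_min_of_bounds {t d C C' : ℝ} (hC : 0 ≤ C) (hC' : 0 ≤ C') (h1 : t ≤ C * d)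
    (h2 : t ≤ C') (hd : 0 ≤ d) : t ≤ (C + C') * min 1 d := by
  rcases le_total 1 d with h | h
  · rw [min_eq_left h]; linarith
  · rw [min_eq_right h]; nlinarith

/-- Smooth approximation of a Lipschitz field supported in an annulus. -/
theorem exists_smooth_approximation {F : E3 → E3} {K : NNReal} (hF : LipschitzWith K F) {a b : ℝ}
    (ha : 0 < a) (hb : b < 1) (hFs : ∀ x, x ∉ annulus a b → F x = 0) :
    ∃ W : ℕ → E3 → E3, (∀ n, ContDiff ℝ ∞ (W n)) ∧ (∀ n, LipschitzWith K (W n)) ∧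
      (∀ n x, ‖W n x - F x‖ ≤ K) ∧ (∀ n, ∀ x ∉ annulus (a / 2) ((1 + b) / 2), W n x = 0) ∧
      ∀ x, Tendsto (fun n => W n x) atTop (𝓝 (F x)) := by
  -- The mollification radius keeps supports in a compact annulus of the punctured unit ball; being
  -- at most `1`, it also gives the uniform error `K`.
  set δ : ℝ := min (min (a / 2) ((1 - b) / 2)) 1 with hδ
  have hδ0 : 0 < δ := lt_min (lt_min (by linarith) (by linarith)) one_pos
  have hδa : δ ≤ a / 2 := (min_le_left _ _).trans (min_le_left _ _)
  have hδb : δ ≤ (1 - b) / 2 := (min_le_left _ _).trans (min_le_right _ _)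
  have hδ1 : δ ≤ 1 := min_le_right _ _
  set φ : ℕ → ContDiffBump (0 : E3) := fun n =>
    ⟨δ / (n + 1) / 2, δ / (n + 1), by positivity, half_lt_self (by positivity)⟩ with hφ
  have hrout : ∀ n, (φ n).rOut = δ / (n + 1) := fun n => rfl
  have hrle : ∀ n, (φ n).rOut ≤ δ := fun n => by
    rw [hrout]
    exact div_le_self hδ0.le (by simp)
  set W : ℕ → E3 → E3 := fun n =>
    ((φ n).normed volume ⋆[ContinuousLinearMap.lsmul ℝ ℝ, volume] F) with hW
  have hdist : ∀ n x, dist (W n x) (F x) ≤ K * (φ n).rOut := fun n x =>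
    (φ n).dist_normed_convolution_le hF.continuous.aestronglyMeasurable fun y hy =>
      (hF.dist_le_mul y x).trans (by gcongr; exact (Metric.mem_ball.1 hy).le)
  refine ⟨W, fun n => ?_, fun n => ?_, fun n x => ?_, fun n x hx => ?_, fun x => ?_⟩
  · exact (φ n).hasCompactSupport_normed.contDiff_convolution_left _ (φ n).contDiff_normed
      hF.continuous.locallyIntegrable
  · refine LipschitzWith.of_dist_le_mul fun x y => ?_
    have hi : ∀ x, Integrable fun t => (φ n).normed volume t • F (x - t) := fun x => by
      refine Continuous.integrable_of_hasCompactSupport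
        ((φ n).continuous_normed.smul (hF.continuous.comp (by fun_prop))) ?_
      exact HasCompactSupport.intro (φ n).hasCompactSupport_normed fun t ht => by
        rw [image_eq_zero_of_notMem_tsupport ht, zero_smul]
    have h1 : W n x - W n y = ∫ t, (φ n).normed volume t • (F (x - t) - F (y - t)) := by
      simp only [hW, convolution_def, ContinuousLinearMap.lsmul_apply, smul_sub]
      rw [integral_sub (hi x) (hi y)]
    rw [dist_eq_norm, h1]
    refine (norm_integral_le_of_norm_le (((φ n).integrable_normed).mul_const (K * dist x y))
      (Eventually.of_forall fun t => ?_)).trans (le_of_eq ?_)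
    · rw [norm_smul, Real.norm_of_nonneg ((φ n).nonneg_normed t)]
      refine mul_le_mul_of_nonneg_left ?_ ((φ n).nonneg_normed t)
      have := hF.dist_le_mul (x - t) (y - t)
      rwa [dist_sub_right, dist_eq_norm] at this
    · rw [integral_mul_const, (φ n).integral_normed, one_mul]
  · rw [← dist_eq_norm]
    refine (hdist n x).trans (mul_le_of_le_one_right K.coe_nonneg ((hrle n).trans hδ1))
  · have hz : ∀ y, dist y x < δ → F y = 0 := by
      intro y hy
      refine hFs y fun hy' => hx ?_
      rw [dist_eq_norm] at hy
      have h1 := norm_sub_norm_le y x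
      have h2 := norm_sub_norm_le x y
      rw [norm_sub_rev] at h2
      exact ⟨by linarith [hy'.1], by linarith [hy'.2]⟩
    have h0 := hz x (by simpa using hδ0)
    rw [← h0]
    refine (φ n).normed_convolution_eq_right fun y hy => ?_
    rw [h0]
    exact hz y ((Metric.mem_ball.1 hy).trans_le (hrle n))
  · rw [tendsto_iff_dist_tendsto_zero]
    refine squeeze_zero (fun _ => dist_nonneg) (fun n => hdist n x) ?_
    have : Tendsto (fun n : ℕ => (K : ℝ) * (δ * (1 / ((n : ℝ) + 1)))) atTop (𝓝 (K * (δ * 0))) :=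
      (tendsto_one_div_add_atTop_nhds_zero_nat.const_mul δ).const_mul _
    simpa [hrout, div_eq_mul_inv] using this

/-- The field `ζ(|x|) ν(x)` on the boundary of a cone extends to a Lipschitz field. -/
theorem IsC2Cone.exists_lipschitz_extension {S : Set E3} (hS : IsC2Cone S) {ζ : ℝ → ℝ}
    {M : NNReal} (hζ : LipschitzWith M ζ) {B : ℝ} (hB : ∀ r, |ζ r| ≤ B) {a b : ℝ} (ha : 0 < a)
    (hs : ∀ r, r ∉ Icc a b → ζ r = 0) :
    ∃ (K : NNReal) (F : E3 → E3), LipschitzWith K F ∧ (∀ x, x ∉ annulus a b → F x = 0) ∧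
      ∀ x ∈ frontier S, F x = ζ ‖x‖ • outwardNormal S x := by
  obtain ⟨N, hN0, hN⟩ := hS.exists_outwardNormal_lipschitz ha b
  have hB0 : 0 ≤ B := (abs_nonneg _).trans (hB 0)
  set f : E3 → E3 := fun x => ζ ‖x‖ • outwardNormal S x with hf
  -- Vanishing outside the annulus is prescribed together with the boundary values, so that the
  -- extension is supported in the annulus.
  set T : Set E3 := frontier S ∪ (annulus a b)ᶜ with hT
  have hzero : ∀ x, x ∉ annulus a b → ζ ‖x‖ = 0 := fun x hx => hs _ hx
  have hζn : ∀ x y : E3, |ζ ‖x‖ - ζ ‖y‖| ≤ M * ‖x - y‖ := fun x y => by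
    have h1 := hζ.dist_le_mul ‖x‖ ‖y‖
    rw [Real.dist_eq, Real.dist_eq] at h1
    exact h1.trans (by gcongr; exact abs_norm_sub_norm_le x y)
  have hmem : ∀ x ∈ T, ζ ‖x‖ ≠ 0 → x ∈ frontier S ∩ annulus a b := fun x hx h0 => by
    have h1 : x ∈ annulus a b := by_contra fun h => h0 (hzero x h)
    exact ⟨hx.resolve_right fun h => h h1, h1⟩
  have hlip : LipschitzOnWith (M + B * N).toNNReal f T := by
    refine LipschitzOnWith.of_dist_le_mul fun x hx y hy => ?_
    rw [Real.coe_toNNReal _ (by positivity), dist_eq_norm, dist_eq_norm]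
    have hbase : ∀ x y : E3, ζ ‖y‖ = 0 → ‖f x - f y‖ ≤ (M + B * N) * ‖x - y‖ := by
      intro x y h0
      have h1 := hζn x y
      simp only [hf, h0, zero_smul, sub_zero] at h1 ⊢
      rw [norm_smul, Real.norm_eq_abs]
      refine (mul_le_of_le_one_right (abs_nonneg _) (norm_outwardNormal_le x)).trans ?_
      refine h1.trans ?_
      gcongr
      exact le_add_of_nonneg_right (by positivity)
    by_cases hy0 : ζ ‖y‖ = 0
    · exact hbase x y hy0
    by_cases hx0 : ζ ‖x‖ = 0
    · rw [norm_sub_rev, norm_sub_rev x y]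
      exact hbase y x hx0
    have hx' := hmem x hx hx0
    have hy' := hmem y hy hy0
    have hy00 : y ≠ 0 := by
      rintro rfl
      have := hy'.2.1
      rw [norm_zero] at this
      linarith
    have heq : f x - f y = (ζ ‖x‖ - ζ ‖y‖) • outwardNormal S x +
        ζ ‖y‖ • (outwardNormal S x - outwardNormal S y) := by
      simp only [hf]
      module
    rw [heq]
    refine (norm_add_le _ _).trans ?_
    rw [norm_smul, norm_smul, Real.norm_eq_abs, Real.norm_eq_abs, add_mul, mul_assoc]
    refine add_le_add ((mul_le_of_le_one_right (abs_nonneg _) (norm_outwardNormal_le x)).trans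
      (hζn x y)) (mul_le_mul (hB _) (hN x hx' y ⟨hy'.1, hy00⟩) (norm_nonneg _) hB0)
  obtain ⟨F, hF, hFe⟩ := hlip.extend_finite_dimension
  refine ⟨_, F, hF, fun x hx => ?_, fun x hx => (hFe (Or.inl hx)).symm⟩
  rw [← hFe (Or.inr hx)]
  simp only [hf, hzero x hx, zero_smul]

end

noncomputable section

/-! ### The stability inequality -/

namespace IsC2Cone

variable {S : Set E3}

theorem ae_prod_frontier (hS : IsC2Cone S) :
    ∀ᵐ z ∂((μHE[2] : Measure E3).restrict (frontier S)).prod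
      ((μHE[2] : Measure E3).restrict (frontier S)),
      z.1 ∈ frontier S \ {0} ∧ z.2 ∈ frontier S \ {0} := by
  have := hS.sigmaFinite_frontier
  filter_upwards [Measure.quasiMeasurePreserving_fst.ae hS.ae_ne_zero,
    Measure.quasiMeasurePreserving_snd.ae hS.ae_ne_zero] with z h1 h2 using ⟨h1, h2⟩

theorem aestronglyMeasurable_boundaryForm (hS : IsC2Cone S) {X : E3 → E3} (hX : Continuous X) :
    AEStronglyMeasurable (fun z : E3 × E3 => boundaryForm S X z.1 z.2)
      (((μHE[2] : Measure E3).restrict (frontier S)).prod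
        ((μHE[2] : Measure E3).restrict (frontier S))) := by
  have := hS.sigmaFinite_frontier
  set μ := (μHE[2] : Measure E3).restrict (frontier S)
  have hn1 : AEStronglyMeasurable (fun z : E3 × E3 => outwardNormal S z.1) (μ.prod μ) :=
    hS.aestronglyMeasurable_outwardNormal.comp_fst
  have hn2 : AEStronglyMeasurable (fun z : E3 × E3 => outwardNormal S z.2) (μ.prod μ) :=
    hS.aestronglyMeasurable_outwardNormal.comp_snd
  have hX1 : AEStronglyMeasurable (fun z : E3 × E3 => X z.1) (μ.prod μ) :=
    (hX.comp continuous_fst).aestronglyMeasurable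
  have hX2 : AEStronglyMeasurable (fun z : E3 × E3 => X z.2) (μ.prod μ) :=
    (hX.comp continuous_snd).aestronglyMeasurable
  exact (((hX1.inner (𝕜 := ℝ) hn2).mul (hX1.inner hn1)).add
    ((hX2.inner hn2).mul (hX2.inner hn1))).sub
    (((hX2.inner hn2).const_mul 2).mul (hX1.inner hn1))

/-- The bound on the boundary form of a Lipschitz field supported in an annulus. -/
theorem exists_abs_boundaryForm_le (hS : IsC2Cone S) {a : ℝ} (ha : 0 < a) (b : ℝ) (K : NNReal)
    {B : ℝ} (hB0 : 0 ≤ B) : ∃ C : ℝ, 0 ≤ C ∧ ∀ X : E3 → E3, LipschitzWith K X →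
      (∀ x, ‖X x‖ ≤ B) → (∀ x, x ∉ annulus a b → X x = 0) →
      ∀ x ∈ frontier S \ {0}, ∀ y ∈ frontier S \ {0},
        |boundaryForm S X x y| ≤ C * (((annulus a b).indicator (fun _ => (1 : ℝ)) x +
          (annulus a b).indicator (fun _ => (1 : ℝ)) y) * min 1 (‖x - y‖ ^ 2)) := by
  obtain ⟨N, hN0, hN⟩ := hS.exists_outwardNormal_lipschitz ha b
  -- The first summand is the second-order bound near the diagonal; the other is the crude bound `2
  -- * B * (2 * B + 2 * B * 2)` for distant points.
  refine ⟨K * (K + 2 * B * N) + 12 * B ^ 2, by positivity, fun X hXl hXB hXs x hx y hy => ?_⟩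
  have hmin : 0 ≤ min 1 (‖x - y‖ ^ 2) := le_min zero_le_one (sq_nonneg _)
  by_cases h : x ∈ annulus a b ∨ y ∈ annulus a b
  · have hind : 1 ≤ (annulus a b).indicator (fun _ => (1 : ℝ)) x +
        (annulus a b).indicator (fun _ => (1 : ℝ)) y := by
      have h0 : ∀ x, 0 ≤ (annulus a b).indicator (fun _ => (1 : ℝ)) x := fun x =>
        indicator_nonneg (fun _ _ => zero_le_one) x
      rcases h with h | h
      · rw [indicator_of_mem h]; linarith [h0 y]
      · rw [indicator_of_mem h]; linarith [h0 x]
    have hν : ‖outwardNormal S x - outwardNormal S y‖ ≤ N * ‖x - y‖ := by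
      rcases h with h | h
      · exact hN x ⟨hx.1, h⟩ y hy
      · rw [norm_sub_rev, norm_sub_rev x y]
        exact hN y ⟨hy.1, h⟩ x hx
    have hν2 : ‖outwardNormal S x - outwardNormal S y‖ ≤ 2 :=
      (norm_sub_le _ _).trans (by
        linarith [norm_outwardNormal_le (S := S) x, norm_outwardNormal_le (S := S) y])
    have hX1 : ‖X x - X y‖ ≤ K * ‖x - y‖ := by
      simpa [dist_eq_norm] using hXl.dist_le_mul x y
    have hX2 : ‖X x - X y‖ ≤ 2 * B := (norm_sub_le _ _).trans (by linarith [hXB x, hXB y])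
    have hQ := abs_boundaryForm_le S X x y
    refine (le_mul_min_of_bounds (C := K * (K + 2 * B * N)) (C' := 12 * B ^ 2)
      (d := ‖x - y‖ ^ 2) (by positivity) (by positivity) ?_ ?_ (sq_nonneg _)).trans ?_
    · refine hQ.trans ?_
      calc _ ≤ K * ‖x - y‖ * (K * ‖x - y‖ + 2 * B * (N * ‖x - y‖)) := by
            gcongr
            exact hXB y
        _ = _ := by ring
    · refine hQ.trans ?_
      calc _ ≤ 2 * B * (2 * B + 2 * B * 2) := by
            gcongr
            exact hXB y
        _ = _ := by ring
    · gcongr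
      exact le_mul_of_one_le_left hmin hind
  · push Not at h
    simp [boundaryForm, hXs x h.1, hXs y h.2, indicator_of_notMem h.1, indicator_of_notMem h.2]

end IsC2Cone

/-- Stability of a cone against Lipschitz variations. -/
theorem IsStableCone.integral_boundaryForm_nonneg {S : Set E3} {s : ℝ} (hs0 : 0 < s)
    (hs1 : s < 1) (hS : IsStableCone s S) {F : E3 → E3} {K : NNReal} (hF : LipschitzWith K F)
    {a b : ℝ} (ha : 0 < a) (hab : a ≤ b) (hb : b < 1) (hFs : ∀ x, x ∉ annulus a b → F x = 0) :
    Integrable (fun z : E3 × E3 => kernelProfile s (‖z.1 - z.2‖ ^ 2) * boundaryForm S F z.1 z.2)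
      (((μHE[2] : Measure E3).restrict (frontier S)).prod
        ((μHE[2] : Measure E3).restrict (frontier S))) ∧
    0 ≤ ∫ z : E3 × E3, kernelProfile s (‖z.1 - z.2‖ ^ 2) * boundaryForm S F z.1 z.2
      ∂(((μHE[2] : Measure E3).restrict (frontier S)).prod
        ((μHE[2] : Measure E3).restrict (frontier S))) := by
  have hS' : IsC2Cone S := ⟨hS.isOpen, hS.cone, hS.c2_boundary⟩
  have hsig := hS'.sigmaFinite_frontier
  have haeP := hS'.ae_prod_frontier
  obtain ⟨W, hWd, hWl, hWF, hWs, hWt⟩ := exists_smooth_approximation hF ha hb hFs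
  have hFc : HasCompactSupport F := HasCompactSupport.intro (isCompact_annulus a b) hFs
  obtain ⟨B, hB⟩ := hF.continuous.bounded_above_of_compact_support hFc
  have hB0 : 0 ≤ B := (norm_nonneg _).trans (hB 0)
  obtain ⟨C, hC0, hC⟩ := hS'.exists_abs_boundaryForm_le (half_pos ha) ((1 + b) / 2) K
    (B := B + K) (by positivity)
  set A := annulus (a / 2) ((1 + b) / 2) with hA
  have hAsub : annulus a b ⊆ A := fun x hx => ⟨by linarith [hx.1], by linarith [hx.2]⟩
  have hint := (hS'.integrable_dampedKernel hs0 hs1 (half_pos ha)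
    (by linarith : a / 2 ≤ (1 + b) / 2)).const_mul C
  set μ := (μHE[2] : Measure E3).restrict (frontier S)
  set G : E3 × E3 → ℝ := fun z => C * ((A.indicator (fun _ => (1 : ℝ)) z.1 +
    A.indicator (fun _ => (1 : ℝ)) z.2) * dampedKernel s (‖z.1 - z.2‖ ^ 2)) with hG
  have hbound : ∀ X : E3 → E3, LipschitzWith K X → (∀ x, ‖X x‖ ≤ B + K) →
      (∀ x, x ∉ A → X x = 0) → ∀ k : ℝ → ℝ, (∀ u, 0 ≤ u → |k u| ≤ kernelProfile s u) →
      ∀ᵐ z ∂μ.prod μ, ‖k (‖z.1 - z.2‖ ^ 2) * boundaryForm S X z.1 z.2‖ ≤ G z := by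
    intro X hXl hXB hXs k hk
    filter_upwards [haeP] with z hz
    rw [norm_mul, Real.norm_eq_abs, Real.norm_eq_abs]
    refine (mul_le_mul (hk _ (sq_nonneg _)) (hC X hXl hXB hXs z.1 hz.1 z.2 hz.2) (abs_nonneg _)
      (kernelProfile_nonneg s (sq_nonneg _))).trans (le_of_eq ?_)
    simp only [hG, dampedKernel]
    ring
  have hkm : Measurable fun z : E3 × E3 => kernelProfile s (‖z.1 - z.2‖ ^ 2) :=
    (measurable_kernelProfile s).comp (by fun_prop)
  have hk0 : ∀ u, 0 ≤ u → |kernelProfile s u| ≤ kernelProfile s u := fun u hu =>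
    (abs_of_nonneg (kernelProfile_nonneg s hu)).le
  have hWB : ∀ n x, ‖W n x‖ ≤ B + K := fun n x => by
    have h1 := norm_add_le (W n x - F x) (F x)
    rw [sub_add_cancel] at h1
    linarith [hWF n x, hB x]
  have hmeas : ∀ X : E3 → E3, Continuous X → AEStronglyMeasurable (fun z : E3 × E3 =>
      kernelProfile s (‖z.1 - z.2‖ ^ 2) * boundaryForm S X z.1 z.2) (μ.prod μ) := fun X hX =>
    hkm.aestronglyMeasurable.mul (hS'.aestronglyMeasurable_boundaryForm hX)
  -- The truncation of the kernel is removed first, for a fixed smooth field; the mollification is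
  -- removed afterwards. Both limits have the same majorant `G`.
  have hpos : ∀ n, 0 ≤ ∫ z : E3 × E3, kernelProfile s (‖z.1 - z.2‖ ^ 2) *
      boundaryForm S (W n) z.1 z.2 ∂μ.prod μ := by
    intro n
    have hWsupp : tsupport (W n) ⊆ A := closure_minimal (fun x hx => by
      by_contra h; exact hx (hWs n x h)) (isClosed_annulus _ _)
    have hWc : HasCompactSupport (W n) :=
      HasCompactSupport.intro (isCompact_annulus _ _) (hWs n)
    have hA1 : A ⊆ Metric.ball (0 : E3) 1 \ {0} := fun x hx => ⟨by
      rw [mem_ball_zero_iff]; linarith [hx.2], by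
      rintro rfl
      have := hx.1
      rw [norm_zero] at this
      linarith⟩
    obtain ⟨l, hl0, hl⟩ := hS.exists_tendsto_boundary hs0 hs1 (hWd n) hWc (hWsupp.trans hA1)
    have hcm : ∀ j : ℕ, Continuous fun z : E3 × E3 =>
        cutoffKernel s (1 / ((j : ℝ) + 1)) (‖z.1 - z.2‖ ^ 2) := fun j =>
      (contDiff_cutoffKernel (s := s) (ε := 1 / ((j : ℝ) + 1)) (by positivity)).continuous.comp
        (by fun_prop)
    have hjm : ∀ j : ℕ, AEStronglyMeasurable (fun z : E3 × E3 =>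
        cutoffKernel s (1 / ((j : ℝ) + 1)) (‖z.1 - z.2‖ ^ 2) * boundaryForm S (W n) z.1 z.2)
        (μ.prod μ) := fun j => (hcm j).aestronglyMeasurable.mul
          (hS'.aestronglyMeasurable_boundaryForm (hWd n).continuous)
    have hjb : ∀ j : ℕ, ∀ᵐ z ∂μ.prod μ, ‖cutoffKernel s (1 / ((j : ℝ) + 1)) (‖z.1 - z.2‖ ^ 2) *
        boundaryForm S (W n) z.1 z.2‖ ≤ G z := fun j =>
      hbound (W n) (hWl n) (hWB n) (hWs n) (cutoffKernel s (1 / ((j : ℝ) + 1))) fun u hu => by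
        rw [abs_of_nonneg cutoffKernel_nonneg]; exact cutoffKernel_le hu
    have hlim := tendsto_integral_of_dominated_convergence (μ := μ.prod μ)
      (F := fun (j : ℕ) (z : E3 × E3) => cutoffKernel s (1 / ((j : ℝ) + 1)) (‖z.1 - z.2‖ ^ 2) *
        boundaryForm S (W n) z.1 z.2)
      (f := fun z : E3 × E3 => kernelProfile s (‖z.1 - z.2‖ ^ 2) * boundaryForm S (W n) z.1 z.2)
      G hjm hint hjb (Eventually.of_forall fun z => ?_)
    · have heq : (fun j : ℕ => ∫ y in frontier S, ∫ x in frontier S,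
          cutoffKernel s (1 / ((j : ℝ) + 1)) (‖x - y‖ ^ 2) * boundaryForm S (W n) x y
            ∂μHE[2] ∂μHE[2]) = fun j : ℕ => ∫ z : E3 × E3,
          cutoffKernel s (1 / ((j : ℝ) + 1)) (‖z.1 - z.2‖ ^ 2) * boundaryForm S (W n) z.1 z.2
            ∂μ.prod μ := by
        funext j
        exact (integral_prod_symm _ (Integrable.mono' hint (hjm j) (hjb j))).symm
      rw [heq] at hl
      rw [tendsto_nhds_unique hlim hl]
      exact hl0
    · by_cases hz : z.1 = z.2
      · simp [hz, boundaryForm]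
        ring_nf
        simp
      · have hu : 0 < ‖z.1 - z.2‖ ^ 2 := by
          have := sub_ne_zero.2 hz
          positivity
        refine tendsto_const_nhds.congr' ?_
        filter_upwards [eventually_cutoffKernel_eq s hu] with j hj
        rw [hj.1]
  have hFbound := hbound F hF (fun x => (hB x).trans (by linarith [K.coe_nonneg]))
    (fun x hx => hFs x fun h => hx (hAsub h)) (kernelProfile s) hk0
  refine ⟨Integrable.mono' hint (hmeas F hF.continuous) hFbound, ?_⟩
  refine ge_of_tendsto' (tendsto_integral_of_dominated_convergence (μ := μ.prod μ)
    (F := fun n (z : E3 × E3) => kernelProfile s (‖z.1 - z.2‖ ^ 2) * boundaryForm S (W n) z.1 z.2)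
    G (fun n => hmeas (W n) (hWd n).continuous) hint
    (fun n => hbound (W n) (hWl n) (hWB n) (hWs n) (kernelProfile s) hk0)
    (Eventually.of_forall fun z => ?_)) hpos
  have h1 := hWt z.1
  have h2 := hWt z.2
  refine Tendsto.const_mul _ ?_
  exact (((h1.inner tendsto_const_nhds).mul (h1.inner tendsto_const_nhds)).add
    ((h2.inner tendsto_const_nhds).mul (h2.inner tendsto_const_nhds))).sub
    (((h2.inner tendsto_const_nhds).const_mul 2).mul (h1.inner tendsto_const_nhds))

end

/-! ### The stability inequality for radial normal variations -/

noncomputable section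

/-- For unit vectors the inner product is one minus half the squared distance. This is how the
curvature term enters, with a negative sign. -/
theorem boundaryForm_of_normal {S : Set E3} {F : E3 → E3} {x y : E3} {c d : ℝ}
    (hx : ‖outwardNormal S x‖ = 1) (hy : ‖outwardNormal S y‖ = 1)
    (hFx : F x = c • outwardNormal S x) (hFy : F y = d • outwardNormal S y) :
    boundaryForm S F x y =
      (c - d) ^ 2 - ‖outwardNormal S x - outwardNormal S y‖ ^ 2 / 2 * (c ^ 2 + d ^ 2) := by
  rw [boundaryForm, hFx, hFy, @norm_sub_sq_real, hx, hy]
  simp only [real_inner_smul_left, real_inner_self_eq_norm_sq, hx, hy,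
    real_inner_comm (outwardNormal S x) (outwardNormal S y)]
  ring

/-- The stability inequality for normal variations `ζ(|x|) ν`. -/
theorem IsStableCone.lintegral_normal_le {S : Set E3} {s : ℝ} (hs0 : 0 < s) (hs1 : s < 1)
    (hS : IsStableCone s S) {ζ : ℝ → ℝ} {M : NNReal} (hζ : LipschitzWith M ζ) {B : ℝ}
    (hB : ∀ r, |ζ r| ≤ B) {a b : ℝ} (ha : 0 < a) (hab : a ≤ b) (hb : b < 1)
    (hζs : ∀ r, r ∉ Icc a b → ζ r = 0) :
    ∫⁻ z : E3 × E3, ENNReal.ofReal (kernelProfile s (‖z.1 - z.2‖ ^ 2) *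
        (‖outwardNormal S z.1 - outwardNormal S z.2‖ ^ 2 * ζ ‖z.1‖ ^ 2))
      ∂(((μHE[2] : Measure E3).restrict (frontier S)).prod
        ((μHE[2] : Measure E3).restrict (frontier S))) ≤
    ∫⁻ z : E3 × E3, ENNReal.ofReal (kernelProfile s (‖z.1 - z.2‖ ^ 2) * (ζ ‖z.1‖ - ζ ‖z.2‖) ^ 2)
      ∂(((μHE[2] : Measure E3).restrict (frontier S)).prod
        ((μHE[2] : Measure E3).restrict (frontier S))) := by
  have hS' : IsC2Cone S := ⟨hS.isOpen, hS.cone, hS.c2_boundary⟩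
  have hsig := hS'.sigmaFinite_frontier
  have haeP := hS'.ae_prod_frontier
  have hdamp := hS'.integrable_dampedKernel hs0 hs1 ha hab
  have hνm := hS'.aestronglyMeasurable_outwardNormal
  obtain ⟨K, F, hF, hFs, hFe⟩ := hS'.exists_lipschitz_extension hζ hB ha hζs
  obtain ⟨hQint, hQ⟩ := hS.integral_boundaryForm_nonneg hs0 hs1 hF ha hab hb hFs
  have hB0 : 0 ≤ B := (abs_nonneg _).trans (hB 0)
  set μ := (μHE[2] : Measure E3).restrict (frontier S)
  have hkm : Measurable fun z : E3 × E3 => kernelProfile s (‖z.1 - z.2‖ ^ 2) :=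
    (measurable_kernelProfile s).comp (by fun_prop)
  have hk0 : ∀ z : E3 × E3, 0 ≤ kernelProfile s (‖z.1 - z.2‖ ^ 2) := fun z =>
    kernelProfile_nonneg s (sq_nonneg _)
  have hζc := hζ.continuous
  set P : E3 × E3 → ℝ := fun z => kernelProfile s (‖z.1 - z.2‖ ^ 2) * (ζ ‖z.1‖ - ζ ‖z.2‖) ^ 2
  set N₁ : E3 × E3 → ℝ := fun z => kernelProfile s (‖z.1 - z.2‖ ^ 2) *
    (‖outwardNormal S z.1 - outwardNormal S z.2‖ ^ 2 * ζ ‖z.1‖ ^ 2)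
  -- Nonnegativity of the second variation says that the integral of `N` is at most that of `P`.
  -- Almost everywhere `N` is the average of `N₁` and its swap, so it has the same integral as `N₁`.
  set N : E3 × E3 → ℝ := fun z => P z - kernelProfile s (‖z.1 - z.2‖ ^ 2) *
    boundaryForm S F z.1 z.2
  have hPm : Measurable P := hkm.fun_mul (by fun_prop)
  have hP0 : ∀ z, 0 ≤ P z := fun z => mul_nonneg (hk0 z) (sq_nonneg _)
  have hN₁0 : ∀ z, 0 ≤ N₁ z := fun z => mul_nonneg (hk0 z) (by positivity)
  have hN₁m : AEMeasurable (fun z => ENNReal.ofReal (N₁ z)) (μ.prod μ) := by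
    have h1 : AEStronglyMeasurable (fun z : E3 × E3 =>
        ‖outwardNormal S z.1 - outwardNormal S z.2‖ ^ 2) (μ.prod μ) :=
      ((hνm.comp_fst.sub hνm.comp_snd).norm.pow 2)
    have h2 : Continuous fun z : E3 × E3 => ζ ‖z.1‖ ^ 2 := by fun_prop
    exact (hkm.aestronglyMeasurable.mul
      (h1.mul h2.aestronglyMeasurable)).aemeasurable.ennreal_ofReal
  have hPint : Integrable P (μ.prod μ) := by
    refine Integrable.mono' (hdamp.const_mul ((M : ℝ) ^ 2 + 4 * B ^ 2)) hPm.aestronglyMeasurable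
      (Eventually.of_forall fun z => ?_)
    rw [Real.norm_of_nonneg (hP0 z)]
    have h0 : ∀ x, 0 ≤ (annulus a b).indicator (fun _ => (1 : ℝ)) x := fun x =>
      indicator_nonneg (fun _ _ => zero_le_one) x
    by_cases h : z.1 ∈ annulus a b ∨ z.2 ∈ annulus a b
    · have hind : 1 ≤ (annulus a b).indicator (fun _ => (1 : ℝ)) z.1 +
          (annulus a b).indicator (fun _ => (1 : ℝ)) z.2 := by
        rcases h with h | h
        · rw [indicator_of_mem h]; linarith [h0 z.2]
        · rw [indicator_of_mem h]; linarith [h0 z.1]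
      have h1 : (ζ ‖z.1‖ - ζ ‖z.2‖) ^ 2 ≤ ((M : ℝ) ^ 2 + 4 * B ^ 2) *
          min 1 (‖z.1 - z.2‖ ^ 2) := by
        refine le_mul_min_of_bounds (by positivity) (by positivity) ?_ ?_ (sq_nonneg _)
        · rw [← sq_abs, ← mul_pow]
          have h2 := hζ.dist_le_mul ‖z.1‖ ‖z.2‖
          rw [Real.dist_eq, Real.dist_eq] at h2
          gcongr
          exact h2.trans (by gcongr; exact abs_norm_sub_norm_le _ _)
        · rw [← sq_abs, show 4 * B ^ 2 = (2 * B) ^ 2 by ring]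
          gcongr
          exact (abs_sub _ _).trans (by linarith [hB ‖z.1‖, hB ‖z.2‖])
      have hd0 := dampedKernel_nonneg s (sq_nonneg ‖z.1 - z.2‖)
      calc P z ≤ kernelProfile s (‖z.1 - z.2‖ ^ 2) * (((M : ℝ) ^ 2 + 4 * B ^ 2) *
            min 1 (‖z.1 - z.2‖ ^ 2)) := mul_le_mul_of_nonneg_left h1 (hk0 z)
        _ = ((M : ℝ) ^ 2 + 4 * B ^ 2) * dampedKernel s (‖z.1 - z.2‖ ^ 2) := by
            rw [dampedKernel]; ring
        _ ≤ _ := by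
            gcongr
            exact le_mul_of_one_le_left hd0 hind
    · push Not at h
      have h1 : ζ ‖z.1‖ = 0 := hζs _ h.1
      have h2 : ζ ‖z.2‖ = 0 := hζs _ h.2
      simp [P, h1, h2, indicator_of_notMem h.1, indicator_of_notMem h.2]
  have hNint : Integrable N (μ.prod μ) := hPint.sub hQint
  have hNe : ∀ᵐ z ∂μ.prod μ, N z = (N₁ z + N₁ z.swap) / 2 := by
    filter_upwards [haeP] with z hz
    simp only [N, P, N₁, Prod.fst_swap, Prod.snd_swap]
    rw [boundaryForm_of_normal (hS'.norm_outwardNormal hz.1.1 hz.1.2)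
      (hS'.norm_outwardNormal hz.2.1 hz.2.2) (hFe _ hz.1.1) (hFe _ hz.2.1),
      norm_sub_rev z.2 z.1, norm_sub_rev (outwardNormal S z.2)]
    ring
  have hN0 : 0 ≤ᵐ[μ.prod μ] N := by
    filter_upwards [hNe] with z hz
    rw [hz]
    exact div_nonneg (add_nonneg (hN₁0 _) (hN₁0 _)) zero_le_two
  have hle : ∫ z, N z ∂μ.prod μ ≤ ∫ z, P z ∂μ.prod μ := by
    have := integral_sub hPint hQint
    simp only [N]
    rw [this]
    linarith
  have hle' : ∫⁻ z, ENNReal.ofReal (N z) ∂μ.prod μ ≤ ∫⁻ z, ENNReal.ofReal (P z) ∂μ.prod μ := by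
    rw [← ofReal_integral_eq_lintegral_ofReal hNint hN0,
      ← ofReal_integral_eq_lintegral_ofReal hPint (Eventually.of_forall hP0)]
    exact ENNReal.ofReal_le_ofReal hle
  refine le_trans (le_of_eq ?_) hle'
  have hswap : ∫⁻ z, ENNReal.ofReal (N₁ z.swap) ∂μ.prod μ =
      ∫⁻ z, ENNReal.ofReal (N₁ z) ∂μ.prod μ :=
    lintegral_prod_swap (fun z => ENNReal.ofReal (N₁ z))
  have h1 : ∫⁻ z, ENNReal.ofReal (N z) ∂μ.prod μ =
      ∫⁻ z, 2⁻¹ * (ENNReal.ofReal (N₁ z) + ENNReal.ofReal (N₁ z.swap)) ∂μ.prod μ := by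
    refine lintegral_congr_ae ?_
    filter_upwards [hNe] with z hz
    rw [hz, ← ENNReal.ofReal_add (hN₁0 _) (hN₁0 _), div_eq_inv_mul, ENNReal.ofReal_mul (by norm_num),
      ENNReal.ofReal_inv_of_pos two_pos, ENNReal.ofReal_ofNat]
  rw [h1, lintegral_const_mul' _ _ (by simp), lintegral_add_left' hN₁m, hswap, ← two_mul,
    ← mul_assoc, ENNReal.inv_mul_cancel two_ne_zero ENNReal.ofNat_ne_top, one_mul]

end

noncomputable section

/-! ### The stability inequality in polar coordinates -/

/-- The outward unit normal, extended by zero off the smooth part of the boundary. -/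
def boundaryNormal (S : Set E3) : E3 → E3 := (frontier S \ {0}).indicator (outwardNormal S)

theorem boundaryNormal_of_mem {S : Set E3} {x : E3} (hx : x ∈ frontier S \ {0}) :
    boundaryNormal S x = outwardNormal S x :=
  indicator_of_mem hx _

theorem ne_zero_of_mem_coneTrace {S : Set E3} {x : E3} (hx : x ∈ coneTrace S) : x ≠ 0 := by
  rintro rfl
  simpa using hx.2

theorem norm_eq_one_of_mem_coneTrace {S : Set E3} {x : E3} (hx : x ∈ coneTrace S) : ‖x‖ = 1 := by
  simpa using hx.2

namespace IsC2Cone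

variable {S : Set E3}

theorem measurable_boundaryNormal (hS : IsC2Cone S) : Measurable (boundaryNormal S) := by
  classical
  rw [boundaryNormal, ← piecewise_eq_indicator]
  exact hS.continuousOn_outwardNormal.measurable_piecewise continuousOn_const
    (measurableSet_frontier_diff S)

theorem boundaryNormal_smul (hS : IsC2Cone S) {r : ℝ} (hr : 0 < r) (x : E3) :
    boundaryNormal S (r • x) = boundaryNormal S x := by
  have hiff : r • x ∈ frontier S \ {0} ↔ x ∈ frontier S \ {0} := by
    simp [smul_mem_frontier_iff_of_cone hS.cone hr, hr.ne']
  by_cases hx : x ∈ frontier S \ {0}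
  · rw [boundaryNormal_of_mem hx, boundaryNormal_of_mem (hiff.2 hx), outwardNormal_smul hS.cone hr]
  · rw [boundaryNormal, indicator_of_notMem hx, indicator_of_notMem fun h => hx (hiff.1 h)]

/-- Replaces the normal by a function that is Borel on the whole space, as Tonelli's theorem and
polar coordinates require. -/
theorem nonlocalCurvSq_eq (hS : IsC2Cone S) (s : ℝ) {x : E3} (hx : x ∈ frontier S \ {0}) :
    nonlocalCurvSq s S x = ∫⁻ y in frontier S, ENNReal.ofReal
      (‖boundaryNormal S x - boundaryNormal S y‖ ^ 2 / ‖x - y‖ ^ (3 + s)) ∂μHE[2] := by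
  refine lintegral_congr_ae ?_
  filter_upwards [hS.ae_ne_zero] with y hy
  rw [boundaryNormal_of_mem hx, boundaryNormal_of_mem hy]

theorem lintegral_frontier_comp_smul (hS : IsC2Cone S) {F : E3 → ℝ≥0∞} (hF : Measurable F) {r : ℝ}
    (hr : 0 < r) : ∫⁻ y in frontier S, F y ∂μHE[2] =
      ENNReal.ofReal (r ^ 2) * ∫⁻ y in frontier S, F (r • y) ∂μHE[2] := by
  rw [hS.lintegral_frontier hF, hS.lintegral_frontier (F := fun y => F (r • y)) (by fun_prop)]
  have h := lintegral_Ioi_comp_mul_left hr fun t => ENNReal.ofReal t *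
    ∫⁻ x in coneTrace S, F (t • x) ∂μHE[1]
  have hfin : ∀ t : ℝ, ENNReal.ofReal (r * t) * ∫⁻ x in coneTrace S, F ((r * t) • x) ∂μHE[1] =
      ENNReal.ofReal r * (ENNReal.ofReal t * ∫⁻ x in coneTrace S, F (r • t • x) ∂μHE[1]) := by
    intro t
    rw [ENNReal.ofReal_mul hr.le, mul_assoc]
    simp only [smul_smul]
  simp only [hfin] at h
  rw [lintegral_const_mul' _ _ ENNReal.ofReal_ne_top] at h
  have h1 : ENNReal.ofReal r * ENNReal.ofReal r⁻¹ = 1 := by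
    rw [← ENNReal.ofReal_mul hr.le, mul_inv_cancel₀ hr.ne', ENNReal.ofReal_one]
  rw [sq, ENNReal.ofReal_mul hr.le, mul_assoc, h, ← mul_assoc, h1, one_mul]

/-- Dilation by `r` contributes `r ^ 2` from the area and `r ^ (-(3 + s))` from the kernel, while
normals do not change. -/
theorem nonlocalCurvSq_smul (hS : IsC2Cone S) (s : ℝ) {x : E3} (hx : x ∈ frontier S \ {0}) {r : ℝ}
    (hr : 0 < r) :
    nonlocalCurvSq s S (r • x) = ENNReal.ofReal (r ^ (-(1 + s))) * nonlocalCurvSq s S x := by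
  have hrx : r • x ∈ frontier S \ {0} :=
    ⟨(smul_mem_frontier_iff_of_cone hS.cone hr _).2 hx.1, by simpa [hr.ne'] using hx.2⟩
  have hn := hS.measurable_boundaryNormal
  rw [hS.nonlocalCurvSq_eq s hrx, hS.nonlocalCurvSq_eq s hx,
    hS.lintegral_frontier_comp_smul (by fun_prop) hr, ← lintegral_const_mul' _ _
      ENNReal.ofReal_ne_top, ← lintegral_const_mul' _ _ ENNReal.ofReal_ne_top]
  refine lintegral_congr fun y => ?_
  rw [← ENNReal.ofReal_mul (by positivity), ← ENNReal.ofReal_mul (by positivity),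
    hS.boundaryNormal_smul hr, hS.boundaryNormal_smul hr, ← smul_sub, norm_smul,
    Real.norm_of_nonneg hr.le, Real.mul_rpow hr.le (norm_nonneg _)]
  congr 1
  have h1 : r ^ (3 + s) = r ^ 2 * r ^ (1 + s) := by
    rw [← Real.rpow_natCast, ← Real.rpow_add hr]
    congr 1
    push_cast
    ring
  have h2 : 0 < r ^ (1 + s) := Real.rpow_pos_of_pos hr _
  rw [h1, Real.rpow_neg hr.le]
  field_simp

/-- Integrating out the second point leaves the squared curvature at the first. By its homogeneity
the radial weight is `r * r ^ (-(1 + s))`, which is the weight of `radialJ`. -/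
theorem lintegral_curvature (hS : IsC2Cone S) (s : ℝ) {ζ : ℝ → ℝ} (hζ : Continuous ζ) :
    ∫⁻ z : E3 × E3, ENNReal.ofReal (kernelProfile s (‖z.1 - z.2‖ ^ 2) *
        (‖outwardNormal S z.1 - outwardNormal S z.2‖ ^ 2 * ζ ‖z.1‖ ^ 2))
      ∂(((μHE[2] : Measure E3).restrict (frontier S)).prod
        ((μHE[2] : Measure E3).restrict (frontier S))) =
    (∫⁻ x in coneTrace S, nonlocalCurvSq s S x ∂μHE[1]) * radialJ ζ ((1 + s) / 2) := by
  have hsig := hS.sigmaFinite_frontier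
  have hn := hS.measurable_boundaryNormal
  have haeP := hS.ae_prod_frontier
  set μ := (μHE[2] : Measure E3).restrict (frontier S)
  set f : E3 × E3 → ℝ≥0∞ := fun z => ENNReal.ofReal
    (‖boundaryNormal S z.1 - boundaryNormal S z.2‖ ^ 2 / ‖z.1 - z.2‖ ^ (3 + s)) with hf
  have hfm : Measurable f := by fun_prop
  have hgm : Measurable fun x : E3 => ENNReal.ofReal (ζ ‖x‖ ^ 2) := by fun_prop
  set c : E3 → ℝ≥0∞ := fun x => ∫⁻ y, f (x, y) ∂μ with hc
  have hcm : Measurable c := hfm.lintegral_prod_right'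
  have hce : ∀ x ∈ frontier S \ {0}, c x = nonlocalCurvSq s S x := fun x hx =>
    (hS.nonlocalCurvSq_eq s hx).symm
  calc _ = ∫⁻ z : E3 × E3, ENNReal.ofReal (ζ ‖z.1‖ ^ 2) * f z ∂μ.prod μ := by
        refine lintegral_congr_ae ?_
        filter_upwards [haeP] with z hz
        rw [hf, ← ENNReal.ofReal_mul (by positivity)]
        rw [boundaryNormal_of_mem hz.1, boundaryNormal_of_mem hz.2, kernelProfile_norm_sq]
        congr 1
        ring
    _ = ∫⁻ x in frontier S, ENNReal.ofReal (ζ ‖x‖ ^ 2) * c x ∂μHE[2] := by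
        have hgf : Measurable fun z : E3 × E3 => ENNReal.ofReal (ζ ‖z.1‖ ^ 2) * f z := by fun_prop
        rw [lintegral_prod _ hgf.aemeasurable]
        exact lintegral_congr fun x =>
          lintegral_const_mul' (ENNReal.ofReal (ζ ‖x‖ ^ 2)) (fun y => f (x, y)) ENNReal.ofReal_ne_top
    _ = ∫⁻ r in Ioi (0 : ℝ), ENNReal.ofReal (r ^ (1 - 2 * ((1 + s) / 2)) * |ζ r| ^ 2) *
          ∫⁻ x in coneTrace S, nonlocalCurvSq s S x ∂μHE[1] := by
        rw [hS.lintegral_frontier (hgm.fun_mul hcm)]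
        refine setLIntegral_congr_fun measurableSet_Ioi fun r hr => ?_
        have hr : 0 < r := hr
        have h1 : ∫⁻ x in coneTrace S, ENNReal.ofReal (ζ ‖r • x‖ ^ 2) * c (r • x) ∂μHE[1] =
            ENNReal.ofReal (ζ r ^ 2) * ENNReal.ofReal (r ^ (-(1 + s))) *
              ∫⁻ x in coneTrace S, nonlocalCurvSq s S x ∂μHE[1] := by
          rw [← lintegral_const_mul' _ _ (ENNReal.mul_ne_top ENNReal.ofReal_ne_top
            ENNReal.ofReal_ne_top)]
          refine setLIntegral_congr_fun (measurableSet_coneTrace S) fun x hx => ?_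
          have hx' : x ∈ frontier S \ {0} := ⟨hx.1, ne_zero_of_mem_coneTrace hx⟩
          rw [hce _ ⟨(smul_mem_frontier_iff_of_cone hS.cone hr _).2 hx.1, by
            simpa [hr.ne'] using hx'.2⟩, hS.nonlocalCurvSq_smul s hx' hr, norm_smul,
            norm_eq_one_of_mem_coneTrace hx, mul_one, Real.norm_of_nonneg hr.le, mul_assoc]
        refine (congrArg (ENNReal.ofReal r * ·) h1).trans ?_
        simp only
        rw [← mul_assoc, ← ENNReal.ofReal_mul (by positivity), ← ENNReal.ofReal_mul hr.le]
        congr 2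
        rw [sq_abs, show (1 - 2 * ((1 + s) / 2)) = 1 + -(1 + s) by ring, Real.rpow_add hr,
          Real.rpow_one]
        ring
    _ = _ := by
        rw [lintegral_mul_const _ (by fun_prop), radialJ, mul_comm]

end IsC2Cone

end

/-! ### The difference term in polar coordinates, and the conclusion -/

noncomputable section

/-- The interaction `∬_{γ×γ} |r x - ρ y|^{-(3+s)}` of two dilated copies of the trace. -/
def traceKernel (s : ℝ) (S : Set E3) (r ρ : ℝ) : ℝ≥0∞ :=
  ∫⁻ x in coneTrace S, ∫⁻ y in coneTrace S,
    ENNReal.ofReal (1 / ‖r • x - ρ • y‖ ^ (3 + s)) ∂μHE[1] ∂μHE[1]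

/-- Each unordered pair of radii is counted twice, and the diagonal contributes nothing because `q`
vanishes on it. -/
theorem lintegral_symmetric_eq {q : ℝ → ℝ → ℝ≥0∞} (hq : Measurable (Function.uncurry q))
    (hsymm : ∀ r ρ, q r ρ = q ρ r) (hdiag : ∀ r, q r r = 0) :
    ∫⁻ r in Ioi (0 : ℝ), ∫⁻ ρ in Ioi (0 : ℝ), q r ρ =
      2 * ∫⁻ r in Ioi (0 : ℝ), ∫⁻ ρ in Ioi (0 : ℝ), (Ioi r).indicator (q r) ρ := by
  set u : ℝ → ℝ → ℝ≥0∞ := fun r ρ => (Ioi r).indicator (q r) ρ with hu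
  have hum : Measurable (Function.uncurry u) := by
    have : Function.uncurry u = {z : ℝ × ℝ | z.1 < z.2}.indicator (Function.uncurry q) := by
      funext z
      simp only [Function.uncurry, hu, indicator_apply, mem_Ioi, mem_ofPred_eq]
    rw [this]
    exact hq.indicator (measurableSet_lt measurable_fst measurable_snd)
  have hadd : ∀ r ρ, q r ρ = u r ρ + u ρ r := by
    intro r ρ
    rcases lt_trichotomy r ρ with h | h | h
    · simp [hu, h, h.not_gt]
    · simp [hu, h, hdiag]
    · simp [hu, h, h.not_gt, hsymm r ρ]
  have hin : ∀ r, ∫⁻ ρ in Ioi (0 : ℝ), q r ρ =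
      (∫⁻ ρ in Ioi (0 : ℝ), u r ρ) + ∫⁻ ρ in Ioi (0 : ℝ), u ρ r := by
    intro r
    simp only [hadd r]
    exact lintegral_add_left (hum.comp (measurable_const.prodMk measurable_id)) _
  simp only [hin]
  have hint : Measurable fun r => ∫⁻ ρ in Ioi (0 : ℝ), u r ρ := hum.lintegral_prod_right'
  rw [lintegral_add_left hint,
    lintegral_lintegral_swap (f := fun r ρ => u ρ r) (hum.comp measurable_swap).aemeasurable,
    two_mul]

theorem lintegral_rpow_mul_comp_mul_left {s l : ℝ} (hl : 0 < l) (f : ℝ → ℝ≥0∞) :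
    ∫⁻ r in Ioi (0 : ℝ), ENNReal.ofReal (r ^ (-s)) * f (l * r) =
      ENNReal.ofReal (l ^ s * l⁻¹) * ∫⁻ r in Ioi (0 : ℝ), ENNReal.ofReal (r ^ (-s)) * f r := by
  have h := lintegral_Ioi_comp_mul_left hl fun r => ENNReal.ofReal (r ^ (-s)) * f r
  rw [ENNReal.ofReal_mul (by positivity), mul_assoc, ← h,
    ← lintegral_const_mul' _ _ ENNReal.ofReal_ne_top]
  refine setLIntegral_congr_fun measurableSet_Ioi fun r hr => ?_
  have hr : 0 < r := hr
  rw [← mul_assoc, ← ENNReal.ofReal_mul (by positivity), Real.mul_rpow hl.le hr.le, ← mul_assoc,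
    ← Real.rpow_add hl, add_neg_cancel, Real.rpow_zero, one_mul]

namespace IsC2Cone

variable {S : Set E3}

theorem measurable_traceKernel (hS : IsC2Cone S) (s : ℝ) :
    Measurable fun z : ℝ × ℝ => traceKernel s S z.1 z.2 := by
  have := hS.isFiniteMeasure_coneTrace
  have m0 : Measurable fun w : ((ℝ × ℝ) × E3) × E3 =>
      ENNReal.ofReal (1 / ‖w.1.1.1 • w.1.2 - w.1.1.2 • w.2‖ ^ (3 + s)) := by fun_prop
  exact (m0.lintegral_prod_right' (ν := (μHE[1] : Measure E3).restrict
    (coneTrace S))).lintegral_prod_right'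

theorem traceKernel_symm (hS : IsC2Cone S) (s r ρ : ℝ) :
    traceKernel s S r ρ = traceKernel s S ρ r := by
  have := hS.isFiniteMeasure_coneTrace
  have m0 : Measurable fun w : E3 × E3 =>
      ENNReal.ofReal (1 / ‖r • w.1 - ρ • w.2‖ ^ (3 + s)) := by fun_prop
  rw [traceKernel, traceKernel, lintegral_lintegral_swap m0.aemeasurable]
  simp only [norm_sub_rev (r • _)]

theorem traceKernel_mul (s : ℝ) {r : ℝ} (hr : 0 < r) (τ : ℝ) :
    traceKernel s S r (r * τ) = ENNReal.ofReal (r ^ (-(3 + s))) *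
      ∫⁻ x in coneTrace S, ∫⁻ y in coneTrace S,
        ENNReal.ofReal (1 / ‖x - τ • y‖ ^ (3 + s)) ∂μHE[1] ∂μHE[1] := by
  rw [traceKernel, ← lintegral_const_mul' _ _ ENNReal.ofReal_ne_top]
  refine lintegral_congr fun x => ?_
  rw [← lintegral_const_mul' _ _ ENNReal.ofReal_ne_top]
  refine lintegral_congr fun y => ?_
  rw [← ENNReal.ofReal_mul (by positivity), mul_smul, ← smul_sub, norm_smul,
    Real.norm_of_nonneg hr.le, Real.mul_rpow hr.le (norm_nonneg _), Real.rpow_neg hr.le, one_div,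
    one_div, mul_inv]

theorem lintegral_difference_eq (hS : IsC2Cone S) (s : ℝ) {ζ : ℝ → ℝ} (hζ : Continuous ζ) :
    ∫⁻ z : E3 × E3, ENNReal.ofReal (kernelProfile s (‖z.1 - z.2‖ ^ 2) * (ζ ‖z.1‖ - ζ ‖z.2‖) ^ 2)
      ∂(((μHE[2] : Measure E3).restrict (frontier S)).prod
        ((μHE[2] : Measure E3).restrict (frontier S))) =
    ∫⁻ r in Ioi (0 : ℝ), ∫⁻ ρ in Ioi (0 : ℝ), ENNReal.ofReal r * ENNReal.ofReal ρ *
      ENNReal.ofReal ((ζ r - ζ ρ) ^ 2) * traceKernel s S r ρ := by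
  have hsig := hS.sigmaFinite_frontier
  have hfin := hS.isFiniteMeasure_coneTrace
  have hkm : Measurable fun z : E3 × E3 => kernelProfile s (‖z.1 - z.2‖ ^ 2) :=
    (measurable_kernelProfile s).comp (by fun_prop)
  set G : E3 × E3 → ℝ≥0∞ := fun z =>
    ENNReal.ofReal (kernelProfile s (‖z.1 - z.2‖ ^ 2) * (ζ ‖z.1‖ - ζ ‖z.2‖) ^ 2) with hG
  have hGm : Measurable G := (hkm.fun_mul (by fun_prop)).ennreal_ofReal
  have hGe : ∀ r ∈ Ioi (0 : ℝ), ∀ ρ ∈ Ioi (0 : ℝ), ∀ x ∈ coneTrace S, ∀ y ∈ coneTrace S,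
      G (r • x, ρ • y) = ENNReal.ofReal ((ζ r - ζ ρ) ^ 2) *
        ENNReal.ofReal (1 / ‖r • x - ρ • y‖ ^ (3 + s)) := by
    intro r hr ρ hρ x hx y hy
    have hr : 0 < r := hr
    have hρ : 0 < ρ := hρ
    simp only [hG]
    rw [kernelProfile_norm_sq, ← ENNReal.ofReal_mul (sq_nonneg _), norm_smul, norm_smul,
      norm_eq_one_of_mem_coneTrace hx, norm_eq_one_of_mem_coneTrace hy, mul_one, mul_one,
      Real.norm_of_nonneg hr.le, Real.norm_of_nonneg hρ.le, mul_comm]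
  rw [lintegral_prod _ hGm.aemeasurable, hS.lintegral_frontier hGm.lintegral_prod_right']
  refine setLIntegral_congr_fun measurableSet_Ioi fun r hr => ?_
  have hr' : 0 < r := hr
  have hm : Measurable fun w : E3 × ℝ => ENNReal.ofReal w.2 * ENNReal.ofReal ((ζ r - ζ w.2) ^ 2) *
      ∫⁻ y in coneTrace S, ENNReal.ofReal (1 / ‖r • w.1 - w.2 • y‖ ^ (3 + s)) ∂μHE[1] := by
    have m0 : Measurable fun w : (E3 × ℝ) × E3 =>
      ENNReal.ofReal (1 / ‖r • w.1.1 - w.1.2 • w.2‖ ^ (3 + s)) := by fun_prop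
    have m1 := m0.lintegral_prod_right' (ν := (μHE[1] : Measure E3).restrict (coneTrace S))
    exact Measurable.fun_mul (by fun_prop) m1
  have h1 : ∀ x ∈ coneTrace S, ∫⁻ y in frontier S, G (r • x, y) ∂μHE[2] =
      ∫⁻ ρ in Ioi (0 : ℝ), ENNReal.ofReal ρ * ENNReal.ofReal ((ζ r - ζ ρ) ^ 2) *
        ∫⁻ y in coneTrace S, ENNReal.ofReal (1 / ‖r • x - ρ • y‖ ^ (3 + s)) ∂μHE[1] := by
    intro x hx
    have hGx : Measurable fun y => G (r • x, y) := by fun_prop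
    rw [hS.lintegral_frontier hGx]
    refine setLIntegral_congr_fun measurableSet_Ioi fun ρ hρ => ?_
    rw [mul_assoc, ← lintegral_const_mul' (ENNReal.ofReal ((ζ r - ζ ρ) ^ 2)) _
      ENNReal.ofReal_ne_top]
    congr 1
    exact setLIntegral_congr_fun (measurableSet_coneTrace S) fun y hy => hGe r hr ρ hρ x hx y hy
  rw [setLIntegral_congr_fun (measurableSet_coneTrace S) h1, lintegral_lintegral_swap
    hm.aemeasurable, ← lintegral_const_mul' _ _ ENNReal.ofReal_ne_top]
  refine lintegral_congr fun ρ => ?_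
  rw [lintegral_const_mul' _ _ (ENNReal.mul_ne_top ENNReal.ofReal_ne_top ENNReal.ofReal_ne_top),
    traceKernel]
  ring

/-- After restriction to `r < ρ` by symmetry, the substitution `ρ = r * τ` produces the weight `r *
(r * τ) * r * r ^ (-(3 + s)) = τ * r ^ (-s)`, one factor `r` being that of `dρ`. -/
theorem lintegral_difference (hS : IsC2Cone S) (s : ℝ) {ζ : ℝ → ℝ} (hζ : Continuous ζ) :
    ∫⁻ z : E3 × E3, ENNReal.ofReal (kernelProfile s (‖z.1 - z.2‖ ^ 2) * (ζ ‖z.1‖ - ζ ‖z.2‖) ^ 2)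
      ∂(((μHE[2] : Measure E3).restrict (frontier S)).prod
        ((μHE[2] : Measure E3).restrict (frontier S))) =
    2 * ∫⁻ r in Ioi (0 : ℝ), ENNReal.ofReal (r ^ (-s)) *
      ∫⁻ τ in Ioi (1 : ℝ), ENNReal.ofReal (τ * |ζ r - ζ (r * τ)| ^ 2) *
        ∫⁻ x in coneTrace S, ∫⁻ y in coneTrace S,
          ENNReal.ofReal (1 / ‖x - τ • y‖ ^ (3 + s)) ∂μHE[1] ∂μHE[1] := by
  rw [hS.lintegral_difference_eq s hζ, lintegral_symmetric_eq]
  · congr 1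
    refine setLIntegral_congr_fun measurableSet_Ioi fun r hr => ?_
    have hr : 0 < r := hr
    set q : ℝ → ℝ≥0∞ := fun ρ => ENNReal.ofReal r * ENNReal.ofReal ρ *
      ENNReal.ofReal ((ζ r - ζ ρ) ^ 2) * traceKernel s S r ρ with hq
    have h := lintegral_Ioi_comp_mul_left hr ((Ioi r).indicator q)
    have hrr : ENNReal.ofReal r * ENNReal.ofReal r⁻¹ = 1 := by
      rw [← ENNReal.ofReal_mul hr.le, mul_inv_cancel₀ hr.ne', ENNReal.ofReal_one]
    have h2 : ∫⁻ ρ in Ioi (0 : ℝ), (Ioi r).indicator q ρ =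
        ENNReal.ofReal r * ∫⁻ τ in Ioi (0 : ℝ), (Ioi r).indicator q (r * τ) := by
      rw [h, ← mul_assoc, hrr, one_mul]
    have h3 : ∀ τ : ℝ, (Ioi r).indicator q (r * τ) =
        (Ioi (1 : ℝ)).indicator (fun τ => q (r * τ)) τ := by
      intro τ
      have : r * τ ∈ Ioi r ↔ τ ∈ Ioi (1 : ℝ) := lt_mul_iff_one_lt_right hr
      simp only [indicator_apply, this]
    have h4 : Ioi (1 : ℝ) ∩ Ioi 0 = Ioi 1 := inter_eq_left.2 (Ioi_subset_Ioi zero_le_one)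
    refine h2.trans ?_
    simp only [h3]
    rw [lintegral_indicator measurableSet_Ioi, Measure.restrict_restrict measurableSet_Ioi, h4,
      ← lintegral_const_mul' _ _ ENNReal.ofReal_ne_top,
      ← lintegral_const_mul' _ _ ENNReal.ofReal_ne_top]
    refine setLIntegral_congr_fun measurableSet_Ioi fun τ hτ => ?_
    have hτ : 0 < τ := zero_lt_one.trans hτ
    simp only [hq]
    rw [traceKernel_mul s hr, ← mul_assoc (ENNReal.ofReal (r ^ (-s))), ← mul_assoc, ← mul_assoc,
      ← mul_assoc,
      ← ENNReal.ofReal_mul hr.le, ← ENNReal.ofReal_mul hr.le, ← ENNReal.ofReal_mul (by positivity),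
      ← ENNReal.ofReal_mul (by positivity), ← ENNReal.ofReal_mul (by positivity), sq_abs]
    congr 2
    have h5 : r ^ (-(3 + s)) = r ^ (-s) * (r ^ 3)⁻¹ := by
      rw [← Real.rpow_natCast, ← Real.rpow_neg hr.le, ← Real.rpow_add hr]
      congr 1
      push_cast
      ring
    rw [h5]
    field_simp
  · have := hS.measurable_traceKernel s
    exact Measurable.fun_mul (by fun_prop) this
  · intro r ρ
    rw [hS.traceKernel_symm, mul_comm (ENNReal.ofReal r), ← neg_sub (ζ ρ), neg_sq]
  · intro r
    simp

end IsC2Cone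

/-- Stability is available inside the unit ball only. The dilate `ξ r = ζ (l * r)` with `l = 2 * b`
is supported in radii at most `1 / 2`, so the inequality holds for it. Both sides for `ξ` are those
for `ζ` times `l ^ s * l⁻¹`, which cancels. -/
theorem lemma4p1 (s : ℝ) (hs0 : 0 < s) (hs1 : s < 1)
    (S : Set (EuclideanSpace ℝ (Fin 3))) (hS : IsStableCone s S)
    (ζ : ℝ → ℝ) (hζ : ContDiff ℝ 2 ζ) (hζc : HasCompactSupport ζ)
    (hζ0 : tsupport ζ ⊆ Ioi 0) :
    (∫⁻ x in coneTrace S, nonlocalCurvSq s S x ∂μHE[1]) * radialJ ζ ((1 + s) / 2) ≤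
      2 * ∫⁻ r in Ioi (0 : ℝ), ENNReal.ofReal (r ^ (-s)) *
        ∫⁻ τ in Ioi (1 : ℝ), ENNReal.ofReal (τ * |ζ r - ζ (r * τ)| ^ 2) *
          ∫⁻ x in coneTrace S, ∫⁻ y in coneTrace S,
            ENNReal.ofReal (1 / ‖x - τ • y‖ ^ (3 + s)) ∂μHE[1] ∂μHE[1] := by
  have hS' : IsC2Cone S := ⟨hS.isOpen, hS.cone, hS.c2_boundary⟩
  -- The support is compact in the open half line, so it has a positive least element; if it is
  -- empty any interval serves.
  obtain ⟨a, b, ha, hab, hs⟩ : ∃ a b : ℝ, 0 < a ∧ a ≤ b ∧ ∀ r, r ∉ Icc a b → ζ r = 0 := by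
    by_cases hne : (tsupport ζ).Nonempty
    · obtain ⟨a, ha, hal⟩ := hζc.isCompact.exists_isLeast hne
      obtain ⟨b, hb, hbl⟩ := hζc.isCompact.exists_isGreatest hne
      exact ⟨a, b, hζ0 ha, hal hb, fun r hr => image_eq_zero_of_notMem_tsupport fun h =>
        hr ⟨hal h, hbl h⟩⟩
    · rw [not_nonempty_iff_eq_empty] at hne
      exact ⟨1, 1, one_pos, le_rfl, fun r _ => image_eq_zero_of_notMem_tsupport (by simp [hne])⟩
  have hb0 : 0 < b := ha.trans_le hab
  obtain ⟨M, hM⟩ := hζ.lipschitzWith_of_hasCompactSupport hζc (by norm_num)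
  obtain ⟨B, hB⟩ := hζ.continuous.bounded_above_of_compact_support hζc
  set l : ℝ := 2 * b with hl
  have hl0 : 0 < l := by positivity
  set ξ : ℝ → ℝ := fun r => ζ (l * r) with hξ
  have hξl : LipschitzWith (M * l.toNNReal) ξ := by
    refine LipschitzWith.of_dist_le_mul fun r t => (hM.dist_le_mul _ _).trans (le_of_eq ?_)
    rw [NNReal.coe_mul, Real.coe_toNNReal _ hl0.le, Real.dist_eq, Real.dist_eq, ← mul_sub, abs_mul,
      abs_of_pos hl0]
    ring
  have hξs : ∀ r, r ∉ Icc (a / l) (b / l) → ξ r = 0 := by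
    intro r hr
    refine hs _ fun h => hr ⟨?_, ?_⟩
    · rw [div_le_iff₀ hl0, mul_comm]; exact h.1
    · rw [le_div_iff₀ hl0, mul_comm]; exact h.2
  have key := hS.lintegral_normal_le hs0 hs1 hξl (fun r => hB (l * r)) (div_pos ha hl0)
    (by gcongr) (by rw [div_lt_one hl0]; linarith) hξs
  rw [hS'.lintegral_curvature s hξl.continuous, hS'.lintegral_difference s hξl.continuous] at key
  set Φ : ℝ → ℝ≥0∞ := fun r => ∫⁻ τ in Ioi (1 : ℝ), ENNReal.ofReal (τ * |ζ r - ζ (r * τ)| ^ 2) *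
    ∫⁻ x in coneTrace S, ∫⁻ y in coneTrace S,
      ENNReal.ofReal (1 / ‖x - τ • y‖ ^ (3 + s)) ∂μHE[1] ∂μHE[1] with hΦ
  have hJ : ∀ η : ℝ → ℝ, radialJ η ((1 + s) / 2) =
      ∫⁻ r in Ioi (0 : ℝ), ENNReal.ofReal (r ^ (-s)) * ENNReal.ofReal (|η r| ^ 2) := by
    intro η
    refine setLIntegral_congr_fun measurableSet_Ioi fun r hr => ?_
    have hr : 0 < r := hr
    rw [← ENNReal.ofReal_mul (by positivity)]
    congr 3
    ring
  have e1 : radialJ ξ ((1 + s) / 2) =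
      ENNReal.ofReal (l ^ s * l⁻¹) * radialJ ζ ((1 + s) / 2) := by
    rw [hJ, hJ]
    exact lintegral_rpow_mul_comp_mul_left hl0 fun r => ENNReal.ofReal (|ζ r| ^ 2)
  have e2 : ∫⁻ r in Ioi (0 : ℝ), ENNReal.ofReal (r ^ (-s)) *
      ∫⁻ τ in Ioi (1 : ℝ), ENNReal.ofReal (τ * |ξ r - ξ (r * τ)| ^ 2) *
        ∫⁻ x in coneTrace S, ∫⁻ y in coneTrace S,
          ENNReal.ofReal (1 / ‖x - τ • y‖ ^ (3 + s)) ∂μHE[1] ∂μHE[1] =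
      ENNReal.ofReal (l ^ s * l⁻¹) * ∫⁻ r in Ioi (0 : ℝ), ENNReal.ofReal (r ^ (-s)) * Φ r := by
    rw [← lintegral_rpow_mul_comp_mul_left hl0 Φ]
    simp only [hΦ, hξ, mul_assoc]
  rw [e1, e2, mul_left_comm, mul_left_comm 2] at key
  have hc0 : ENNReal.ofReal (l ^ s * l⁻¹) ≠ 0 := by
    rw [Ne, ENNReal.ofReal_eq_zero, not_le]
    positivity
  exact (ENNReal.mul_le_mul_iff_right hc0 ENNReal.ofReal_ne_top).1 key

end
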